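/- All multicategories and polycategories are symmetric, and lists of objects are finite. Let $\mathcal P$ be a small polycategory, with composition along one object. **Tensors and duals.** A morphism $t\in\mathcal P(S;T)$, where $S$ is a list of objects and $T$ an object, exhibits $T$ as the *tensor product* of $S$ if composition with $t$ is a bijection $\mathcal P(T,\Gamma;\Delta)\cong\mathcal P(S,\Gamma;\Delta)$ for all lists $\Gamma,\Delta$. A morphism $t\in\mathcal P(T;S)$ exhibits $T$ as the *cotensor product* of $S$ if composition with $t$ is a bijection $\mathcal P(\Gamma;\Delta,T)\cong\mathcal P(\Gamma;\Delta,S)$ for all $\Gamma,\Delta$. For $S=(A,B)$ these are the binary tensor and cotensor products of $A$ and $B$, and for the empty list $S$ they are the unit and the counit. A morphism $e\in\mathcal P(B,A;)$ exhibits $B$ as the *dual* of $A$ if composition with $e$ is a bijection $\mathcal P(\Gamma;\Delta,B)\cong\mathcal P(\Gamma,A;\Delta)$ for all $\Gamma,\Delta$. A polycategory is *$*$-autonomous* if it has all binary tensor and cotensor products, a unit and a counit, and every object has a dual. **Modules.** A *$\mathcal P$-module* is a family of sets $\mathcal U(\Gamma;\Delta)$, indexed by pairs of lists of objects of $\mathcal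 P$, with symmetric group actions and with actions $$\mathcal P(\Pi;\Sigma,A)\times\mathcal U(A,\Gamma;\Delta)\to\mathcal U(\Pi,\Gamma;\Sigma,\Delta),\qquad \mathcal U(\Gamma;\Delta,A)\times\mathcal P(A,\Pi;\Sigma)\to\mathcal U(\Gamma,\Pi;\Delta,\Sigma)$$ satisfying the same equivariance, associativity, interchange and unit laws as composition in a polycategory. The hom-sets of $\mathcal P$ form a module, again denoted $\mathcal P$. For an object $A$ let $y_A$ and $\bar y_A$ be the modules $y_A(\Gamma;\Delta)=\mathcal P(\Gamma;\Delta,A)$ and $\bar y_A(\Gamma;\Delta)=\mathcal P(\Gamma,A;\Delta)$. A multimorphism $(\mathcal U_1,\dots,\mathcal U_n)\to\mathcal V$ consists of functions $$\mathcal U_1(\Gamma_1;\Delta_1)\times\cdots\times\mathcal U_n(\Gamma_n;\Delta_n)\to\mathcal V(\Gamma_1,\dots,\Gamma_n;\Delta_1,\dots,\Delta_n)$$ that commute with the symmetric group actions and with the left and right actions of $\mathcal P$ in each argument. Let $\mathcal J$ be a set of binary or nullary tensor and cotensor products that exist in $\mathcal P$, called *distinguished*. A *$(\mathcal P,\mathcal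 J)$-module* is a module $\mathcal U$ such that, for all $\Gamma,\Delta$, acting by $t$ is a bijection $\mathcal U(T,\Gamma;\Delta)\cong\mathcal U(S,\Gamma;\Delta)$ for each distinguished tensor product $t\in\mathcal P(S;T)$, and a bijection $\mathcal U(\Gamma;\Delta,T)\cong\mathcal U(\Gamma;\Delta,S)$ for each distinguished cotensor product $t\in\mathcal P(T;S)$. The $(\mathcal P,\mathcal J)$-modules and their multimorphisms form a multicategory $\mathrm{Mod}(\mathcal P,\mathcal J)$, which contains $\mathcal P$, $y_A$ and $\bar y_A$. **The envelope.** For a multicategory $\mathcal E$ and an object $\bot$ of it, the *Chu construction* $\mathrm{Chu}(\mathcal E,\bot)$ is the following polycategory. Its objects are triples $A=(A^+,A^-,\underline A)$ with $\underline A\in\mathcal E(A^+,A^-;\bot)$. A morphism $f:(A_1,\dots,A_m)\to(B_1,\dots,B_n)$ consists of morphisms of $\mathcal E$ $$f^+_j:(A_1^+,\dots,A_m^+,B_1^-,\dots,\widehat{B_j^-},\dots,B_n^-)\to B_j^+,\qquad f^-_i:(A_1^+,\dots,\widehat{A_i^+},\dots,A_m^+,B_1^-,\dots,B_n^-)\to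 A_i^-,$$ $$\underline f:(A_1^+,\dots,A_m^+,B_1^-,\dots,B_n^-)\to\bot$$ such that $\underline{B_j}\circ f^+_j=\underline f$ and $\underline{A_i}\circ f^-_i=\underline f$ for all $i,j$, up to permutation of the arguments. The identity of $A$ is $(1_{A^+},1_{A^-},\underline A)$, and composition is induced by that of $\mathcal E$. Put $A^*=(A^-,A^+,\underline A\sigma)$, where $\sigma$ is the symmetry. The *envelope* of $(\mathcal P,\mathcal J)$ is $\mathrm{Env}(\mathcal P,\mathcal J)=\mathrm{Chu}(\mathrm{Mod}(\mathcal P,\mathcal J),\mathcal P)$. For an object $A$ of $\mathcal P$ let $\gamma_A:(y_A,\bar y_A)\to\mathcal P$ be composition along $A$. **Theorem.** Let $\mathcal P$ be a small polycategory and $\mathcal J$ a set of distinguished tensor and cotensor products in $\mathcal P$ as above. 1. The polycategory $\mathrm{Env}(\mathcal P,\mathcal J)$ is $*$-autonomous, and $A^*$ is a dual of $A$ for each of its objects $A$. 2. The assignment $A\mapsto(y_A,\bar y_A,\gamma_A)$ extends to a functor of polycategories $F:\mathcal P\to\mathrm{Env}(\mathcal P,\mathcal J)$ that is fully faithful, that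 is, bijective on all hom-sets $\mathcal P(\Gamma;\Delta)$, so that $\mathcal P$ is contained in $\mathrm{Env}(\mathcal P,\mathcal J)$ as a full sub-polycategory. For $f\in\mathcal P(A_1,\dots,A_m;B_1,\dots,B_n)$, evaluating the component $\underline{F(f)}:(y_{A_1},\dots,y_{A_m},\bar y_{B_1},\dots,\bar y_{B_n})\to\mathcal P$ at the identities $(1_{A_1},\dots,1_{A_m},1_{B_1},\dots,1_{B_n})$ gives back $f$. 3. This functor preserves the distinguished tensor and cotensor products: if $t$ in $\mathcal J$ exhibits $T$ as the tensor (respectively cotensor) product of a list $S$, then $F(t)$ exhibits $F(T)$ as the tensor (respectively cotensor) product of $F(S)$ in $\mathrm{Env}(\mathcal P,\mathcal J)$. This includes distinguished units and counits. -/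

import Mathlib

universe u' v' u v w w₁ w₂ w₃

/-- Finite families of objects of `C`, used as coordinate-free lists: a list is the case where the
indexing set is a finite ordinal, and every family is relabelled to a list by an enumeration of its
indexing set. -/
structure Fam (C : Type u) : Type (max 1 u) where
  I : Type
  fin : Finite I
  obj : I → C

namespace Fam

abbrev nil {C : Type u} : Fam C := ⟨Empty, inferInstance, Empty.elim⟩

abbrev single {C : Type u} (A : C) : Fam C := ⟨Unit, inferInstance, fun _ => A⟩

/-- Concatenation. -/
abbrev append {C : Type u} (Γ Δ : Fam C) : Fam C :=
  ⟨Γ.I ⊕ Δ.I, haveI := Γ.fin; haveI := Δ.fin; inferInstance, Sum.elim Γ.obj Δ.obj⟩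

abbrev map {C : Type u} {D : Type v} (F : C → D) (Γ : Fam C) : Fam D :=
  ⟨Γ.I, Γ.fin, fun i => F (Γ.obj i)⟩

/-- Omission of one entry. -/
abbrev erase {C : Type u} (Γ : Fam C) (k : Γ.I) : Fam C :=
  ⟨{i : Γ.I // i ≠ k}, haveI := Γ.fin; inferInstance, fun i => Γ.obj i.1⟩

/-- Concatenation of a finite family of lists. -/
abbrev sigma {C : Type u} {K : Type} (hK : Finite K) (s : K → Fam C) : Fam C :=
  ⟨Σ k, (s k).I, haveI := fun k => (s k).fin; inferInstance, fun p => (s p.1).obj p.2⟩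

/-- Relabellings. Between lists these are the permutations. -/
structure Iso {C : Type u} (Γ Δ : Fam C) where
  equiv : Γ.I ≃ Δ.I
  obj_eq : ∀ i, Δ.obj (equiv i) = Γ.obj i

end Fam
infixl:65 " ⊎ " => Fam.append
infix:50 " ≅ₗ " => Fam.Iso

namespace Fam.Iso

theorem ext {C : Type u} {Γ Δ : Fam C} {σ τ : Γ ≅ₗ Δ} (h : ∀ i, σ.equiv i = τ.equiv i) : σ = τ := by
  cases σ; cases τ; congr; exact Equiv.ext h

abbrev refl {C : Type u} (Γ : Fam C) : Γ ≅ₗ Γ := ⟨Equiv.refl _, fun _ => rfl⟩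

abbrev symm {C : Type u} {Γ Δ : Fam C} (σ : Γ ≅ₗ Δ) : Δ ≅ₗ Γ :=
  ⟨σ.equiv.symm, fun i => by rw [← σ.obj_eq, Equiv.apply_symm_apply]⟩

abbrev trans {C : Type u} {Γ Δ Θ : Fam C} (σ : Γ ≅ₗ Δ) (τ : Δ ≅ₗ Θ) : Γ ≅ₗ Θ :=
  ⟨σ.equiv.trans τ.equiv, fun i => (τ.obj_eq _).trans (σ.obj_eq i)⟩

abbrev append {C : Type u} {Γ Γ' Δ Δ' : Fam C} (σ : Γ ≅ₗ Γ') (τ : Δ ≅ₗ Δ') :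
    Γ ⊎ Δ ≅ₗ Γ' ⊎ Δ' :=
  ⟨Equiv.sumCongr σ.equiv τ.equiv, by rintro (i | i); exacts [σ.obj_eq i, τ.obj_eq i]⟩

abbrev map {C : Type u} {D : Type v} (F : C → D) {Γ Δ : Fam C} (σ : Γ ≅ₗ Δ) : Γ.map F ≅ₗ Δ.map F :=
  ⟨σ.equiv, fun i => congrArg F (σ.obj_eq i)⟩

abbrev nilLeft {C : Type u} (Γ : Fam C) : nil ⊎ Γ ≅ₗ Γ :=
  ⟨Equiv.emptySum Empty Γ.I, by rintro (⟨⟨⟩⟩ | i); rfl⟩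

abbrev nilRight {C : Type u} (Γ : Fam C) : Γ ⊎ nil ≅ₗ Γ :=
  ⟨Equiv.sumEmpty Γ.I Empty, by rintro (i | ⟨⟨⟩⟩); rfl⟩

abbrev assoc {C : Type u} (Γ Δ Θ : Fam C) : Γ ⊎ Δ ⊎ Θ ≅ₗ Γ ⊎ (Δ ⊎ Θ) :=
  ⟨Equiv.sumAssoc _ _ _, by rintro ((i | i) | i) <;> rfl⟩

abbrev comm {C : Type u} (Γ Δ : Fam C) : Γ ⊎ Δ ≅ₗ Δ ⊎ Γ :=
  ⟨Equiv.sumComm _ _, by rintro (i | i) <;> rfl⟩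

abbrev rightComm {C : Type u} (Γ Δ Θ : Fam C) : Γ ⊎ Δ ⊎ Θ ≅ₗ Γ ⊎ Θ ⊎ Δ :=
  ⟨⟨Sum.elim (Sum.elim (fun i => .inl (.inl i)) fun i => .inr i) fun i => .inl (.inr i),
    Sum.elim (Sum.elim (fun i => .inl (.inl i)) fun i => .inr i) fun i => .inl (.inr i),
    by rintro ((i | i) | i) <;> rfl, by rintro ((i | i) | i) <;> rfl⟩,
    by rintro ((i | i) | i) <;> rfl⟩

abbrev leftComm {C : Type u} (Γ Δ Θ : Fam C) : Γ ⊎ (Δ ⊎ Θ) ≅ₗ Δ ⊎ (Γ ⊎ Θ) :=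
  ⟨⟨Sum.elim (fun i => .inr (.inl i)) (Sum.elim (fun i => .inl i) fun i => .inr (.inr i)),
    Sum.elim (fun i => .inr (.inl i)) (Sum.elim (fun i => .inl i) fun i => .inr (.inr i)),
    by rintro (i | (i | i)) <;> rfl, by rintro (i | (i | i)) <;> rfl⟩,
    by rintro (i | (i | i)) <;> rfl⟩

end Fam.Iso

/-- Symmetric polycategories, with composition along one object. It is enough to compose along the
last output and the first input, because `perm` moves any object there. -/
structure Polycat where
  Ob : Type u
  Hom : Fam Ob → Fam Ob → Type v
  perm {Γ Γ' Δ Δ' : Fam Ob} : Γ ≅ₗ Γ' → Δ ≅ₗ Δ' → Hom Γ Δ → Hom Γ' Δ'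
  id (A : Ob) : Hom (.single A) (.single A)
  comp {Γ Δ Φ Ψ : Fam Ob} {A : Ob} :
    Hom Γ (Δ ⊎ .single A) → Hom (.single A ⊎ Φ) Ψ → Hom (Γ ⊎ Φ) (Δ ⊎ Ψ)
  perm_refl {Γ Δ : Fam Ob} (f : Hom Γ Δ) : perm (.refl Γ) (.refl Δ) f = f
  perm_perm {Γ Γ' Γ'' Δ Δ' Δ'' : Fam Ob} (σ : Γ ≅ₗ Γ') (σ' : Γ' ≅ₗ Γ'') (τ : Δ ≅ₗ Δ')
    (τ' : Δ' ≅ₗ Δ'') (f : Hom Γ Δ) :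
    perm σ' τ' (perm σ τ f) = perm (σ.trans σ') (τ.trans τ') f
  comp_perm {Γ Γ' Δ Δ' Φ Φ' Ψ Ψ' : Fam Ob} {A : Ob} (σ : Γ ≅ₗ Γ') (τ : Δ ≅ₗ Δ')
    (ρ : Φ ≅ₗ Φ') (κ : Ψ ≅ₗ Ψ') (f : Hom Γ (Δ ⊎ .single A)) (g : Hom (.single A ⊎ Φ) Ψ) :
    comp (perm σ (τ.append (.refl _)) f) (perm (.append (.refl _) ρ) κ g) =
      perm (σ.append ρ) (τ.append κ) (comp f g)
  id_comp {Φ Ψ : Fam Ob} {A : Ob} (g : Hom (.single A ⊎ Φ) Ψ) :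
    comp (perm (.refl _) (Fam.Iso.nilLeft _).symm (id A)) g =
      perm (.refl _) (Fam.Iso.nilLeft _).symm g
  comp_id {Γ Δ : Fam Ob} {A : Ob} (f : Hom Γ (Δ ⊎ .single A)) :
    comp f (perm (Fam.Iso.nilRight _).symm (.refl _) (id A)) =
      perm (Fam.Iso.nilRight _).symm (.refl _) f
  assoc {Γ Δ Φ Ψ Θ Ξ : Fam Ob} {A B : Ob} (f : Hom Γ (Δ ⊎ .single A))
    (g : Hom (.single A ⊎ Φ) (Ψ ⊎ .single B)) (h : Hom (.single B ⊎ Θ) Ξ) :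
    comp f (perm (.assoc _ _ _) (.refl _) (comp g h)) =
      perm (.assoc _ _ _) (.assoc _ _ _)
        (comp (perm (.refl _) (Fam.Iso.assoc _ _ _).symm (comp f g)) h)
  interchange_out {Γ Δ Φ Ψ Θ Ξ : Fam Ob} {A B : Ob}
    (f : Hom Γ (Δ ⊎ .single A ⊎ .single B)) (g : Hom (.single A ⊎ Φ) Ψ)
    (h : Hom (.single B ⊎ Θ) Ξ) :
    comp (perm (.refl _) (.rightComm _ _ _) (comp f h)) g =
      perm (.rightComm _ _ _) (.rightComm _ _ _)
        (comp (perm (.refl _) (.rightComm _ _ _)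
          (comp (perm (.refl _) (.rightComm _ _ _) f) g)) h)
  interchange_in {Γ Δ Φ Ψ Θ Ξ : Fam Ob} {A B : Ob} (f : Hom Γ (Δ ⊎ .single A))
    (g : Hom Φ (Ψ ⊎ .single B)) (h : Hom (.single A ⊎ (.single B ⊎ Θ)) Ξ) :
    comp g (perm (.leftComm _ _ _) (.refl _) (comp f h)) =
      perm (.leftComm _ _ _) (.leftComm _ _ _)
        (comp f (perm (.leftComm _ _ _) (.refl _)
          (comp g (perm (.leftComm _ _ _) (.refl _) h))))

namespace Fam.Iso

theorem exists_of_fix {C : Type u} {X Y : Fam C} {A : C} (τ : X ⊎ single A ≅ₗ Y ⊎ single A)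
    (h : τ.equiv (.inr ()) = .inr ()) : ∃ ρ : X ≅ₗ Y, τ = ρ.append (refl (single A)) := by
  have h1 : ∀ x, ∃ y, τ.equiv (.inl x) = .inl y := by
    intro x
    rcases hx : τ.equiv (.inl x) with y | y
    · exact ⟨y, rfl⟩
    · exact absurd (τ.equiv.injective (hx.trans h.symm)) (by simp)
  choose f hf using h1
  have hb : Function.Bijective f := by
    constructor
    · intro x x' hx
      have := τ.equiv.injective ((hf x).trans ((congrArg Sum.inl hx).trans (hf x').symm))
      exact Sum.inl_injective this
    · intro y
      obtain ⟨x | x, hx⟩ := τ.equiv.surjective (.inl y)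
      · exact ⟨x, Sum.inl_injective ((hf x).symm.trans hx)⟩
      · exact absurd (h.symm.trans hx) (by simp)
  refine ⟨⟨Equiv.ofBijective f hb, fun i => ?_⟩, ext ?_⟩
  · have := τ.obj_eq (.inl i)
    rw [hf] at this
    exact this
  · rintro (x | x)
    · exact hf x
    · exact h

theorem symm_apply_eq {C : Type u} {Γ Δ : Fam C} (σ : Γ ≅ₗ Δ) {i : Γ.I} {j : Δ.I}
    (h : σ.equiv i = j) : σ.symm.equiv j = i := by
  subst h; exact σ.equiv.symm_apply_apply i

end Fam.Iso

/-- Symmetric multicategories, with composition into the last input. -/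
structure Multicat where
  Ob : Type u
  Hom : Fam Ob → Ob → Type v
  perm {Γ Γ' : Fam Ob} {A A' : Ob} : Γ ≅ₗ Γ' → A = A' → Hom Γ A → Hom Γ' A'
  id (A : Ob) : Hom (.single A) A
  comp {Γ Δ : Fam Ob} {A B : Ob} : Hom Γ A → Hom (Δ ⊎ .single A) B → Hom (Γ ⊎ Δ) B
  perm_refl {Γ : Fam Ob} {A : Ob} (f : Hom Γ A) : perm (.refl Γ) rfl f = f
  perm_perm {Γ Γ' Γ'' : Fam Ob} {A A' A'' : Ob} (σ : Γ ≅ₗ Γ') (h : A = A') (τ : Γ' ≅ₗ Γ'')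
    (h' : A' = A'') (f : Hom Γ A) : perm τ h' (perm σ h f) = perm (σ.trans τ) (h.trans h') f
  comp_perm {Γ Γ' Δ Δ' : Fam Ob} {A B B' : Ob} (σ : Γ ≅ₗ Γ') (ρ : Δ ≅ₗ Δ') (h : B = B')
    (f : Hom Γ A) (g : Hom (Δ ⊎ .single A) B) :
    comp (perm σ rfl f) (perm (ρ.append (.refl _)) h g) = perm (σ.append ρ) h (comp f g)
  id_comp {Δ : Fam Ob} {A B : Ob} (g : Hom (Δ ⊎ .single A) B) :
    comp (id A) g = perm (.comm _ _) rfl g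
  comp_id {Γ : Fam Ob} {A : Ob} (f : Hom Γ A) :
    comp f (perm (Fam.Iso.nilLeft _).symm rfl (id A)) = perm (Fam.Iso.nilRight _).symm rfl f
  assoc {Γ Δ Θ : Fam Ob} {A B D : Ob} (f : Hom Γ A) (g : Hom (Δ ⊎ .single A) B)
    (h : Hom (Θ ⊎ .single B) D) :
    comp (comp f g) h =
      perm (Fam.Iso.assoc _ _ _).symm rfl (comp f (perm (.rightComm _ _ _) rfl (comp g h)))
  interchange {Γ Δ Θ : Fam Ob} {A B D : Ob} (f : Hom Γ A) (g : Hom Δ B)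
    (h : Hom (Θ ⊎ .single A ⊎ .single B) D) :
    comp f (perm (Fam.Iso.assoc _ _ _).symm rfl (comp g h)) =
      perm (.leftComm _ _ _) rfl
        (comp g (perm (Fam.Iso.assoc _ _ _).symm rfl (comp f (perm (.rightComm _ _ _) rfl h))))

namespace Multicat

def sub (E : Multicat.{u, v}) {Γ Δ Δ' Θ : Fam E.Ob} {A B : E.Ob} (f : E.Hom Γ A) (g : E.Hom Δ B)
    (a : Δ' ⊎ .single A ≅ₗ Δ) (c : Γ ⊎ Δ' ≅ₗ Θ) : E.Hom Θ B :=
  E.perm c rfl (E.comp f (E.perm a.symm rfl g))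

variable (E : Multicat.{u, v})

theorem perm_congr {Γ Γ' : Fam E.Ob} {A A' : E.Ob} {σ τ : Γ ≅ₗ Γ'} {h : A = A'} {f : E.Hom Γ A}
    (hh : ∀ i, σ.equiv i = τ.equiv i) : E.perm σ h f = E.perm τ h f := by
  rw [Fam.Iso.ext hh]

theorem perm_id' {Γ : Fam E.Ob} {A : E.Ob} {σ : Γ ≅ₗ Γ} {h : A = A} {f : E.Hom Γ A}
    (hh : ∀ i, σ.equiv i = i) : E.perm σ h f = f := by
  rw [Fam.Iso.ext (τ := .refl Γ) hh]; exact E.perm_refl f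

theorem comp_perm_left {Γ Γ' Δ : Fam E.Ob} {A B : E.Ob} (σ : Γ ≅ₗ Γ')
    (f : E.Hom Γ A) (g : E.Hom (Δ ⊎ .single A) B) :
    E.comp (E.perm σ rfl f) g = E.perm (σ.append (.refl _)) rfl (E.comp f g) := by
  rw [← E.comp_perm, E.perm_id' (σ := (Fam.Iso.refl Δ).append _)]
  rintro (i | i) <;> rfl

theorem comp_perm_right {Γ Δ Δ' : Fam E.Ob} {A B B' : E.Ob} (ρ : Δ ≅ₗ Δ') (h : B = B')
    (f : E.Hom Γ A) (g : E.Hom (Δ ⊎ .single A) B) :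
    E.comp f (E.perm (ρ.append (.refl _)) h g) =
      E.perm ((Fam.Iso.refl _).append ρ) h (E.comp f g) := by
  rw [← E.comp_perm, E.perm_refl]

theorem perm_sub {Γ Δ Δ' Θ Θ' : Fam E.Ob} {A B B' : E.Ob} (f : E.Hom Γ A) (g : E.Hom Δ B)
    (a : Δ' ⊎ .single A ≅ₗ Δ) (c : Γ ⊎ Δ' ≅ₗ Θ) (σ : Θ ≅ₗ Θ') (h : B = B') :
    E.perm σ h (E.sub f g a c) = E.sub f (E.perm (.refl _) h g) a (c.trans σ) := by
  subst h
  rw [E.perm_refl, sub, E.perm_perm]; rfl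

theorem sub_perm_left {Γ Γ' Δ Δ' Θ : Fam E.Ob} {A A' B : E.Ob} (σ : Γ ≅ₗ Γ') (h : A = A')
    (f : E.Hom Γ A) (g : E.Hom Δ B) (a : Δ' ⊎ .single A' ≅ₗ Δ) (c : Γ' ⊎ Δ' ≅ₗ Θ) :
    E.sub (E.perm σ h f) g a c =
      E.sub f g (a := h ▸ a) ((σ.append (.refl _)).trans c) := by
  subst h
  rw [sub, E.comp_perm_left, E.perm_perm]; rfl

theorem sub_perm {Γ Δ Δ₀ Δ' Θ : Fam E.Ob} {A B : E.Ob} (τ : Δ₀ ≅ₗ Δ)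
    (f : E.Hom Γ A) (g : E.Hom Δ₀ B) (a : Δ' ⊎ .single A ≅ₗ Δ) (c : Γ ⊎ Δ' ≅ₗ Θ) :
    E.sub f (E.perm τ rfl g) a c = E.sub f g (a.trans τ.symm) c := by
  rw [sub, E.perm_perm]
  rfl

theorem sub_congr {Γ Δ Δ' Δ'' Θ : Fam E.Ob} {A B : E.Ob} (f : E.Hom Γ A) (g : E.Hom Δ B)
    (a : Δ' ⊎ .single A ≅ₗ Δ) (c : Γ ⊎ Δ' ≅ₗ Θ) (a' : Δ'' ⊎ .single A ≅ₗ Δ) (c' : Γ ⊎ Δ'' ≅ₗ Θ)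
    (h1 : a.equiv (.inr ()) = a'.equiv (.inr ()))
    (h2 : ∀ i, c.equiv (.inl i) = c'.equiv (.inl i))
    (h3 : ∀ i j, a.equiv (.inl i) = a'.equiv (.inl j) → c.equiv (.inr i) = c'.equiv (.inr j)) :
    E.sub f g a c = E.sub f g a' c' := by
  obtain ⟨ρ, hρ⟩ := Fam.Iso.exists_of_fix (a.trans a'.symm) (a'.symm_apply_eq h1.symm)
  have e1 : a'.symm = a.symm.trans (ρ.append (.refl _)) := by
    rw [← hρ]; apply Fam.Iso.ext; intro i
    exact congrArg a'.equiv.symm (a.equiv.apply_symm_apply i).symm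
  rw [sub, sub, e1, ← E.perm_perm (h := rfl) (h' := rfl), E.comp_perm_right, E.perm_perm]
  apply E.perm_congr
  rintro (i | i)
  · exact h2 i
  · apply h3
    have := congrArg (fun t => a'.equiv (t.equiv (.inl i))) hρ
    exact (a'.equiv.apply_symm_apply _).symm.trans this

theorem sub_assoc {Γ G G' H H' Δ Δ' Θ₀ Θ : Fam E.Ob} {A B D : E.Ob}
    (f : E.Hom Γ A) (g : E.Hom G B) (h : E.Hom H D)
    (ag : G' ⊎ .single A ≅ₗ G) (b : H' ⊎ .single B ≅ₗ H)
    (d : G ⊎ H' ≅ₗ Δ) (a : Δ' ⊎ .single A ≅ₗ Δ) (c : Γ ⊎ Δ' ≅ₗ Θ)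
    (c₀ : Γ ⊎ G' ≅ₗ Θ₀) (c' : Θ₀ ⊎ H' ≅ₗ Θ)
    (h1 : d.equiv (.inl (ag.equiv (.inr ()))) = a.equiv (.inr ()))
    (h2 : ∀ i, c'.equiv (.inl (c₀.equiv (.inl i))) = c.equiv (.inl i))
    (h3 : ∀ i j, d.equiv (.inl (ag.equiv (.inl i))) = a.equiv (.inl j) →
      c'.equiv (.inl (c₀.equiv (.inr i))) = c.equiv (.inr j))
    (h4 : ∀ i j, d.equiv (.inr i) = a.equiv (.inl j) →
      c'.equiv (.inr i) = c.equiv (.inr j)) :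
    E.sub f (E.sub g h b d) a c = E.sub (E.sub f g ag c₀) h b c' := by
  have e1 : E.sub f (E.sub g h b d) a c = E.sub f (E.comp (E.perm ag.symm rfl g) (E.perm b.symm rfl h))
      (a.trans ((ag.append (.refl _)).trans d).symm) c := by
    have : E.sub g h b d = E.perm ((ag.append (.refl _)).trans d) rfl
        (E.comp (E.perm ag.symm rfl g) (E.perm b.symm rfl h)) := by
      rw [← E.perm_perm (h := rfl) (h' := rfl), ← E.comp_perm_left, E.perm_perm,
        E.perm_id' (fun i => ag.equiv.apply_symm_apply i)]
      rfl
    rw [this, E.sub_perm]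
  have e2 : E.sub (E.sub f g ag c₀) h b c' = E.sub f
      (E.comp (E.perm ag.symm rfl g) (E.perm b.symm rfl h)) (Fam.Iso.rightComm _ _ _)
      ((Fam.Iso.assoc _ _ _).symm.trans ((c₀.append (.refl _)).trans c')) := by
    conv_lhs => rw [sub, sub]
    rw [E.comp_perm_left, E.assoc, sub, E.perm_perm, E.perm_perm]
    rfl
  rw [e1, e2]
  apply E.sub_congr
  · show (Equiv.sumCongr ag.equiv (Equiv.refl _)).symm (d.equiv.symm (a.equiv (.inr ()))) = .inl (.inr ())
    rw [← h1, Equiv.symm_apply_apply]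
    show Sum.inl (ag.equiv.symm _) = _
    rw [Equiv.symm_apply_apply]
  · intro i; exact (h2 i).symm
  · intro j i hij
    have hij' : a.equiv (.inl j) =
        d.equiv ((ag.append (.refl H')).equiv ((Fam.Iso.rightComm _ _ _).equiv (.inl i))) := by
      rw [← hij]
      show _ = ((ag.append (.refl H')).trans d).equiv (((ag.append (.refl H')).trans d).equiv.symm (a.equiv (.inl j)))
      rw [Equiv.apply_symm_apply]
    rcases i with i | i
    · exact (h3 i j hij'.symm).symm
    · exact (h4 i j hij'.symm).symm

theorem sub_congr' {Γ Δ Δ' Δ'' Θ : Fam E.Ob} {A B : E.Ob} (f : E.Hom Γ A) (g : E.Hom Δ B)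
    (a : Δ' ⊎ .single A ≅ₗ Δ) (c : Γ ⊎ Δ' ≅ₗ Θ) (a' : Δ'' ⊎ .single A ≅ₗ Δ)
    (h1 : a.equiv (.inr ()) = a'.equiv (.inr ())) :
    ∃ ρ : Δ'' ≅ₗ Δ', (∀ i, a.equiv (.inl (ρ.equiv i)) = a'.equiv (.inl i)) ∧
      E.sub f g a c = E.sub f g a' (((Fam.Iso.refl Γ).append ρ).trans c) := by
  obtain ⟨ρ, hρ⟩ := Fam.Iso.exists_of_fix (a'.trans a.symm) (a.symm_apply_eq h1)
  have h2 : ∀ i, a.equiv (.inl (ρ.equiv i)) = a'.equiv (.inl i) := by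
    intro i
    have := congrArg (fun t => a.equiv (t.equiv (.inl i))) hρ
    exact this.symm.trans (a.equiv.apply_symm_apply _)
  refine ⟨ρ, h2, ?_⟩
  apply E.sub_congr _ _ _ _ _ _ h1
  · intro i; rfl
  · intro i j h
    show c.equiv (.inr i) = c.equiv (.inr (ρ.equiv j))
    rw [← h2] at h
    rw [Sum.inl_injective (a.equiv.injective h)]

theorem sub_comm {Γ Δ H H' Ha Hb Hab Hab' Θ Θ' Θ'' : Fam E.Ob} {A B D : E.Ob}
    (f : E.Hom Γ A) (g : E.Hom Δ B) (h : E.Hom H D)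
    (w : H' ⊎ .single A ⊎ .single B ≅ₗ H)
    (b : Hb ⊎ .single B ≅ₗ H) (d : Δ ⊎ Hb ≅ₗ Θ') (a : Hab ⊎ .single A ≅ₗ Θ') (c : Γ ⊎ Hab ≅ₗ Θ)
    (b' : Ha ⊎ .single A ≅ₗ H) (d' : Γ ⊎ Ha ≅ₗ Θ'')
    (a' : Hab' ⊎ .single B ≅ₗ Θ'') (c' : Δ ⊎ Hab' ≅ₗ Θ)
    (hB : b.equiv (.inr ()) = w.equiv (.inr ()))
    (hA : b'.equiv (.inr ()) = w.equiv (.inl (.inr ())))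
    (hB' : ∀ i, b.equiv (.inl i) = w.equiv (.inl (.inr ())) → d.equiv (.inr i) = a.equiv (.inr ()))
    (hA' : ∀ i, b'.equiv (.inl i) = w.equiv (.inr ()) → d'.equiv (.inr i) = a'.equiv (.inr ()))
    (hΓ : ∀ i j, d'.equiv (.inl i) = a'.equiv (.inl j) → c.equiv (.inl i) = c'.equiv (.inr j))
    (hΔ : ∀ i j, d.equiv (.inl i) = a.equiv (.inl j) → c'.equiv (.inl i) = c.equiv (.inr j))
    (hH : ∀ x i j k l, b.equiv (.inl i) = w.equiv (.inl (.inl x)) →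
      b'.equiv (.inl j) = w.equiv (.inl (.inl x)) →
      d.equiv (.inr i) = a.equiv (.inl k) → d'.equiv (.inr j) = a'.equiv (.inl l) →
        c.equiv (.inr k) = c'.equiv (.inr l)) :
    E.sub f (E.sub g h b d) a c = E.sub g (E.sub f h b' d') a' c' := by
  obtain ⟨ρ, hρ, e1⟩ := E.sub_congr' g h b d w hB
  obtain ⟨ρ', hρ', e2⟩ := E.sub_congr' f h b' d' ((Fam.Iso.rightComm _ _ _).trans w) hA
  have e3 : E.sub f (E.sub g h b d) a c = E.sub f (E.perm (Fam.Iso.assoc _ _ _).symm rfl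
      (E.comp g (E.perm w.symm rfl h)))
      (a.trans (((Fam.Iso.assoc _ _ _).trans (((Fam.Iso.refl Δ).append ρ).trans d)).symm)) c := by
    rw [e1]
    rw [← E.sub_perm, E.perm_perm, sub, sub]
    congr 3
    exact E.perm_congr (by rintro (i | i | i) <;> rfl)
  have e4 : E.sub g (E.sub f h b' d') a' c' = E.sub g (E.perm (Fam.Iso.assoc _ _ _).symm rfl
      (E.comp f (E.perm (.rightComm _ _ _) rfl (E.perm w.symm rfl h))))
      (a'.trans (((Fam.Iso.assoc _ _ _).trans (((Fam.Iso.refl Γ).append ρ').trans d')).symm)) c' := by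
    rw [e2]
    rw [← E.sub_perm, E.perm_perm, E.perm_perm, sub, sub]
    congr 3
    exact E.perm_congr (by rintro (i | i | i) <;> rfl)
  have hd : d.equiv (.inr (ρ.equiv (.inr ()))) = a.equiv (.inr ()) := hB' _ (hρ _)
  have hd' : d'.equiv (.inr (ρ'.equiv (.inr ()))) = a'.equiv (.inr ()) := hA' _ (hρ' _)
  obtain ⟨r, hr, e5⟩ := E.sub_congr' f (E.perm (Fam.Iso.assoc _ _ _).symm rfl
      (E.comp g (E.perm w.symm rfl h)))
      (a.trans (((Fam.Iso.assoc _ _ _).trans (((Fam.Iso.refl Δ).append ρ).trans d)).symm)) c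
      (.refl _) (Fam.Iso.symm_apply_eq ((Fam.Iso.assoc _ _ _).trans (((Fam.Iso.refl Δ).append ρ).trans d)) hd)
  obtain ⟨r', hr', e6⟩ := E.sub_congr' g (E.perm (Fam.Iso.assoc _ _ _).symm rfl
      (E.comp f (E.perm (.rightComm _ _ _) rfl (E.perm w.symm rfl h))))
      (a'.trans (((Fam.Iso.assoc _ _ _).trans (((Fam.Iso.refl Γ).append ρ').trans d')).symm)) c'
      (.refl _) (Fam.Iso.symm_apply_eq ((Fam.Iso.assoc _ _ _).trans (((Fam.Iso.refl Γ).append ρ').trans d')) hd')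
  have hr1 : ∀ i, a.equiv (.inl (r.equiv i)) = ((Fam.Iso.assoc _ _ _).trans (((Fam.Iso.refl Δ).append ρ).trans d)).equiv (.inl i) := by
    intro i
    have := congrArg ((Fam.Iso.assoc _ _ _).trans (((Fam.Iso.refl Δ).append ρ).trans d)).equiv (hr i)
    exact (Equiv.apply_symm_apply _ _).symm.trans this
  have hr1' : ∀ i, a'.equiv (.inl (r'.equiv i)) = ((Fam.Iso.assoc _ _ _).trans (((Fam.Iso.refl Γ).append ρ').trans d')).equiv (.inl i) := by
    intro i
    have := congrArg ((Fam.Iso.assoc _ _ _).trans (((Fam.Iso.refl Γ).append ρ').trans d')).equiv (hr' i)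
    exact (Equiv.apply_symm_apply _ _).symm.trans this
  rw [e3, e4, e5, e6, sub, sub]
  have t1 : ∀ {X : Fam E.Ob} {B : E.Ob} (z : E.Hom X B), E.perm (Fam.Iso.refl X).symm rfl z = z :=
    fun z => E.perm_id' (fun _ => rfl)
  rw [t1, t1, E.interchange, E.perm_perm]
  apply E.perm_congr
  rintro (i | i | i)
  · exact (hΔ _ _ (hr1 (.inl i)).symm).symm
  · exact hΓ _ _ (hr1' (.inl i)).symm
  · exact hH i _ _ _ _ (hρ (.inl i)) (hρ' (.inl i)) (hr1 (.inr i)).symm (hr1' (.inr i)).symm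

end Multicat

namespace Fam.Iso

noncomputable abbrev ofFun {C : Type u} {Γ Δ : Fam C} (f : Γ.I → Δ.I)
    (hf : Function.Bijective f) (h : ∀ i, Δ.obj (f i) = Γ.obj i) : Γ ≅ₗ Δ :=
  ⟨Equiv.ofBijective f hf, h⟩

abbrev single {C : Type u} {A B : C} (h : A = B) : .single A ≅ₗ .single B :=
  ⟨Equiv.refl _, fun _ => h.symm⟩

/-- Put back an entry that has been erased. -/
noncomputable abbrev insert {C : Type u} (Γ : Fam C) (k : Γ.I) {A : C} (h : Γ.obj k = A) :
    Γ.erase k ⊎ .single A ≅ₗ Γ :=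
  ofFun (Sum.elim (fun i => i.1) fun _ => k)
    ⟨by
      rintro (⟨i, hi⟩ | i) (⟨j, hj⟩ | j) hij
      · exact congrArg Sum.inl (Subtype.ext hij)
      · exact absurd hij hi
      · exact absurd hij.symm hj
      · rfl, fun i => by
        by_cases hi : i = k
        · exact ⟨.inr (), hi.symm⟩
        · exact ⟨.inl ⟨i, hi⟩, rfl⟩⟩
    (by rintro (i | i); exacts [rfl, h])

abbrev mapAppend {C : Type u} {D : Type v} (F : C → D) (Γ Δ : Fam C) :
    Γ.map F ⊎ Δ.map F ≅ₗ (Γ ⊎ Δ).map F :=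
  ⟨Equiv.refl _, by rintro (i | i) <;> rfl⟩

abbrev erase {C : Type u} {Γ Δ : Fam C} (σ : Γ ≅ₗ Δ) {i : Γ.I} {j : Δ.I} (h : σ.equiv i = j) :
    Γ.erase i ≅ₗ Δ.erase j :=
  ⟨σ.equiv.subtypeEquiv fun a => by rw [← h]; simp, fun a => σ.obj_eq a.1⟩

noncomputable abbrev eraseInl {C : Type u} (X Y : Fam C) (k : X.I) (x : (X.erase k).I) :
    Y ⊎ (X.erase x.1).erase ⟨k, x.2.symm⟩ ≅ₗ (X.erase k ⊎ Y).erase (.inl x) :=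
  ofFun (Sum.elim (fun y => ⟨.inr y, by simp⟩)
      fun z => ⟨.inl ⟨z.1.1, fun h => z.2 (Subtype.ext h)⟩, fun h => z.1.2 (congrArg Subtype.val (Sum.inl_injective h))⟩)
    ⟨by rintro (y | ⟨⟨z, h1⟩, h2⟩) (y' | ⟨⟨z', h1'⟩, h2'⟩) hij <;> simp_all,
      by
        rintro ⟨⟨z, h1⟩ | y, h2⟩
        · exact ⟨.inr ⟨⟨z, fun h => h2 (congrArg Sum.inl (Subtype.ext h))⟩, fun h => h1 (congrArg Subtype.val h)⟩, rfl⟩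
        · exact ⟨.inl y, rfl⟩⟩
    (by rintro (i | i) <;> rfl)

noncomputable abbrev eraseInr {C : Type u} (X Y : Fam C) (l : Y.I) (y : (Y.erase l).I) :
    X ⊎ (Y.erase y.1).erase ⟨l, y.2.symm⟩ ≅ₗ (X ⊎ Y.erase l).erase (.inr y) :=
  ofFun (Sum.elim (fun x => ⟨.inl x, by simp⟩)
      fun z => ⟨.inr ⟨z.1.1, fun h => z.2 (Subtype.ext h)⟩, fun h => z.1.2 (congrArg Subtype.val (Sum.inr_injective h))⟩)
    ⟨by rintro (y | ⟨⟨z, h1⟩, h2⟩) (y' | ⟨⟨z', h1'⟩, h2'⟩) hij <;> simp_all,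
      by
        rintro ⟨y | ⟨z, h1⟩, h2⟩
        · exact ⟨.inl y, rfl⟩
        · exact ⟨.inr ⟨⟨z, fun h => h2 (congrArg Sum.inr (Subtype.ext h))⟩, fun h => h1 (congrArg Subtype.val h)⟩, rfl⟩⟩
    (by rintro (i | i) <;> rfl)

end Fam.Iso

namespace Multicat
variable (E : Multicat.{u, v})

theorem sub_perm_perm {Γ Γ' Δ₀ Δ Δ' Δ₀' Θ Θ' : Fam E.Ob} {A A' B B' : E.Ob}
    {σ : Γ ≅ₗ Γ'} {h : A = A'} {τ : Δ₀ ≅ₗ Δ} {h' : B = B'}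
    {f : E.Hom Γ A} {g : E.Hom Δ₀ B} {a : Δ' ⊎ .single A' ≅ₗ Δ} {c : Γ' ⊎ Δ' ≅ₗ Θ'}
    {a' : Δ₀' ⊎ .single A ≅ₗ Δ₀} {c' : Γ ⊎ Δ₀' ≅ₗ Θ} {ρ : Θ ≅ₗ Θ'} {h'' : B = B'}
    (h1 : τ.equiv (a'.equiv (.inr ())) = a.equiv (.inr ()))
    (h2 : ∀ i, ρ.equiv (c'.equiv (.inl i)) = c.equiv (.inl (σ.equiv i)))
    (h3 : ∀ i j, τ.equiv (a'.equiv (.inl i)) = a.equiv (.inl j) →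
      ρ.equiv (c'.equiv (.inr i)) = c.equiv (.inr j)) :
    E.sub (E.perm σ h f) (E.perm τ h' g) a c = E.perm ρ h'' (E.sub f g a' c') := by
  subst h h'
  rw [E.sub_perm_left, E.sub_perm, E.perm_sub, E.perm_refl]
  apply E.sub_congr
  · exact (τ.symm_apply_eq (h1))
  · intro i; exact (h2 i).symm
  · intro i j hij
    refine (h3 j i ?_).symm
    rw [← hij]
    exact τ.equiv.apply_symm_apply _

theorem sub_eq_perm {Γ Δ Δ' Δ'' Θ Θ' : Fam E.Ob} {A B : E.Ob} {f : E.Hom Γ A} {g : E.Hom Δ B}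
    {a : Δ' ⊎ .single A ≅ₗ Δ} {c : Γ ⊎ Δ' ≅ₗ Θ'} {a' : Δ'' ⊎ .single A ≅ₗ Δ} {c' : Γ ⊎ Δ'' ≅ₗ Θ}
    {ρ : Θ ≅ₗ Θ'} {e : B = B}
    (h1 : a.equiv (.inr ()) = a'.equiv (.inr ()))
    (h2 : ∀ i, c.equiv (.inl i) = ρ.equiv (c'.equiv (.inl i)))
    (h3 : ∀ i j, a.equiv (.inl i) = a'.equiv (.inl j) →
      c.equiv (.inr i) = ρ.equiv (c'.equiv (.inr j))) :
    E.sub f g a c = E.perm ρ e (E.sub f g a' c') := by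
  rw [E.perm_sub, E.perm_refl]
  exact E.sub_congr _ _ _ _ _ _ h1 h2 h3

theorem id_sub {Γ Δ Δ' Θ : Fam E.Ob} {A A' B : E.Ob} {g : E.Hom Δ B} {σ : .single A ≅ₗ Γ}
    {e : A = A'} {a : Δ' ⊎ .single A' ≅ₗ Δ} {c : Γ ⊎ Δ' ≅ₗ Θ} {ρ : Δ ≅ₗ Θ} {e₀ : B = B}
    (h1 : ∀ i, c.equiv (.inl i) = ρ.equiv (a.equiv (.inr ())))
    (h2 : ∀ j, c.equiv (.inr j) = ρ.equiv (a.equiv (.inl j))) :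
    E.sub (E.perm σ e (E.id A)) g a c = E.perm ρ e₀ g := by
  subst e
  rw [sub, E.comp_perm_left, E.id_comp, E.perm_perm, E.perm_perm, E.perm_perm]
  apply E.perm_congr
  intro i
  obtain ⟨i, rfl⟩ := a.equiv.surjective i
  show c.equiv ((σ.append (.refl _)).equiv ((Fam.Iso.comm _ _).equiv
    (a.equiv.symm (a.equiv i)))) = _
  rw [Equiv.symm_apply_apply]
  rcases i with i | i
  · exact h2 i
  · exact h1 _

theorem id_sub' {Γ Δ Δ' Θ Θ' : Fam E.Ob} {A A' B B' : E.Ob} {g : E.Hom Δ B} {σ : .single A ≅ₗ Γ}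
    {e : A = A'} {a : Δ' ⊎ .single A' ≅ₗ Δ} {c : Γ ⊎ Δ' ≅ₗ Θ} {τ : Θ ≅ₗ Θ'} {ρ : Δ ≅ₗ Θ'}
    {e₀ e₁ : B = B'}
    (h1 : ∀ i, τ.equiv (c.equiv (.inl i)) = ρ.equiv (a.equiv (.inr ())))
    (h2 : ∀ j, τ.equiv (c.equiv (.inr j)) = ρ.equiv (a.equiv (.inl j))) :
    E.perm τ e₁ (E.sub (E.perm σ e (E.id A)) g a c) = E.perm ρ e₀ g := by
  subst e₀
  rw [E.perm_sub, E.perm_refl]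
  exact E.id_sub h1 h2

theorem id_sub'' {Γ Δ Δ₁ Δ' Θ Θ' : Fam E.Ob} {A A' B B₁ B' : E.Ob} {g : E.Hom Δ B}
    {σ : .single A ≅ₗ Γ} {κ : Δ ≅ₗ Δ₁}
    {e : A = A'} {a : Δ' ⊎ .single A' ≅ₗ Δ₁} {c : Γ ⊎ Δ' ≅ₗ Θ} {τ : Θ ≅ₗ Θ'} {ρ : Δ ≅ₗ Θ'}
    {e₀ : B = B'} {e₂ : B = B₁} {e₁ : B₁ = B'}
    (h : ∀ z i, κ.equiv z = a.equiv i →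
      τ.equiv (c.equiv (Sum.elim .inr (fun _ => .inl (σ.equiv ())) i)) = ρ.equiv z) :
    E.perm τ e₁ (E.sub (E.perm σ e (E.id A)) (E.perm κ e₂ g) a c) = E.perm ρ e₀ g := by
  subst e₂
  rw [E.sub_perm]
  apply E.id_sub'
  · intro i
    obtain ⟨i, rfl⟩ := σ.equiv.surjective i
    exact h _ (.inr ()) (κ.equiv.apply_symm_apply _)
  · intro i
    exact h _ (.inl i) (κ.equiv.apply_symm_apply _)

theorem sub_eq_perm' {Γ Δ Δ₁ Δ₂ Δ' Δ'' Θ₁ Θ₂ Θ' : Fam E.Ob} {A B B₁ B₂ B' : E.Ob}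
    {f : E.Hom Γ A} {g : E.Hom Δ B}
    {κ₁ : Δ ≅ₗ Δ₁} {κ₂ : Δ ≅ₗ Δ₂} {e₁ : B = B₁} {e₂ : B = B₂}
    {a : Δ' ⊎ .single A ≅ₗ Δ₁} {c : Γ ⊎ Δ' ≅ₗ Θ₁}
    {a' : Δ'' ⊎ .single A ≅ₗ Δ₂} {c' : Γ ⊎ Δ'' ≅ₗ Θ₂}
    {ρ₁ : Θ₁ ≅ₗ Θ'} {ρ₂ : Θ₂ ≅ₗ Θ'} {e : B₁ = B'} {e' : B₂ = B'}
    (h1 : ∀ z, κ₁.equiv z = a.equiv (.inr ()) → κ₂.equiv z = a'.equiv (.inr ()))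
    (h2 : ∀ i, ρ₁.equiv (c.equiv (.inl i)) = ρ₂.equiv (c'.equiv (.inl i)))
    (h3 : ∀ z i j, κ₁.equiv z = a.equiv (.inl i) → κ₂.equiv z = a'.equiv (.inl j) →
      ρ₁.equiv (c.equiv (.inr i)) = ρ₂.equiv (c'.equiv (.inr j))) :
    E.perm ρ₁ e (E.sub f (E.perm κ₁ e₁ g) a c) = E.perm ρ₂ e' (E.sub f (E.perm κ₂ e₂ g) a' c') := by
  subst e₁ e₂ e
  rw [E.sub_perm, E.sub_perm, E.perm_sub, E.perm_sub, E.perm_refl]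
  apply E.sub_congr
  · exact (κ₂.symm_apply_eq (h1 _ (κ₁.equiv.apply_symm_apply _))).symm
  · exact h2
  · intro i j hij
    refine h3 _ i j (κ₁.equiv.apply_symm_apply _) ?_
    exact (congrArg κ₂.equiv hij).trans (κ₂.equiv.apply_symm_apply _)

theorem sub_id {Γ Δ Δ' Θ Θ' : Fam E.Ob} {A A₀ A₁ A₂ : E.Ob} (q : A = A₀) {f : E.Hom Γ A}
    {σ : .single A₀ ≅ₗ Δ} {e : A₀ = A₁} {a : Δ' ⊎ .single A ≅ₗ Δ} {c : Γ ⊎ Δ' ≅ₗ Θ}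
    {ρ : Θ ≅ₗ Θ'} {ρ' : Γ ≅ₗ Θ'} {e' : A₁ = A₂} {e₀ : A = A₂}
    (h : ∀ i, ρ.equiv (c.equiv (.inl i)) = ρ'.equiv i) :
    E.perm ρ e' (E.sub f (E.perm σ e (E.id A₀)) a c) = E.perm ρ' e₀ f := by
  subst q e e'
  rw [E.sub_perm]
  obtain ⟨r, hr, e1⟩ := E.sub_congr' f (E.id A) (a.trans σ.symm) c (.nilLeft _) rfl
  rw [e1, sub, E.comp_id, E.perm_perm, E.perm_perm]
  apply E.perm_congr
  exact h

theorem sub_perm_left' {Γ Γ' Δ Δ' Θ : Fam E.Ob} {A A' B : E.Ob} (σ : Γ ≅ₗ Γ') (h : A = A')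
    (f : E.Hom Γ A) (g : E.Hom Δ B) (a : Δ' ⊎ .single A' ≅ₗ Δ) (c : Γ' ⊎ Δ' ≅ₗ Θ) :
    E.sub (E.perm σ h f) g a c =
      E.sub f g (((Fam.Iso.refl _).append (.single h)).trans a)
        ((σ.append (.refl _)).trans c) := by
  subst h
  rw [E.sub_perm_left]
  apply E.sub_congr
  · rfl
  · intro i; rfl
  · intro i j hij
    have : i = j := Sum.inl_injective (a.equiv.injective hij)
    subst this; rfl

theorem sub_assoc' {Γ G G' H H' H'' Δ Δ' Δ'' Θ₀ Θ₀' Θ Θ' Θ'' : Fam E.Ob} {A B B' D D' D'' : E.Ob}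
    {f : E.Hom Γ A} {g : E.Hom G B} {h : E.Hom H D}
    {ag : G' ⊎ .single A ≅ₗ G} {b : H' ⊎ .single B ≅ₗ H} {b' : H'' ⊎ .single B' ≅ₗ H}
    {d : G ⊎ H' ≅ₗ Δ} {τ : Δ ≅ₗ Δ''} {a : Δ' ⊎ .single A ≅ₗ Δ''} {c : Γ ⊎ Δ' ≅ₗ Θ}
    {c₀ : Γ ⊎ G' ≅ₗ Θ₀} {σ : Θ₀ ≅ₗ Θ₀'} {c' : Θ₀' ⊎ H'' ≅ₗ Θ'} {ρ : Θ ≅ₗ Θ''} {ρ' : Θ' ≅ₗ Θ''}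
    {e1 : D = D'} {e2 : D' = D''} {e3 : B = B'} {e4 : D = D''}
    (h0 : b'.equiv (.inr ()) = b.equiv (.inr ()))
    (h1 : τ.equiv (d.equiv (.inl (ag.equiv (.inr ())))) = a.equiv (.inr ()))
    (h2 : ∀ i, ρ'.equiv (c'.equiv (.inl (σ.equiv (c₀.equiv (.inl i))))) =
      ρ.equiv (c.equiv (.inl i)))
    (h3 : ∀ i j, τ.equiv (d.equiv (.inl (ag.equiv (.inl i)))) = a.equiv (.inl j) →
      ρ'.equiv (c'.equiv (.inl (σ.equiv (c₀.equiv (.inr i))))) = ρ.equiv (c.equiv (.inr j)))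
    (h4 : ∀ i i' j, b.equiv (.inl i) = b'.equiv (.inl i') →
      τ.equiv (d.equiv (.inr i)) = a.equiv (.inl j) →
      ρ'.equiv (c'.equiv (.inr i')) = ρ.equiv (c.equiv (.inr j))) :
    E.perm ρ e2 (E.sub f (E.perm τ e1 (E.sub g h b d)) a c) =
      E.perm ρ' e4 (E.sub (E.perm σ e3 (E.sub f g ag c₀)) h b' c') := by
  subst e1 e2 e3
  rw [E.perm_sub, E.perm_sub, E.perm_refl, E.perm_refl, E.perm_sub, E.perm_refl, E.sub_perm_left']
  obtain ⟨r, hr, e⟩ := E.sub_congr' (E.sub f g ag c₀) h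
    (((Fam.Iso.refl _).append (.single rfl)).trans b')
    ((σ.append (.refl _)).trans (c'.trans ρ')) b h0
  rw [e]
  apply E.sub_assoc
  · exact h1
  · exact h2
  · exact h3
  · intro i j hij
    exact h4 _ _ _ (hr i).symm hij

theorem sub_comm' {Γ Δ H H' Ha Hb Hab Hab' Θ₁ Θ₂ Θ Θ' Θ'' Ξ₁ Ξ₂ : Fam E.Ob}
    {A B D D₁ D₂ D' : E.Ob}
    {f : E.Hom Γ A} {g : E.Hom Δ B} {h : E.Hom H D}
    (w : H' ⊎ .single A ⊎ .single B ≅ₗ H)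
    {b : Hb ⊎ .single B ≅ₗ H} {d : Δ ⊎ Hb ≅ₗ Θ'} {τ : Θ' ≅ₗ Ξ₁}
    {a : Hab ⊎ .single A ≅ₗ Ξ₁} {c : Γ ⊎ Hab ≅ₗ Θ₁}
    {b' : Ha ⊎ .single A ≅ₗ H} {d' : Γ ⊎ Ha ≅ₗ Θ''} {τ' : Θ'' ≅ₗ Ξ₂}
    {a' : Hab' ⊎ .single B ≅ₗ Ξ₂} {c' : Δ ⊎ Hab' ≅ₗ Θ₂} {ρ : Θ₁ ≅ₗ Θ} {ρ' : Θ₂ ≅ₗ Θ}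
    {e1 : D = D₁} {e2 : D₁ = D'} {e3 : D = D₂} {e4 : D₂ = D'}
    (hB : b.equiv (.inr ()) = w.equiv (.inr ()))
    (hA : b'.equiv (.inr ()) = w.equiv (.inl (.inr ())))
    (hB' : ∀ i, b.equiv (.inl i) = w.equiv (.inl (.inr ())) →
      τ.equiv (d.equiv (.inr i)) = a.equiv (.inr ()))
    (hA' : ∀ i, b'.equiv (.inl i) = w.equiv (.inr ()) →
      τ'.equiv (d'.equiv (.inr i)) = a'.equiv (.inr ()))
    (hΓ : ∀ i j, τ'.equiv (d'.equiv (.inl i)) = a'.equiv (.inl j) →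
      ρ.equiv (c.equiv (.inl i)) = ρ'.equiv (c'.equiv (.inr j)))
    (hΔ : ∀ i j, τ.equiv (d.equiv (.inl i)) = a.equiv (.inl j) →
      ρ'.equiv (c'.equiv (.inl i)) = ρ.equiv (c.equiv (.inr j)))
    (hH : ∀ x i j k l, b.equiv (.inl i) = w.equiv (.inl (.inl x)) →
      b'.equiv (.inl j) = w.equiv (.inl (.inl x)) →
      τ.equiv (d.equiv (.inr i)) = a.equiv (.inl k) →
      τ'.equiv (d'.equiv (.inr j)) = a'.equiv (.inl l) →
        ρ.equiv (c.equiv (.inr k)) = ρ'.equiv (c'.equiv (.inr l))) :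
    E.perm ρ e2 (E.sub f (E.perm τ e1 (E.sub g h b d)) a c) =
      E.perm ρ' e4 (E.sub g (E.perm τ' e3 (E.sub f h b' d')) a' c') := by
  subst e1 e2 e3
  rw [E.perm_sub, E.perm_sub, E.perm_refl, E.perm_refl, E.perm_sub, E.perm_sub, E.perm_refl,
    E.perm_refl]
  exact E.sub_comm f g h w _ _ _ _ _ _ _ _ hB hA hB' hA' hΓ hΔ hH

theorem comp_eq_sub {Γ Δ Θ : Fam E.Ob} {A B : E.Ob} (f : E.Hom Γ A) (g : E.Hom (Δ ⊎ .single A) B)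
    (c : Γ ⊎ Δ ≅ₗ Θ) : E.perm c rfl (E.comp f g) = E.sub f g (.refl _) c := by
  rw [sub, E.perm_id' (σ := (Fam.Iso.refl _).symm) (fun _ => rfl)]

end Multicat

/-- Objects of the Chu construction. -/
structure ChuOb (E : Multicat.{u, v}) (bot : E.Ob) where
  pos : E.Ob
  neg : E.Ob
  pair : E.Hom (.single pos ⊎ .single neg) bot

/-- The dual interchanges the two components. -/
abbrev ChuOb.dual {E : Multicat.{u, v}} {bot : E.Ob} (A : ChuOb E bot) : ChuOb E bot :=
  ⟨A.neg, A.pos, E.perm (.comm _ _) rfl A.pair⟩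

theorem ChuOb.dual_dual {E : Multicat.{u, v}} {bot : E.Ob} (A : ChuOb E bot) :
    A.dual.dual = A := by
  cases A
  simp only [dual, E.perm_perm]
  congr
  apply E.perm_id'
  rintro (i | i) <;> rfl

/-- Morphisms of the Chu construction. All objects are written on one side: a morphism from `Γ` to
`Δ` is given by the list of `Γ` and the duals of `Δ`, so that `comp k` has as target the component
of the omitted object. -/
@[ext]
structure ChuHom (E : Multicat.{u, v}) (bot : E.Ob) (X : Fam (ChuOb E bot)) where
  under : E.Hom (X.map ChuOb.pos) bot
  comp (k : X.I) : E.Hom ((X.erase k).map ChuOb.pos) (X.obj k).neg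
  compat (k : X.I) :
    E.perm (.insert (X.map ChuOb.pos) k rfl) rfl (E.comp (comp k) (X.obj k).pair) = under

namespace ChuHom

/-- `A` is the dual of `B`. -/
structure DualPair {E : Multicat.{u, v}} {bot : E.Ob} (A B : ChuOb E bot) : Prop where
  pos_eq : A.pos = B.neg
  neg_eq : A.neg = B.pos
  pair_eq : E.perm ⟨Equiv.sumComm _ _, by rintro (_ | _); exacts [pos_eq.symm, neg_eq.symm]⟩ rfl
    A.pair = B.pair

variable {E : Multicat.{u, v}} {bot : E.Ob}

theorem DualPair.symm {A B : ChuOb E bot} (h : DualPair A B) : DualPair B A where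
  pos_eq := h.neg_eq.symm
  neg_eq := h.pos_eq.symm
  pair_eq := by
    rw [← h.pair_eq, E.perm_perm]
    apply E.perm_id'
    rintro (i | i) <;> rfl

theorem dualPair (A : ChuOb E bot) : DualPair A A.dual := ⟨rfl, rfl, rfl⟩

theorem pair_of_eq {A B : ChuOb E bot} (h : A = B) :
    B.pair = E.perm (.append (.single (congrArg ChuOb.pos h)) (.single (congrArg ChuOb.neg h)))
      rfl A.pair := by
  subst h
  exact (E.perm_id' (by rintro (i | i) <;> rfl)).symm

theorem compat_sub {X : Fam (ChuOb E bot)} (f : ChuHom E bot X) (k : X.I) :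
    E.sub (f.comp k) (X.obj k).pair (.refl _) (.insert (X.map ChuOb.pos) k rfl) = f.under := by
  rw [← E.comp_eq_sub, f.compat]

theorem sub_under {X Y : Fam (ChuOb E bot)} (f : ChuHom E bot X) (g : ChuHom E bot Y) (k : X.I)
    (l : Y.I) (h : DualPair (X.obj k) (Y.obj l)) :
    E.sub (g.comp l) f.under (.insert (X.map ChuOb.pos) k h.pos_eq)
      ((Fam.Iso.comm _ _).trans (.mapAppend ChuOb.pos (X.erase k) (Y.erase l))) =
    E.sub (f.comp k) g.under (.insert (Y.map ChuOb.pos) l h.neg_eq.symm)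
      (.mapAppend ChuOb.pos (X.erase k) (Y.erase l)) := by
  rw [← f.compat_sub k, ← g.compat_sub l, ← h.pair_eq, E.sub_perm]
  apply E.sub_comm (w := (Fam.Iso.nilLeft _).append (.refl _) |>.trans
    (.append (.single h.pos_eq.symm) (.refl _)))
  · rfl
  · rfl
  · rintro ⟨⟩ -; rfl
  · rintro ⟨⟩ -; rfl
  · intro i j hij
    obtain rfl : i = j := Subtype.ext hij
    rfl
  · intro i j hij
    obtain rfl : i = j := Subtype.ext hij
    rfl
  · rintro ⟨⟩

def perm {X X' : Fam (ChuOb E bot)} (σ : X ≅ₗ X') (f : ChuHom E bot X) : ChuHom E bot X' where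
  under := E.perm (σ.map _) rfl f.under
  comp k := E.perm ((σ.erase (σ.equiv.apply_symm_apply k)).map _)
    (congrArg ChuOb.neg (σ.symm.obj_eq k)) (f.comp (σ.equiv.symm k))
  compat k := by
    rw [← f.compat (σ.equiv.symm k), E.comp_eq_sub, E.comp_eq_sub]
    rw [pair_of_eq (σ.symm.obj_eq k)]
    apply E.sub_perm_perm
    · rfl
    · intro i; rfl
    · rintro ⟨⟩ ⟨⟩ -
      exact σ.equiv.apply_symm_apply k

theorem perm_comp {X X' : Fam (ChuOb E bot)} (σ : X ≅ₗ X') (f : ChuHom E bot X) (k : X.I)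
    (k' : X'.I) (h : σ.equiv k = k') :
    (f.perm σ).comp k' = E.perm ((σ.erase h).map _)
      (congrArg ChuOb.neg ((σ.obj_eq k).symm.trans (by rw [h]))) (f.comp k) := by
  obtain rfl : k = σ.equiv.symm k' := by rw [← h, Equiv.symm_apply_apply]
  rfl

/-- Composition along a pair of dual objects. -/
noncomputable def cut₀ {X Y : Fam (ChuOb E bot)} (f : ChuHom E bot X) (g : ChuHom E bot Y) (k : X.I) (l : Y.I)
    (h : DualPair (X.obj k) (Y.obj l)) : ChuHom E bot (X.erase k ⊎ Y.erase l) where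
  under := E.sub (f.comp k) g.under (.insert (Y.map ChuOb.pos) l h.neg_eq.symm)
    (.mapAppend ChuOb.pos (X.erase k) (Y.erase l))
  comp
    | .inl x => E.sub (g.comp l) (f.comp x.1)
        (.insert ((X.erase x.1).map ChuOb.pos) ⟨k, x.2.symm⟩ h.pos_eq)
        (.trans (Fam.Iso.mapAppend ChuOb.pos (Y.erase l) ((X.erase x.1).erase ⟨k, x.2.symm⟩))
          ((Fam.Iso.eraseInl X (Y.erase l) k x).map _))
    | .inr y => E.sub (f.comp k) (g.comp y.1)
        (.insert ((Y.erase y.1).map ChuOb.pos) ⟨l, y.2.symm⟩ h.neg_eq.symm)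
        (.trans (Fam.Iso.mapAppend ChuOb.pos (X.erase k) ((Y.erase y.1).erase ⟨l, y.2.symm⟩))
          ((Fam.Iso.eraseInr (X.erase k) Y l y).map _))
  compat := by
    rintro (x | y)
    · rw [← sub_under f g k l h, ← f.compat_sub x.1, E.comp_eq_sub]
      symm
      apply E.sub_assoc
      · rfl
      · intro i; rfl
      · intro i j hij
        exact congrArg Sum.inl (Subtype.ext hij)
      · rintro ⟨⟩ j hij
        exact congrArg Sum.inl (Subtype.ext hij)
    · rw [← g.compat_sub y.1, E.comp_eq_sub]
      symm
      apply E.sub_assoc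
      · rfl
      · intro i; rfl
      · intro i j hij
        exact congrArg Sum.inr (Subtype.ext hij)
      · rintro ⟨⟩ j hij
        exact congrArg Sum.inr (Subtype.ext hij)


theorem perm_refl {X : Fam (ChuOb E bot)} (f : ChuHom E bot X) : f.perm (.refl X) = f := by
  apply ChuHom.ext
  · exact E.perm_id' fun _ => rfl
  · funext k
    exact E.perm_id' fun _ => rfl

theorem perm_perm {X Y Z : Fam (ChuOb E bot)} (σ : X ≅ₗ Y) (τ : Y ≅ₗ Z) (f : ChuHom E bot X) :
    (f.perm σ).perm τ = f.perm (σ.trans τ) := by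
  apply ChuHom.ext
  · exact E.perm_perm _ _ _ _ _
  · funext k
    exact E.perm_perm _ _ _ _ _

theorem perm_congr {X Y : Fam (ChuOb E bot)} {σ τ : X ≅ₗ Y} {f : ChuHom E bot X}
    (h : ∀ i, σ.equiv i = τ.equiv i) : f.perm σ = f.perm τ := by
  rw [Fam.Iso.ext h]

theorem cut₀_perm {X X' Y Y' : Fam (ChuOb E bot)} (σ : X ≅ₗ X') (τ : Y ≅ₗ Y')
    (f : ChuHom E bot X) (g : ChuHom E bot Y) (k : X.I) (l : Y.I) (k' : X'.I) (l' : Y'.I)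
    (hk : σ.equiv k = k') (hl : τ.equiv l = l')
    (h : DualPair (X.obj k) (Y.obj l)) (h' : DualPair (X'.obj k') (Y'.obj l')) :
    cut₀ (f.perm σ) (g.perm τ) k' l' h' =
      (cut₀ f g k l h).perm ((σ.erase hk).append (τ.erase hl)) := by
  apply ChuHom.ext
  · show E.sub ((f.perm σ).comp k') _ _ _ = _
    rw [perm_comp σ f k k' hk]
    apply E.sub_perm_perm
    · exact hl
    · intro i; rfl
    · intro i j hij
      exact congrArg Sum.inr (Subtype.ext hij)
  · funext z
    obtain ⟨z, rfl⟩ := ((σ.erase hk).append (τ.erase hl)).equiv.surjective z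
    rw [perm_comp _ _ z _ rfl]
    rcases z with x | y
    · show E.sub ((g.perm τ).comp l') ((f.perm σ).comp (σ.equiv x.1)) _ _ = _
      rw [perm_comp τ g l l' hl, perm_comp σ f x.1 _ rfl]
      apply E.sub_perm_perm
      · exact Subtype.ext hk
      · intro i; rfl
      · intro i j hij
        exact Subtype.ext (congrArg Sum.inl (Subtype.ext (show _ = j.1.1 from congrArg Subtype.val hij)))
    · show E.sub ((f.perm σ).comp k') ((g.perm τ).comp (τ.equiv y.1)) _ _ = _
      rw [perm_comp σ f k k' hk, perm_comp τ g y.1 _ rfl]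
      apply E.sub_perm_perm
      · exact Subtype.ext hl
      · intro i; rfl
      · intro i j hij
        exact Subtype.ext (congrArg Sum.inr (Subtype.ext (show _ = j.1.1 from congrArg Subtype.val hij)))

theorem cut₀_comm {X Y : Fam (ChuOb E bot)} (f : ChuHom E bot X) (g : ChuHom E bot Y) (k : X.I)
    (l : Y.I) (h : DualPair (X.obj k) (Y.obj l)) :
    cut₀ g f l k h.symm = (cut₀ f g k l h).perm (.comm _ _) := by
  apply ChuHom.ext
  · refine Eq.trans ?_ (congrArg (E.perm _ _) (sub_under f g k l h))
    apply E.sub_eq_perm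
    · rfl
    · intro i; rfl
    · intro i j hij
      obtain rfl : i = j := Subtype.ext hij
      rfl
  · funext z
    obtain ⟨z, rfl⟩ := (Fam.Iso.comm (X.erase k) (Y.erase l)).equiv.surjective z
    rw [perm_comp _ _ z _ rfl]
    rcases z with x | y
    · apply E.sub_eq_perm
      · rfl
      · intro i; rfl
      · intro i j hij
        obtain rfl : i = j := Subtype.ext hij
        rfl
    · apply E.sub_eq_perm
      · rfl
      · intro i; rfl
      · intro i j hij
        obtain rfl : i = j := Subtype.ext hij
        rfl

noncomputable def cut {X Y Z : Fam (ChuOb E bot)} (f : ChuHom E bot X) (g : ChuHom E bot Y)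
    (k : X.I) (l : Y.I) (h : DualPair (X.obj k) (Y.obj l)) (c : X.erase k ⊎ Y.erase l ≅ₗ Z) :
    ChuHom E bot Z :=
  (cut₀ f g k l h).perm c

theorem cut_assoc {X Y Z V W U : Fam (ChuOb E bot)} {f : ChuHom E bot X} {g : ChuHom E bot Y}
    {h : ChuHom E bot Z} {k : X.I} {l m : Y.I} {n : Z.I} (hlm : l ≠ m)
    {c : X.erase k ⊎ Y.erase l ≅ₗ V} {m' : V.I} {d : V.erase m' ⊎ Z.erase n ≅ₗ U}
    {c' : Y.erase m ⊎ Z.erase n ≅ₗ W} {l' : W.I} {d' : X.erase k ⊎ W.erase l' ≅ₗ U}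
    {h1 : DualPair (X.obj k) (Y.obj l)} {h2 : DualPair (V.obj m') (Z.obj n)}
    {h3 : DualPair (Y.obj m) (Z.obj n)} {h4 : DualPair (X.obj k) (W.obj l')}
    (em : c.equiv (.inr ⟨m, hlm.symm⟩) = m') (el : c'.equiv (.inl ⟨l, hlm⟩) = l')
    (ex : ∀ x p, d.equiv (.inl ⟨c.equiv (.inl x), p⟩) = d'.equiv (.inl x))
    (ey : ∀ y p q r s, d.equiv (.inl ⟨c.equiv (.inr ⟨y, p⟩), q⟩) =
      d'.equiv (.inr ⟨c'.equiv (.inl ⟨y, r⟩), s⟩))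
    (ez : ∀ z p, d.equiv (.inr z) = d'.equiv (.inr ⟨c'.equiv (.inr z), p⟩)) :
    cut (cut f g k l h1 c) h m' n h2 d = cut f (cut g h m n h3 c') k l' h4 d' := by
  apply ChuHom.ext
  · show E.perm _ _ (E.sub ((cut f g k l h1 c).comp m') _ _ _) = E.perm _ _ (E.sub _ (E.perm _ _ (E.sub _ _ _ _)) _ _)
    rw [cut, perm_comp _ _ _ _ em]
    symm
    apply E.sub_assoc'
    · rfl
    · exact el
    · intro i; exact ex _ _
    · rintro i j hij
      have := ey i.1.1 (fun h => i.2 (Subtype.ext h)) (fun h => i.1.2 (congrArg Subtype.val (Sum.inr_injective (c.equiv.injective (h.trans em.symm))))) i.1.2 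
        (fun h => i.2 (Subtype.ext (congrArg Subtype.val (Sum.inl_injective (c'.equiv.injective (h.trans el.symm))))))
      refine this.trans ?_
      exact congrArg (fun z => d'.equiv (.inr z)) (Subtype.ext hij)
    · intro i i' j hii hij
      obtain rfl : i = i' := Subtype.ext hii
      refine (ez _ (by rw [← el]; simp)).trans ?_
      exact congrArg (fun z => d'.equiv (.inr z)) (Subtype.ext hij)
  · funext w
    obtain ⟨⟨v, p⟩ | z, rfl⟩ := d.equiv.surjective w
    · obtain ⟨x | ⟨y, hyl⟩, rfl⟩ := c.equiv.surjective v
      · refine (perm_comp d (cut₀ (cut f g k l h1 c) h m' n h2) (.inl ⟨_, p⟩) _ rfl).trans ?_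
        refine Eq.trans ?_ (perm_comp d' (cut₀ f (cut g h m n h3 c') k l' h4) (.inl x) _
          (ex x p).symm).symm
        show E.perm _ _ (E.sub _ ((cut f g k l h1 c).comp _) _ _) =
          E.perm _ _ (E.sub ((cut g h m n h3 c').comp l') _ _ _)
        rw [cut, cut, perm_comp c _ (.inl x) _ rfl, perm_comp c' _ _ _ el]
        apply E.sub_assoc'
        · rfl
        · exact Subtype.ext em
        · intro i
          exact Subtype.ext (ez _ _).symm
        · intro i j hij
          refine Subtype.ext ?_
          have hij' : c.equiv (.inr _) = j.1.1 := congrArg Subtype.val hij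
          have hm : i.1.1 ≠ m := fun h => i.2 (Subtype.ext h)
          have hl : i.1.1 ≠ l := i.1.2
          refine (ey i.1.1 hl (fun h => j.2 (Subtype.ext (hij'.symm.trans h))) hm
            (fun h => hl (congrArg Subtype.val (Sum.inl_injective (c'.equiv.injective (h.trans el.symm)))))).symm.trans ?_
          exact congrArg (fun z => d.equiv (.inl z)) (Subtype.ext hij')
        · intro i i' j hii hij
          refine Subtype.ext ?_
          have hii' : i.1.1 = i'.1.1 := congrArg Subtype.val hii
          have hij' : c.equiv (.inl _) = j.1.1 := congrArg Subtype.val hij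
          refine Eq.trans ?_ ((ex ⟨i.1.1, fun h => i.2 (Subtype.ext h)⟩ 
            (fun h => j.2 (Subtype.ext (hij'.symm.trans h)))).symm.trans ?_)
          · exact congrArg (fun z => d'.equiv (.inl z)) (Subtype.ext hii'.symm)
          · exact congrArg (fun z => d.equiv (.inl z)) (Subtype.ext hij')
      · have hym : y ≠ m := by
          rintro rfl
          exact p em
        have hyl' : c'.equiv (.inl ⟨y, hym⟩) ≠ l' := by
          rw [← el]
          exact fun h => hyl (congrArg Subtype.val (Sum.inl_injective (c'.equiv.injective h)))
        refine (perm_comp d (cut₀ (cut f g k l h1 c) h m' n h2) (.inl ⟨_, p⟩) _ rfl).trans ?_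
        refine Eq.trans ?_ (perm_comp d' (cut₀ f (cut g h m n h3 c') k l' h4) (.inr ⟨_, hyl'⟩) _
          (ey y hyl p hym hyl').symm).symm
        show E.perm _ _ (E.sub _ ((cut f g k l h1 c).comp _) _ _) =
          E.perm _ _ (E.sub _ ((cut g h m n h3 c').comp _) _ _)
        rw [cut, cut, perm_comp c _ (.inr ⟨y, hyl⟩) _ rfl, perm_comp c' _ (.inl ⟨y, hym⟩) _ rfl]
        apply E.sub_comm' (w := ((Fam.Iso.insert (((Y.erase y).map ChuOb.pos).erase ⟨l, Ne.symm hyl⟩)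
          ⟨⟨m, Ne.symm hym⟩, fun h => hlm (congrArg Subtype.val h).symm⟩ h3.pos_eq).append (.refl _)).trans
          (Fam.Iso.insert ((Y.erase y).map ChuOb.pos) ⟨l, Ne.symm hyl⟩ h1.neg_eq.symm))
        · rfl
        · rfl
        · intro i hi
          refine Subtype.ext (Eq.trans ?_ em)
          exact congrArg (fun z => c.equiv (.inr z)) (Subtype.ext (show i.1.1 = m from congrArg Subtype.val hi))
        · intro i hi
          refine Subtype.ext (Eq.trans ?_ el)
          exact congrArg (fun z => c'.equiv (.inl z)) (Subtype.ext (show i.1.1 = l from congrArg Subtype.val hi))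
        · intro i j hij
          refine Subtype.ext ((ez i (fun h => ?_)).trans ?_)
          · exact absurd (c'.equiv.injective (h.trans el.symm)) (by simp)
          · exact congrArg (fun z => d'.equiv (.inr z)) (Subtype.ext (show _ = j.1.1 from congrArg Subtype.val hij))
        · intro i j hij
          refine Subtype.ext ((ex i (fun h => ?_)).symm.trans ?_)
          · exact absurd (c.equiv.injective (h.trans em.symm)) (by simp)
          · exact congrArg (fun z => d.equiv (.inl z)) (Subtype.ext (show _ = j.1.1 from congrArg Subtype.val hij))
        · intro x i i' j j' hi hi' hj hj'
          have t1 : i.1.1 = x.1.1.1 := congrArg Subtype.val hi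
          have t2 : i'.1.1 = x.1.1.1 := congrArg Subtype.val hi'
          have t3 : c.equiv (.inr _) = j.1.1 := congrArg Subtype.val hj
          have t4 : c'.equiv (.inl _) = j'.1.1 := congrArg Subtype.val hj'
          have u1 : x.1.1.1 ≠ l := fun h => x.1.2 (Subtype.ext h)
          have u2 : x.1.1.1 ≠ m := fun h => x.2 (Subtype.ext (Subtype.ext h))
          have v1 : c.equiv (.inr ⟨x.1.1.1, u1⟩) = j.1.1 :=
            Eq.trans (congrArg (fun z => c.equiv (.inr z)) (Subtype.ext t1.symm)) t3
          have v2 : c'.equiv (.inl ⟨x.1.1.1, u2⟩) = j'.1.1 :=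
            Eq.trans (congrArg (fun z => c'.equiv (.inl z)) (Subtype.ext t2.symm)) t4
          refine Subtype.ext ?_
          refine Eq.trans ?_ ((ey x.1.1.1 u1 (fun h => j.2 (Subtype.ext (v1.symm.trans h))) u2
            (fun h => j'.2 (Subtype.ext (v2.symm.trans h)))).trans ?_)
          · exact congrArg (fun z => d.equiv (.inl z)) (Subtype.ext v1.symm)
          · exact congrArg (fun z => d'.equiv (.inr z)) (Subtype.ext v2)
    · have hz : c'.equiv (.inr z) ≠ l' := by
        rw [← el]
        exact fun h => absurd (c'.equiv.injective h) (by simp)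
      refine (perm_comp d (cut₀ (cut f g k l h1 c) h m' n h2) (.inr z) _ rfl).trans ?_
      refine Eq.trans ?_ (perm_comp d' (cut₀ f (cut g h m n h3 c') k l' h4) (.inr ⟨_, hz⟩) _
        (ez z hz).symm).symm
      show E.perm _ _ (E.sub ((cut f g k l h1 c).comp m') _ _ _) =
        E.perm _ _ (E.sub _ ((cut g h m n h3 c').comp _) _ _)
      rw [cut, cut, perm_comp c _ _ _ em, perm_comp c' _ (.inr z) _ rfl]
      symm
      apply E.sub_assoc'
      · rfl
      · exact Subtype.ext el
      · intro i
        exact Subtype.ext (ex _ _)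
      · intro i j hij
        refine Subtype.ext ?_
        have t : c'.equiv (.inl ⟨i.1.1, _⟩) = j.1.1 := congrArg Subtype.val hij
        have hl : i.1.1 ≠ l := fun h => i.2 (Subtype.ext h)
        refine (ey i.1.1 hl (fun h => i.1.2 (congrArg Subtype.val
          (Sum.inr_injective (c.equiv.injective (h.trans em.symm))))) i.1.2
          (fun h => j.2 (Subtype.ext (t.symm.trans h)))).trans ?_
        exact congrArg (fun z => d'.equiv (.inr z)) (Subtype.ext t)
      · intro i i' j hii hij
        refine Subtype.ext ?_
        have t0 : i.1.1 = i'.1.1 := congrArg Subtype.val hii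
        have t : c'.equiv (.inr _) = j.1.1 := congrArg Subtype.val hij
        refine Eq.trans ?_ ((ez ⟨i.1.1, fun h => i.2 (Subtype.ext h)⟩
          (fun h => j.2 (Subtype.ext (t.symm.trans h)))).trans ?_)
        · exact congrArg (fun z => d.equiv (.inr z)) (Subtype.ext t0.symm)
        · exact congrArg (fun z => d'.equiv (.inr z)) (Subtype.ext t)



theorem perm_cut {X Y Z Z' : Fam (ChuOb E bot)} (f : ChuHom E bot X) (g : ChuHom E bot Y)
    (k : X.I) (l : Y.I) (h : DualPair (X.obj k) (Y.obj l)) (c : X.erase k ⊎ Y.erase l ≅ₗ Z)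
    (ρ : Z ≅ₗ Z') : (cut f g k l h c).perm ρ = cut f g k l h (c.trans ρ) :=
  perm_perm _ _ _

theorem cut_perm {X X' Y Y' Z : Fam (ChuOb E bot)} (σ : X ≅ₗ X') (τ : Y ≅ₗ Y')
    (f : ChuHom E bot X) (g : ChuHom E bot Y) (k : X.I) (l : Y.I) {k' : X'.I} {l' : Y'.I}
    (hk : σ.equiv k = k') (hl : τ.equiv l = l')
    (h : DualPair (X.obj k) (Y.obj l)) (h' : DualPair (X'.obj k') (Y'.obj l'))
    (c : X'.erase k' ⊎ Y'.erase l' ≅ₗ Z) :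
    cut (f.perm σ) (g.perm τ) k' l' h' c =
      cut f g k l h (((σ.erase hk).append (τ.erase hl)).trans c) := by
  rw [cut, cut₀_perm σ τ f g k l k' l' hk hl h h', perm_perm]
  rfl

theorem cut_comm {X Y Z : Fam (ChuOb E bot)} (f : ChuHom E bot X) (g : ChuHom E bot Y) (k : X.I)
    (l : Y.I) (h : DualPair (X.obj k) (Y.obj l)) (c : X.erase k ⊎ Y.erase l ≅ₗ Z) :
    cut f g k l h c = cut g f l k h.symm ((Fam.Iso.comm _ _).trans c) := by
  rw [cut, cut, cut₀_comm f g k l h, perm_perm]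
  apply perm_congr
  rintro (i | i) <;> rfl

theorem cut_congr {X Y Z : Fam (ChuOb E bot)} {f : ChuHom E bot X} {g : ChuHom E bot Y} {k : X.I}
    {l : Y.I} {h : DualPair (X.obj k) (Y.obj l)} {c c' : X.erase k ⊎ Y.erase l ≅ₗ Z}
    (hc : ∀ i, c.equiv i = c'.equiv i) : cut f g k l h c = cut f g k l h c' :=
  perm_congr hc

theorem cut_perm_left {X X' Y Z : Fam (ChuOb E bot)} (σ : X ≅ₗ X')
    (f : ChuHom E bot X) (g : ChuHom E bot Y) (k : X.I) (l : Y.I) {k' : X'.I}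
    (hk : σ.equiv k = k') (h : DualPair (X.obj k) (Y.obj l)) (h' : DualPair (X'.obj k') (Y.obj l))
    (c : X'.erase k' ⊎ Y.erase l ≅ₗ Z) :
    cut (f.perm σ) g k' l h' c =
      cut f g k l h (((σ.erase hk).append (.refl _)).trans c) := by
  have := cut_perm (l' := l) σ (.refl Y) f g k l hk rfl h h' c
  rw [perm_refl] at this
  refine this.trans ?_
  apply cut_congr
  rintro (i | i) <;> rfl

theorem cut_perm_right {X Y Y' Z : Fam (ChuOb E bot)} (τ : Y ≅ₗ Y')
    (f : ChuHom E bot X) (g : ChuHom E bot Y) (k : X.I) (l : Y.I) {l' : Y'.I}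
    (hl : τ.equiv l = l') (h : DualPair (X.obj k) (Y.obj l)) (h' : DualPair (X.obj k) (Y'.obj l'))
    (c : X.erase k ⊎ Y'.erase l' ≅ₗ Z) :
    cut f (g.perm τ) k l' h' c =
      cut f g k l h ((Fam.Iso.append (.refl _) (τ.erase hl)).trans c) := by
  have := cut_perm (k' := k) (.refl X) τ f g k l rfl hl h h' c
  rw [perm_refl] at this
  refine this.trans ?_
  apply cut_congr
  rintro (i | i) <;> rfl

/-- The identity of `A`, as a morphism with one entry `A` and one entry the dual of `A`. -/
noncomputable def one (A : ChuOb E bot) : ChuHom E bot (.single A ⊎ .single A.dual) where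
  under := E.perm (.mapAppend ChuOb.pos (.single A) (.single A.dual)) rfl A.pair
  comp
    | .inl _ => E.perm ⟨⟨fun _ => ⟨.inr (), by simp⟩, fun _ => (), fun _ => rfl,
        by rintro ⟨_ | _, h⟩; exacts [absurd rfl h, rfl]⟩, fun _ => rfl⟩ rfl (E.id A.neg)
    | .inr _ => E.perm ⟨⟨fun _ => ⟨.inl (), by simp⟩, fun _ => (), fun _ => rfl,
        by rintro ⟨_ | _, h⟩; exacts [rfl, absurd rfl h]⟩, fun _ => rfl⟩ rfl (E.id A.pos)
  compat := by
    rintro (_ | _)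
    · show E.perm _ _ (E.comp _ A.pair) = _
      refine (E.comp_eq_sub _ _ _).trans ?_
      apply E.id_sub
      · rintro ⟨_ | _, hz⟩
        · exact absurd rfl hz
        · rfl
      · intro i; rfl
    · refine (E.comp_eq_sub _ _ _).trans ?_
      refine (E.perm_refl _).symm.trans ?_
      apply E.id_sub''
      rintro (z | z) (i | i) h
      · cases h
      · rfl
      · rfl
      · cases h

theorem cut_one {X Y : Fam (ChuOb E bot)} {f : ChuHom E bot X} {k : X.I} {A : ChuOb E bot}
    {h : DualPair (X.obj k) A} {c : X.erase k ⊎ (.single A ⊎ .single A.dual).erase (.inl ()) ≅ₗ Y}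
    {ρ : X ≅ₗ Y}
    (h1 : ∀ i, c.equiv (.inl i) = ρ.equiv i.1)
    (h2 : ∀ i, c.equiv (.inr i) = ρ.equiv k) :
    cut f (one A) k (.inl ()) h c = f.perm ρ := by
  apply ChuHom.ext
  · show E.perm _ _ (E.sub (f.comp k) (E.perm _ _ A.pair) _ _) = E.perm _ _ f.under
    rw [← f.compat_sub k, ← h.pair_eq, E.perm_perm]
    refine Eq.trans ?_ (congrArg (fun z => E.perm _ _ (E.sub _ z _ _)) (E.perm_refl _))
    apply E.sub_eq_perm'
    · rintro (_ | _) h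
      · cases h
      · rfl
    · exact h1
    · rintro (_ | _) i j - -
      · exact h2 _
      · exact h2 _
  · funext w
    obtain ⟨⟨x, hx⟩ | ⟨_ | _, hz⟩, rfl⟩ := c.equiv.surjective w
    · refine (perm_comp c (cut₀ f (one A) k (.inl ()) h) (.inl ⟨x, hx⟩) _ rfl).trans ?_
      rw [perm_comp ρ f x _ (h1 ⟨x, hx⟩).symm]
      apply E.id_sub'
      · intro i
        exact Subtype.ext (h2 _)
      · intro j
        exact Subtype.ext (h1 _)
    · exact absurd rfl hz
    · refine (perm_comp c (cut₀ f (one A) k (.inl ()) h) (.inr ⟨.inr (), hz⟩) _ rfl).trans ?_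
      rw [perm_comp ρ f k _ (h2 _).symm]
      apply E.sub_id h.neg_eq
      intro i
      exact Subtype.ext (h1 _)

theorem cut_one' {X Y : Fam (ChuOb E bot)} {f : ChuHom E bot X} {k : X.I} {A : ChuOb E bot}
    {h : DualPair (X.obj k) A.dual}
    {c : X.erase k ⊎ (.single A ⊎ .single A.dual).erase (.inr ()) ≅ₗ Y}
    {ρ : X ≅ₗ Y}
    (h1 : ∀ i, c.equiv (.inl i) = ρ.equiv i.1)
    (h2 : ∀ i, c.equiv (.inr i) = ρ.equiv k) :
    cut f (one A) k (.inr ()) h c = f.perm ρ := by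
  apply ChuHom.ext
  · show E.perm _ _ (E.sub (f.comp k) (E.perm _ _ A.pair) _ _) = E.perm _ _ f.under
    have hp : A.pair = E.perm (.comm _ _) rfl A.dual.pair := by
      refine Eq.trans ?_ (E.perm_perm _ _ _ _ _).symm
      symm
      apply E.perm_id'
      rintro (_ | _) <;> rfl
    rw [← f.compat_sub k, hp, ← h.pair_eq, E.perm_perm, E.perm_perm]
    refine Eq.trans ?_ (congrArg (fun z => E.perm _ _ (E.sub _ z _ _)) (E.perm_refl _))
    apply E.sub_eq_perm'
    · rintro (_ | _) h
      · cases h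
      · rfl
    · exact h1
    · rintro (_ | _) i j - -
      · exact h2 _
      · exact h2 _
  · funext w
    obtain ⟨⟨x, hx⟩ | ⟨_ | _, hz⟩, rfl⟩ := c.equiv.surjective w
    · refine (perm_comp c (cut₀ f (one A) k (.inr ()) h) (.inl ⟨x, hx⟩) _ rfl).trans ?_
      rw [perm_comp ρ f x _ (h1 ⟨x, hx⟩).symm]
      apply E.id_sub'
      · intro i
        exact Subtype.ext (h2 _)
      · intro j
        exact Subtype.ext (h1 _)
    · refine (perm_comp c (cut₀ f (one A) k (.inr ()) h) (.inr ⟨.inl (), hz⟩) _ rfl).trans ?_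
      rw [perm_comp ρ f k _ (h2 _).symm]
      apply E.sub_id h.neg_eq
      intro i
      exact Subtype.ext (h1 _)
    · exact absurd rfl hz

end ChuHom

namespace Chu
variable {E : Multicat.{u, v}} {bot : E.Ob}

def cutFun {C : Type u} (F : C → C) (Γ Δ Φ Ψ : Fam C) (A B : C) :
    ((Γ ⊎ (Δ ⊎ .single A).map F).erase (.inr (.inr ())) ⊎
      ((.single B ⊎ Φ) ⊎ Ψ.map F).erase (.inl (.inl ()))).I →
      ((Γ ⊎ Φ) ⊎ (Δ ⊎ Ψ).map F).I
  | .inl ⟨.inl i, _⟩ => .inl (.inl i)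
  | .inl ⟨.inr (.inl i), _⟩ => .inr (.inl i)
  | .inl ⟨.inr (.inr _), h⟩ => absurd rfl h
  | .inr ⟨.inl (.inl _), h⟩ => absurd rfl h
  | .inr ⟨.inl (.inr i), _⟩ => .inl (.inr i)
  | .inr ⟨.inr i, _⟩ => .inr (.inr i)

noncomputable abbrev cutIso {C : Type u} (F : C → C) (Γ Δ Φ Ψ : Fam C) (A B : C) :
    (Γ ⊎ (Δ ⊎ .single A).map F).erase (.inr (.inr ())) ⊎
      ((.single B ⊎ Φ) ⊎ Ψ.map F).erase (.inl (.inl ())) ≅ₗ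
      (Γ ⊎ Φ) ⊎ (Δ ⊎ Ψ).map F :=
  .ofFun (cutFun F Γ Δ Φ Ψ A B)
    ⟨by
      rintro (⟨i | i | i, hi⟩ | ⟨(i | i) | i, hi⟩) (⟨j | j | j, hj⟩ | ⟨(j | j) | j, hj⟩) h <;>
        first
        | exact absurd rfl hi
        | exact absurd rfl hj
        | (cases h; done)
        | (cases h; rfl),
     by
      rintro ((i | i) | (i | i))
      · exact ⟨.inl ⟨.inl i, by simp⟩, rfl⟩
      · exact ⟨.inr ⟨.inl (.inr i), by simp⟩, rfl⟩
      · exact ⟨.inl ⟨.inr (.inl i), by simp⟩, rfl⟩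
      · exact ⟨.inr ⟨.inr i, by simp⟩, rfl⟩⟩
    (by
      rintro (⟨i | i | i, hi⟩ | ⟨(i | i) | i, hi⟩) <;>
        first
        | exact absurd rfl hi
        | rfl)

open ChuHom in
theorem cut_swap {X Y Z V W U : Fam (ChuOb E bot)} {f : ChuHom E bot X} {g : ChuHom E bot Y}
    {h : ChuHom E bot Z} {k l : X.I} {m : Y.I} {n : Z.I} (hkl : k ≠ l)
    {c : X.erase k ⊎ Y.erase m ≅ₗ V} {l' : V.I} {d : V.erase l' ⊎ Z.erase n ≅ₗ U}
    {c' : X.erase l ⊎ Z.erase n ≅ₗ W} {k' : W.I} {d' : W.erase k' ⊎ Y.erase m ≅ₗ U}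
    {h1 : DualPair (X.obj k) (Y.obj m)} {h2 : DualPair (V.obj l') (Z.obj n)}
    {h3 : DualPair (X.obj l) (Z.obj n)} {h4 : DualPair (W.obj k') (Y.obj m)}
    (el : c.equiv (.inl ⟨l, hkl.symm⟩) = l') (ek : c'.equiv (.inl ⟨k, hkl⟩) = k')
    (ex : ∀ x p q r s, d.equiv (.inl ⟨c.equiv (.inl ⟨x, p⟩), q⟩) =
      d'.equiv (.inl ⟨c'.equiv (.inl ⟨x, r⟩), s⟩))
    (ey : ∀ y p, d.equiv (.inl ⟨c.equiv (.inr y), p⟩) = d'.equiv (.inr y))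
    (ez : ∀ z p, d.equiv (.inr z) = d'.equiv (.inl ⟨c'.equiv (.inr z), p⟩)) :
    cut (cut f g k m h1 c) h l' n h2 d = cut (cut f h l n h3 c') g k' m h4 d' := by
  rw [cut_comm f g, cut_comm (cut f h l n h3 c') g]
  exact cut_assoc hkl el ek ey ex ez

open ChuHom in
theorem cut_swap' {X Y Z V W U : Fam (ChuOb E bot)} {f : ChuHom E bot X} {g : ChuHom E bot Y}
    {h : ChuHom E bot Z} {k : X.I} {l : Y.I} {m n : Z.I} (hmn : m ≠ n)
    {c : X.erase k ⊎ Z.erase m ≅ₗ V} {n' : V.I} {d : Y.erase l ⊎ V.erase n' ≅ₗ U}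
    {c' : Y.erase l ⊎ Z.erase n ≅ₗ W} {m' : W.I} {d' : X.erase k ⊎ W.erase m' ≅ₗ U}
    {h1 : DualPair (X.obj k) (Z.obj m)} {h2 : DualPair (Y.obj l) (V.obj n')}
    {h3 : DualPair (Y.obj l) (Z.obj n)} {h4 : DualPair (X.obj k) (W.obj m')}
    (en : c.equiv (.inr ⟨n, hmn.symm⟩) = n') (em : c'.equiv (.inr ⟨m, hmn⟩) = m')
    (ex : ∀ x p, d.equiv (.inr ⟨c.equiv (.inl x), p⟩) = d'.equiv (.inl x))
    (ey : ∀ y p, d.equiv (.inl y) = d'.equiv (.inr ⟨c'.equiv (.inl y), p⟩))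
    (ez : ∀ z p q r s, d.equiv (.inr ⟨c.equiv (.inr ⟨z, p⟩), q⟩) =
      d'.equiv (.inr ⟨c'.equiv (.inr ⟨z, r⟩), s⟩)) :
    cut g (cut f h k m h1 c) l n' h2 d = cut f (cut g h l n h3 c') k m' h4 d' := by
  rw [cut_comm g (cut f h k m h1 c), cut_comm g h]
  exact cut_assoc hmn en em ex ez ey

noncomputable abbrev comp {Γ Δ Φ Ψ : Fam (ChuOb E bot)} {A : ChuOb E bot}
    (f : ChuHom E bot (Γ ⊎ (Δ ⊎ .single A).map ChuOb.dual))
    (g : ChuHom E bot ((.single A ⊎ Φ) ⊎ Ψ.map ChuOb.dual)) :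
    ChuHom E bot ((Γ ⊎ Φ) ⊎ (Δ ⊎ Ψ).map ChuOb.dual) :=
  ChuHom.cut f g (.inr (.inr ())) (.inl (.inl ())) (ChuHom.dualPair A).symm
    (cutIso ChuOb.dual Γ Δ Φ Ψ A A)

end Chu

/-- The Chu construction. -/
noncomputable def chu (E : Multicat.{u, v}) (bot : E.Ob) : Polycat.{max u v, v} where
  Ob := ChuOb E bot
  Hom Γ Δ := ChuHom E bot (Γ ⊎ Δ.map ChuOb.dual)
  perm σ τ f := f.perm (σ.append (τ.map _))
  id A := ChuHom.one A
  comp f g := Chu.comp f g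
  perm_refl f := by
    refine Eq.trans (ChuHom.perm_congr ?_) (ChuHom.perm_refl f)
    rintro (i | i) <;> rfl
  perm_perm σ σ' τ τ' f := by
    refine (ChuHom.perm_perm _ _ _).trans (ChuHom.perm_congr ?_)
    rintro (i | i) <;> rfl
  comp_perm σ τ ρ κ f g := by
    refine (ChuHom.cut_perm _ _ _ _ _ _ ?_ ?_ (ChuHom.dualPair _).symm _ _).trans
      ((ChuHom.cut_congr ?_).trans (ChuHom.perm_cut _ _ _ _ _ _ _).symm)
    · rfl
    · rfl
    · rintro (⟨i | i | i, hi⟩ | ⟨(i | i) | i, hi⟩) <;>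
        first
        | exact absurd rfl hi
        | rfl
  id_comp {Φ Ψ A} g := by
    refine (ChuHom.cut_perm_left _ (ChuHom.one A) g (.inr ()) (.inl (.inl ())) rfl
      (ChuHom.dualPair A).symm _ _).trans ?_
    refine (ChuHom.cut_comm _ _ _ _ _ _).trans ?_
    apply ChuHom.cut_one'
    · rintro ⟨(i | i) | i, hi⟩
      · exact absurd rfl hi
      · rfl
      · rfl
    · rintro ⟨i | i, hi⟩
      · rfl
      · exact absurd rfl hi
  comp_id {Γ Δ A} f := by
    refine (ChuHom.cut_perm_right _ f (ChuHom.one A) (.inr (.inr ())) (.inl ()) rfl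
      (ChuHom.dualPair A).symm _ _).trans ?_
    apply ChuHom.cut_one
    · rintro ⟨i | i | i, hi⟩
      · rfl
      · rfl
      · exact absurd rfl hi
    · rintro ⟨i | i, hi⟩
      · exact absurd rfl hi
      · rfl
  assoc {Γ Δ Φ Ψ Θ Ξ A B} f g h := by
    refine (ChuHom.cut_perm_right _ f (Chu.comp g h) (.inr (.inr ())) (.inl (.inl (.inl ()))) rfl
      (ChuHom.dualPair A).symm _ _).trans ?_
    refine Eq.trans ?_ (ChuHom.perm_cut _ _ _ _ _ _ _).symm
    refine Eq.trans ?_ (ChuHom.cut_perm_left _ (Chu.comp f g) h (.inr (.inr (.inr ())))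
      (.inl (.inl ())) rfl (ChuHom.dualPair B).symm _ _).symm
    symm
    refine ChuHom.cut_assoc (f := f) (g := g) (h := h) (k := .inr (.inr ())) (l := .inl (.inl ()))
      (m := .inr (.inr ())) (n := .inl (.inl ())) (by simp)
      (c := Chu.cutIso ChuOb.dual Γ Δ Φ (Ψ ⊎ .single B) A A)
      (c' := Chu.cutIso ChuOb.dual (.single A ⊎ Φ) Ψ Θ Ξ B B) rfl rfl ?_ ?_ ?_
    · rintro ⟨i | i | i, hi⟩ p
      · rfl
      · rfl
      · exact absurd rfl hi
    · rintro ((i | i) | (i | i)) p q r s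
      · exact absurd rfl p
      · rfl
      · rfl
      · exact absurd rfl r
    · rintro ⟨(i | i) | i, hi⟩ p
      · exact absurd rfl hi
      · rfl
      · rfl
  interchange_out {Γ Δ Φ Ψ Θ Ξ A B} f g h := by
    refine (ChuHom.cut_perm_left _ (Chu.comp f h) g (.inr (.inl (.inr ()))) (.inl (.inl ())) rfl
      (ChuHom.dualPair A).symm _ _).trans ?_
    refine Eq.trans ?_ (ChuHom.perm_cut _ _ _ _ _ _ _).symm
    refine Eq.trans ?_ (ChuHom.cut_perm_left _ (Chu.comp (Γ := Γ)
      (Δ := Δ ⊎ .single B) (ChuHom.perm ((Fam.Iso.refl Γ).append (.map ChuOb.dual (.rightComm Δ _ _))) f) g)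
      h (.inr (.inl (.inr ())))
      (.inl (.inl ())) rfl (ChuHom.dualPair B).symm _ _).symm
    refine Eq.trans ?_ (congrArg (fun z : ChuHom E bot ((Γ ⊎ Φ) ⊎
      (Δ ⊎ .single B ⊎ Ψ).map ChuOb.dual) => ChuHom.cut z h (.inr (.inl (.inr ()))) (.inl (.inl ()))
        (ChuHom.dualPair B).symm _)
      (ChuHom.cut_perm_left _ f g (.inr (.inl (.inr ()))) (.inl (.inl ())) rfl
      (ChuHom.dualPair A).symm _ _).symm)
    refine Chu.cut_swap (f := f) (g := h) (h := g) (k := .inr (.inr ())) (l := .inr (.inl (.inr ())))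
      (m := .inl (.inl ())) (n := .inl (.inl ())) (by simp)
      (c := Chu.cutIso ChuOb.dual Γ (Δ ⊎ .single A) Θ Ξ B B) ?_ ?_ ?_ ?_ ?_
    · rfl
    · rfl
    · rintro (i | ((i | i) | i)) p q r s
      · rfl
      · rfl
      · exact absurd rfl r
      · exact absurd rfl p
    · rintro ⟨(i | i) | i, hi⟩ p
      · exact absurd rfl hi
      · rfl
      · rfl
    · rintro ⟨(i | i) | i, hi⟩ p
      · exact absurd rfl hi
      · rfl
      · rfl
  interchange_in {Γ Δ Φ Ψ Θ Ξ A B} f g h := by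
    refine (ChuHom.cut_perm_right _ g (Chu.comp f h) (.inr (.inr ())) (.inl (.inr (.inl ()))) rfl
      (ChuHom.dualPair B).symm _ _).trans ?_
    refine Eq.trans ?_ (ChuHom.perm_cut _ _ _ _ _ _ _).symm
    refine Eq.trans ?_ (ChuHom.cut_perm_right _ f (Chu.comp (Φ := .single A ⊎ Θ)
      (Ψ := Ξ) g (ChuHom.perm ((Fam.Iso.leftComm _ _ Θ).append (.map ChuOb.dual (.refl Ξ))) h)) (.inr (.inr ()))
      (.inl (.inr (.inl ()))) rfl (ChuHom.dualPair A).symm _ _).symm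
    refine Eq.trans ?_ (congrArg (fun z : ChuHom E bot ((Φ ⊎ (.single A ⊎ Θ)) ⊎
      (Ψ ⊎ Ξ).map ChuOb.dual) => ChuHom.cut f z (.inr (.inr ())) (.inl (.inr (.inl ())))
        (ChuHom.dualPair A).symm _)
      (ChuHom.cut_perm_right _ g h (.inr (.inr ())) (.inl (.inr (.inl ()))) rfl
      (ChuHom.dualPair B).symm _ _).symm)
    refine Chu.cut_swap' (f := f) (g := g) (h := h) (k := .inr (.inr ())) (l := .inr (.inr ()))
      (m := .inl (.inl ())) (n := .inl (.inr (.inl ()))) (by simp)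
      (c := Chu.cutIso ChuOb.dual Γ Δ (.single B ⊎ Θ) Ξ A A) ?_ ?_ ?_ ?_ ?_
    · rfl
    · rfl
    · rintro ⟨i | i | i, hi⟩ p
      · rfl
      · rfl
      · exact absurd rfl hi
    · rintro ⟨i | i | i, hi⟩ p
      · rfl
      · rfl
      · exact absurd rfl hi
    · rintro ((i | (i | i)) | i) p q r s
      · exact absurd rfl p
      · exact absurd rfl r
      · rfl
      · rfl

/-- A family of sets indexed by pairs of finite lists, on which the symmetries act. -/
structure Bi (C : Type u) where
  obj : Fam C → Fam C → Type w
  perm {Γ Γ' Δ Δ' : Fam C} : Γ ≅ₗ Γ' → Δ ≅ₗ Δ' → obj Γ Δ → obj Γ' Δ'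
  perm_refl {Γ Δ : Fam C} (f : obj Γ Δ) : perm (.refl Γ) (.refl Δ) f = f
  perm_perm {Γ Γ' Γ'' Δ Δ' Δ'' : Fam C} (σ : Γ ≅ₗ Γ') (σ' : Γ' ≅ₗ Γ'') (τ : Δ ≅ₗ Δ')
    (τ' : Δ' ≅ₗ Δ'') (f : obj Γ Δ) :
    perm σ' τ' (perm σ τ f) = perm (σ.trans σ') (τ.trans τ') f

namespace Bi
variable {C : Type u} (X : Bi.{u, w} C)

theorem perm_congr {Γ Γ' Δ Δ' : Fam C} {σ σ' : Γ ≅ₗ Γ'} {τ τ' : Δ ≅ₗ Δ'} {f : X.obj Γ Δ}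
    (h1 : ∀ i, σ.equiv i = σ'.equiv i) (h2 : ∀ i, τ.equiv i = τ'.equiv i) :
    X.perm σ τ f = X.perm σ' τ' f := by
  rw [Fam.Iso.ext h1, Fam.Iso.ext h2]

theorem perm_id' {Γ Δ : Fam C} {σ : Γ ≅ₗ Γ} {τ : Δ ≅ₗ Δ} {f : X.obj Γ Δ}
    (h1 : ∀ i, σ.equiv i = i) (h2 : ∀ i, τ.equiv i = i) : X.perm σ τ f = f := by
  rw [Fam.Iso.ext (τ := .refl Γ) h1, Fam.Iso.ext (τ := .refl Δ) h2]; exact X.perm_refl f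

theorem perm_surj {Γ Γ' Δ Δ' : Fam C} (σ : Γ ≅ₗ Γ') (τ : Δ ≅ₗ Δ') (f : X.obj Γ' Δ') :
    ∃ g, f = X.perm σ τ g := by
  refine ⟨X.perm σ.symm τ.symm f, ?_⟩
  rw [X.perm_perm, X.perm_id']
  · exact fun i => σ.equiv.apply_symm_apply i
  · exact fun i => τ.equiv.apply_symm_apply i

theorem perm_bijective {Γ Γ' Δ Δ' : Fam C} (σ : Γ ≅ₗ Γ') (τ : Δ ≅ₗ Δ') :
    Function.Bijective (X.perm σ τ) := by
  refine ⟨fun f g h => ?_, fun f => (X.perm_surj σ τ f).imp fun _ h => h.symm⟩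
  have := congrArg (X.perm σ.symm τ.symm) h
  simp only [X.perm_perm] at this
  rwa [X.perm_id' (fun i => σ.equiv.symm_apply_apply i) (fun i => τ.equiv.symm_apply_apply i),
    X.perm_id' (fun i => σ.equiv.symm_apply_apply i) (fun i => τ.equiv.symm_apply_apply i)] at this

end Bi

/-- An equivariant operation of the shape of composition in a polycategory. -/
structure Act {C : Type u} (X : Bi.{u, v} C) (Y : Bi.{u, v'} C) (Z : Bi.{u, w} C) where
  comp {Γ Δ Φ Ψ : Fam C} {A : C} :
    X.obj Γ (Δ ⊎ .single A) → Y.obj (.single A ⊎ Φ) Ψ → Z.obj (Γ ⊎ Φ) (Δ ⊎ Ψ)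
  comp_perm {Γ Γ' Δ Δ' Φ Φ' Ψ Ψ' : Fam C} {A : C} (σ : Γ ≅ₗ Γ') (τ : Δ ≅ₗ Δ')
    (ρ : Φ ≅ₗ Φ') (κ : Ψ ≅ₗ Ψ') (f : X.obj Γ (Δ ⊎ .single A)) (g : Y.obj (.single A ⊎ Φ) Ψ) :
    comp (X.perm σ (τ.append (.refl _)) f) (Y.perm (.append (.refl _) ρ) κ g) =
      Z.perm (σ.append ρ) (τ.append κ) (comp f g)

namespace Act
variable {C : Type u} {X : Bi.{u, v} C} {Y : Bi.{u, v'} C} {Z : Bi.{u, w} C} (m : Act X Y Z)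

/-- Composition along an object in an arbitrary place. -/
def compAt {Γ Γ' Δ Δ' D G Φ Ψ : Fam C} {A : C} (f : X.obj Γ D) (g : Y.obj G Ψ)
    (a : Δ ⊎ .single A ≅ₗ D) (a' : .single A ⊎ Φ ≅ₗ G) (b : Γ ⊎ Φ ≅ₗ Γ') (c : Δ ⊎ Ψ ≅ₗ Δ') :
    Z.obj Γ' Δ' :=
  Z.perm b c (m.comp (X.perm (.refl _) a.symm f) (Y.perm a'.symm (.refl _) g))

theorem perm_at {Γ Γ' Γ'' Δ Δ' Δ'' D G Φ Ψ : Fam C} {A : C} {f : X.obj Γ D} {g : Y.obj G Ψ}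
    {a : Δ ⊎ .single A ≅ₗ D} {a' : .single A ⊎ Φ ≅ₗ G} {b : Γ ⊎ Φ ≅ₗ Γ'} {c : Δ ⊎ Ψ ≅ₗ Δ'}
    (σ : Γ' ≅ₗ Γ'') (τ : Δ' ≅ₗ Δ'') :
    Z.perm σ τ (m.compAt f g a a' b c) = m.compAt f g a a' (b.trans σ) (c.trans τ) :=
  Z.perm_perm _ _ _ _ _

theorem at_eq {Γ Γ' Δ Δ' Φ Ψ : Fam C} {A : C} {f : X.obj Γ (Δ ⊎ .single A)}
    {g : Y.obj (.single A ⊎ Φ) Ψ} {b : Γ ⊎ Φ ≅ₗ Γ'} {c : Δ ⊎ Ψ ≅ₗ Δ'} :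
    m.compAt f g (.refl _) (.refl _) b c = Z.perm b c (m.comp f g) := by
  rw [compAt, X.perm_id' (fun _ => rfl) (fun _ => rfl), Y.perm_id' (fun _ => rfl) (fun _ => rfl)]

theorem at_perm_left {Γ₀ Γ Γ' Δ Δ' D₀ D G Φ Ψ : Fam C} {A : C} {f : X.obj Γ₀ D₀} {g : Y.obj G Ψ}
    {σ : Γ₀ ≅ₗ Γ} {τ : D₀ ≅ₗ D}
    {a : Δ ⊎ .single A ≅ₗ D} {a' : .single A ⊎ Φ ≅ₗ G} {b : Γ ⊎ Φ ≅ₗ Γ'} {c : Δ ⊎ Ψ ≅ₗ Δ'} :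
    m.compAt (X.perm σ τ f) g a a' b c =
      m.compAt f g (a.trans τ.symm) a' ((σ.append (.refl _)).trans b) c := by
  have e : X.perm (.refl _) a.symm (X.perm σ τ f) =
      X.perm σ ((Fam.Iso.refl Δ).append (.refl _)) (X.perm (.refl _) (a.trans τ.symm).symm f) := by
    rw [X.perm_perm, X.perm_perm]
    apply X.perm_congr
    · intro i; rfl
    · intro i
      show a.equiv.symm (τ.equiv i) = Sum.map id id (a.equiv.symm (τ.equiv i))
      rw [Sum.map_id_id]; rfl
  have e' : Y.perm a'.symm (.refl _) g =
      Y.perm (.append (.refl _) (.refl _)) (.refl _) (Y.perm a'.symm (.refl _) g) := by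
    symm
    apply Y.perm_id'
    · rintro (i | i) <;> rfl
    · intro i; rfl
  rw [compAt, e, e', m.comp_perm, Z.perm_perm, compAt]
  apply Z.perm_congr
  · rintro (i | i) <;> rfl
  · rintro (i | i) <;> rfl

theorem at_perm_right {Γ Γ' Δ Δ' D G₀ G Φ Ψ₀ Ψ : Fam C} {A : C} {f : X.obj Γ D} {g : Y.obj G₀ Ψ₀}
    {σ : G₀ ≅ₗ G} {τ : Ψ₀ ≅ₗ Ψ}
    {a : Δ ⊎ .single A ≅ₗ D} {a' : .single A ⊎ Φ ≅ₗ G} {b : Γ ⊎ Φ ≅ₗ Γ'} {c : Δ ⊎ Ψ ≅ₗ Δ'} :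
    m.compAt f (Y.perm σ τ g) a a' b c =
      m.compAt f g a (a'.trans σ.symm) b ((Fam.Iso.append (.refl _) τ).trans c) := by
  have e : Y.perm a'.symm (.refl _) (Y.perm σ τ g) =
      Y.perm (.append (.refl _) (.refl _)) τ (Y.perm (a'.trans σ.symm).symm (.refl _) g) := by
    rw [Y.perm_perm, Y.perm_perm]
    apply Y.perm_congr
    · intro i
      show a'.equiv.symm (σ.equiv i) = Sum.map id id (a'.equiv.symm (σ.equiv i))
      rw [Sum.map_id_id]; rfl
    · intro i; rfl
  have e' : X.perm (.refl _) a.symm f =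
      X.perm (.refl _) (.append (.refl _) (.refl _)) (X.perm (.refl _) a.symm f) := by
    symm
    apply X.perm_id'
    · intro i; rfl
    · rintro (i | i) <;> rfl
  rw [compAt, e, e', m.comp_perm, Z.perm_perm, compAt]
  apply Z.perm_congr
  · rintro (i | i) <;> rfl
  · rintro (i | i) <;> rfl

theorem at_congr' {Γ Γ' Δ₁ Δ₂ Δ' D G Φ₁ Φ₂ Ψ : Fam C} {A : C} {f : X.obj Γ D} {g : Y.obj G Ψ}
    {a : Δ₁ ⊎ .single A ≅ₗ D} {a' : .single A ⊎ Φ₁ ≅ₗ G} {b : Γ ⊎ Φ₁ ≅ₗ Γ'} {c : Δ₁ ⊎ Ψ ≅ₗ Δ'}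
    (a₂ : Δ₂ ⊎ .single A ≅ₗ D) (a₂' : .single A ⊎ Φ₂ ≅ₗ G)
    (h1 : a.equiv (.inr ()) = a₂.equiv (.inr ())) (h2 : a'.equiv (.inl ()) = a₂'.equiv (.inl ())) :
    ∃ (ρ : Δ₂ ≅ₗ Δ₁) (κ : Φ₂ ≅ₗ Φ₁), (∀ i, a.equiv (.inl (ρ.equiv i)) = a₂.equiv (.inl i)) ∧
      (∀ i, a'.equiv (.inr (κ.equiv i)) = a₂'.equiv (.inr i)) ∧
      m.compAt f g a a' b c =
        m.compAt f g a₂ a₂' ((Fam.Iso.append (.refl _) κ).trans b) ((ρ.append (.refl _)).trans c) := by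
  obtain ⟨ρ, hρ⟩ := Fam.Iso.exists_of_fix (a₂.trans a.symm) (a.symm_apply_eq h1)
  obtain ⟨κ, hκ⟩ := Fam.Iso.exists_of_fix
    (((Fam.Iso.comm _ _).trans (a₂'.trans a'.symm)).trans (.comm _ _))
    (congrArg Sum.swap (a'.symm_apply_eq h2))
  have hρ1 : ∀ i, a.equiv (.inl (ρ.equiv i)) = a₂.equiv (.inl i) := by
    intro i
    have := congrArg (fun t => a.equiv (t.equiv (.inl i))) hρ
    exact this.symm.trans (a.equiv.apply_symm_apply _)
  have hκ1 : ∀ i, a'.equiv (.inr (κ.equiv i)) = a₂'.equiv (.inr i) := by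
    intro i
    have : Sum.swap (a'.equiv.symm (a₂'.equiv (.inr i))) = .inl (κ.equiv i) :=
      congrArg (fun t => t.equiv (.inl i)) hκ
    have := congrArg Sum.swap this
    rw [Sum.swap_swap] at this
    have := congrArg a'.equiv this
    rw [Equiv.apply_symm_apply] at this
    exact this.symm
  refine ⟨ρ, κ, hρ1, hκ1, ?_⟩
  rw [compAt, compAt]
  have e1 : X.perm (.refl _) a.symm f =
      X.perm (.refl _) (ρ.append (.refl _)) (X.perm (.refl _) a₂.symm f) := by
    rw [X.perm_perm]
    apply X.perm_congr
    · intro i; rfl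
    · intro i
      obtain ⟨i | i, rfl⟩ := a₂.equiv.surjective i
      · rw [← hρ1]
        refine (a.equiv.symm_apply_apply _).trans ?_
        show _ = Sum.map ρ.equiv id (a₂.equiv.symm _)
        rw [hρ1, Equiv.symm_apply_apply]; rfl
      · rw [← h1]
        refine (a.equiv.symm_apply_apply _).trans ?_
        show _ = Sum.map ρ.equiv id (a₂.equiv.symm _)
        rw [h1, Equiv.symm_apply_apply]; rfl
  have e2 : Y.perm a'.symm (.refl _) g =
      Y.perm (.append (.refl _) κ) (.refl _) (Y.perm a₂'.symm (.refl _) g) := by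
    rw [Y.perm_perm]
    apply Y.perm_congr
    · intro i
      obtain ⟨i | i, rfl⟩ := a₂'.equiv.surjective i
      · rw [← h2]
        refine (a'.equiv.symm_apply_apply _).trans ?_
        show _ = Sum.map id κ.equiv (a₂'.equiv.symm _)
        rw [h2, Equiv.symm_apply_apply]; rfl
      · rw [← hκ1]
        refine (a'.equiv.symm_apply_apply _).trans ?_
        show _ = Sum.map id κ.equiv (a₂'.equiv.symm _)
        rw [hκ1, Equiv.symm_apply_apply]; rfl
    · intro i; rfl
  rw [e1, e2, m.comp_perm, Z.perm_perm]

theorem at_congr {Γ Γ' Δ₁ Δ₂ Δ' D G Φ₁ Φ₂ Ψ : Fam C} {A : C} {f : X.obj Γ D} {g : Y.obj G Ψ}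
    {a : Δ₁ ⊎ .single A ≅ₗ D} {a' : .single A ⊎ Φ₁ ≅ₗ G} {b : Γ ⊎ Φ₁ ≅ₗ Γ'} {c : Δ₁ ⊎ Ψ ≅ₗ Δ'}
    {a₂ : Δ₂ ⊎ .single A ≅ₗ D} {a₂' : .single A ⊎ Φ₂ ≅ₗ G} {b₂ : Γ ⊎ Φ₂ ≅ₗ Γ'} {c₂ : Δ₂ ⊎ Ψ ≅ₗ Δ'}
    (h1 : a.equiv (.inr ()) = a₂.equiv (.inr ())) (h2 : a'.equiv (.inl ()) = a₂'.equiv (.inl ()))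
    (hb : ∀ i, b.equiv (.inl i) = b₂.equiv (.inl i))
    (hb' : ∀ i j, a'.equiv (.inr i) = a₂'.equiv (.inr j) →
      b.equiv (.inr i) = b₂.equiv (.inr j))
    (hc : ∀ i j, a.equiv (.inl i) = a₂.equiv (.inl j) → c.equiv (.inl i) = c₂.equiv (.inl j))
    (hc' : ∀ i, c.equiv (.inr i) = c₂.equiv (.inr i)) :
    m.compAt f g a a' b c = m.compAt f g a₂ a₂' b₂ c₂ := by
  obtain ⟨ρ, κ, h3, h4, e⟩ := m.at_congr' (f := f) (g := g) (b := b) (c := c) a₂ a₂' h1 h2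
  rw [e]
  apply Z.perm_congr
  · rintro (i | i)
    · exact hb i
    · exact hb' _ _ (h4 i)
  · rintro (i | i)
    · exact hc _ _ (h3 i)
    · exact hc' i

theorem at_perm {Γ₀ Γ Γ' Δ₁ Δ₂ Δ' D₀ D G₀ G Φ₁ Φ₂ Ψ₀ Ψ : Fam C} {A : C} {f : X.obj Γ₀ D₀}
    {g : Y.obj G₀ Ψ₀} {σ : Γ₀ ≅ₗ Γ} {τ : D₀ ≅ₗ D} {σ' : G₀ ≅ₗ G} {τ' : Ψ₀ ≅ₗ Ψ}
    {a : Δ₁ ⊎ .single A ≅ₗ D} {a' : .single A ⊎ Φ₁ ≅ₗ G} {b : Γ ⊎ Φ₁ ≅ₗ Γ'} {c : Δ₁ ⊎ Ψ ≅ₗ Δ'}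
    {a₂ : Δ₂ ⊎ .single A ≅ₗ D₀} {a₂' : .single A ⊎ Φ₂ ≅ₗ G₀} {b₂ : Γ₀ ⊎ Φ₂ ≅ₗ Γ'}
    {c₂ : Δ₂ ⊎ Ψ₀ ≅ₗ Δ'}
    (h1 : a.equiv (.inr ()) = τ.equiv (a₂.equiv (.inr ())))
    (h2 : a'.equiv (.inl ()) = σ'.equiv (a₂'.equiv (.inl ())))
    (hb : ∀ i, b.equiv (.inl (σ.equiv i)) = b₂.equiv (.inl i))
    (hb' : ∀ i j, a'.equiv (.inr i) = σ'.equiv (a₂'.equiv (.inr j)) →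
      b.equiv (.inr i) = b₂.equiv (.inr j))
    (hc : ∀ i j, a.equiv (.inl i) = τ.equiv (a₂.equiv (.inl j)) →
      c.equiv (.inl i) = c₂.equiv (.inl j))
    (hc' : ∀ i, c.equiv (.inr (τ'.equiv i)) = c₂.equiv (.inr i)) :
    m.compAt (X.perm σ τ f) (Y.perm σ' τ' g) a a' b c = m.compAt f g a₂ a₂' b₂ c₂ := by
  rw [m.at_perm_left, m.at_perm_right]
  apply m.at_congr
  · exact τ.symm_apply_eq h1.symm
  · exact σ'.symm_apply_eq h2.symm
  · exact hb
  · exact fun i j h => hb' i j (σ'.equiv.symm_apply_eq.mp h)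
  · exact fun i j h => hc i j (τ.equiv.symm_apply_eq.mp h)
  · exact hc'

theorem at_canon' {Γ₀ Γ Γ' Δ Δ₁ Δ' D G Φ Φ₁ Ψ₀ Ψ : Fam C} {A : C} {f : X.obj Γ₀ (Δ₁ ⊎ .single A)}
    {g : Y.obj (.single A ⊎ Φ₁) Ψ₀} {σ : Γ₀ ≅ₗ Γ} {τ : Δ₁ ⊎ .single A ≅ₗ D}
    {σ' : .single A ⊎ Φ₁ ≅ₗ G} {τ' : Ψ₀ ≅ₗ Ψ}
    {a : Δ ⊎ .single A ≅ₗ D} {a' : .single A ⊎ Φ ≅ₗ G} {b : Γ ⊎ Φ ≅ₗ Γ'} {c : Δ ⊎ Ψ ≅ₗ Δ'}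
    (h1 : a.equiv (.inr ()) = τ.equiv (.inr ())) (h2 : a'.equiv (.inl ()) = σ'.equiv (.inl ())) :
    ∃ (b₂ : Γ₀ ⊎ Φ₁ ≅ₗ Γ') (c₂ : Δ₁ ⊎ Ψ₀ ≅ₗ Δ') (κ : Φ₁ ≅ₗ Φ) (ρ : Δ₁ ≅ₗ Δ),
      (∀ j, a'.equiv (.inr (κ.equiv j)) = σ'.equiv (.inr j)) ∧
      (∀ j, a.equiv (.inl (ρ.equiv j)) = τ.equiv (.inl j)) ∧
      (∀ i, b₂.equiv (.inl i) = b.equiv (.inl (σ.equiv i))) ∧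
      (∀ j, b₂.equiv (.inr j) = b.equiv (.inr (κ.equiv j))) ∧
      (∀ j, c₂.equiv (.inl j) = c.equiv (.inl (ρ.equiv j))) ∧
      (∀ i, c₂.equiv (.inr i) = c.equiv (.inr (τ'.equiv i))) ∧
      m.compAt (X.perm σ τ f) (Y.perm σ' τ' g) a a' b c = Z.perm b₂ c₂ (m.comp f g) := by
  rw [m.at_perm_left, m.at_perm_right]
  obtain ⟨ρ, κ, h3, h4, e⟩ := m.at_congr' (f := f) (g := g) (a := a.trans τ.symm)
    (a' := a'.trans σ'.symm) (b := (σ.append (.refl _)).trans b)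
    (c := (Fam.Iso.append (.refl _) τ').trans c) (.refl _) (.refl _) (τ.symm_apply_eq h1.symm)
    (σ'.symm_apply_eq h2.symm)
  refine ⟨_, _, κ, ρ, ?_, ?_, ?_, ?_, ?_, ?_, e.trans (m.at_eq)⟩
  · intro j
    exact σ'.equiv.symm_apply_eq.mp (h4 j)
  · intro j
    exact τ.equiv.symm_apply_eq.mp (h3 j)
  all_goals intro i; rfl

theorem at_canon {Γ₀ Γ Γ' Δ Δ₁ Δ' D G Φ Φ₁ Ψ₀ Ψ : Fam C} {A : C} {f : X.obj Γ₀ (Δ₁ ⊎ .single A)}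
    {g : Y.obj (.single A ⊎ Φ₁) Ψ₀} {σ : Γ₀ ≅ₗ Γ} {τ : Δ₁ ⊎ .single A ≅ₗ D}
    {σ' : .single A ⊎ Φ₁ ≅ₗ G} {τ' : Ψ₀ ≅ₗ Ψ}
    {a : Δ ⊎ .single A ≅ₗ D} {a' : .single A ⊎ Φ ≅ₗ G} {b : Γ ⊎ Φ ≅ₗ Γ'} {c : Δ ⊎ Ψ ≅ₗ Δ'}
    {b₂ : Γ₀ ⊎ Φ₁ ≅ₗ Γ'} {c₂ : Δ₁ ⊎ Ψ₀ ≅ₗ Δ'}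
    (h1 : a.equiv (.inr ()) = τ.equiv (.inr ())) (h2 : a'.equiv (.inl ()) = σ'.equiv (.inl ()))
    (hb : ∀ i, b.equiv (.inl (σ.equiv i)) = b₂.equiv (.inl i))
    (hb' : ∀ i j, a'.equiv (.inr i) = σ'.equiv (.inr j) → b.equiv (.inr i) = b₂.equiv (.inr j))
    (hc : ∀ i j, a.equiv (.inl i) = τ.equiv (.inl j) → c.equiv (.inl i) = c₂.equiv (.inl j))
    (hc' : ∀ i, c.equiv (.inr (τ'.equiv i)) = c₂.equiv (.inr i)) :
    m.compAt (X.perm σ τ f) (Y.perm σ' τ' g) a a' b c = Z.perm b₂ c₂ (m.comp f g) := by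
  obtain ⟨b₃, c₃, κ, ρ, h3, h4, h5, h6, h7, h8, e⟩ := m.at_canon' (f := f) (g := g) (σ := σ)
    (τ' := τ') (b := b) (c := c) h1 h2
  rw [e]
  apply Z.perm_congr
  · rintro (i | i)
    · exact (h5 i).trans (hb i)
    · exact (h6 i).trans (hb' _ _ (h3 i))
  · rintro (i | i)
    · exact (h7 i).trans (hc _ _ (h4 i))
    · exact (h8 i).trans (hc' i)

end Act

/-- The associativity law of a polycategory, for factors of three kinds. -/
def AssocLaw {C : Type u} {X : Bi.{u, v} C} {Y : Bi.{u, v'} C} {Z : Bi.{u, w} C}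
    {V : Bi.{u, w₁} C} {W : Bi.{u, w₂} C} {T : Bi.{u, w₃} C}
    (m₁ : Act X Y V) (m₂ : Act V Z W) (m₃ : Act Y Z T) (m₄ : Act X T W) : Prop :=
  ∀ {Γ Δ Φ Ψ Θ Ξ : Fam C} {A B : C} (f : X.obj Γ (Δ ⊎ .single A))
    (g : Y.obj (.single A ⊎ Φ) (Ψ ⊎ .single B)) (h : Z.obj (.single B ⊎ Θ) Ξ),
    m₄.comp f (T.perm (.assoc _ _ _) (.refl _) (m₃.comp g h)) =
      W.perm (.assoc _ _ _) (.assoc _ _ _)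
        (m₂.comp (V.perm (.refl _) (Fam.Iso.assoc _ _ _).symm (m₁.comp f g)) h)

/-- The interchange law for compositions along two outputs. -/
def OutLaw {C : Type u} {X : Bi.{u, v} C} {Y : Bi.{u, v'} C} {Z : Bi.{u, w} C}
    {V : Bi.{u, w₁} C} {W : Bi.{u, w₂} C} {T : Bi.{u, w₃} C}
    (m₁ : Act X Z V) (m₂ : Act V Y W) (m₃ : Act X Y T) (m₄ : Act T Z W) : Prop :=
  ∀ {Γ Δ Φ Ψ Θ Ξ : Fam C} {A B : C} (f : X.obj Γ (Δ ⊎ .single A ⊎ .single B))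
    (g : Y.obj (.single A ⊎ Φ) Ψ) (h : Z.obj (.single B ⊎ Θ) Ξ),
    m₂.comp (V.perm (.refl _) (.rightComm _ _ _) (m₁.comp f h)) g =
      W.perm (.rightComm _ _ _) (.rightComm _ _ _)
        (m₄.comp (T.perm (.refl _) (.rightComm _ _ _)
          (m₃.comp (X.perm (.refl _) (.rightComm _ _ _) f) g)) h)

/-- The interchange law for compositions along two inputs. -/
def InLaw {C : Type u} {X : Bi.{u, v} C} {Y : Bi.{u, v'} C} {Z : Bi.{u, w} C}
    {V : Bi.{u, w₁} C} {W : Bi.{u, w₂} C} {T : Bi.{u, w₃} C}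
    (m₁ : Act X Z V) (m₂ : Act Y V W) (m₃ : Act Y Z T) (m₄ : Act X T W) : Prop :=
  ∀ {Γ Δ Φ Ψ Θ Ξ : Fam C} {A B : C} (f : X.obj Γ (Δ ⊎ .single A))
    (g : Y.obj Φ (Ψ ⊎ .single B)) (h : Z.obj (.single A ⊎ (.single B ⊎ Θ)) Ξ),
    m₂.comp g (V.perm (.leftComm _ _ _) (.refl _) (m₁.comp f h)) =
      W.perm (.leftComm _ _ _) (.leftComm _ _ _)
        (m₄.comp f (T.perm (.leftComm _ _ _) (.refl _)
          (m₃.comp g (Z.perm (.leftComm _ _ _) (.refl _) h))))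

section
variable {C : Type u} {X : Bi.{u, v} C} {Y : Bi.{u, v'} C} {Z : Bi.{u, w} C}
    {V : Bi.{u, w₁} C} {W : Bi.{u, w₂} C} {T : Bi.{u, w₃} C}

theorem AssocLaw.compAt {m₁ : Act X Y V} {m₂ : Act V Z W} {m₃ : Act Y Z T} {m₄ : Act X T W}
    (law : AssocLaw m₁ m₂ m₃ m₄)
    {Γ D G E H Ξ T₀ R S U Γ' Δ' D' D'' E' E'' G'' H' H'' T' : Fam C} {A B : C}
    {f : X.obj Γ D} {g : Y.obj G E} {h : Z.obj H Ξ}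
    {p : E' ⊎ .single B ≅ₗ E} {p' : .single B ⊎ H' ≅ₗ H} {q : G ⊎ H' ≅ₗ T₀} {r : E' ⊎ Ξ ≅ₗ R}
    {a : D' ⊎ .single A ≅ₗ D} {a' : .single A ⊎ T' ≅ₗ T₀} {b : Γ ⊎ T' ≅ₗ Γ'} {c : D' ⊎ R ≅ₗ Δ'}
    {s : D'' ⊎ .single A ≅ₗ D} {s' : .single A ⊎ G'' ≅ₗ G} {t : Γ ⊎ G'' ≅ₗ S} {w : D'' ⊎ E ≅ₗ U}
    {k : E'' ⊎ .single B ≅ₗ U} {k' : .single B ⊎ H'' ≅ₗ H} {l : S ⊎ H'' ≅ₗ Γ'} {n : E'' ⊎ Ξ ≅ₗ Δ'}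
    (h1 : a.equiv (.inr ()) = s.equiv (.inr ()))
    (h2 : a'.equiv (.inl ()) = q.equiv (.inl (s'.equiv (.inl ()))))
    (h3 : w.equiv (.inr (p.equiv (.inr ()))) = k.equiv (.inr ()))
    (h4 : p'.equiv (.inl ()) = k'.equiv (.inl ()))
    (i1 : ∀ i, b.equiv (.inl i) = l.equiv (.inl (t.equiv (.inl i))))
    (i2 : ∀ i j, q.equiv (.inl (s'.equiv (.inr i))) = a'.equiv (.inr j) →
      b.equiv (.inr j) = l.equiv (.inl (t.equiv (.inr i))))
    (i3 : ∀ i i' j, p'.equiv (.inr i) = k'.equiv (.inr i') → q.equiv (.inr i) = a'.equiv (.inr j) →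
      b.equiv (.inr j) = l.equiv (.inr i'))
    (o1 : ∀ i i' j, a.equiv (.inl i) = s.equiv (.inl i') → w.equiv (.inl i') = k.equiv (.inl j) →
      c.equiv (.inl i) = n.equiv (.inl j))
    (o2 : ∀ i j, w.equiv (.inr (p.equiv (.inl i))) = k.equiv (.inl j) →
      c.equiv (.inr (r.equiv (.inl i))) = n.equiv (.inl j))
    (o3 : ∀ i, c.equiv (.inr (r.equiv (.inr i))) = n.equiv (.inr i)) :
    m₄.compAt f (m₃.compAt g h p p' q r) a a' b c = m₂.compAt (m₁.compAt f g s s' t w) h k k' l n := by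
  obtain ⟨f, rfl⟩ := X.perm_surj (.refl _) s f
  obtain ⟨g, rfl⟩ := Y.perm_surj s' p g
  obtain ⟨h, rfl⟩ := Z.perm_surj k' (.refl _) h
  obtain ⟨q₂, r₂, κ, ρ, e1, e2, e3, e4, e5, e6, e⟩ := m₃.at_canon' (f := g) (g := h) (σ := s')
    (τ' := .refl _) (τ := p) (σ' := k') (a := p) (a' := p') (b := q) (c := r) rfl h4
  obtain ⟨t₂, w₂, κ', ρ', e1', e2', e3', e4', e5', e6', e'⟩ := m₁.at_canon' (f := f) (g := g)
    (σ := .refl _) (τ' := p) (τ := s) (σ' := s') (a := s) (a' := s') (b := t) (c := w) rfl rfl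
  have hκ : ∀ j, κ'.equiv j = j := fun j => Sum.inr_injective (s'.equiv.injective (e1' j))
  have hρ : ∀ j, ρ.equiv j = j := fun j => Sum.inl_injective (p.equiv.injective (e2 j))
  have hρ' : ∀ j, ρ'.equiv j = j := fun j => Sum.inl_injective (s.equiv.injective (e2' j))
  rw [e, e']
  have f1 : T.perm q₂ r₂ (m₃.comp g h) = T.perm ((Fam.Iso.assoc _ _ _).symm.trans q₂) r₂
      (T.perm (.assoc _ _ _) (.refl _) (m₃.comp g h)) := by
    rw [T.perm_perm]; apply T.perm_congr
    · rintro ((i | i) | i) <;> rfl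
    · intro i; rfl
  have f2 : V.perm t₂ w₂ (m₁.comp f g) = V.perm t₂ ((Fam.Iso.assoc _ _ _).trans w₂)
      (V.perm (.refl _) (Fam.Iso.assoc _ _ _).symm (m₁.comp f g)) := by
    rw [V.perm_perm]; apply V.perm_congr
    · intro i; rfl
    · rintro (i | (i | i)) <;> rfl
  rw [f1, f2]
  obtain ⟨b₂, c₂, μ, ν, d1, d2, d3, d4, d5, d6, d⟩ := m₄.at_canon' (f := f)
    (g := T.perm (.assoc _ _ _) (.refl _) (m₃.comp g h)) (σ := .refl _) (τ := s)
    (σ' := (Fam.Iso.assoc _ _ _).symm.trans q₂) (τ' := r₂) (a := a) (a' := a') (b := b) (c := c) h1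
    (h2.trans (e3 _).symm)
  obtain ⟨l₂, n₂, μ', ν', d1', d2', d3', d4', d5', d6', d'⟩ := m₂.at_canon'
    (f := V.perm (.refl _) (Fam.Iso.assoc _ _ _).symm (m₁.comp f g)) (g := h) (σ := t₂)
    (τ := (Fam.Iso.assoc _ _ _).trans w₂) (σ' := k') (τ' := .refl _) (a := k) (a' := k') (b := l)
    (c := n) (h3.symm.trans (e6' _).symm) rfl
  have hμ' : ∀ j, μ'.equiv j = j := fun j => Sum.inr_injective (k'.equiv.injective (d1' j))
  rw [d, d', law, W.perm_perm]
  apply W.perm_congr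
  · rintro ((i | i) | i)
    · refine (d3 i).trans ((i1 i).trans ?_)
      refine Eq.trans ?_ (d3' _).symm
      rw [e3']; rfl
    · refine (d4 (.inl i)).trans ((i2 i _ ?_).trans ?_)
      · exact (e3 _).symm.trans (d1 (.inl i)).symm
      · refine Eq.trans ?_ (d3' _).symm
        rw [e4', hκ]
    · refine (d4 (.inr i)).trans ((i3 (κ.equiv i) i _ (e1 i) ?_).trans ?_)
      · exact (e4 _).symm.trans (d1 (.inr i)).symm
      · refine Eq.trans ?_ (d4' _).symm
        rw [hμ']
  · rintro ((i | i) | i)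
    · refine (d5 i).trans ((o1 _ i (ν'.equiv (.inl i)) (d2 i) ?_).trans ?_)
      · refine Eq.trans ?_ (d2' (.inl i)).symm
        refine Eq.trans ?_ (e5' i).symm
        rw [hρ']
      · exact (d5' _).symm
    · refine (d6 (.inl i)).trans ?_
      rw [e5, hρ]
      refine (o2 i (ν'.equiv (.inr i)) ?_).trans (d5' _).symm
      exact ((d2' (.inr i)).trans (e6' _)).symm
    · refine (d6 (.inr i)).trans ?_
      rw [e6]
      exact (o3 _).trans (d6' _).symm

theorem OutLaw.compAt {m₁ : Act X Z V} {m₂ : Act V Y W} {m₃ : Act X Y T} {m₄ : Act T Z W}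
    (law : OutLaw m₁ m₂ m₃ m₄)
    {Γ D D₀ G H Ψ Ξ P Q R R' R₂ R₂' S S₂ Γ' Δ' G' G'' H' H'' : Fam C} {A B : C}
    {f : X.obj Γ D} {g : Y.obj G Ψ} {h : Z.obj H Ξ} (w₀ : D₀ ⊎ .single A ⊎ .single B ≅ₗ D)
    {p : P ⊎ .single B ≅ₗ D} {p' : .single B ⊎ H' ≅ₗ H} {q : Γ ⊎ H' ≅ₗ S} {r : P ⊎ Ξ ≅ₗ R}
    {a : R' ⊎ .single A ≅ₗ R} {a' : .single A ⊎ G' ≅ₗ G} {b : S ⊎ G' ≅ₗ Γ'} {c : R' ⊎ Ψ ≅ₗ Δ'}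
    {s : Q ⊎ .single A ≅ₗ D} {s' : .single A ⊎ G'' ≅ₗ G} {t : Γ ⊎ G'' ≅ₗ S₂} {w : Q ⊎ Ψ ≅ₗ R₂}
    {k : R₂' ⊎ .single B ≅ₗ R₂} {k' : .single B ⊎ H'' ≅ₗ H} {l : S₂ ⊎ H'' ≅ₗ Γ'}
    {n : R₂' ⊎ Ξ ≅ₗ Δ'}
    (h1 : p.equiv (.inr ()) = w₀.equiv (.inr ()))
    (h2 : s.equiv (.inr ()) = w₀.equiv (.inl (.inr ())))
    (h3 : ∀ i, p.equiv (.inl i) = w₀.equiv (.inl (.inr ())) →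
      r.equiv (.inl i) = a.equiv (.inr ()))
    (h4 : ∀ i, s.equiv (.inl i) = w₀.equiv (.inr ()) → w.equiv (.inl i) = k.equiv (.inr ()))
    (h5 : a'.equiv (.inl ()) = s'.equiv (.inl ())) (h6 : p'.equiv (.inl ()) = k'.equiv (.inl ()))
    (i1 : ∀ i, b.equiv (.inl (q.equiv (.inl i))) = l.equiv (.inl (t.equiv (.inl i))))
    (i2 : ∀ i j, p'.equiv (.inr i) = k'.equiv (.inr j) →
      b.equiv (.inl (q.equiv (.inr i))) = l.equiv (.inr j))
    (i3 : ∀ i j, a'.equiv (.inr i) = s'.equiv (.inr j) →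
      b.equiv (.inr i) = l.equiv (.inl (t.equiv (.inr j))))
    (o1 : ∀ x i j i' j', p.equiv (.inl i) = w₀.equiv (.inl (.inl x)) →
      s.equiv (.inl j) = w₀.equiv (.inl (.inl x)) → r.equiv (.inl i) = a.equiv (.inl i') →
      w.equiv (.inl j) = k.equiv (.inl j') → c.equiv (.inl i') = n.equiv (.inl j'))
    (o2 : ∀ i j, r.equiv (.inr i) = a.equiv (.inl j) → c.equiv (.inl j) = n.equiv (.inr i))
    (o3 : ∀ i j, w.equiv (.inr i) = k.equiv (.inl j) → c.equiv (.inr i) = n.equiv (.inl j)) :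
    m₂.compAt (m₁.compAt f h p p' q r) g a a' b c = m₄.compAt (m₃.compAt f g s s' t w) h k k' l n := by
  obtain ⟨f, rfl⟩ := X.perm_surj (.refl _) w₀ f
  obtain ⟨g, rfl⟩ := Y.perm_surj s' (.refl _) g
  obtain ⟨h, rfl⟩ := Z.perm_surj k' (.refl _) h
  have f0 : X.perm (.refl _) w₀ f = X.perm (.refl _) ((Fam.Iso.rightComm _ _ _).trans w₀)
      (X.perm (.refl _) (.rightComm _ _ _) f) := by
    rw [X.perm_perm]; apply X.perm_congr
    · intro i; rfl
    · rintro ((i | i) | i) <;> rfl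
  obtain ⟨q₂, r₂, κ, ρ, e1, e2, e3, e4, e5, e6, e⟩ := m₁.at_canon' (f := f) (g := h) (σ := .refl _)
    (τ' := .refl _) (τ := w₀) (σ' := k') (a := p) (a' := p') (b := q) (c := r) h1 h6
  obtain ⟨t₂, w₂, κ', ρ', e1', e2', e3', e4', e5', e6', e'⟩ := m₃.at_canon'
    (f := X.perm (.refl _) (.rightComm _ _ _) f) (g := g)
    (σ := .refl _) (τ' := .refl _) (τ := (Fam.Iso.rightComm _ _ _).trans w₀) (σ' := s') (a := s)
    (a' := s') (b := t) (c := w) h2 rfl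
  have hκ : ∀ j, κ'.equiv j = j := fun j => Sum.inr_injective (s'.equiv.injective (e1' j))
  rw [e, f0, e']
  have f1 : V.perm q₂ r₂ (m₁.comp f h) = V.perm q₂ ((Fam.Iso.rightComm _ _ _).trans r₂)
      (V.perm (.refl _) (.rightComm _ _ _) (m₁.comp f h)) := by
    rw [V.perm_perm]; apply V.perm_congr
    · intro i; rfl
    · rintro ((i | i) | i) <;> rfl
  have f2 : T.perm t₂ w₂ (m₃.comp (X.perm (.refl _) (.rightComm _ _ _) f) g) =
      T.perm t₂ ((Fam.Iso.rightComm _ _ _).trans w₂)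
      (T.perm (.refl _) (.rightComm _ _ _)
        (m₃.comp (X.perm (.refl _) (.rightComm _ _ _) f) g)) := by
    rw [T.perm_perm]; apply T.perm_congr
    · intro i; rfl
    · rintro ((i | i) | i) <;> rfl
  rw [f1, f2]
  obtain ⟨b₂, c₂, μ, ν, d1, d2, d3, d4, d5, d6, d⟩ := m₂.at_canon'
    (f := V.perm (.refl _) (.rightComm _ _ _) (m₁.comp f h)) (g := g) (σ := q₂)
    (τ := (Fam.Iso.rightComm _ _ _).trans r₂) (σ' := s') (τ' := .refl _) (a := a) (a' := a')
    (b := b) (c := c)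
    ((h3 _ (e2 (.inr ()))).symm.trans (e5 (.inr ())).symm) h5
  obtain ⟨l₂, n₂, μ', ν', d1', d2', d3', d4', d5', d6', d'⟩ := m₄.at_canon'
    (f := T.perm (.refl _) (.rightComm _ _ _)
      (m₃.comp (X.perm (.refl _) (.rightComm _ _ _) f) g)) (g := h) (σ := t₂)
    (τ := (Fam.Iso.rightComm _ _ _).trans w₂) (σ' := k') (τ' := .refl _) (a := k) (a' := k')
    (b := l) (c := n) ((h4 _ (e2' (.inr ()))).symm.trans (e5' (.inr ())).symm) rfl
  have hμ' : ∀ j, μ'.equiv j = j := fun j => Sum.inr_injective (k'.equiv.injective (d1' j))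
  rw [d, d', law, W.perm_perm]
  apply W.perm_congr
  · rintro ((i | i) | i)
    · refine (d3 (.inl i)).trans ((congrArg (fun z => b.equiv (.inl z)) (e3 i)).trans ((i1 i).trans ?_))
      exact ((d3' (.inl i)).trans (congrArg (fun z => l.equiv (.inl z)) (e3' i))).symm
    · refine (d4 i).trans ((i3 _ i (d1 i)).trans ?_)
      refine Eq.trans ?_ ((d3' (.inr i)).trans (congrArg (fun z => l.equiv (.inl z)) (e4' i))).symm
      rw [hκ]
    · refine (d3 (.inr i)).trans ((congrArg (fun z => b.equiv (.inl z)) (e4 i)).trans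
        ((i2 _ i (e1 i)).trans ?_))
      refine Eq.trans ?_ (d4' i).symm
      rw [hμ']
  · rintro ((x | i) | i)
    · exact (d5 (.inl x)).trans ((o1 x _ _ _ _ (e2 (.inl x)) (e2' (.inl x))
        ((e5 _).symm.trans (d2 (.inl x)).symm) ((e5' _).symm.trans (d2' (.inl x)).symm)).trans
        (d5' _).symm)
    · exact (d6 i).trans ((o3 i _ ((e6' i).symm.trans (d2' (.inr i)).symm)).trans (d5' (.inr i)).symm)
    · exact (d5 (.inr i)).trans ((o2 i _ ((e6 i).symm.trans (d2 (.inr i)).symm)).trans (d6' i).symm)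

theorem InLaw.compAt {m₁ : Act X Z V} {m₂ : Act Y V W} {m₃ : Act Y Z T} {m₄ : Act X T W}
    (law : InLaw m₁ m₂ m₃ m₄)
    {Γ Φ D E H H₀ Ξ P Q R R₂ S S' S₂ S₂' Γ' Δ' D' D'' E' E'' : Fam C} {A B : C}
    {f : X.obj Γ D} {g : Y.obj Φ E} {h : Z.obj H Ξ} (w₀ : .single A ⊎ (.single B ⊎ H₀) ≅ₗ H)
    {p : D' ⊎ .single A ≅ₗ D} {p' : .single A ⊎ P ≅ₗ H} {q : Γ ⊎ P ≅ₗ S} {r : D' ⊎ Ξ ≅ₗ R}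
    {a : E' ⊎ .single B ≅ₗ E} {a' : .single B ⊎ S' ≅ₗ S} {b : Φ ⊎ S' ≅ₗ Γ'} {c : E' ⊎ R ≅ₗ Δ'}
    {s : E'' ⊎ .single B ≅ₗ E} {s' : .single B ⊎ Q ≅ₗ H} {t : Φ ⊎ Q ≅ₗ S₂} {w : E'' ⊎ Ξ ≅ₗ R₂}
    {k : D'' ⊎ .single A ≅ₗ D} {k' : .single A ⊎ S₂' ≅ₗ S₂} {l : Γ ⊎ S₂' ≅ₗ Γ'}
    {n : D'' ⊎ R₂ ≅ₗ Δ'}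
    (h1 : p'.equiv (.inl ()) = w₀.equiv (.inl ()))
    (h2 : s'.equiv (.inl ()) = w₀.equiv (.inr (.inl ())))
    (h3 : ∀ i, p'.equiv (.inr i) = w₀.equiv (.inr (.inl ())) →
      q.equiv (.inr i) = a'.equiv (.inl ()))
    (h4 : ∀ i, s'.equiv (.inr i) = w₀.equiv (.inl ()) → t.equiv (.inr i) = k'.equiv (.inl ()))
    (h5 : a.equiv (.inr ()) = s.equiv (.inr ())) (h6 : p.equiv (.inr ()) = k.equiv (.inr ()))
    (i1 : ∀ i, c.equiv (.inr (r.equiv (.inr i))) = n.equiv (.inr (w.equiv (.inr i))))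
    (i2 : ∀ i j, p.equiv (.inl i) = k.equiv (.inl j) →
      c.equiv (.inr (r.equiv (.inl i))) = n.equiv (.inl j))
    (i3 : ∀ i j, a.equiv (.inl i) = s.equiv (.inl j) →
      c.equiv (.inl i) = n.equiv (.inr (w.equiv (.inl j))))
    (o1 : ∀ x i j i' j', p'.equiv (.inr i) = w₀.equiv (.inr (.inr x)) →
      s'.equiv (.inr j) = w₀.equiv (.inr (.inr x)) → q.equiv (.inr i) = a'.equiv (.inr i') →
      t.equiv (.inr j) = k'.equiv (.inr j') → b.equiv (.inr i') = l.equiv (.inr j'))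
    (o2 : ∀ i j, q.equiv (.inl i) = a'.equiv (.inr j) → b.equiv (.inr j) = l.equiv (.inl i))
    (o3 : ∀ i j, t.equiv (.inl i) = k'.equiv (.inr j) → b.equiv (.inl i) = l.equiv (.inr j)) :
    m₂.compAt g (m₁.compAt f h p p' q r) a a' b c = m₄.compAt f (m₃.compAt g h s s' t w) k k' l n := by
  obtain ⟨f, rfl⟩ := X.perm_surj (.refl _) k f
  obtain ⟨g, rfl⟩ := Y.perm_surj (.refl _) s g
  obtain ⟨h, rfl⟩ := Z.perm_surj w₀ (.refl _) h
  have f0 : Z.perm w₀ (.refl _) h = Z.perm ((Fam.Iso.leftComm _ _ _).trans w₀) (.refl _)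
      (Z.perm (.leftComm _ _ _) (.refl _) h) := by
    rw [Z.perm_perm]; apply Z.perm_congr
    · rintro (i | (i | i)) <;> rfl
    · intro i; rfl
  obtain ⟨q₂, r₂, κ, ρ, e1, e2, e3, e4, e5, e6, e⟩ := m₁.at_canon' (f := f) (g := h) (σ := .refl _)
    (τ' := .refl _) (τ := k) (σ' := w₀) (a := p) (a' := p') (b := q) (c := r) h6 h1
  obtain ⟨t₂, w₂, κ', ρ', e1', e2', e3', e4', e5', e6', e'⟩ := m₃.at_canon'
    (g := Z.perm (.leftComm _ _ _) (.refl _) h) (f := g)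
    (σ := .refl _) (τ' := .refl _) (σ' := (Fam.Iso.leftComm _ _ _).trans w₀) (τ := s) (a := s)
    (a' := s') (b := t) (c := w) rfl h2
  have hρ : ∀ j, ρ'.equiv j = j := fun j => Sum.inl_injective (s.equiv.injective (e2' j))
  rw [e, f0, e']
  have f1 : V.perm q₂ r₂ (m₁.comp f h) = V.perm ((Fam.Iso.leftComm _ _ _).trans q₂) r₂
      (V.perm (.leftComm _ _ _) (.refl _) (m₁.comp f h)) := by
    rw [V.perm_perm]; apply V.perm_congr
    · rintro (i | (i | i)) <;> rfl
    · intro i; rfl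
  have f2 : T.perm t₂ w₂ (m₃.comp g (Z.perm (.leftComm _ _ _) (.refl _) h)) =
      T.perm ((Fam.Iso.leftComm _ _ _).trans t₂) w₂
      (T.perm (.leftComm _ _ _) (.refl _)
        (m₃.comp g (Z.perm (.leftComm _ _ _) (.refl _) h))) := by
    rw [T.perm_perm]; apply T.perm_congr
    · rintro (i | (i | i)) <;> rfl
    · intro i; rfl
  rw [f1, f2]
  obtain ⟨b₂, c₂, μ, ν, d1, d2, d3, d4, d5, d6, d⟩ := m₂.at_canon'
    (g := V.perm (.leftComm _ _ _) (.refl _) (m₁.comp f h)) (f := g) (τ' := r₂)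
    (σ' := (Fam.Iso.leftComm _ _ _).trans q₂) (τ := s) (σ := .refl _) (a := a) (a' := a')
    (b := b) (c := c) h5
    ((h3 _ (e1 (.inl ()))).symm.trans (e4 (.inl ())).symm)
  obtain ⟨l₂, n₂, μ', ν', d1', d2', d3', d4', d5', d6', d'⟩ := m₄.at_canon'
    (g := T.perm (.leftComm _ _ _) (.refl _)
      (m₃.comp g (Z.perm (.leftComm _ _ _) (.refl _) h))) (f := f) (τ' := w₂)
    (σ' := (Fam.Iso.leftComm _ _ _).trans t₂) (τ := k) (σ := .refl _) (a := k) (a' := k')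
    (b := l) (c := n) rfl ((h4 _ (e1' (.inl ()))).symm.trans (e4' (.inl ())).symm)
  have hν' : ∀ j, ν'.equiv j = j := fun j => Sum.inl_injective (k.equiv.injective (d2' j))
  rw [d, d', law, W.perm_perm]
  apply W.perm_congr
  · rintro (i | (i | x))
    · exact (d4 (.inl i)).trans ((o2 i _ ((e3 i).symm.trans (d1 (.inl i)).symm)).trans (d3' i).symm)
    · exact (d3 i).trans ((o3 i _ ((e3' i).symm.trans (d1' (.inl i)).symm)).trans (d4' (.inl i)).symm)
    · exact (d4 (.inr x)).trans ((o1 x _ _ _ _ (e1 (.inr x)) (e1' (.inr x))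
        ((e4 _).symm.trans (d1 (.inr x)).symm) ((e4' _).symm.trans (d1' (.inr x)).symm)).trans
        (d4' _).symm)
  · rintro (i | (i | i))
    · refine (d6 (.inl i)).trans ((congrArg (fun z => c.equiv (.inr z)) (e5 i)).trans
        ((i2 _ i (e2 i)).trans ?_))
      refine Eq.trans ?_ (d5' i).symm
      rw [hν']
    · refine (d5 i).trans ((i3 _ i (d2 i)).trans ?_)
      refine Eq.trans ?_ ((d6' (.inl i)).trans (congrArg (fun z => n.equiv (.inr z)) (e5' i))).symm
      rw [hρ]
    · refine (d6 (.inr i)).trans ((congrArg (fun z => c.equiv (.inr z)) (e6 i)).trans ((i1 i).trans ?_))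
      exact ((d6' (.inr i)).trans (congrArg (fun z => n.equiv (.inr z)) (e6' i))).symm
end

namespace Polycat

abbrev bi (P : Polycat.{u, v}) : Bi.{u, v} P.Ob := ⟨P.Hom, P.perm, P.perm_refl, P.perm_perm⟩

abbrev act (P : Polycat.{u, v}) : Act P.bi P.bi P.bi := ⟨P.comp, P.comp_perm⟩

variable (P : Polycat.{u, v})

theorem assocLaw : AssocLaw P.act P.act P.act P.act := fun f g h => P.assoc f g h
theorem outLaw : OutLaw P.act P.act P.act P.act := fun f g h => P.interchange_out f g h
theorem inLaw : InLaw P.act P.act P.act P.act := fun f g h => P.interchange_in f g h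

variable {P} in
theorem perm_comp {Γ Γ' Δ Δ' Φ Ψ : Fam P.Ob} {A : P.Ob} {f : P.Hom Γ (Δ ⊎ .single A)}
    {g : P.Hom (.single A ⊎ Φ) Ψ} {b : Γ ⊎ Φ ≅ₗ Γ'} {c : Δ ⊎ Ψ ≅ₗ Δ'} :
    P.perm b c (P.comp f g) = P.act.compAt f g (.refl _) (.refl _) b c :=
  P.act.at_eq.symm

end Polycat

/-- Modules over a polycategory: sets with symmetric actions and a left and a right action, subject to
the unit, associativity and interchange laws of a polycategory with one factor taken in the module.
The remaining choices of that factor in the interchange laws follow from these by symmetry. -/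
structure PModule (P : Polycat.{u, v}) extends Bi.{u, w} P.Ob where
  lact : Act P.bi toBi toBi
  ract : Act toBi P.bi toBi
  id_lact {Γ Δ : Fam P.Ob} {A : P.Ob} (x : obj (.single A ⊎ Γ) Δ) :
    lact.comp (P.perm (.refl _) (Fam.Iso.nilLeft _).symm (P.id A)) x =
      perm (.refl _) (Fam.Iso.nilLeft _).symm x
  ract_id {Γ Δ : Fam P.Ob} {A : P.Ob} (x : obj Γ (Δ ⊎ .single A)) :
    ract.comp x (P.perm (Fam.Iso.nilRight _).symm (.refl _) (P.id A)) =
      perm (Fam.Iso.nilRight _).symm (.refl _) x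
  assoc_left : AssocLaw ract ract P.act ract
  assoc_mid : AssocLaw lact ract ract lact
  assoc_right : AssocLaw P.act lact lact lact
  out_left : OutLaw ract ract ract ract
  out_mid : OutLaw P.act lact lact ract
  in_left : InLaw ract lact P.act ract
  in_right : InLaw lact lact lact lact

namespace PModule

variable {P : Polycat.{u, v}}

/-- The hom-sets of `P` as a module. -/
def self (P : Polycat.{u, v}) : PModule.{u, v, max 1 u v} P where
  obj Γ Δ := ULift.{max 1 u} (P.Hom Γ Δ)
  perm σ τ x := ⟨P.perm σ τ x.down⟩
  perm_refl x := congrArg ULift.up (P.perm_refl x.down)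
  perm_perm σ σ' τ τ' x := congrArg ULift.up (P.perm_perm σ σ' τ τ' x.down)
  lact := ⟨fun f x => ⟨P.comp f x.down⟩, fun σ τ ρ κ f x => congrArg ULift.up (P.comp_perm σ τ ρ κ f x.down)⟩
  ract := ⟨fun x f => ⟨P.comp x.down f⟩, fun σ τ ρ κ x f => congrArg ULift.up (P.comp_perm σ τ ρ κ x.down f)⟩
  id_lact x := congrArg ULift.up (P.id_comp x.down)
  ract_id x := congrArg ULift.up (P.comp_id x.down)
  assoc_left f g h := congrArg ULift.up (P.assoc f.down g h)
  assoc_mid f g h := congrArg ULift.up (P.assoc f g.down h)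
  assoc_right f g h := congrArg ULift.up (P.assoc f g h.down)
  out_left f g h := congrArg ULift.up (P.interchange_out f.down g h)
  out_mid f g h := congrArg ULift.up (P.interchange_out f g.down h)
  in_left f g h := congrArg ULift.up (P.interchange_in f.down g h)
  in_right f g h := congrArg ULift.up (P.interchange_in f g h.down)

abbrev shiftBi (U : PModule.{u, v, w} P) (K L : Fam P.Ob) : Bi.{u, w} P.Ob where
  obj Γ Δ := U.obj (Γ ⊎ K) (Δ ⊎ L)
  perm σ τ x := U.perm (σ.append (.refl _)) (τ.append (.refl _)) x
  perm_refl x := U.perm_id' (by rintro (i | i) <;> rfl) (by rintro (i | i) <;> rfl)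
  perm_perm σ σ' τ τ' x := (U.perm_perm _ _ _ _ _).trans
    (U.perm_congr (by rintro (i | i) <;> rfl) (by rintro (i | i) <;> rfl))

abbrev shiftLact (U : PModule.{u, v, w} P) (K L : Fam P.Ob) :
    Act P.bi (U.shiftBi K L) (U.shiftBi K L) where
  comp f x := U.lact.compAt f x (.refl _) (Fam.Iso.assoc _ _ _).symm (Fam.Iso.assoc _ _ _).symm
    (Fam.Iso.assoc _ _ _).symm
  comp_perm σ τ ρ κ f x := by
    refine Eq.trans ?_ (U.lact.perm_at _ _).symm
    apply U.lact.at_perm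
    · rfl
    · rfl
    · rintro i; rfl
    · rintro (i | i) (j | j) h <;> cases h <;> rfl
    · rintro i j h; cases h; rfl
    · rintro (i | i) <;> rfl

abbrev shiftRact (U : PModule.{u, v, w} P) (K L : Fam P.Ob) :
    Act (U.shiftBi K L) P.bi (U.shiftBi K L) where
  comp x f := U.ract.compAt x f (.rightComm _ _ _) (.refl _) (.rightComm _ _ _) (.rightComm _ _ _)
  comp_perm σ τ ρ κ x f := by
    refine Eq.trans ?_ (U.ract.perm_at _ _).symm
    apply U.ract.at_perm
    · rfl
    · rfl
    · rintro (i | i) <;> rfl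
    · rintro i j h; cases h; rfl
    · rintro (i | i) (j | j) h <;> cases h <;> rfl
    · rintro i; rfl

/-- The shifted module, with values `U(Γ, K; Δ, L)`. -/
def shift (U : PModule.{u, v, w} P) (K L : Fam P.Ob) : PModule.{u, v, w} P where
  toBi := U.shiftBi K L
  lact := U.shiftLact K L
  ract := U.shiftRact K L
  id_lact {Γ Δ A} x := by
    have e : U.perm (Fam.Iso.assoc _ _ _).symm (.refl _) (U.perm (.assoc _ Γ K) (.refl (Δ ⊎ L)) x) = x := by
      rw [U.perm_perm]
      exact U.perm_id' (by rintro ((i | i) | i) <;> rfl) fun i => rfl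
    show U.lact.compAt _ x _ _ _ _ = U.perm _ _ x
    conv_lhs => rw [← e]
    rw [U.lact.at_perm_right]
    refine (U.lact.at_congr (a₂ := .refl _) (a₂' := .refl _) (b₂ := (Fam.Iso.assoc _ _ _).symm)
      (c₂ := (Fam.Iso.assoc _ _ _).symm) ?_ ?_ ?_ ?_ ?_ ?_).trans (U.lact.at_eq.trans ?_)
    · rfl
    · rfl
    · rintro i; rfl
    · rintro (i | i) (j | j) h <;> cases h <;> rfl
    · rintro i j h; cases h; rfl
    · rintro (i | i) <;> rfl
    · refine (congrArg (U.perm _ _) (U.id_lact _)).trans ?_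
      rw [U.perm_perm, U.perm_perm]
      apply U.perm_congr
      · rintro ((i | i) | i) <;> rfl
      · rintro (i | i) <;> rfl
  ract_id {Γ Δ A} x := by
    have e : U.perm (.refl _) (.rightComm _ _ _) (U.perm (.refl (Γ ⊎ K)) (.rightComm Δ _ L) x) = x := by
      rw [U.perm_perm]
      exact U.perm_id' (fun i => rfl) (by rintro ((i | i) | i) <;> rfl)
    show U.ract.compAt x _ _ _ _ _ = U.perm _ _ x
    conv_lhs => rw [← e]
    rw [U.ract.at_perm_left]
    refine (U.ract.at_congr (a₂ := .refl _) (a₂' := .refl _) (b₂ := .rightComm _ _ _)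
      (c₂ := .rightComm _ _ _) ?_ ?_ ?_ ?_ ?_ ?_).trans (U.ract.at_eq.trans ?_)
    · rfl
    · rfl
    · rintro (i | i) <;> rfl
    · rintro i j h; cases h; rfl
    · rintro (i | i) (j | j) h <;> cases h <;> rfl
    · rintro i; rfl
    · refine (congrArg (U.perm _ _) (U.ract_id _)).trans ?_
      rw [U.perm_perm, U.perm_perm]
      apply U.perm_congr
      · rintro (i | i) <;> rfl
      · rintro ((i | i) | i) <;> rfl
  assoc_left f g h := by
    show U.ract.compAt f (P.perm _ _ (P.comp g h)) _ _ _ _ =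
      U.perm _ _ (U.ract.compAt (U.perm _ _ (U.ract.compAt f g _ _ _ _)) h _ _ _ _)
    rw [Polycat.perm_comp, U.ract.perm_at, U.ract.perm_at]
    apply AssocLaw.compAt (@U.assoc_left)
    · rfl
    · rfl
    · rfl
    · rfl
    · rintro (i | i) <;> rfl
    · rintro i j h; cases h; rfl
    · rintro i i' j h h'; cases h; cases h'; rfl
    · rintro (i | i) (i' | i') (j | j) h h' <;> cases h <;> cases h' <;> rfl
    · rintro i (j | j) h <;> cases h; rfl
    · rintro i; rfl
  assoc_mid f g h := by
    show U.lact.compAt f (U.perm _ _ (U.ract.compAt g h _ _ _ _)) _ _ _ _ =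
      U.perm _ _ (U.ract.compAt (U.perm _ _ (U.lact.compAt f g _ _ _ _)) h _ _ _ _)
    rw [U.lact.perm_at, U.ract.perm_at, U.ract.perm_at]
    apply AssocLaw.compAt (@U.assoc_mid)
    · rfl
    · rfl
    · rfl
    · rfl
    · rintro i; rfl
    · rintro (i | i) ((j | j) | j) h <;> cases h <;> rfl
    · rintro i i' ((j | j) | j) h h' <;> cases h <;> cases h'; rfl
    · rintro i i' (j | j) h h' <;> cases h <;> cases h'; rfl
    · rintro (i | i) (j | j) h <;> cases h <;> rfl
    · rintro i; rfl
  assoc_right f g h := by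
    show U.lact.compAt f (U.perm _ _ (U.lact.compAt g h _ _ _ _)) _ _ _ _ =
      U.perm _ _ (U.lact.compAt (P.perm _ _ (P.comp f g)) h _ _ _ _)
    rw [Polycat.perm_comp, U.lact.perm_at, U.lact.perm_at]
    apply AssocLaw.compAt (@U.assoc_right)
    · rfl
    · rfl
    · rfl
    · rfl
    · rintro i; rfl
    · rintro i ((j | j) | j) h <;> cases h; rfl
    · rintro (i | i) (i' | i') ((j | j) | j) h h' <;> cases h <;> cases h' <;> rfl
    · rintro i i' (j | j) h h' <;> cases h <;> cases h'; rfl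
    · rintro i (j | j) h <;> cases h; rfl
    · rintro (i | i) <;> rfl
  out_left f g h := by
    show U.ract.compAt (U.perm _ _ (U.ract.compAt f h _ _ _ _)) g _ _ _ _ =
      U.perm _ _ (U.ract.compAt (U.perm _ _ (U.ract.compAt (U.perm _ _ f) g _ _ _ _)) h _ _ _ _)
    rw [U.ract.perm_at, U.ract.perm_at, U.ract.perm_at, U.ract.at_perm_left]
    apply OutLaw.compAt (@U.out_left)
      (((Fam.Iso.rightComm _ _ _).append (.refl _)).trans (.rightComm _ _ _))
    · rfl
    · rfl
    · rintro ((i | i) | i) h <;> cases h; rfl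
    · rintro ((i | i) | i) h <;> cases h; rfl
    · rfl
    · rfl
    · rintro (i | i) <;> rfl
    · rintro i j h; cases h; rfl
    · rintro i j h; cases h; rfl
    · rintro (x | x) ((i | i) | i) ((j | j) | j) ((i' | i') | i') ((j' | j') | j') h h' k k' <;>
        cases h <;> cases h' <;> cases k <;> cases k' <;> rfl
    · rintro i ((j | j) | j) h <;> cases h; rfl
    · rintro i ((j | j) | j) h <;> cases h; rfl
  out_mid f g h := by
    show U.lact.compAt (P.perm _ _ (P.comp f h)) g _ _ _ _ =
      U.perm _ _ (U.ract.compAt (U.perm _ _ (U.lact.compAt (P.perm _ _ f) g _ _ _ _)) h _ _ _ _)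
    rw [Polycat.perm_comp, U.lact.perm_at, U.ract.perm_at, U.lact.at_perm_left]
    apply OutLaw.compAt (@U.out_mid) (.refl _)
    · rfl
    · rfl
    · rintro (i | i) h <;> cases h; rfl
    · rintro (i | i) h <;> cases h; rfl
    · rfl
    · rfl
    · rintro i; rfl
    · rintro i j h; cases h; rfl
    · rintro (i | i) (j | j) h <;> cases h <;> rfl
    · rintro x (i | i) (j | j) (i' | i') ((j' | j') | j') h h' k k' <;>
        cases h <;> cases h' <;> cases k <;> cases k' <;> rfl
    · rintro i (j | j) h <;> cases h; rfl
    · rintro (i | i) ((j | j) | j) h <;> cases h <;> rfl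
  in_left f g h := by
    show U.lact.compAt g (U.perm _ _ (U.ract.compAt f h _ _ _ _)) _ _ _ _ =
      U.perm _ _ (U.ract.compAt f (P.perm _ _ (P.comp g (P.perm _ _ h))) _ _ _ _)
    rw [U.ract.perm_at, Polycat.perm_comp, U.ract.perm_at, P.act.at_perm_right]
    apply InLaw.compAt (@U.in_left) (.refl _)
    · rfl
    · rfl
    · rintro (i | i) h <;> cases h; rfl
    · rintro (i | i) h <;> cases h; rfl
    · rfl
    · rfl
    · rintro i; rfl
    · rintro (i | i) (j | j) h <;> cases h <;> rfl
    · rintro i j h; cases h; rfl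
    · rintro x (i | i) (j | j) ((i' | i') | i') (j' | j') h h' k k' <;>
        cases h <;> cases h' <;> cases k <;> cases k' <;> rfl
    · rintro (i | i) ((j | j) | j) h <;> cases h <;> rfl
    · rintro i (j | j) h <;> cases h; rfl
  in_right f g h := by
    show U.lact.compAt g (U.perm _ _ (U.lact.compAt f h _ _ _ _)) _ _ _ _ =
      U.perm _ _ (U.lact.compAt f (U.perm _ _ (U.lact.compAt g (U.perm _ _ h) _ _ _ _)) _ _ _ _)
    rw [U.lact.perm_at, U.lact.perm_at, U.lact.perm_at, U.lact.at_perm_right]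
    apply InLaw.compAt (@U.in_right)
      ((Fam.Iso.append (.refl _) (Fam.Iso.assoc _ _ _).symm).trans (Fam.Iso.assoc _ _ _).symm)
    · rfl
    · rfl
    · rintro ((i | i) | i) h <;> cases h; rfl
    · rintro ((i | i) | i) h <;> cases h; rfl
    · rfl
    · rfl
    · rintro (i | i) <;> rfl
    · rintro i j h; cases h; rfl
    · rintro i j h; cases h; rfl
    · rintro (x | x) ((i | i) | i) ((j | j) | j) ((i' | i') | i') ((j' | j') | j') h h' k k' <;>
        cases h <;> cases h' <;> cases k <;> cases k' <;> rfl
    · rintro i ((j | j) | j) h <;> cases h; rfl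
    · rintro i ((j | j) | j) h <;> cases h; rfl

end PModule

namespace Polycat
variable (P : Polycat.{u, v})

/-- `t` exhibits `T` as the tensor product of the list `S`. -/
def IsTensor {S : Fam P.Ob} {T : P.Ob} (t : P.Hom S (.single T)) : Prop :=
  ∀ Γ Δ : Fam P.Ob, Function.Bijective fun g : P.Hom (.single T ⊎ Γ) Δ =>
    P.comp (P.perm (.refl _) (Fam.Iso.nilLeft _).symm t) g

/-- `t` exhibits `T` as the cotensor product of the list `S`. -/
def IsCotensor {S : Fam P.Ob} {T : P.Ob} (t : P.Hom (.single T) S) : Prop :=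
  ∀ Γ Δ : Fam P.Ob, Function.Bijective fun g : P.Hom Γ (Δ ⊎ .single T) =>
    P.comp g (P.perm (Fam.Iso.nilRight _).symm (.refl _) t)

/-- `e` exhibits `B` as the dual of `A`. -/
def IsDual {A B : P.Ob} (e : P.Hom (.single B ⊎ .single A) .nil) : Prop :=
  ∀ Γ Δ : Fam P.Ob, Function.Bijective fun g : P.Hom Γ (Δ ⊎ .single B) => P.comp g e

/-- A set of distinguished tensor and cotensor products, binary or nullary. -/
structure Distinguished where
  tensor {A B T : P.Ob} : P.Hom (.single A ⊎ .single B) (.single T) → Prop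
  unit {T : P.Ob} : P.Hom .nil (.single T) → Prop
  cotensor {A B T : P.Ob} : P.Hom (.single T) (.single A ⊎ .single B) → Prop
  counit {T : P.Ob} : P.Hom (.single T) .nil → Prop
  isTensor {A B T : P.Ob} {t : P.Hom (.single A ⊎ .single B) (.single T)} :
    tensor t → P.IsTensor t
  isUnit {T : P.Ob} {t : P.Hom .nil (.single T)} : unit t → P.IsTensor t
  isCotensor {A B T : P.Ob} {t : P.Hom (.single T) (.single A ⊎ .single B)} :
    cotensor t → P.IsCotensor t
  isCounit {T : P.Ob} {t : P.Hom (.single T) .nil} : counit t → P.IsCotensor t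

end Polycat

namespace PModule
variable {P : Polycat.{u, v}}

/-- Composition with `t` is a bijection from `U(T, Γ; Δ)` to `U(S, Γ; Δ)`. -/
def RespectsTensor (U : PModule.{u, v, w} P) {S : Fam P.Ob} {T : P.Ob} (t : P.Hom S (.single T)) :
    Prop :=
  ∀ Γ Δ : Fam P.Ob, Function.Bijective fun x : U.obj (.single T ⊎ Γ) Δ =>
    U.lact.comp (P.perm (.refl _) (Fam.Iso.nilLeft _).symm t) x

/-- Composition with `t` is a bijection from `U(Γ; Δ, T)` to `U(Γ; Δ, S)`. -/
def RespectsCotensor (U : PModule.{u, v, w} P) {S : Fam P.Ob} {T : P.Ob}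
    (t : P.Hom (.single T) S) : Prop :=
  ∀ Γ Δ : Fam P.Ob, Function.Bijective fun x : U.obj Γ (Δ ⊎ .single T) =>
    U.ract.comp x (P.perm (Fam.Iso.nilRight _).symm (.refl _) t)

theorem self_respectsTensor {S : Fam P.Ob} {T : P.Ob} {t : P.Hom S (.single T)}
    (h : P.IsTensor t) : (self P).RespectsTensor t := fun Γ Δ =>
  Equiv.ulift.symm.bijective.comp ((h Γ Δ).comp Equiv.ulift.bijective)

theorem self_respectsCotensor {S : Fam P.Ob} {T : P.Ob} {t : P.Hom (.single T) S}
    (h : P.IsCotensor t) : (self P).RespectsCotensor t := fun Γ Δ =>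
  Equiv.ulift.symm.bijective.comp ((h Γ Δ).comp Equiv.ulift.bijective)

theorem shift_respectsTensor {U : PModule.{u, v, w} P} (K L : Fam P.Ob) {S : Fam P.Ob} {T : P.Ob}
    {t : P.Hom S (.single T)} (h : U.RespectsTensor t) : (U.shift K L).RespectsTensor t := by
  intro Γ Δ
  have e : (fun x : (U.shift K L).obj (.single T ⊎ Γ) Δ =>
      (U.shift K L).lact.comp (P.perm (.refl _) (Fam.Iso.nilLeft _).symm t) x) =
      U.perm (Fam.Iso.assoc S Γ K).symm (Fam.Iso.assoc .nil Δ L).symm ∘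
        (fun x => U.lact.comp (P.perm (.refl _) (Fam.Iso.nilLeft _).symm t) x) ∘
          U.perm (Fam.Iso.assoc (.single T) Γ K).symm.symm (.refl _) := by
    funext x
    refine congrArg (fun z => U.perm _ _ (U.lact.comp z _)) (P.bi.perm_id' ?_ ?_)
    · exact fun i => rfl
    · exact fun i => rfl
  rw [e]
  exact (U.perm_bijective _ _).comp ((h (Γ ⊎ K) (Δ ⊎ L)).comp (U.perm_bijective _ _))

theorem shift_respectsCotensor {U : PModule.{u, v, w} P} (K L : Fam P.Ob) {S : Fam P.Ob} {T : P.Ob}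
    {t : P.Hom (.single T) S} (h : U.RespectsCotensor t) : (U.shift K L).RespectsCotensor t := by
  intro Γ Δ
  have e : (fun x : (U.shift K L).obj Γ (Δ ⊎ .single T) =>
      (U.shift K L).ract.comp x (P.perm (Fam.Iso.nilRight _).symm (.refl _) t)) =
      U.perm (.rightComm Γ K .nil) (.rightComm Δ L S) ∘
        (fun x => U.ract.comp x (P.perm (Fam.Iso.nilRight _).symm (.refl _) t)) ∘
          U.perm (.refl _) (Fam.Iso.rightComm Δ L (.single T)).symm := by
    funext x
    refine congrArg (fun z => U.perm _ _ (U.ract.comp _ z)) (P.bi.perm_id' ?_ ?_)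
    · exact fun i => rfl
    · exact fun i => rfl
  rw [e]
  exact (U.perm_bijective _ _).comp ((h (Γ ⊎ K) (Δ ⊎ L)).comp (U.perm_bijective _ _))

structure RespectsJ (U : PModule.{u, v, w} P) (J : P.Distinguished) : Prop where
  tensor {A B T : P.Ob} {t : P.Hom (.single A ⊎ .single B) (.single T)} :
    J.tensor t → U.RespectsTensor t
  unit {T : P.Ob} {t : P.Hom .nil (.single T)} : J.unit t → U.RespectsTensor t
  cotensor {A B T : P.Ob} {t : P.Hom (.single T) (.single A ⊎ .single B)} :
    J.cotensor t → U.RespectsCotensor t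
  counit {T : P.Ob} {t : P.Hom (.single T) .nil} : J.counit t → U.RespectsCotensor t

theorem self_respectsJ (J : P.Distinguished) : (self P).RespectsJ J :=
  ⟨fun h => self_respectsTensor (J.isTensor h), fun h => self_respectsTensor (J.isUnit h),
    fun h => self_respectsCotensor (J.isCotensor h), fun h => self_respectsCotensor (J.isCounit h)⟩

theorem shift_respectsJ {U : PModule.{u, v, w} P} {J : P.Distinguished} (K L : Fam P.Ob)
    (h : U.RespectsJ J) : (U.shift K L).RespectsJ J :=
  ⟨fun k => shift_respectsTensor K L (h.tensor k), fun k => shift_respectsTensor K L (h.unit k),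
    fun k => shift_respectsCotensor K L (h.cotensor k),
    fun k => shift_respectsCotensor K L (h.counit k)⟩

/-- The contravariant representable module. -/
def yo (A : P.Ob) : PModule.{u, v, max 1 u v} P := (self P).shift .nil (.single A)

/-- The covariant representable module. -/
def noy (A : P.Ob) : PModule.{u, v, max 1 u v} P := (self P).shift (.single A) .nil

end PModule

/-- Modules that respect the distinguished tensor and cotensor products. They take values in a
universe with respect to which `P` is small. -/
structure JModule (P : Polycat.{u, v}) (J : P.Distinguished) where
  toPModule : PModule.{u, v, max 1 u v} P
  respects : toPModule.RespectsJ J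

namespace JModule
variable {P : Polycat.{u, v}} (J : P.Distinguished)

def self : JModule P J := ⟨PModule.self P, PModule.self_respectsJ J⟩

def yo (A : P.Ob) : JModule P J := ⟨PModule.yo A, PModule.shift_respectsJ _ _ (PModule.self_respectsJ J)⟩

def noy (A : P.Ob) : JModule P J := ⟨PModule.noy A, PModule.shift_respectsJ _ _ (PModule.self_respectsJ J)⟩

end JModule

namespace Fam.Iso

/-- Componentwise relabelling of a concatenation of lists. -/
noncomputable abbrev sigma {C : Type u} {K : Type} (hK : Finite K) {s t : K → Fam C} (e : ∀ k, s k ≅ₗ t k) :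
    Fam.sigma hK s ≅ₗ Fam.sigma hK t :=
  ofFun (fun p => ⟨p.1, (e p.1).equiv p.2⟩)
    (Equiv.sigmaCongrRight fun k => (e k).equiv).bijective (fun p => (e p.1).obj_eq p.2)

/-- Splitting off one list from a concatenation. -/
noncomputable abbrev split {C : Type u} {K : Type} (hK : Finite K) (s : K → Fam C) (k : K) :
    s k ⊎ Fam.sigma (K := {i // i ≠ k}) inferInstance (fun i => s i.1) ≅ₗ Fam.sigma hK s :=
  ofFun (Sum.elim (fun i => ⟨k, i⟩) fun p => ⟨p.1.1, p.2⟩)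
    ⟨by
      rintro (i | ⟨⟨l, hl⟩, i⟩) (j | ⟨⟨m, hm⟩, j⟩) h
      · cases h; rfl
      · exact absurd (congrArg Sigma.fst h).symm hm
      · exact absurd (congrArg Sigma.fst h) hl
      · cases h; rfl,
    by
      rintro ⟨l, i⟩
      by_cases h : l = k
      · subst h; exact ⟨.inl i, rfl⟩
      · exact ⟨.inr ⟨⟨l, h⟩, i⟩, rfl⟩⟩
    (by rintro (i | ⟨⟨l, hl⟩, i⟩) <;> rfl)

section
variable {C : Type u} {K : Type} (hK : Finite K) {s t : K → Fam C} (k : K) {Φ Θ : Fam C}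

/-- Regrouping a concatenation around a decomposition of its entry at `k`. -/
noncomputable abbrev around (a : Φ ⊎ Θ ≅ₗ t k) (e : ∀ i : {i // i ≠ k}, s i ≅ₗ t i) :
    Φ ⊎ (Θ ⊎ Fam.sigma (K := {i // i ≠ k}) inferInstance fun i => s i.1) ≅ₗ Fam.sigma hK t :=
  (Fam.Iso.assoc _ _ _).symm.trans
    ((a.append (sigma inferInstance e)).trans (split hK t k))

noncomputable abbrev aroundR (a : Θ ⊎ Φ ≅ₗ t k) (e : ∀ i : {i // i ≠ k}, s i ≅ₗ t i) :
    (Θ ⊎ Fam.sigma (K := {i // i ≠ k}) inferInstance fun i => s i.1) ⊎ Φ ≅ₗ Fam.sigma hK t :=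
  (Fam.Iso.rightComm _ _ _).trans
    ((a.append (sigma inferInstance e)).trans (split hK t k))

/-- Adding a list to the entry at `k` of a concatenation. -/
noncomputable abbrev insertAt (a : Φ ⊎ s k ≅ₗ t k) (e : ∀ i : {i // i ≠ k}, s i ≅ₗ t i) :
    Φ ⊎ Fam.sigma hK s ≅ₗ Fam.sigma hK t :=
  (Fam.Iso.append (.refl Φ) (split hK s k).symm).trans
    ((Fam.Iso.assoc _ _ _).symm.trans ((a.append (sigma inferInstance e)).trans (split hK t k)))

noncomputable abbrev insertAtR (a : s k ⊎ Φ ≅ₗ t k) (e : ∀ i : {i // i ≠ k}, s i ≅ₗ t i) :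
    Fam.sigma hK s ⊎ Φ ≅ₗ Fam.sigma hK t :=
  (Fam.Iso.append (split hK s k).symm (.refl Φ)).trans
    ((Fam.Iso.rightComm _ _ _).trans ((a.append (sigma inferInstance e)).trans (split hK t k)))

theorem insertAt_eq {a : Φ ⊎ s k ≅ₗ t k} {e : ∀ i : {i // i ≠ k}, s i ≅ₗ t i} (i : (s k).I) :
    (insertAt hK k a e).equiv (.inr ⟨k, i⟩) = ⟨k, a.equiv (.inr i)⟩ :=
  congrArg (fun z => ((Fam.Iso.assoc _ _ _).symm.trans
    ((a.append (sigma inferInstance e)).trans (split hK t k))).equiv (.inr z))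
    ((split hK s k).equiv.symm_apply_apply (.inl i))

theorem insertAt_ne {a : Φ ⊎ s k ≅ₗ t k} {e : ∀ i : {i // i ≠ k}, s i ≅ₗ t i} (l : K) (hl : l ≠ k)
    (i : (s l).I) :
    (insertAt hK k a e).equiv (.inr ⟨l, i⟩) = ⟨l, (e ⟨l, hl⟩).equiv i⟩ :=
  congrArg (fun z => ((Fam.Iso.assoc _ _ _).symm.trans
    ((a.append (sigma inferInstance e)).trans (split hK t k))).equiv (.inr z))
    ((split hK s k).equiv.symm_apply_apply (.inr ⟨⟨l, hl⟩, i⟩))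

theorem insertAtR_eq {a : s k ⊎ Φ ≅ₗ t k} {e : ∀ i : {i // i ≠ k}, s i ≅ₗ t i} (i : (s k).I) :
    (insertAtR hK k a e).equiv (.inl ⟨k, i⟩) = ⟨k, a.equiv (.inl i)⟩ :=
  congrArg (fun z => ((Fam.Iso.rightComm _ _ _).trans
    ((a.append (sigma inferInstance e)).trans (split hK t k))).equiv (.inl z))
    ((split hK s k).equiv.symm_apply_apply (.inl i))

theorem insertAtR_ne {a : s k ⊎ Φ ≅ₗ t k} {e : ∀ i : {i // i ≠ k}, s i ≅ₗ t i} (l : K) (hl : l ≠ k)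
    (i : (s l).I) :
    (insertAtR hK k a e).equiv (.inl ⟨l, i⟩) = ⟨l, (e ⟨l, hl⟩).equiv i⟩ :=
  congrArg (fun z => ((Fam.Iso.rightComm _ _ _).trans
    ((a.append (sigma inferInstance e)).trans (split hK t k))).equiv (.inl z))
    ((split hK s k).equiv.symm_apply_apply (.inr ⟨⟨l, hl⟩, i⟩))

end

end Fam.Iso

namespace JModule
variable {P : Polycat.{u, v}} {J : P.Distinguished}

/-- Elements of a module. -/
structure Elt (U : JModule P J) where
  inp : Fam P.Ob
  out : Fam P.Ob
  el : U.toPModule.obj inp out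

/-- Relabelling of elements. -/
structure EltIso {U : JModule P J} (x y : Elt U) where
  inp : x.inp ≅ₗ y.inp
  out : x.out ≅ₗ y.out
  el_eq : U.toPModule.perm inp out x.el = y.el

/-- `LStep f x y`: acting by `f` on an input of `x` yields `y`. -/
structure LStep {U : JModule P J} {Φ Ψ : Fam P.Ob} {A : P.Ob} (f : P.Hom Φ (Ψ ⊎ .single A))
    (x y : Elt U) where
  rest : Fam P.Ob
  src : .single A ⊎ rest ≅ₗ x.inp
  inp : Φ ⊎ rest ≅ₗ y.inp
  out : Ψ ⊎ x.out ≅ₗ y.out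
  el_eq : U.toPModule.lact.compAt f x.el (.refl _) src inp out = y.el

/-- `RStep g x y`: acting by `g` on an output of `x` yields `y`. -/
structure RStep {U : JModule P J} {Φ Ψ : Fam P.Ob} {A : P.Ob} (g : P.Hom (.single A ⊎ Φ) Ψ)
    (x y : Elt U) where
  rest : Fam P.Ob
  src : rest ⊎ .single A ≅ₗ x.out
  inp : x.inp ⊎ Φ ≅ₗ y.inp
  out : rest ⊎ Ψ ≅ₗ y.out
  el_eq : U.toPModule.ract.compAt x.el g src (.refl _) inp out = y.el

/-- Multimorphisms of modules: functions that commute with the symmetric actions and with the left and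
right action on each argument. -/
@[ext]
structure MultiHom (Γ : Fam (JModule P J)) (W : JModule P J) where
  toFun (x : ∀ k, Elt (Γ.obj k)) :
    W.toPModule.obj (.sigma Γ.fin fun k => (x k).inp) (.sigma Γ.fin fun k => (x k).out)
  map_perm (x y : ∀ k, Elt (Γ.obj k)) (e : ∀ k, EltIso (x k) (y k)) :
    W.toPModule.perm (.sigma _ fun k => (e k).inp) (.sigma _ fun k => (e k).out) (toFun x) =
      toFun y
  map_lact (x y : ∀ k, Elt (Γ.obj k)) (k : Γ.I) (e : ∀ i : {i // i ≠ k}, EltIso (x i) (y i))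
    {Φ Ψ : Fam P.Ob} {A : P.Ob} (f : P.Hom Φ (Ψ ⊎ .single A)) (s : LStep f (x k) (y k)) :
    W.toPModule.lact.compAt f (toFun x) (.refl _)
      (Fam.Iso.around (s := fun i => (x i).inp) (t := fun i => (x i).inp) Γ.fin k s.src
        fun i => .refl (x i).inp)
      (Fam.Iso.around (s := fun i => (x i).inp) (t := fun i => (y i).inp) Γ.fin k s.inp
        fun i => (e i).inp)
      (Fam.Iso.insertAt (s := fun i => (x i).out) (t := fun i => (y i).out) Γ.fin k s.out
        fun i => (e i).out) = toFun y
  map_ract (x y : ∀ k, Elt (Γ.obj k)) (k : Γ.I) (e : ∀ i : {i // i ≠ k}, EltIso (x i) (y i))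
    {Φ Ψ : Fam P.Ob} {A : P.Ob} (g : P.Hom (.single A ⊎ Φ) Ψ) (s : RStep g (x k) (y k)) :
    W.toPModule.ract.compAt (toFun x) g
      (Fam.Iso.aroundR (s := fun i => (x i).out) (t := fun i => (x i).out) Γ.fin k s.src
        fun i => .refl (x i).out) (.refl _)
      (Fam.Iso.insertAtR (s := fun i => (x i).inp) (t := fun i => (y i).inp) Γ.fin k s.inp
        fun i => (e i).inp)
      (Fam.Iso.aroundR (s := fun i => (x i).out) (t := fun i => (y i).out) Γ.fin k s.out
        fun i => (e i).out) = toFun y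

end JModule

namespace Act
variable {C : Type u} {X : Bi.{u, v} C} {Y : Bi.{u, v'} C} {Z : Bi.{u, w} C} (m : Act X Y Z)

theorem at_permR {Γ Γ' Δ₁ Δ₂ Δ' D G₀ G Φ₁ Φ₂ Ψ₀ Ψ : Fam C} {A : C} {f : X.obj Γ D}
    {g : Y.obj G₀ Ψ₀} {σ' : G₀ ≅ₗ G} {τ' : Ψ₀ ≅ₗ Ψ}
    {a : Δ₁ ⊎ .single A ≅ₗ D} {a' : .single A ⊎ Φ₁ ≅ₗ G} {b : Γ ⊎ Φ₁ ≅ₗ Γ'} {c : Δ₁ ⊎ Ψ ≅ₗ Δ'}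
    {a₂ : Δ₂ ⊎ .single A ≅ₗ D} {a₂' : .single A ⊎ Φ₂ ≅ₗ G₀} {b₂ : Γ ⊎ Φ₂ ≅ₗ Γ'}
    {c₂ : Δ₂ ⊎ Ψ₀ ≅ₗ Δ'}
    (h1 : a.equiv (.inr ()) = a₂.equiv (.inr ()))
    (h2 : a'.equiv (.inl ()) = σ'.equiv (a₂'.equiv (.inl ())))
    (hb : ∀ i, b.equiv (.inl i) = b₂.equiv (.inl i))
    (hb' : ∀ i j, a'.equiv (.inr i) = σ'.equiv (a₂'.equiv (.inr j)) →
      b.equiv (.inr i) = b₂.equiv (.inr j))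
    (hc : ∀ i j, a.equiv (.inl i) = a₂.equiv (.inl j) →
      c.equiv (.inl i) = c₂.equiv (.inl j))
    (hc' : ∀ i, c.equiv (.inr (τ'.equiv i)) = c₂.equiv (.inr i)) :
    m.compAt f (Y.perm σ' τ' g) a a' b c = m.compAt f g a₂ a₂' b₂ c₂ := by
  rw [m.at_perm_right]
  apply m.at_congr h1
  · exact σ'.symm_apply_eq h2.symm
  · exact hb
  · exact fun i j h => hb' i j (σ'.equiv.symm_apply_eq.mp h)
  · exact hc
  · exact hc'

theorem at_permL {Γ₀ Γ Γ' Δ₁ Δ₂ Δ' D₀ D G Φ₁ Φ₂ Ψ : Fam C} {A : C} {f : X.obj Γ₀ D₀}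
    {g : Y.obj G Ψ} {σ : Γ₀ ≅ₗ Γ} {τ : D₀ ≅ₗ D}
    {a : Δ₁ ⊎ .single A ≅ₗ D} {a' : .single A ⊎ Φ₁ ≅ₗ G} {b : Γ ⊎ Φ₁ ≅ₗ Γ'} {c : Δ₁ ⊎ Ψ ≅ₗ Δ'}
    {a₂ : Δ₂ ⊎ .single A ≅ₗ D₀} {a₂' : .single A ⊎ Φ₂ ≅ₗ G} {b₂ : Γ₀ ⊎ Φ₂ ≅ₗ Γ'}
    {c₂ : Δ₂ ⊎ Ψ ≅ₗ Δ'}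
    (h1 : a.equiv (.inr ()) = τ.equiv (a₂.equiv (.inr ())))
    (h2 : a'.equiv (.inl ()) = a₂'.equiv (.inl ()))
    (hb : ∀ i, b.equiv (.inl (σ.equiv i)) = b₂.equiv (.inl i))
    (hb' : ∀ i j, a'.equiv (.inr i) = a₂'.equiv (.inr j) →
      b.equiv (.inr i) = b₂.equiv (.inr j))
    (hc : ∀ i j, a.equiv (.inl i) = τ.equiv (a₂.equiv (.inl j)) →
      c.equiv (.inl i) = c₂.equiv (.inl j))
    (hc' : ∀ i, c.equiv (.inr i) = c₂.equiv (.inr i)) :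
    m.compAt (X.perm σ τ f) g a a' b c = m.compAt f g a₂ a₂' b₂ c₂ := by
  rw [m.at_perm_left]
  apply m.at_congr
  · exact τ.symm_apply_eq h1.symm
  · exact h2
  · exact hb
  · exact hb'
  · exact fun i j h => hc i j (τ.equiv.symm_apply_eq.mp h)
  · exact hc'

end Act

namespace JModule
variable {P : Polycat.{u, v}} {J : P.Distinguished}

abbrev EltIso.refl {U : JModule P J} (x : Elt U) : EltIso x x :=
  ⟨.refl _, .refl _, U.toPModule.perm_refl _⟩

namespace MultiHom

variable {Γ : Fam (JModule P J)} {W : JModule P J} (φ : MultiHom Γ W)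

theorem perm_eq {x y : ∀ k, Elt (Γ.obj k)} (e : ∀ k, EltIso (x k) (y k)) {G D : Fam P.Ob}
    {σ : Fam.sigma Γ.fin (fun k => (x k).inp) ≅ₗ G}
    {σ' : Fam.sigma Γ.fin (fun k => (y k).inp) ≅ₗ G}
    {τ : Fam.sigma Γ.fin (fun k => (x k).out) ≅ₗ D}
    {τ' : Fam.sigma Γ.fin (fun k => (y k).out) ≅ₗ D}
    (h1 : ∀ k i, σ.equiv ⟨k, i⟩ = σ'.equiv ⟨k, (e k).inp.equiv i⟩)
    (h2 : ∀ k i, τ.equiv ⟨k, i⟩ = τ'.equiv ⟨k, (e k).out.equiv i⟩) :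
    W.toPModule.perm σ τ (φ.toFun x) = W.toPModule.perm σ' τ' (φ.toFun y) := by
  rw [← φ.map_perm x y e, W.toPModule.perm_perm]
  apply W.toPModule.perm_congr
  · rintro ⟨k, i⟩; exact h1 k i
  · rintro ⟨k, i⟩; exact h2 k i

theorem lact_eq {x y : ∀ k, Elt (Γ.obj k)} (k : Γ.I) (e : ∀ i : {i // i ≠ k}, EltIso (x i) (y i))
    {Φ Ψ : Fam P.Ob} {A : P.Ob} {f : P.Hom Φ (Ψ ⊎ .single A)} (s : LStep f (x k) (y k))
    {R G D G₀ D₀ : Fam P.Ob}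
    {σ : Fam.sigma Γ.fin (fun k => (x k).inp) ≅ₗ G₀}
    {τ : Fam.sigma Γ.fin (fun k => (x k).out) ≅ₗ D₀}
    {σ' : Fam.sigma Γ.fin (fun k => (y k).inp) ≅ₗ G}
    {τ' : Fam.sigma Γ.fin (fun k => (y k).out) ≅ₗ D}
    {src : .single A ⊎ R ≅ₗ G₀}
    {inp : Φ ⊎ R ≅ₗ G}
    {out : Ψ ⊎ D₀ ≅ₗ D}
    (h1 : src.equiv (.inl ()) = σ.equiv ⟨k, s.src.equiv (.inl ())⟩)
    (h2 : ∀ i, inp.equiv (.inl i) = σ'.equiv ⟨k, s.inp.equiv (.inl i)⟩)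
    (h3 : ∀ i j, src.equiv (.inr i) = σ.equiv ⟨k, s.src.equiv (.inr j)⟩ →
      inp.equiv (.inr i) = σ'.equiv ⟨k, s.inp.equiv (.inr j)⟩)
    (h4 : ∀ i (l : {l // l ≠ k}) j, src.equiv (.inr i) = σ.equiv ⟨l, j⟩ →
      inp.equiv (.inr i) = σ'.equiv ⟨l, (e l).inp.equiv j⟩)
    (h5 : ∀ i, out.equiv (.inl i) = τ'.equiv ⟨k, s.out.equiv (.inl i)⟩)
    (h6 : ∀ i, out.equiv (.inr (τ.equiv ⟨k, i⟩)) = τ'.equiv ⟨k, s.out.equiv (.inr i)⟩)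
    (h7 : ∀ (l : {l // l ≠ k}) i, out.equiv (.inr (τ.equiv ⟨l, i⟩)) =
      τ'.equiv ⟨l, (e l).out.equiv i⟩) :
    W.toPModule.lact.compAt f (W.toPModule.perm σ τ (φ.toFun x)) (.refl _) src inp out =
      W.toPModule.perm σ' τ' (φ.toFun y) := by
  rw [← φ.map_lact x y k e f s, Act.perm_at]
  apply Act.at_permR
  · rfl
  · exact h1
  · exact h2
  · rintro i (j | ⟨l, j⟩) h
    · exact h3 i j h
    · exact h4 i l j h
  · rintro i j h; cases h; exact h5 i
  · rintro ⟨l, i⟩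
    by_cases hl : l = k
    · subst hl
      refine (h6 i).trans (congrArg τ'.equiv ?_)
      exact (Fam.Iso.insertAt_eq (s := fun i => (x i).out) (t := fun i => (y i).out) Γ.fin l i).symm
    · refine (h7 ⟨l, hl⟩ i).trans (congrArg τ'.equiv ?_)
      exact (Fam.Iso.insertAt_ne (s := fun i => (x i).out) (t := fun i => (y i).out)
        (a := s.out) (e := fun i => (e i).out) Γ.fin k l hl i).symm

theorem ract_eq {x y : ∀ k, Elt (Γ.obj k)} (k : Γ.I) (e : ∀ i : {i // i ≠ k}, EltIso (x i) (y i))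
    {Φ Ψ : Fam P.Ob} {A : P.Ob} {g : P.Hom (.single A ⊎ Φ) Ψ} (s : RStep g (x k) (y k))
    {R G D G₀ D₀ : Fam P.Ob}
    {σ : Fam.sigma Γ.fin (fun k => (x k).inp) ≅ₗ G₀}
    {τ : Fam.sigma Γ.fin (fun k => (x k).out) ≅ₗ D₀}
    {σ' : Fam.sigma Γ.fin (fun k => (y k).inp) ≅ₗ G}
    {τ' : Fam.sigma Γ.fin (fun k => (y k).out) ≅ₗ D}
    {src : R ⊎ .single A ≅ₗ D₀}
    {inp : G₀ ⊎ Φ ≅ₗ G}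
    {out : R ⊎ Ψ ≅ₗ D}
    (h1 : src.equiv (.inr ()) = τ.equiv ⟨k, s.src.equiv (.inr ())⟩)
    (h2 : ∀ i, out.equiv (.inr i) = τ'.equiv ⟨k, s.out.equiv (.inr i)⟩)
    (h3 : ∀ i j, src.equiv (.inl i) = τ.equiv ⟨k, s.src.equiv (.inl j)⟩ →
      out.equiv (.inl i) = τ'.equiv ⟨k, s.out.equiv (.inl j)⟩)
    (h4 : ∀ i (l : {l // l ≠ k}) j, src.equiv (.inl i) = τ.equiv ⟨l, j⟩ →
      out.equiv (.inl i) = τ'.equiv ⟨l, (e l).out.equiv j⟩)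
    (h5 : ∀ i, inp.equiv (.inr i) = σ'.equiv ⟨k, s.inp.equiv (.inr i)⟩)
    (h6 : ∀ i, inp.equiv (.inl (σ.equiv ⟨k, i⟩)) = σ'.equiv ⟨k, s.inp.equiv (.inl i)⟩)
    (h7 : ∀ (l : {l // l ≠ k}) i, inp.equiv (.inl (σ.equiv ⟨l, i⟩)) =
      σ'.equiv ⟨l, (e l).inp.equiv i⟩) :
    W.toPModule.ract.compAt (W.toPModule.perm σ τ (φ.toFun x)) g src (.refl _) inp out =
      W.toPModule.perm σ' τ' (φ.toFun y) := by
  rw [← φ.map_ract x y k e g s, Act.perm_at]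
  apply Act.at_permL
  · exact h1
  · rfl
  · rintro ⟨l, i⟩
    by_cases hl : l = k
    · subst hl
      refine (h6 i).trans (congrArg σ'.equiv ?_)
      exact (Fam.Iso.insertAtR_eq (s := fun i => (x i).inp) (t := fun i => (y i).inp) Γ.fin l
        i).symm
    · refine (h7 ⟨l, hl⟩ i).trans (congrArg σ'.equiv ?_)
      exact (Fam.Iso.insertAtR_ne (s := fun i => (x i).inp) (t := fun i => (y i).inp)
        (a := s.inp) (e := fun i => (e i).inp) Γ.fin k l hl i).symm
  · rintro i j h; cases h; exact h5 i
  · rintro i (j | ⟨l, j⟩) h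
    · exact h3 i j h
    · exact h4 i l j h
  · exact h2

end MultiHom
end JModule

namespace Fam.Iso

/-- Reindexing a concatenation of lists. -/
noncomputable abbrev reindex {C : Type u} {K L : Type} (hK : Finite K) (hL : Finite L) (e : K ≃ L)
    (s : L → Fam C) : Fam.sigma hK (fun k => s (e k)) ≅ₗ Fam.sigma hL s :=
  ofFun (fun p => ⟨e p.1, p.2⟩) (Equiv.sigmaCongrLeft (β := fun l => (s l).I) e).bijective (fun _ => rfl)

/-- A concatenation of one list. -/
noncomputable abbrev sigmaUnit {C : Type u} (hK : Finite Unit) (s : Unit → Fam C) :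
    s () ≅ₗ Fam.sigma hK s :=
  ofFun (fun i => ⟨(), i⟩)
    ⟨fun i j h => by cases h; rfl, fun ⟨_, i⟩ => ⟨i, rfl⟩⟩ (fun _ => rfl)

/-- Flattening a concatenation one of whose entries is itself a concatenation. -/
noncomputable abbrev graft {C : Type u} {K L : Type} (hK : Finite K) (hL : Finite (L ⊕ Unit))
    (hM : Finite (K ⊕ L)) (s : K ⊕ L → Fam C) :
    Fam.sigma hL (Sum.elim (fun l => s (.inr l)) fun _ => Fam.sigma hK fun k => s (.inl k)) ≅ₗ
      Fam.sigma hM s :=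
  ofFun (fun p => match p with
      | ⟨.inl l, i⟩ => ⟨.inr l, i⟩
      | ⟨.inr _, ⟨k, i⟩⟩ => ⟨.inl k, i⟩)
    ⟨by
      rintro ⟨l | l, i⟩ ⟨m | m, j⟩ h
      · cases h; rfl
      · cases h
      · cases h
      · obtain ⟨k, i⟩ := i; obtain ⟨k', j⟩ := j; cases h; rfl,
    by
      rintro ⟨k | l, i⟩
      · exact ⟨⟨.inr (), ⟨k, i⟩⟩, rfl⟩
      · exact ⟨⟨.inl l, i⟩, rfl⟩⟩
    (by rintro ⟨l | l, i⟩ <;> rfl)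

end Fam.Iso

namespace JModule
variable {P : Polycat.{u, v}} {J : P.Distinguished}

def Elt.cast {U V : JModule P J} (h : U = V) (x : Elt U) : Elt V := ⟨x.inp, x.out, h ▸ x.el⟩

namespace MultiHom

/-- Relabelling of lists of elements. -/
def resp {Γ Γ' : Fam (JModule P J)} (σ : Γ ≅ₗ Γ') (x : ∀ k, Elt (Γ'.obj k)) (k : Γ.I) :
    Elt (Γ.obj k) := (x (σ.equiv k)).cast (σ.obj_eq k)

noncomputable def permFun {Γ Γ' : Fam (JModule P J)} {W : JModule P J} (σ : Γ ≅ₗ Γ')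
    (φ : MultiHom Γ W) (x : ∀ k, Elt (Γ'.obj k)) :
    W.toPModule.obj (.sigma Γ'.fin fun k => (x k).inp) (.sigma Γ'.fin fun k => (x k).out) :=
  W.toPModule.perm (.reindex Γ.fin Γ'.fin σ.equiv fun k => (x k).inp)
    (.reindex Γ.fin Γ'.fin σ.equiv fun k => (x k).out)
    (φ.toFun (resp σ x))

noncomputable def permL {Γ Γ' : Fam (JModule P J)} {W : JModule P J} (σ : Γ ≅ₗ Γ')
    (φ : MultiHom Γ W) : MultiHom Γ' W where
  toFun := permFun σ φ
  map_perm x y e := by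
    obtain ⟨K, hK, o⟩ := Γ
    obtain ⟨σ, h⟩ := σ
    change K ≃ Γ'.I at σ
    obtain rfl : (fun k => Γ'.obj (σ k)) = o := funext h
    refine (W.toPModule.perm_perm _ _ _ _ _).trans ?_
    refine φ.perm_eq (x := fun k => x (σ k)) (y := fun k => y (σ k)) (fun k => e (σ k)) ?_ ?_
    · intro k i; rfl
    · intro k i; rfl
  map_lact x y k e Φ Ψ A f s := by
    obtain ⟨K, hK, o⟩ := Γ
    obtain ⟨σ, h⟩ := σ
    change K ≃ Γ'.I at σ
    obtain rfl : (fun k => Γ'.obj (σ k)) = o := funext h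
    obtain ⟨k, rfl⟩ := σ.surjective k
    refine φ.lact_eq (x := fun k => x (σ k)) (y := fun k => y (σ k)) k
      (fun i => e ⟨σ i, fun h => i.2 (σ.injective h)⟩) s ?_ ?_ ?_ ?_ ?_ ?_ ?_
    · rfl
    · intro i; rfl
    · rintro (i | ⟨⟨l, hl⟩, i⟩) j h
      · obtain rfl := Sum.inr_injective (s.src.equiv.injective (eq_of_heq (Sigma.mk.inj h).2))
        rfl
      · cases h; exact absurd rfl hl
    · rintro (i | ⟨⟨l, hl⟩, i⟩) ⟨m, hm⟩ j h
      · have := congrArg Sigma.fst h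
        exact absurd (σ.injective this).symm hm
      · obtain ⟨l, rfl⟩ := σ.surjective l
        have := σ.injective (congrArg Sigma.fst h)
        subst this
        cases h
        rfl
    · intro i; rfl
    · intro i
      exact Fam.Iso.insertAt_eq (s := fun i => (x i).out) (t := fun i => (y i).out) Γ'.fin (σ k) i
    · rintro ⟨l, hl⟩ i
      exact Fam.Iso.insertAt_ne (s := fun i => (x i).out) (t := fun i => (y i).out)
        (a := s.out) (e := fun i => (e i).out) Γ'.fin (σ k) (σ l) _ i
  map_ract x y k e Φ Ψ A f s := by
    obtain ⟨K, hK, o⟩ := Γ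
    obtain ⟨σ, h⟩ := σ
    change K ≃ Γ'.I at σ
    obtain rfl : (fun k => Γ'.obj (σ k)) = o := funext h
    obtain ⟨k, rfl⟩ := σ.surjective k
    refine φ.ract_eq (x := fun k => x (σ k)) (y := fun k => y (σ k)) k
      (fun i => e ⟨σ i, fun h => i.2 (σ.injective h)⟩) s ?_ ?_ ?_ ?_ ?_ ?_ ?_
    · rfl
    · intro i; rfl
    · rintro (i | ⟨⟨l, hl⟩, i⟩) j h
      · obtain rfl := Sum.inl_injective (s.src.equiv.injective (eq_of_heq (Sigma.mk.inj h).2))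
        rfl
      · cases h; exact absurd rfl hl
    · rintro (i | ⟨⟨l, hl⟩, i⟩) ⟨m, hm⟩ j h
      · have := congrArg Sigma.fst h
        exact absurd (σ.injective this).symm hm
      · obtain ⟨l, rfl⟩ := σ.surjective l
        have := σ.injective (congrArg Sigma.fst h)
        subst this
        cases h
        rfl
    · intro i; rfl
    · intro i
      exact Fam.Iso.insertAtR_eq (s := fun i => (x i).inp) (t := fun i => (y i).inp) Γ'.fin (σ k) i
    · rintro ⟨l, hl⟩ i
      exact Fam.Iso.insertAtR_ne (s := fun i => (x i).inp) (t := fun i => (y i).inp)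
        (a := s.inp) (e := fun i => (e i).inp) Γ'.fin (σ k) (σ l) _ i

/-- Relabelling of the arguments. -/
noncomputable def perm {Γ Γ' : Fam (JModule P J)} {W W' : JModule P J} (σ : Γ ≅ₗ Γ') (h : W = W')
    (φ : MultiHom Γ W) : MultiHom Γ' W' := h ▸ permL σ φ

noncomputable def id (W : JModule P J) : MultiHom (.single W) W where
  toFun x := W.toPModule.perm (.sigmaUnit _ fun k => (x k).inp) (.sigmaUnit _ fun k => (x k).out)
    (x ()).el
  map_perm x y e := by
    rw [← (e ()).el_eq, W.toPModule.perm_perm, W.toPModule.perm_perm]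
    apply W.toPModule.perm_congr
    · intro i; rfl
    · intro i; rfl
  map_lact x y k e Φ Ψ A f s := by
    obtain ⟨⟩ := k
    rw [← s.el_eq, Act.perm_at]
    apply Act.at_permR
    · rfl
    · rfl
    · intro i; rfl
    · rintro (i | ⟨⟨⟨⟩, hl⟩, i⟩) j h
      · obtain rfl := Sum.inr_injective (s.src.equiv.injective (eq_of_heq (Sigma.mk.inj h).2))
        rfl
      · exact absurd rfl hl
    · rintro i j h; cases h; rfl
    · intro i
      exact Fam.Iso.insertAt_eq (s := fun i => (x i).out) (t := fun i => (y i).out)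
        (Fam.single W).fin () i
  map_ract x y k e Φ Ψ A f s := by
    obtain ⟨⟩ := k
    rw [← s.el_eq, Act.perm_at]
    apply Act.at_permL
    · rfl
    · rfl
    · intro i
      exact Fam.Iso.insertAtR_eq (s := fun i => (x i).inp) (t := fun i => (y i).inp)
        (Fam.single W).fin () i
    · rintro i j h; cases h; rfl
    · rintro (i | ⟨⟨⟨⟩, hl⟩, i⟩) j h
      · obtain rfl := Sum.inl_injective (s.src.equiv.injective (eq_of_heq (Sigma.mk.inj h).2))
        rfl
      · exact absurd rfl hl
    · intro i; rfl

section
variable {Γ Δ : Fam (JModule P J)} {V W : JModule P J}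

/-- The arguments of the second multimorphism in a composite. -/
def mid (φ : MultiHom Γ V) (x : ∀ k, Elt ((Γ ⊎ Δ).obj k)) (k : (Δ ⊎ .single V).I) :
    Elt ((Δ ⊎ .single V).obj k) where
  inp := Sum.elim (fun d => (x (.inr d)).inp)
    (fun _ => .sigma Γ.fin fun g => (x (.inl g)).inp) k
  out := Sum.elim (fun d => (x (.inr d)).out)
    (fun _ => .sigma Γ.fin fun g => (x (.inl g)).out) k
  el := match k with
    | .inl d => (x (.inr d)).el
    | .inr _ => φ.toFun fun g => x (.inl g)

noncomputable def midIso (φ : MultiHom Γ V) {x y : ∀ k, Elt ((Γ ⊎ Δ).obj k)} (e : ∀ k, EltIso (x k) (y k)) :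
    ∀ k, EltIso (mid φ x k) (mid φ y k)
  | .inl d => ⟨(e (.inr d)).inp, (e (.inr d)).out, (e (.inr d)).el_eq⟩
  | .inr _ => ⟨.sigma _ fun g => (e (.inl g)).inp, .sigma _ fun g => (e (.inl g)).out,
      φ.map_perm (fun g => x (.inl g)) (fun g => y (.inl g)) fun g => e (.inl g)⟩

noncomputable def compFun (φ : MultiHom Γ V) (ψ : MultiHom (Δ ⊎ .single V) W)
    (x : ∀ k, Elt ((Γ ⊎ Δ).obj k)) :
    W.toPModule.obj (.sigma (Γ ⊎ Δ).fin fun k => (x k).inp)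
      (.sigma (Γ ⊎ Δ).fin fun k => (x k).out) :=
  W.toPModule.perm
    (.graft Γ.fin (Δ ⊎ .single V).fin (Γ ⊎ Δ).fin fun k => (x k).inp)
    (.graft Γ.fin (Δ ⊎ .single V).fin (Γ ⊎ Δ).fin fun k => (x k).out)
    (ψ.toFun (mid φ x))

noncomputable def midIsoL (φ : MultiHom Γ V) {x y : ∀ k, Elt ((Γ ⊎ Δ).obj k)} (g : Γ.I)
    (e : ∀ i : {i : (Γ ⊎ Δ).I // i ≠ Sum.inl g}, EltIso (x i.1) (y i.1)) :
    ∀ k : {k : (Δ ⊎ .single V).I // k ≠ .inr ()}, EltIso (mid φ x k) (mid φ y k)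
  | ⟨.inl d, _⟩ => ⟨(e ⟨.inr d, Sum.inr_ne_inl⟩).inp, (e ⟨.inr d, Sum.inr_ne_inl⟩).out,
      (e ⟨.inr d, Sum.inr_ne_inl⟩).el_eq⟩
  | ⟨.inr (), h⟩ => absurd rfl h

noncomputable def midIsoR (φ : MultiHom Γ V) {x y : ∀ k, Elt ((Γ ⊎ Δ).obj k)} (d : Δ.I)
    (e : ∀ i : {i : (Γ ⊎ Δ).I // i ≠ Sum.inr d}, EltIso (x i.1) (y i.1)) :
    ∀ k : {k : (Δ ⊎ .single V).I // k ≠ .inl d}, EltIso (mid φ x k) (mid φ y k)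
  | ⟨.inl d', h⟩ =>
    have h' : Sum.inr d' ≠ Sum.inr d := fun k => h (congrArg Sum.inl (Sum.inr_injective k))
    ⟨(e ⟨.inr d', h'⟩).inp, (e ⟨.inr d', h'⟩).out, (e ⟨.inr d', h'⟩).el_eq⟩
  | ⟨.inr _, _⟩ => ⟨.sigma _ fun g => (e ⟨.inl g, Sum.inl_ne_inr⟩).inp,
      .sigma _ fun g => (e ⟨.inl g, Sum.inl_ne_inr⟩).out,
      φ.map_perm (fun g => x (.inl g)) (fun g => y (.inl g)) fun g => e ⟨.inl g, Sum.inl_ne_inr⟩⟩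

noncomputable def midLStep (φ : MultiHom Γ V) {x y : ∀ k, Elt ((Γ ⊎ Δ).obj k)} (g : Γ.I)
    (e : ∀ i : {i : (Γ ⊎ Δ).I // i ≠ Sum.inl g}, EltIso (x i.1) (y i.1))
    {Φ Ψ : Fam P.Ob} {A : P.Ob} {f : P.Hom Φ (Ψ ⊎ .single A)} (s : LStep f (x (.inl g)) (y (.inl g))) :
    LStep f (mid φ x (.inr ())) (mid φ y (.inr ())) :=
  ⟨_, _, _, _, φ.map_lact (fun g => x (.inl g)) (fun g => y (.inl g)) g
    (fun i => e ⟨.inl i, fun h => i.2 (Sum.inl_injective h)⟩) f s⟩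

noncomputable def midRStep (φ : MultiHom Γ V) {x y : ∀ k, Elt ((Γ ⊎ Δ).obj k)} (g : Γ.I)
    (e : ∀ i : {i : (Γ ⊎ Δ).I // i ≠ Sum.inl g}, EltIso (x i.1) (y i.1))
    {Φ Ψ : Fam P.Ob} {A : P.Ob} {f : P.Hom (.single A ⊎ Φ) Ψ} (s : RStep f (x (.inl g)) (y (.inl g))) :
    RStep f (mid φ x (.inr ())) (mid φ y (.inr ())) :=
  ⟨_, _, _, _, φ.map_ract (fun g => x (.inl g)) (fun g => y (.inl g)) g
    (fun i => e ⟨.inl i, fun h => i.2 (Sum.inl_injective h)⟩) f s⟩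

noncomputable def midLStep' (φ : MultiHom Γ V) {x y : ∀ k, Elt ((Γ ⊎ Δ).obj k)} (d : Δ.I)
    {Φ Ψ : Fam P.Ob} {A : P.Ob} {f : P.Hom Φ (Ψ ⊎ .single A)} (s : LStep f (x (.inr d)) (y (.inr d))) :
    LStep f (mid φ x (.inl d)) (mid φ y (.inl d)) :=
  ⟨s.rest, s.src, s.inp, s.out, s.el_eq⟩

noncomputable def midRStep' (φ : MultiHom Γ V) {x y : ∀ k, Elt ((Γ ⊎ Δ).obj k)} (d : Δ.I)
    {Φ Ψ : Fam P.Ob} {A : P.Ob} {f : P.Hom (.single A ⊎ Φ) Ψ} (s : RStep f (x (.inr d)) (y (.inr d))) :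
    RStep f (mid φ x (.inl d)) (mid φ y (.inl d)) :=
  ⟨s.rest, s.src, s.inp, s.out, s.el_eq⟩

/-- Composition of multimorphisms. -/
noncomputable def comp (φ : MultiHom Γ V) (ψ : MultiHom (Δ ⊎ .single V) W) :
    MultiHom (Γ ⊎ Δ) W where
  toFun := compFun φ ψ
  map_perm x y e := by
    refine (W.toPModule.perm_perm _ _ _ _ _).trans ?_
    refine ψ.perm_eq (midIso φ e) ?_ ?_
    · rintro (l | l) i <;> rfl
    · rintro (l | l) i <;> rfl
  map_lact x y k e Φ Ψ A f s := by
    rcases k with g | d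
    · refine ψ.lact_eq (.inr ()) (midIsoL φ g e) (midLStep φ g e s) ?_ ?_ ?_ ?_ ?_ ?_ ?_
      · rfl
      · intro i; rfl
      · rintro (i | ⟨⟨l | l, hl⟩, i⟩) (j | ⟨⟨l', hl'⟩, j⟩) h
        · obtain rfl := Sum.inr_injective (s.src.equiv.injective (eq_of_heq (Sigma.mk.inj h).2))
          rfl
        · exact absurd (Sum.inl_injective (congrArg Sigma.fst h)).symm hl'
        · exact absurd (congrArg Sigma.fst h) hl
        · cases h; rfl
        · cases h
        · cases h
      · rintro (i | ⟨⟨l | l, hl⟩, i⟩) ⟨m | m, hm⟩ j h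
        · cases h
        · exact absurd rfl hm
        · cases h
        · exact absurd rfl hm
        · cases h; rfl
        · exact absurd rfl hm
      · intro i; rfl
      · rintro ⟨l, i⟩
        by_cases hl : l = g
        · subst hl
          refine (Fam.Iso.insertAt_eq (s := fun i => (x i).out) (t := fun i => (y i).out)
            (a := s.out) (e := fun i => (e i).out) (Γ ⊎ Δ).fin (.inl l) i).trans ?_
          exact congrArg (Fam.Iso.graft Γ.fin (Δ ⊎ .single V).fin (Γ ⊎ Δ).fin
            (fun k => (y k).out)).equiv (congrArg (Sigma.mk (Sum.inr ()))
            (Fam.Iso.insertAt_eq (s := fun i => (x (.inl i)).out) (t := fun i => (y (.inl i)).out)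
            (a := s.out) (e := fun i => (e ⟨.inl i, _⟩).out) Γ.fin l i).symm)
        · have hl' : (Sum.inl l : Γ.I ⊕ Δ.I) ≠ .inl g := fun h => hl (Sum.inl_injective h)
          refine (Fam.Iso.insertAt_ne (s := fun i => (x i).out) (t := fun i => (y i).out)
            (a := s.out) (e := fun i => (e i).out) (Γ ⊎ Δ).fin (.inl g) (.inl l) hl' i).trans ?_
          exact congrArg (Fam.Iso.graft Γ.fin (Δ ⊎ .single V).fin (Γ ⊎ Δ).fin
            (fun k => (y k).out)).equiv (congrArg (Sigma.mk (Sum.inr ()))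
            (Fam.Iso.insertAt_ne (s := fun i => (x (.inl i)).out) (t := fun i => (y (.inl i)).out)
            (a := s.out) (e := fun i => (e ⟨.inl i, fun h => i.2 (Sum.inl_injective h)⟩).out)
            Γ.fin g l hl i).symm)
      · rintro ⟨l | l, hl⟩ i
        · exact Fam.Iso.insertAt_ne (s := fun i => (x i).out) (t := fun i => (y i).out)
            (a := s.out) (e := fun i => (e i).out) (Γ ⊎ Δ).fin (.inl g) (.inr l) _ i
        · exact absurd rfl hl
    · refine ψ.lact_eq (.inl d) (midIsoR φ d e) (midLStep' φ d s) ?_ ?_ ?_ ?_ ?_ ?_ ?_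
      · rfl
      · intro i; rfl
      · rintro (i | ⟨⟨l, hl⟩, i⟩) j h
        · obtain rfl := Sum.inr_injective (s.src.equiv.injective (eq_of_heq (Sigma.mk.inj h).2))
          rfl
        · exact absurd (congrArg Sigma.fst h) hl
      · rintro (i | ⟨⟨l, hl⟩, i⟩) ⟨m | m, hm⟩ j h
        · exact absurd (congrArg Sum.inl (Sum.inr_injective (congrArg Sigma.fst h)).symm) hm
        · cases h
        · cases h; rfl
        · obtain ⟨m, j⟩ := j; cases h; rfl
      · intro i; rfl
      · intro i
        exact Fam.Iso.insertAt_eq (s := fun i => (x i).out) (t := fun i => (y i).out)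
            (a := s.out) (e := fun i => (e i).out) (Γ ⊎ Δ).fin (.inr d) i
      · rintro ⟨l | l, hl⟩ i
        · have hl' : (Sum.inr l : Γ.I ⊕ Δ.I) ≠ .inr d :=
            fun h => hl (congrArg Sum.inl (Sum.inr_injective h))
          exact Fam.Iso.insertAt_ne (s := fun i => (x i).out) (t := fun i => (y i).out)
            (a := s.out) (e := fun i => (e i).out) (Γ ⊎ Δ).fin (.inr d) (.inr l) hl' i
        · obtain ⟨l, i⟩ := i
          exact Fam.Iso.insertAt_ne (s := fun i => (x i).out) (t := fun i => (y i).out)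
            (a := s.out) (e := fun i => (e i).out) (Γ ⊎ Δ).fin (.inr d) (.inl l) _ i
  map_ract x y k e Φ Ψ A f s := by
    rcases k with g | d
    · refine ψ.ract_eq (.inr ()) (midIsoL φ g e) (midRStep φ g e s) ?_ ?_ ?_ ?_ ?_ ?_ ?_
      · rfl
      · intro i; rfl
      · rintro (i | ⟨⟨l | l, hl⟩, i⟩) (j | ⟨⟨l', hl'⟩, j⟩) h
        · obtain rfl := Sum.inl_injective (s.src.equiv.injective (eq_of_heq (Sigma.mk.inj h).2))
          rfl
        · exact absurd (Sum.inl_injective (congrArg Sigma.fst h)).symm hl'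
        · exact absurd (congrArg Sigma.fst h) hl
        · cases h; rfl
        · cases h
        · cases h
      · rintro (i | ⟨⟨l | l, hl⟩, i⟩) ⟨m | m, hm⟩ j h
        · cases h
        · exact absurd rfl hm
        · cases h
        · exact absurd rfl hm
        · cases h; rfl
        · exact absurd rfl hm
      · intro i; rfl
      · rintro ⟨l, i⟩
        by_cases hl : l = g
        · subst hl
          refine (Fam.Iso.insertAtR_eq (s := fun i => (x i).inp) (t := fun i => (y i).inp)
            (a := s.inp) (e := fun i => (e i).inp) (Γ ⊎ Δ).fin (.inl l) i).trans ?_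
          exact congrArg (Fam.Iso.graft Γ.fin (Δ ⊎ .single V).fin (Γ ⊎ Δ).fin
            (fun k => (y k).inp)).equiv (congrArg (Sigma.mk (Sum.inr ()))
            (Fam.Iso.insertAtR_eq (s := fun i => (x (.inl i)).inp) (t := fun i => (y (.inl i)).inp)
            (a := s.inp) (e := fun i => (e ⟨.inl i, _⟩).inp) Γ.fin l i).symm)
        · have hl' : (Sum.inl l : Γ.I ⊕ Δ.I) ≠ .inl g := fun h => hl (Sum.inl_injective h)
          refine (Fam.Iso.insertAtR_ne (s := fun i => (x i).inp) (t := fun i => (y i).inp)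
            (a := s.inp) (e := fun i => (e i).inp) (Γ ⊎ Δ).fin (.inl g) (.inl l) hl' i).trans ?_
          exact congrArg (Fam.Iso.graft Γ.fin (Δ ⊎ .single V).fin (Γ ⊎ Δ).fin
            (fun k => (y k).inp)).equiv (congrArg (Sigma.mk (Sum.inr ()))
            (Fam.Iso.insertAtR_ne (s := fun i => (x (.inl i)).inp) (t := fun i => (y (.inl i)).inp)
            (a := s.inp) (e := fun i => (e ⟨.inl i, fun h => i.2 (Sum.inl_injective h)⟩).inp)
            Γ.fin g l hl i).symm)
      · rintro ⟨l | l, hl⟩ i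
        · exact Fam.Iso.insertAtR_ne (s := fun i => (x i).inp) (t := fun i => (y i).inp)
            (a := s.inp) (e := fun i => (e i).inp) (Γ ⊎ Δ).fin (.inl g) (.inr l) _ i
        · exact absurd rfl hl
    · refine ψ.ract_eq (.inl d) (midIsoR φ d e) (midRStep' φ d s) ?_ ?_ ?_ ?_ ?_ ?_ ?_
      · rfl
      · intro i; rfl
      · rintro (i | ⟨⟨l, hl⟩, i⟩) j h
        · obtain rfl := Sum.inl_injective (s.src.equiv.injective (eq_of_heq (Sigma.mk.inj h).2))
          rfl
        · exact absurd (congrArg Sigma.fst h) hl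
      · rintro (i | ⟨⟨l, hl⟩, i⟩) ⟨m | m, hm⟩ j h
        · exact absurd (congrArg Sum.inl (Sum.inr_injective (congrArg Sigma.fst h)).symm) hm
        · cases h
        · cases h; rfl
        · obtain ⟨m, j⟩ := j; cases h; rfl
      · intro i; rfl
      · intro i
        exact Fam.Iso.insertAtR_eq (s := fun i => (x i).inp) (t := fun i => (y i).inp)
            (a := s.inp) (e := fun i => (e i).inp) (Γ ⊎ Δ).fin (.inr d) i
      · rintro ⟨l | l, hl⟩ i
        · have hl' : (Sum.inr l : Γ.I ⊕ Δ.I) ≠ .inr d :=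
            fun h => hl (congrArg Sum.inl (Sum.inr_injective h))
          exact Fam.Iso.insertAtR_ne (s := fun i => (x i).inp) (t := fun i => (y i).inp)
            (a := s.inp) (e := fun i => (e i).inp) (Γ ⊎ Δ).fin (.inr d) (.inr l) hl' i
        · obtain ⟨l, i⟩ := i
          exact Fam.Iso.insertAtR_ne (s := fun i => (x i).inp) (t := fun i => (y i).inp)
            (a := s.inp) (e := fun i => (e i).inp) (Γ ⊎ Δ).fin (.inr d) (.inl l) _ i

end
end MultiHom
end JModule

/-- The multicategory of modules that respect the distinguished tensor and cotensor products. -/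
noncomputable def jmod (P : Polycat.{u, v}) (J : P.Distinguished) : Multicat where
  Ob := JModule P J
  Hom := JModule.MultiHom
  perm := JModule.MultiHom.perm
  id := JModule.MultiHom.id
  comp := JModule.MultiHom.comp
  perm_refl {Γ W} f := by
    apply JModule.MultiHom.ext
    funext x
    refine W.toPModule.perm_id' ?_ ?_
    · rintro ⟨k, i⟩; rfl
    · rintro ⟨k, i⟩; rfl
  perm_perm {Γ Γ' Γ'' W W' W''} σ h τ h' f := by
    subst h h'
    obtain ⟨K', hK', o'⟩ := Γ'
    obtain ⟨τ, h'⟩ := τ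
    change K' ≃ Γ''.I at τ
    obtain rfl : (fun k => Γ''.obj (τ k)) = o' := funext h'
    obtain ⟨K, hK, o⟩ := Γ
    obtain ⟨σ, h⟩ := σ
    change K ≃ K' at σ
    obtain rfl : (fun k => Γ''.obj (τ (σ k))) = o := funext h
    apply JModule.MultiHom.ext
    funext x
    refine (W.toPModule.perm_perm _ _ _ _ _).trans ?_
    apply W.toPModule.perm_congr
    · rintro ⟨k, i⟩; rfl
    · rintro ⟨k, i⟩; rfl
  comp_perm {Γ Γ' Δ Δ' V W W'} σ ρ h f g := by
    subst h
    obtain ⟨K, hK, o⟩ := Γ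
    obtain ⟨σ, h⟩ := σ
    change K ≃ Γ'.I at σ
    obtain rfl : (fun k => Γ'.obj (σ k)) = o := funext h
    obtain ⟨L, hL, o⟩ := Δ
    obtain ⟨ρ, h⟩ := ρ
    change L ≃ Δ'.I at ρ
    obtain rfl : (fun k => Δ'.obj (ρ k)) = o := funext h
    apply JModule.MultiHom.ext
    funext x
    refine (W.toPModule.perm_perm _ _ _ _ _).trans ((W.toPModule.perm_perm _ _ _ _ _).trans ?_).symm
    refine g.perm_eq (x := JModule.MultiHom.mid f (JModule.MultiHom.resp _ x))
      (y := JModule.MultiHom.resp _ (JModule.MultiHom.mid (JModule.MultiHom.permL _ f) x))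
      (fun k => match k with
      | .inl d => .refl _
      | .inr _ => ⟨_, _, rfl⟩) ?_ ?_
    · rintro (k | k) i <;> rfl
    · rintro (k | k) i <;> rfl
  id_comp {Δ V W} g := by
    apply JModule.MultiHom.ext
    funext x
    refine (g.perm_eq (x := JModule.MultiHom.resp _ x) (y := JModule.MultiHom.mid _ x)
      (fun k => match k with
      | .inl d => .refl _
      | .inr _ => ⟨_, _, rfl⟩) ?_ ?_).symm
    · rintro (k | k) i <;> rfl
    · rintro (k | k) i <;> rfl
  comp_id {Γ W} f := by
    apply JModule.MultiHom.ext
    funext x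
    refine (W.toPModule.perm_perm _ _ _ _ _).trans ((W.toPModule.perm_perm _ _ _ _ _).trans ?_)
    apply W.toPModule.perm_congr
    · rintro ⟨k, i⟩; rfl
    · rintro ⟨k, i⟩; rfl
  assoc {Γ Δ Θ A B D} f g h := by
    apply JModule.MultiHom.ext
    funext x
    refine ((D.toPModule.perm_perm _ _ _ _ _).trans ((D.toPModule.perm_perm _ _ _ _ _).trans
      ((D.toPModule.perm_perm _ _ _ _ _).trans ?_))).symm
    let z := JModule.MultiHom.resp (.rightComm Δ (.single A) Θ)
      (JModule.MultiHom.mid f (JModule.MultiHom.resp (Fam.Iso.assoc Γ Δ Θ).symm x))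
    let e : ∀ k : (Δ ⊎ .single A).I,
        JModule.EltIso (z (.inl k)) (JModule.MultiHom.mid f (fun j => x (.inl j)) k) := fun k =>
      match k with
      | .inl _ => .refl _
      | .inr _ => .refl _
    refine h.perm_eq (x := JModule.MultiHom.mid g z) (y := JModule.MultiHom.mid (f.comp g) x)
      (fun k => match k with
      | .inl d => .refl _
      | .inr _ => ⟨(Fam.Iso.sigma (Δ ⊎ .single A).fin fun k => (e k).inp).trans
          (.graft Γ.fin (Δ ⊎ .single A).fin (Γ ⊎ Δ).fin fun k => (x (.inl k)).inp),
          (Fam.Iso.sigma (Δ ⊎ .single A).fin fun k => (e k).out).trans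
          (.graft Γ.fin (Δ ⊎ .single A).fin (Γ ⊎ Δ).fin fun k => (x (.inl k)).out), ?_⟩) ?_ ?_
    · exact g.perm_eq e (fun _ _ => rfl) (fun _ _ => rfl)
    · rintro (k | k) i
      · rfl
      · obtain ⟨k | k, i⟩ := i <;> rfl
    · rintro (k | k) i
      · rfl
      · obtain ⟨k | k, i⟩ := i <;> rfl
  interchange {Γ Δ Θ A B D} f g h := by
    apply JModule.MultiHom.ext
    funext x
    refine (D.toPModule.perm_perm _ _ _ _ _).trans ((D.toPModule.perm_perm _ _ _ _ _).trans ?_)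
    refine ((D.toPModule.perm_perm _ _ _ _ _).trans ((D.toPModule.perm_perm _ _ _ _ _).trans
      ((D.toPModule.perm_perm _ _ _ _ _).trans ((D.toPModule.perm_perm _ _ _ _ _).trans ?_)))).symm
    refine h.perm_eq (x := JModule.MultiHom.resp _ (JModule.MultiHom.mid f (JModule.MultiHom.resp _
        (JModule.MultiHom.mid g (JModule.MultiHom.resp _ x)))))
      (y := JModule.MultiHom.mid g (JModule.MultiHom.resp _ (JModule.MultiHom.mid f x)))
      (fun k => match k with
      | .inl (.inl d) => .refl _
      | .inl (.inr d) => .refl _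
      | .inr _ => .refl _) ?_ ?_
    · rintro ((k | k) | k) i <;> rfl
    · rintro ((k | k) | k) i <;> rfl

namespace Fam.Iso

/-- A concatenation of two lists. -/
noncomputable abbrev sigmaPair {C : Type u} (hK : Finite (Unit ⊕ Unit)) (s : Unit ⊕ Unit → Fam C) :
    s (.inl ()) ⊎ s (.inr ()) ≅ₗ Fam.sigma hK s :=
  ofFun (Sum.elim (fun i => ⟨.inl (), i⟩) fun i => ⟨.inr (), i⟩)
    ⟨by
      rintro (i | i) (j | j) h <;> cases h <;> rfl,
    by
      rintro ⟨_ | _, i⟩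
      · exact ⟨.inl i, rfl⟩
      · exact ⟨.inr i, rfl⟩⟩
    (by rintro (i | i) <;> rfl)

end Fam.Iso

namespace PModule
variable {P : Polycat.{u, v}}

theorem shift_lact_at (U : PModule.{u, v, w} P) {K L : Fam P.Ob} {Γ Δ Φ D G R : Fam P.Ob} {A : P.Ob}
    {f : P.Hom Φ (Δ ⊎ .single A)} {x : U.obj (G ⊎ K) (D ⊎ L)} {src : .single A ⊎ R ≅ₗ G}
    {inp : Φ ⊎ R ≅ₗ Γ} {Δ' : Fam P.Ob} {out : Δ ⊎ D ≅ₗ Δ'} :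
    (U.shift K L).lact.compAt (X := P.bi) (Y := U.shiftBi K L) (Z := U.shiftBi K L) f x (.refl _) src inp out =
      U.lact.compAt f x (.refl _) ((Fam.Iso.assoc _ _ _).symm.trans (src.append (.refl _)))
        ((Fam.Iso.assoc _ _ _).symm.trans (inp.append (.refl _)))
        ((Fam.Iso.assoc _ _ _).symm.trans (out.append (.refl _))) := by
  show U.perm _ _ (U.lact.compAt (P.perm _ _ f) (U.perm _ _ x) _ _ _ _) = _
  rw [U.lact.perm_at]
  apply U.lact.at_perm
  · rfl
  · exact congrArg Sum.inl (src.equiv.symm_apply_apply _).symm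
  · intro i; rfl
  · rintro (i | i) (j | j) h
    · have h' := (Sum.inl_injective h).trans (src.equiv.symm_apply_apply (.inr j))
      cases h'; rfl
    · cases h
    · cases h
    · cases h; rfl
  · rintro i j h; cases h; rfl
  · rintro (i | i) <;> rfl

theorem shift_ract_at (U : PModule.{u, v, w} P) {K L : Fam P.Ob} {Γ Δ Φ D G R : Fam P.Ob} {A : P.Ob}
    {f : P.Hom (.single A ⊎ Φ) Δ} {x : U.obj (G ⊎ K) (D ⊎ L)} {src : R ⊎ .single A ≅ₗ D}
    {inp : G ⊎ Φ ≅ₗ Γ} {Δ' : Fam P.Ob} {out : R ⊎ Δ ≅ₗ Δ'} :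
    (U.shift K L).ract.compAt (X := U.shiftBi K L) (Y := P.bi) (Z := U.shiftBi K L) x f src (.refl _) inp out =
      U.ract.compAt x f ((Fam.Iso.rightComm _ _ _).trans (src.append (.refl _))) (.refl _)
        ((Fam.Iso.rightComm _ _ _).trans (inp.append (.refl _)))
        ((Fam.Iso.rightComm _ _ _).trans (out.append (.refl _))) := by
  show U.perm _ _ (U.ract.compAt (U.perm _ _ x) (P.perm _ _ f) _ _ _ _) = _
  rw [U.ract.perm_at]
  apply U.ract.at_perm
  · exact congrArg Sum.inl (src.equiv.symm_apply_apply _).symm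
  · rfl
  · rintro (i | i) <;> rfl
  · rintro i j h; cases h; rfl
  · rintro (i | i) (j | j) h
    · have h' := (Sum.inl_injective h).trans (src.equiv.symm_apply_apply (.inl j))
      cases h'; rfl
    · cases h
    · cases h
    · cases h; rfl
  · intro i; rfl

end PModule

namespace JModule
variable {P : Polycat.{u, v}} {J : P.Distinguished}

section
variable {A : P.Ob} (x : ∀ k, Elt ((Fam.single (yo J A) ⊎ Fam.single (noy J A)).obj k))

abbrev yoEl : P.Hom ((x (.inl ())).inp ⊎ .nil) ((x (.inl ())).out ⊎ .single A) := (x (.inl ())).el.down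

abbrev noyEl : P.Hom ((x (.inr ())).inp ⊎ .single A) ((x (.inr ())).out ⊎ .nil) := (x (.inr ())).el.down

noncomputable def cutEl :
    P.Hom (.sigma (Fam.single (yo J A) ⊎ Fam.single (noy J A)).fin fun k => (x k).inp)
      (.sigma (Fam.single (yo J A) ⊎ Fam.single (noy J A)).fin fun k => (x k).out) :=
  P.act.compAt (yoEl x) (noyEl x) (.refl _) (.comm _ _)
    (((Fam.Iso.nilRight _).append (.refl _)).trans (.sigmaPair _ fun k => (x k).inp))
    ((Fam.Iso.append (.refl _) (.nilRight _)).trans (.sigmaPair _ fun k => (x k).out))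
end

/-- The pairing given by composition. -/
noncomputable def cut (J : P.Distinguished) (A : P.Ob) :
    MultiHom (.single (yo J A) ⊎ .single (noy J A)) (self J) where
  toFun x := ⟨cutEl x⟩
  map_perm x y e := by
    refine congrArg ULift.up ?_
    have h1 : P.perm ((e (.inl ())).inp.append (.refl _)) ((e (.inl ())).out.append (.refl _)) (yoEl x) = yoEl y :=
      congrArg ULift.down (e (.inl ())).el_eq
    have h2 : P.perm ((e (.inr ())).inp.append (.refl _)) ((e (.inr ())).out.append (.refl _)) (noyEl x) = noyEl y :=
      congrArg ULift.down (e (.inr ())).el_eq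
    show P.perm _ _ (cutEl x) = cutEl y
    unfold cutEl
    rw [← h1, ← h2]
    refine (P.act.perm_at _ _).trans ?_
    symm
    apply P.act.at_perm
    · rfl
    · rfl
    · rintro (i | ⟨⟨⟩⟩); rfl
    · rintro i j h; cases h; rfl
    · rintro i j h; cases h; rfl
    · rintro (i | ⟨⟨⟩⟩); rfl
  map_lact x y k e Φ Ψ B f s := by
    refine congrArg ULift.up ?_
    rcases k with _ | _
    · have h2 : P.perm ((e ⟨.inr (), by simp⟩).inp.append (.refl _))
          ((e ⟨.inr (), by simp⟩).out.append (.refl _)) (noyEl x) = noyEl y :=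
        congrArg ULift.down (e ⟨.inr (), by simp⟩).el_eq
      have h1 := congrArg ULift.down ((PModule.shift_lact_at (PModule.self P)).symm.trans s.el_eq)
      change P.act.compAt f (yoEl x) _ _ _ _ = yoEl y at h1
      show P.act.compAt f (cutEl x) _ _ _ _ = cutEl y
      unfold cutEl
      rw [← h1, ← h2, P.act.at_perm_right]
      apply AssocLaw.compAt P.assocLaw
      · rfl
      · rfl
      · rfl
      · rfl
      · intro i; rfl
      · rintro (i | ⟨⟨⟩⟩) (j | ⟨⟨⟨⟩ | ⟨⟩, hl⟩, j⟩) h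
        · obtain rfl := Sum.inr_injective (s.src.equiv.injective (eq_of_heq (Sigma.mk.inj h).2))
          rfl
        · exact absurd rfl hl
        · cases h
      · rintro i i' (j | ⟨⟨⟨⟩ | ⟨⟩, hl⟩, j⟩) h h'
        · cases h'
        · exact absurd rfl hl
        · cases h'
          obtain rfl := Sum.inl_injective h
          exact congrArg (Sigma.mk (Sum.inr ())) (Equiv.apply_symm_apply _ i')
      · rintro i i' j h h'
        cases h
        obtain rfl := Sum.inl_injective h'
        rfl
      · rintro i j h
        obtain rfl := Sum.inl_injective h
        exact Fam.Iso.insertAt_eq (s := fun i => (x i).out) (t := fun i => (y i).out)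
          (a := s.out) (e := fun i => (e i).out) _ _ i
      · rintro (i | ⟨⟨⟩⟩)
        exact Fam.Iso.insertAt_ne (s := fun i => (x i).out) (t := fun i => (y i).out)
          (a := s.out) (e := fun i => (e i).out) _ (.inl ()) (.inr ()) (by simp) i
    · have h2 : P.perm ((e ⟨.inl (), by simp⟩).inp.append (.refl _))
          ((e ⟨.inl (), by simp⟩).out.append (.refl _)) (yoEl x) = yoEl y :=
        congrArg ULift.down (e ⟨.inl (), by simp⟩).el_eq
      have h1 := congrArg ULift.down ((PModule.shift_lact_at (PModule.self P)).symm.trans s.el_eq)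
      change P.act.compAt f (noyEl x) _ _ _ _ = noyEl y at h1
      show P.act.compAt f (cutEl x) _ _ _ _ = cutEl y
      unfold cutEl
      rw [← h1, ← h2, P.act.at_perm_left]
      apply InLaw.compAt P.inLaw ((Fam.Iso.append (.refl _) s.src).trans (.comm _ _))
      · rfl
      · rfl
      · rintro i h
        obtain rfl := Sum.inl_injective h
        rfl
      · rintro (i | i) h
        · cases h
        · rfl
      · rfl
      · rfl
      · rintro (i | ⟨⟨⟩⟩)
        exact Fam.Iso.insertAt_eq (s := fun i => (x i).out) (t := fun i => (y i).out)
          (a := s.out) (e := fun i => (e i).out) _ _ i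
      · rintro i j h
        obtain rfl := Sum.inl_injective h
        exact (Fam.Iso.insertAt_ne (s := fun i => (x i).out) (t := fun i => (y i).out)
          (a := s.out) (e := fun i => (e i).out) _ (.inr ()) (.inl ()) (by simp) _).trans
          (congrArg (Sigma.mk (Sum.inl ())) (Equiv.apply_symm_apply _ j))
      · rintro i j h
        cases h
        rfl
      · rintro r i (j | j) (i' | ⟨⟨⟨⟩ | ⟨⟩, hl⟩, i'⟩) j' h1 h2 h3 h4
        · obtain rfl := Sum.inl_injective h1
          obtain rfl := Sum.inr_injective (s.src.equiv.injective (Sum.inl_injective h2))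
          obtain rfl := Sum.inr_injective (s.src.equiv.injective (eq_of_heq (Sigma.mk.inj h3).2))
          obtain rfl := Sum.inl_injective h4
          rfl
        · cases h3
        · exact absurd rfl hl
        all_goals cases h2
      · rintro (i | ⟨⟨⟩⟩) (j | ⟨⟨⟨⟩ | ⟨⟩, hl⟩, j⟩) h
        · cases h
        · cases h; rfl
        · exact absurd rfl hl
      · rintro i j h
        obtain rfl := Sum.inl_injective h
        rfl
  map_ract x y k e Φ Ψ B f s := by
    refine congrArg ULift.up ?_
    rcases k with _ | _
    · have h2 : P.perm ((e ⟨.inr (), by simp⟩).inp.append (.refl _))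
          ((e ⟨.inr (), by simp⟩).out.append (.refl _)) (noyEl x) = noyEl y :=
        congrArg ULift.down (e ⟨.inr (), by simp⟩).el_eq
      have h1 := congrArg ULift.down ((PModule.shift_ract_at (PModule.self P)).symm.trans s.el_eq)
      change P.act.compAt (yoEl x) f _ _ _ _ = yoEl y at h1
      show P.act.compAt (cutEl x) f _ _ _ _ = cutEl y
      unfold cutEl
      rw [← h1, ← h2, P.act.at_perm_right]
      apply OutLaw.compAt P.outLaw (s.src.append (.refl _))
      · rfl
      · rfl
      · rintro i h
        obtain rfl := Sum.inl_injective h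
        rfl
      · rintro (i | i) h
        · cases h
        · rfl
      · rfl
      · rfl
      · rintro (i | ⟨⟨⟩⟩)
        exact Fam.Iso.insertAtR_eq (s := fun i => (x i).inp) (t := fun i => (y i).inp)
          (a := s.inp) (e := fun i => (e i).inp) _ _ i
      · rintro i j h
        obtain rfl := Sum.inl_injective h
        exact (Fam.Iso.insertAtR_ne (s := fun i => (x i).inp) (t := fun i => (y i).inp)
          (a := s.inp) (e := fun i => (e i).inp) _ (.inl ()) (.inr ()) (by simp) _).trans
          (congrArg (Sigma.mk (Sum.inr ())) (Equiv.apply_symm_apply _ j))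
      · rintro i j h
        cases h
        rfl
      · rintro r i (j | j) (i' | ⟨⟨⟨⟩ | ⟨⟩, hl⟩, i'⟩) j' h1 h2 h3 h4
        · obtain rfl := Sum.inl_injective h1
          obtain rfl := Sum.inl_injective (s.src.equiv.injective (Sum.inl_injective h2))
          obtain rfl := Sum.inl_injective (s.src.equiv.injective (eq_of_heq (Sigma.mk.inj h3).2))
          obtain rfl := Sum.inl_injective h4
          rfl
        · exact absurd rfl hl
        · cases h3
        all_goals cases h2
      · rintro (i | ⟨⟨⟩⟩) (j | ⟨⟨⟨⟩ | ⟨⟩, hl⟩, j⟩) h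
        · cases h
        · exact absurd rfl hl
        · cases h; rfl
      · rintro i j h
        obtain rfl := Sum.inl_injective h
        rfl
    · have h2 : P.perm ((e ⟨.inl (), by simp⟩).inp.append (.refl _))
          ((e ⟨.inl (), by simp⟩).out.append (.refl _)) (yoEl x) = yoEl y :=
        congrArg ULift.down (e ⟨.inl (), by simp⟩).el_eq
      have h1 := congrArg ULift.down ((PModule.shift_ract_at (PModule.self P)).symm.trans s.el_eq)
      change P.act.compAt (noyEl x) f _ _ _ _ = noyEl y at h1
      show P.act.compAt (cutEl x) f _ _ _ _ = cutEl y
      unfold cutEl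
      rw [← h1, ← h2, P.act.at_perm_left]
      symm
      apply AssocLaw.compAt P.assocLaw
      · rfl
      · rfl
      · rfl
      · rfl
      · rintro (i | ⟨⟨⟩⟩)
        exact (Fam.Iso.insertAtR_ne (s := fun i => (x i).inp) (t := fun i => (y i).inp)
          (a := s.inp) (e := fun i => (e i).inp) _ (.inr ()) (.inl ()) (by simp) i).symm
      · rintro i j h
        obtain rfl := Sum.inl_injective h
        exact (Fam.Iso.insertAtR_eq (s := fun i => (x i).inp) (t := fun i => (y i).inp)
          (a := s.inp) (e := fun i => (e i).inp) _ _ i).symm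
      · rintro i i' j h h'
        cases h
        obtain rfl := Sum.inl_injective h'
        rfl
      · rintro i i' (j | ⟨⟨⟨⟩ | ⟨⟩, hl⟩, j⟩) h h'
        · cases h'
        · cases h'
          obtain rfl := Sum.inl_injective h
          exact congrArg (Sigma.mk (Sum.inl ())) (Equiv.apply_symm_apply _ i).symm
        · exact absurd rfl hl
      · rintro (i | ⟨⟨⟩⟩) (j | ⟨⟨⟨⟩ | ⟨⟩, hl⟩, j⟩) h
        · obtain rfl := Sum.inl_injective (s.src.equiv.injective (eq_of_heq (Sigma.mk.inj h).2))
          rfl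
        · cases h
        · exact absurd rfl hl
      · intro i; rfl

end JModule

/-- The envelope: the Chu construction on the multicategory of modules that respect the
distinguished tensor and cotensor products, at the module given by the hom-sets. -/
noncomputable def env (P : Polycat.{u, v}) (J : P.Distinguished) : Polycat :=
  chu (jmod P J) (JModule.self J)

/-- The two modules represented by `A`, paired by composition. -/
noncomputable def yonedaOb (P : Polycat.{u, v}) (J : P.Distinguished) (A : P.Ob) :
    ChuOb (jmod P J) (JModule.self J) :=
  ⟨JModule.yo J A, JModule.noy J A, JModule.cut J A⟩

/-- A polycategory is star-autonomous if it has all tensor and cotensor products, including the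
nullary ones, and every object has a dual. -/
structure Polycat.IsStarAutonomous (P : Polycat.{u, v}) : Prop where
  tensor (A B : P.Ob) : ∃ (T : P.Ob) (t : P.Hom (.single A ⊎ .single B) (.single T)), P.IsTensor t
  unit : ∃ (T : P.Ob) (t : P.Hom .nil (.single T)), P.IsTensor t
  cotensor (A B : P.Ob) : ∃ (T : P.Ob) (t : P.Hom (.single T) (.single A ⊎ .single B)),
    P.IsCotensor t
  counit : ∃ (T : P.Ob) (t : P.Hom (.single T) .nil), P.IsCotensor t
  dual (A : P.Ob) : ∃ (B : P.Ob) (e : P.Hom (.single B ⊎ .single A) .nil), P.IsDual e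

/-- Functors of symmetric polycategories with a given action on objects. -/
structure PolyFunctor (P : Polycat.{u, v}) (Q : Polycat.{u', v'}) (F : P.Ob → Q.Ob) where
  map {Γ Δ : Fam P.Ob} : P.Hom Γ Δ → Q.Hom (Γ.map F) (Δ.map F)
  map_perm {Γ Γ' Δ Δ' : Fam P.Ob} (σ : Γ ≅ₗ Γ') (τ : Δ ≅ₗ Δ') (f : P.Hom Γ Δ) :
    map (P.perm σ τ f) = Q.perm (σ.map F) (τ.map F) (map f)
  map_id (A : P.Ob) : map (P.id A) = Q.id (F A)
  map_comp {Γ Δ Φ Ψ : Fam P.Ob} {A : P.Ob} (f : P.Hom Γ (Δ ⊎ .single A))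
    (g : P.Hom (.single A ⊎ Φ) Ψ) :
    map (P.comp f g) = Q.perm (.mapAppend F Γ Φ) (.mapAppend F Δ Ψ)
      (Q.comp (A := F A) (Q.perm (.refl _) (Fam.Iso.mapAppend F Δ (.single A)).symm (map f))
        (Q.perm (Fam.Iso.mapAppend F (.single A) Φ).symm (.refl _) (map g)))

namespace PolyFunctor
variable {P : Polycat.{u, v}} {Q : Polycat.{u', v'}} {F : P.Ob → Q.Ob} (G : PolyFunctor P Q F)

def FullyFaithful : Prop :=
  ∀ Γ Δ : Fam P.Ob, Function.Bijective fun f : P.Hom Γ Δ => G.map f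

/-- Preservation of the distinguished tensor and cotensor products. -/
structure Preserves (J : P.Distinguished) : Prop where
  tensor {A B T : P.Ob} {t : P.Hom (.single A ⊎ .single B) (.single T)} :
    J.tensor t → Q.IsTensor (T := F T) (G.map t)
  unit {T : P.Ob} {t : P.Hom .nil (.single T)} : J.unit t → Q.IsTensor (T := F T) (G.map t)
  cotensor {A B T : P.Ob} {t : P.Hom (.single T) (.single A ⊎ .single B)} :
    J.cotensor t → Q.IsCotensor (T := F T) (G.map t)
  counit {T : P.Ob} {t : P.Hom (.single T) .nil} : J.counit t → Q.IsCotensor (T := F T) (G.map t)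

end PolyFunctor

namespace JModule
variable {P : Polycat.{u, v}} (J : P.Distinguished)

/-- The identity of `A` as an element of the contravariant representable module. -/
def yoOne (A : P.Ob) : Elt (yo J A) where
  inp := .single A
  out := .nil
  el := ⟨P.perm (Fam.Iso.nilRight _).symm (Fam.Iso.nilLeft _).symm (P.id A)⟩

/-- The identity of `A` as an element of the covariant representable module. -/
def noyOne (A : P.Ob) : Elt (noy J A) where
  inp := .nil
  out := .single A
  el := ⟨P.perm (Fam.Iso.nilLeft _).symm (Fam.Iso.nilRight _).symm (P.id A)⟩

/-- The identities of all objects in two lists. -/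
def ones (Γ Δ : Fam P.Ob) (k : (Γ ⊎ Δ).I) :
    Elt (((Γ.map (yonedaOb P J) ⊎ (Δ.map (yonedaOb P J)).map ChuOb.dual).map ChuOb.pos).obj k) :=
  match k with
  | .inl i => yoOne J (Γ.obj i)
  | .inr j => noyOne J (Δ.obj j)

noncomputable def onesInp (Γ Δ : Fam P.Ob) :
    Γ ≅ₗ .sigma (Γ ⊎ Δ).fin fun k => (ones J Γ Δ k).inp :=
  .ofFun (fun i => ⟨.inl i, ()⟩)
    ⟨fun i j h => Sum.inl_injective (congrArg Sigma.fst h), by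
      rintro ⟨i | j, z⟩
      · exact ⟨i, rfl⟩
      · exact Empty.elim z⟩
    (fun _ => rfl)

noncomputable def onesOut (Γ Δ : Fam P.Ob) :
    Δ ≅ₗ .sigma (Γ ⊎ Δ).fin fun k => (ones J Γ Δ k).out :=
  .ofFun (fun i => ⟨.inr i, ()⟩)
    ⟨fun i j h => Sum.inr_injective (congrArg Sigma.fst h), by
      rintro ⟨i | j, z⟩
      · exact Empty.elim z
      · exact ⟨j, rfl⟩⟩
    (fun _ => rfl)

/-- The component into the hom-sets of a morphism of the envelope between objects of `P`, evaluated
at identities. -/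
noncomputable def atOnes {Γ Δ : Fam P.Ob}
    (g : (env P J).Hom (Γ.map (yonedaOb P J)) (Δ.map (yonedaOb P J))) : P.Hom Γ Δ :=
  P.perm (onesInp J Γ Δ).symm (onesOut J Γ Δ).symm
    (MultiHom.toFun (ChuHom.under (E := jmod P J) (bot := self J) g) (ones J Γ Δ)).down

end JModule

/-!
# The envelope of a polycategory

The Chu construction of a symmetric multicategory `E` with dualizing object `bot` is star-autonomous as
soon as `E` is closed, has pullbacks, and has an object representing the multimorphisms out of each
list. Duals need no hypothesis, since the list of inputs and outputs of a morphism is stored as a single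
list in which an output counts as its dual: composition with the evaluation `ChuHom.counit A` is then a
relabelling. A morphism `t` is universal at an entry if its component there is a tensor product in `E`
and the positive component of the entry is the object of all ways to complete the other components
(`ChuHom.universal_of`). For a list `S`, the first requirement is met by a tensor product of the positive
components, and the second by a wide pullback of internal homs (`ChuHom.IsCone`). Cotensor products are
duals of tensor products. This gives `ChuHom.chu_isStarAutonomous`.

Modules satisfy its hypotheses. Internal homs consist of natural families with values in shifted modules
(`PModule.hom`), and pullbacks are pointwise (`PModule.widePullback`); both inherit the invertibility of
the distinguished products. A tensor product of a list of modules is made of formal expressions in the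
actions and in the inverses of the distinguished products, two of them being identified if all
multimorphisms give them the same value (`JModule.Term`). It represents multimorphisms without further
inputs, and closedness supplies the rest (`Multicat.WeakTensor.tensorUniversal`).

The functor comes from the Yoneda lemma: multimorphisms out of a list of representable modules are
determined by their value at the identities, which is arbitrary (`JModule.ones_generic`). In particular
the pairing of `y_A` with `ȳ_A` exhibits each as an internal hom from the other to the hom-sets of `P`
(`JModule.negRep_yonedaOb`, `JModule.negRep_dual_yonedaOb`), so that a morphism of the envelope between
images of objects of `P` is determined by its component into the hom-sets (`JModule.under_bijective`), and
then by the value of that at the identities (`JModule.atOnes_bijective`). Evaluation at the identities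
respects relabelling, identities and composition (`JModule.atOnes_perm`, `JModule.atOnes_id`,
`JModule.atOnes_comp`), and the functor `JModule.yoneda` is its inverse.

A distinguished tensor product `t` of `S` acts invertibly on every module by definition. By the Yoneda
lemma, this says precisely that its component into `y_T` is a tensor product of modules
(`JModule.weakTensor_outComp`). The condition on the positive component is then automatic, because all
objects involved are determined by internal homs into the hom-sets (`ChuHom.coneUniversal_of_negRep`).
Cotensor products are treated alike.
-/

/-! ### Universal multimorphisms -/

/-- Finite families can be built, up to relabelling, by adding one entry at a time. -/
theorem Fam.induction {C : Type u} {motive : Fam C → Prop}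
    (iso : ∀ {Γ Δ : Fam C}, (Γ ≅ₗ Δ) → motive Γ → motive Δ) (nil : motive .nil)
    (snoc : ∀ (Γ : Fam C) (A : C), motive Γ → motive (Γ ⊎ .single A)) (Γ : Fam C) : motive Γ := by
  obtain ⟨I, hI, o⟩ := Γ
  refine Finite.induction_empty_option
    (P := fun I => ∀ (h : Finite I) (o : I → C), motive ⟨I, h, o⟩) ?_ ?_ ?_ I hI o
  · intro I I' e ih h o
    exact iso (Γ := ⟨I, .of_equiv _ e.symm, fun i => o (e i)⟩) ⟨e, fun _ => rfl⟩ (ih _ _)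
  · intro h o
    exact iso (Γ := .nil) ⟨Equiv.equivOfIsEmpty _ _, fun i => Empty.elim i⟩ nil
  · intro I _ ih h o
    refine iso (Γ := ⟨I, inferInstance, fun i => o (some i)⟩ ⊎ .single (o none))
      ⟨(Equiv.optionEquivSumPUnit I).symm, ?_⟩ (snoc _ _ (ih _ _))
    rintro (i | i) <;> rfl

namespace Multicat
variable (E : Multicat.{u, v})

theorem perm_bijective {Γ Γ' : Fam E.Ob} {A A' : E.Ob} (σ : Γ ≅ₗ Γ') (h : A = A') :
    Function.Bijective (E.perm σ h) := by
  refine Function.bijective_iff_has_inverse.mpr ⟨E.perm σ.symm h.symm, fun f => ?_, fun f => ?_⟩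
  · rw [E.perm_perm]; exact E.perm_id' fun i => σ.equiv.symm_apply_apply i
  · rw [E.perm_perm]; exact E.perm_id' fun i => σ.equiv.apply_symm_apply i

theorem perm_sub_refl {Γ Δ Δ' Θ : Fam E.Ob} {A B : E.Ob} (f : E.Hom Γ A) (g : E.Hom Δ B)
    (a : Δ' ⊎ .single A ≅ₗ Δ) (σ : Γ ⊎ Δ' ≅ₗ Θ) :
    E.perm σ rfl (E.sub f g a (.refl _)) = E.sub f g a σ := by
  rw [sub, E.perm_refl]; rfl

variable {E}

/-- Substitution into the entry `H` of `e` is bijective: `e` exhibits `H` as an internal hom from the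
remaining entries of `e` to its target. -/
def HomUniversal {Δ Δ' : Fam E.Ob} {H B : E.Ob} (e : E.Hom Δ B) (a : Δ' ⊎ .single H ≅ₗ Δ) : Prop :=
  ∀ Y : Fam E.Ob, Function.Bijective fun h : E.Hom Y H => E.sub h e a (.refl (Y ⊎ Δ'))

/-- Precomposition with `t` is bijective in the presence of any further inputs: `t` exhibits `T` as a
tensor product. -/
def TensorUniversal {Γ : Fam E.Ob} {T : E.Ob} (t : E.Hom Γ T) : Prop :=
  ∀ (Y : Fam E.Ob) (W : E.Ob), Function.Bijective fun g : E.Hom (Y ⊎ .single T) W => E.comp t g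

/-- Precomposition with `t` is a bijection from the unary multimorphisms out of `T` to the
multimorphisms out of the list `Γ`, without further inputs. -/
def WeakTensor {Γ : Fam E.Ob} {T : E.Ob} (t : E.Hom Γ T) : Prop :=
  ∀ W : E.Ob, Function.Bijective fun g : E.Hom (.single T) W =>
    E.sub t g (.nilLeft _) (.nilRight _)

/-- Composition with a unary multimorphism. -/
def post {Y : Fam E.Ob} {A B : E.Ob} (h : E.Hom Y A) (f : E.Hom (.single A) B) : E.Hom Y B :=
  E.sub h f (.nilLeft _) (.nilRight _)

/-- `p₀` and `p` exhibit `Q` as the wide pullback of the family `f`, for maps out of any list of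
objects. -/
structure IsWidePullback {ι : Type} {Q D : E.Ob} {B : ι → E.Ob} (p₀ : E.Hom (.single Q) D)
    (p : ∀ i, E.Hom (.single Q) (B i)) (f : ∀ i, E.Hom (.single (B i)) D) : Prop where
  comm (i : ι) : post (p i) (f i) = p₀
  lift {Y : Fam E.Ob} (a₀ : E.Hom Y D) (a : ∀ i, E.Hom Y (B i)) (h : ∀ i, post (a i) (f i) = a₀) :
    ∃ c : E.Hom Y Q, post c p₀ = a₀ ∧ ∀ i, post c (p i) = a i
  hom_ext {Y : Fam E.Ob} {c d : E.Hom Y Q} (h₀ : post c p₀ = post d p₀)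
    (h : ∀ i, post c (p i) = post d (p i)) : c = d

variable (E) in
/-- The wide pullback of any family of unary multimorphisms into one object exists. -/
def HasWidePullbacks : Prop :=
  ∀ {ι : Type} {D : E.Ob} {B : ι → E.Ob} (f : ∀ i, E.Hom (.single (B i)) D),
    ∃ (Q : E.Ob) (p₀ : E.Hom (.single Q) D) (p : ∀ i, E.Hom (.single Q) (B i)),
      IsWidePullback p₀ p f

variable (E) in
/-- Multimorphisms out of any list are represented by one object, as far as no further inputs are
concerned. -/
def HasWeakTensors : Prop :=
  ∀ Γ : Fam E.Ob, ∃ (T : E.Ob) (t : E.Hom Γ T), WeakTensor t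

variable (E) in
/-- The multicategory has internal homs out of single objects. -/
def HasHoms : Prop :=
  ∀ B W : E.Ob, ∃ (H : E.Ob) (ev : E.Hom (.single B ⊎ .single H) W), HomUniversal ev (.refl _)

theorem HomUniversal.bijective {Δ Δ' Δ'' Y Θ : Fam E.Ob} {H B : E.Ob} {e : E.Hom Δ B}
    {a : Δ' ⊎ .single H ≅ₗ Δ} (hu : HomUniversal e a) (a' : Δ'' ⊎ .single H ≅ₗ Δ)
    (c : Y ⊎ Δ'' ≅ₗ Θ) (h : a'.equiv (.inr ()) = a.equiv (.inr ())) :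
    Function.Bijective fun h : E.Hom Y H => E.sub h e a' c := by
  obtain ⟨ρ, hρ⟩ := Fam.Iso.exists_of_fix (a.trans a'.symm) (a'.symm_apply_eq h)
  have : (fun h : E.Hom Y H => E.sub h e a' c) =
      E.perm (((Fam.Iso.refl Y).append ρ).trans c) rfl ∘ fun h => E.sub h e a (.refl _) := by
    funext f
    apply E.sub_eq_perm
    · exact h
    · intro i; rfl
    · intro i j hij
      have h1 : a'.equiv (.inl (ρ.equiv j)) = a.equiv (.inl j) := by
        have := congrArg (fun t => a'.equiv (t.equiv (.inl j))) hρ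
        exact this.symm.trans (a'.equiv.apply_symm_apply _)
      rw [← h1] at hij
      exact congrArg c.equiv (congrArg Sum.inr (Sum.inl_injective (a'.equiv.injective hij)))
  rw [this]
  exact (E.perm_bijective _ _).comp (hu Y)

/-- Internal homs out of lists are iterated internal homs out of single objects. -/
theorem HasHoms.exists_hom (hE : E.HasHoms) (Γ : Fam E.Ob) (W : E.Ob) :
    ∃ (H : E.Ob) (e : E.Hom (Γ ⊎ .single H) W), HomUniversal e (.refl _) := by
  induction Γ using Fam.induction generalizing W with
  | @iso Γ Δ σ ih =>
    obtain ⟨H, e, he⟩ := ih W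
    refine ⟨H, E.perm (σ.append (.refl _)) rfl e, fun Y => ?_⟩
    simp only [E.sub_perm]
    exact he.bijective _ _ rfl
  | nil =>
    refine ⟨W, E.perm (Fam.Iso.nilLeft _).symm rfl (E.id W), fun Y => ?_⟩
    have : (fun h : E.Hom Y W => E.sub h (E.perm (Fam.Iso.nilLeft _).symm rfl (E.id W))
        (.refl _) (.refl _)) = E.perm (Fam.Iso.nilRight _).symm rfl := by
      funext h
      rw [← E.comp_id]
      exact (E.perm_refl _).symm.trans (E.comp_eq_sub _ _ _) |>.symm
    rw [this]
    exact E.perm_bijective _ _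
  | snoc Γ A ih =>
    obtain ⟨K, k, hk⟩ := hE A W
    obtain ⟨H, e, he⟩ := ih K
    refine ⟨H, E.sub e k (.refl _) (.rightComm _ _ _), fun Y => ?_⟩
    have : (fun h : E.Hom Y H => E.sub h (E.sub e k (.refl _) (.rightComm _ _ _)) (.refl _)
        (.refl _)) = (fun h => E.sub h k (.refl _) (.assoc _ _ _)) ∘
          fun h => E.sub h e (.refl _) (.refl _) := by
      funext h
      apply E.sub_assoc
      · rfl
      · intro i; rfl
      · rintro i j h; cases h; rfl
      · rintro i j h; cases h; rfl
    rw [this]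
    exact (hk.bijective _ _ rfl).comp (he Y)

theorem TensorUniversal.bijective {Γ Δ Y Θ : Fam E.Ob} {T W : E.Ob} {t : E.Hom Γ T}
    (ht : TensorUniversal t) (a : Y ⊎ .single T ≅ₗ Δ) (c : Γ ⊎ Y ≅ₗ Θ) :
    Function.Bijective fun g : E.Hom Δ W => E.sub t g a c :=
  (E.perm_bijective c rfl).comp ((ht Y W).comp (E.perm_bijective a.symm rfl))

/-- In the presence of internal homs, a weak tensor product is a tensor product: further inputs are
moved, one at a time, into the target. -/
theorem WeakTensor.tensorUniversal (hE : E.HasHoms) {Γ : Fam E.Ob} {T : E.Ob} {t : E.Hom Γ T}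
    (ht : WeakTensor t) : TensorUniversal t := by
  suffices key : ∀ Y : Fam E.Ob, ∀ (W : E.Ob) (Δ Θ : Fam E.Ob) (a : Y ⊎ .single T ≅ₗ Δ)
      (c : Γ ⊎ Y ≅ₗ Θ), Function.Bijective fun g : E.Hom Δ W => E.sub t g a c by
    intro Y W
    have := key Y W _ _ (.refl _) (.refl _)
    simpa only [← E.comp_eq_sub, E.perm_refl] using this
  intro Y
  induction Y using Fam.induction with
  | @iso Y Y' σ ih =>
    intro W Δ Θ a c
    convert ih W Δ Θ ((σ.append (.refl _)).trans a) (((Fam.Iso.refl _).append σ).trans c) using 2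
    apply E.sub_congr
    · rfl
    · intro i; rfl
    · intro i j hij
      exact congrArg (fun z => c.equiv (.inr z)) (Sum.inl_injective (a.equiv.injective hij))
  | nil =>
    intro W Δ Θ a c
    have : (fun g : E.Hom Δ W => E.sub t g a c) = E.perm ((Fam.Iso.nilRight _).symm.trans c) rfl ∘
        (fun g : E.Hom (.single T) W => E.sub t g (.nilLeft _) (.nilRight _)) ∘
          E.perm (a.symm.trans (.nilLeft _)) rfl := by
      funext g
      symm
      refine Eq.trans (E.perm_sub _ _ _ _ _ _) ?_
      rw [E.perm_refl, E.sub_perm]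
      apply E.sub_congr
      · rfl
      · intro i; rfl
      · rintro ⟨⟩
    rw [this]
    exact (E.perm_bijective _ _).comp ((ht W).comp (E.perm_bijective _ _))
  | snoc Y B ih =>
    intro W Δ Θ a c
    obtain ⟨H, ev, hev⟩ := hE B W
    have h1 := hev.bijective (.refl _) ((Fam.Iso.rightComm Y (.single T) (.single B)).trans a) rfl
    have h2 := hev.bijective (.refl _) ((Fam.Iso.assoc Γ Y (.single B)).trans c) rfl
    have h3 := ih H _ _ (.refl _) (.refl _)
    have e : (fun g : E.Hom Δ W => E.sub t g a c) ∘ (fun h => E.sub h ev (.refl _)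
        ((Fam.Iso.rightComm Y (.single T) (.single B)).trans a)) =
        (fun h => E.sub h ev (.refl _) ((Fam.Iso.assoc Γ Y (.single B)).trans c)) ∘
          fun g => E.sub t g (.refl _) (.refl _) := by
      funext g
      apply E.sub_assoc
      · rfl
      · intro i; rfl
      · intro i j hij
        obtain rfl := Sum.inl_injective (a.equiv.injective hij)
        rfl
      · intro i j hij
        obtain rfl := Sum.inl_injective (a.equiv.injective hij)
        rfl
    refine (Function.Bijective.of_comp_iff _ h1).mp ?_
    rw [e]
    exact h2.comp h3

end Multicat

/-! ### Universal morphisms of the Chu construction -/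

namespace Fam.Iso

/-- Regrouping of `Y` with the entries of `X` other than `k`, one of which is singled out. -/
noncomputable abbrev cone {C : Type u} (Y X : Fam C) (k : X.I) (x : (X.erase k).I) :
    (Y ⊎ (X.erase x.1).erase ⟨k, x.2.symm⟩) ⊎ .single (X.obj x.1) ≅ₗ Y ⊎ X.erase k :=
  ofFun (Sum.elim (Sum.elim .inl fun z => .inr ⟨z.1.1, fun h => z.2 (Subtype.ext h)⟩) fun _ => .inr x)
    ⟨by
      obtain ⟨x, hx⟩ := x
      rintro ((y | ⟨⟨z, h1⟩, h2⟩) | _) ((y' | ⟨⟨z', h1'⟩, h2'⟩) | _) hij <;>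
        first
        | (cases hij; done)
        | (cases hij; rfl)
        | exact absurd (congrArg Subtype.val (Sum.inr_injective hij)) h1
        | exact absurd (congrArg Subtype.val (Sum.inr_injective hij)).symm h1',
    by
      rintro (y | z)
      · exact ⟨.inl (.inl y), rfl⟩
      · by_cases h : z = x
        · exact ⟨.inr (), congrArg Sum.inr h.symm⟩
        · exact ⟨.inl (.inr ⟨⟨z.1, fun e => h (Subtype.ext e)⟩, fun e => z.2 (congrArg Subtype.val e)⟩), rfl⟩⟩
    (by rintro ((i | i) | i) <;> rfl)

end Fam.Iso

namespace ChuHom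
variable {E : Multicat.{u, v}} {bot : E.Ob}

/-- Composition with `t` along its entry `k` is bijective. -/
def Universal {X : Fam (ChuOb E bot)} (t : ChuHom E bot X) (k : X.I) : Prop :=
  ∀ ⦃Y Z : Fam (ChuOb E bot)⦄ (l : Y.I) (h : DualPair (X.obj k) (Y.obj l))
    (c : X.erase k ⊎ Y.erase l ≅ₗ Z), Function.Bijective fun g : ChuHom E bot Y => cut t g k l h c

/-- The universal property of the positive component of the entry `k` of `t`: maps into it from a
list `Y` are the same as families of maps of the shape of a morphism with entries other than `k`,
with additional inputs `Y`. -/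
structure ConeUniversal {X : Fam (ChuOb E bot)} (t : ChuHom E bot X) (k : X.I) : Prop where
  hom_ext {A : E.Ob} (hA : (X.obj k).pos = A) {Y : Fam E.Ob} (h h' : E.Hom Y A)
    (hu : E.sub h t.under (.insert (X.map ChuOb.pos) k hA) (.refl _) =
      E.sub h' t.under (.insert (X.map ChuOb.pos) k hA) (.refl _))
    (hc : ∀ x : (X.erase k).I,
      E.sub h (t.comp x.1) (.insert ((X.erase x.1).map ChuOb.pos) ⟨k, x.2.symm⟩ hA) (.refl _) =
        E.sub h' (t.comp x.1) (.insert ((X.erase x.1).map ChuOb.pos) ⟨k, x.2.symm⟩ hA) (.refl _)) :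
    h = h'
  lift {A : E.Ob} (hA : (X.obj k).pos = A) {Y : Fam E.Ob}
    (b : E.Hom (Y ⊎ (X.map ChuOb.pos).erase k) bot)
    (c : ∀ x : (X.erase k).I,
      E.Hom (Y ⊎ ((X.erase x.1).map ChuOb.pos).erase ⟨k, x.2.symm⟩) (X.obj x.1).neg)
    (h : ∀ x, E.sub (c x) (X.obj x.1).pair (.refl _)
      ((Fam.Iso.cone Y (X.map ChuOb.pos) k x)) = b) :
    ∃ f : E.Hom Y A, E.sub f t.under (.insert (X.map ChuOb.pos) k hA) (.refl _) = b ∧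
      ∀ x : (X.erase k).I,
        E.sub f (t.comp x.1) (.insert ((X.erase x.1).map ChuOb.pos) ⟨k, x.2.symm⟩ hA) (.refl _) = c x

/-- A morphism `t` is universal at `k` if its component at `k` is a tensor product and the positive
component of the entry at `k` has the corresponding universal property. -/
theorem universal_of {X : Fam (ChuOb E bot)} {t : ChuHom E bot X} {k : X.I}
    (ht : Multicat.TensorUniversal (t.comp k)) (hc : t.ConeUniversal k) : t.Universal k := by
  classical
  intro Y Z l h c
  suffices H : Function.Bijective fun g : ChuHom E bot Y => cut₀ t g k l h by
    refine Function.Bijective.comp (g := fun g => perm c g) ?_ H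
    refine Function.bijective_iff_has_inverse.mpr ⟨perm c.symm, fun f => ?_, fun f => ?_⟩
    · exact (perm_perm _ _ _).trans
        ((perm_congr fun i => c.equiv.symm_apply_apply i).trans (perm_refl f))
    · exact (perm_perm _ _ _).trans
        ((perm_congr fun i => c.equiv.apply_symm_apply i).trans (perm_refl f))
  -- The components of a preimage at entries other than `l`, and the one into `bot`, come from the
  -- universal property of `t.comp k`; the component at `l` comes from that of the positive component.
  have hu := ht.bijective (W := bot) (.insert (Y.map ChuOb.pos) l h.neg_eq.symm)
      (.mapAppend ChuOb.pos (X.erase k) (Y.erase l))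
  have hy : ∀ y : (Y.erase l).I, Function.Bijective
      fun g : E.Hom ((Y.erase y.1).map ChuOb.pos) (Y.obj y.1).neg => E.sub (t.comp k) g
        (.insert ((Y.erase y.1).map ChuOb.pos) ⟨l, y.2.symm⟩ h.neg_eq.symm)
        (.trans (Fam.Iso.mapAppend ChuOb.pos (X.erase k) ((Y.erase y.1).erase ⟨l, y.2.symm⟩))
          ((Fam.Iso.eraseInr (X.erase k) Y l y).map _)) := fun y => ht.bijective _ _
  constructor
  · intro g g' hg
    have e1 : g.under = g'.under := hu.1 (congrArg under hg)
    have e2 : ∀ y : (Y.erase l).I, g.comp y.1 = g'.comp y.1 := fun y =>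
      (hy y).1 (congrFun (congrArg comp hg) (.inr y))
    have e3 : g.comp l = g'.comp l := by
      apply hc.hom_ext h.pos_eq
      · apply (E.perm_bijective ((Fam.Iso.comm _ _).trans
          (.mapAppend ChuOb.pos (X.erase k) (Y.erase l))) rfl).1
        refine (E.perm_sub_refl _ _ _ _).trans (Eq.trans ?_ (E.perm_sub_refl _ _ _ _).symm)
        exact (sub_under t g k l h).trans ((congrArg under hg).trans (sub_under t g' k l h).symm)
      · intro x
        apply (E.perm_bijective (.trans (Fam.Iso.mapAppend ChuOb.pos (Y.erase l)
          ((X.erase x.1).erase ⟨k, x.2.symm⟩))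
          ((Fam.Iso.eraseInl X (Y.erase l) k x).map _)) rfl).1
        refine (E.perm_sub_refl _ _ _ _).trans (Eq.trans ?_ (E.perm_sub_refl _ _ _ _).symm)
        exact congrFun (congrArg comp hg) (.inl x)
    apply ChuHom.ext e1
    funext m
    by_cases hm : m = l
    · subst hm; exact e3
    · exact e2 ⟨m, hm⟩
  · intro d
    obtain ⟨gu, hgu⟩ := hu.2 d.under
    choose gy hgy using fun y => (hy y).2 (d.comp (.inr y))
    obtain ⟨b, hb⟩ := (E.perm_bijective ((Fam.Iso.comm _ _).trans
      (.mapAppend ChuOb.pos (X.erase k) (Y.erase l))) rfl).2 d.under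
    choose cx hcx using fun x : (X.erase k).I => (E.perm_bijective
      (Fam.Iso.trans (Fam.Iso.mapAppend ChuOb.pos (Y.erase l)
        ((X.erase x.1).erase ⟨k, x.2.symm⟩))
        ((Fam.Iso.eraseInl X (Y.erase l) k x).map _)) rfl).2 (d.comp (.inl x))
    obtain ⟨gl, hgl, hgx⟩ := hc.lift h.pos_eq (Y := (Y.erase l).map ChuOb.pos) b cx (fun x => by
      apply (E.perm_bijective ((Fam.Iso.comm _ _).trans
        (.mapAppend ChuOb.pos (X.erase k) (Y.erase l))) rfl).1
      rw [hb, ← d.compat_sub (.inl x), ← hcx, E.sub_perm_left]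
      symm
      apply E.sub_eq_perm
      · rfl
      · rintro (i | i) <;> rfl
      · intro i j _; rfl)
    have hgl' : E.sub gl t.under (.insert (X.map ChuOb.pos) k h.pos_eq)
        ((Fam.Iso.comm _ _).trans (.mapAppend ChuOb.pos (X.erase k) (Y.erase l))) = d.under := by
      rw [← hb, ← hgl]
      exact (E.perm_sub_refl _ _ _ _).symm
    let gc : ∀ m : Y.I, E.Hom ((Y.erase m).map ChuOb.pos) (Y.obj m).neg := fun m =>
      if hm : m = l then hm ▸ gl else gy ⟨m, hm⟩
    have gcl : gc l = gl := dif_pos rfl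
    have gcy : ∀ y : (Y.erase l).I, gc y.1 = gy y := fun y => dif_neg y.2
    let g : ChuHom E bot Y := ⟨gu, gc, fun m => by
      refine (E.comp_eq_sub _ _ _).trans ?_
      apply hu.1
      refine Eq.trans ?_ hgu.symm
      by_cases hm : m = l
      · subst hm
        rw [gcl, ← hgl', ← t.compat_sub k, ← h.symm.pair_eq, E.sub_perm]
        dsimp only
        apply E.sub_comm (w := (Fam.Iso.nilLeft _).append (.refl _) |>.trans
          (.append (.single h.neg_eq) (.refl _)))
        · rfl
        · rfl
        · rintro ⟨⟩ -; rfl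
        · rintro ⟨⟩ -; rfl
        · intro i j hij
          obtain rfl : i = j := Subtype.ext hij
          rfl
        · intro i j hij
          obtain rfl : i = j := Subtype.ext hij
          rfl
        · rintro ⟨⟩
      · have e := gcy ⟨m, hm⟩
        dsimp only at e
        rw [e, ← d.compat_sub (.inr ⟨m, hm⟩), ← hgy]
        apply E.sub_assoc
        · rfl
        · intro i; rfl
        · intro i j hij
          exact congrArg Sum.inr (Subtype.ext hij)
        · rintro ⟨⟩ j hij
          exact congrArg Sum.inr (Subtype.ext hij)⟩
    refine ⟨g, ChuHom.ext hgu ?_⟩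
    funext z
    rcases z with x | y
    · rw [← hcx x, ← hgx x]
      refine Eq.trans ?_ (E.perm_sub_refl _ _ _ _).symm
      exact congrArg (fun z => E.sub z _ _ _) gcl
    · rw [← hgy y]
      exact congrArg (fun z => E.sub _ z _ _) (gcy y)

end ChuHom

theorem Function.Bijective.of_eq {α : Type u} {β : Type v} {f g : α → β} (hg : Function.Bijective g)
    (h : ∀ x, f x = g x) : Function.Bijective f := by
  rwa [funext h]

namespace ChuHom
variable {E : Multicat.{u, v}} {bot : E.Ob}

theorem perm_bijective {X Y : Fam (ChuOb E bot)} (σ : X ≅ₗ Y) :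
    Function.Bijective (perm (E := E) (bot := bot) σ) := by
  refine Function.bijective_iff_has_inverse.mpr ⟨perm σ.symm, fun f => ?_, fun f => ?_⟩
  · exact (perm_perm _ _ _).trans
      ((perm_congr fun i => σ.equiv.symm_apply_apply i).trans (perm_refl f))
  · exact (perm_perm _ _ _).trans
      ((perm_congr fun i => σ.equiv.apply_symm_apply i).trans (perm_refl f))

theorem Universal.perm {X X' : Fam (ChuOb E bot)} {t : ChuHom E bot X} {k : X.I}
    (ht : t.Universal k) (σ : X ≅ₗ X') {k' : X'.I} (h : σ.equiv k = k') :
    (t.perm σ).Universal k' := by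
  intro Y Z l d c
  have d' : DualPair (X.obj k) (Y.obj l) := by
    have := σ.obj_eq k
    rw [h] at this
    rwa [this] at d
  convert ht l d' (((σ.erase h).append (.refl _)).trans c) using 2
  exact cut_perm_left σ t _ k l h d' d c

/-- Universality at the only output is the property of a tensor product. -/
theorem Universal.isTensor {S : Fam (ChuOb E bot)} {T : ChuOb E bot}
    {t : (chu E bot).Hom S (.single T)}
    (ht : Universal (X := S ⊎ (Fam.single T).map ChuOb.dual) t (.inr ())) :
    (chu E bot).IsTensor t := by
  intro Γ Δ
  have key := fun c => ht (Y := (.single T ⊎ Γ) ⊎ Δ.map ChuOb.dual)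
    (Z := (S ⊎ Γ) ⊎ (Fam.nil ⊎ Δ).map ChuOb.dual) (.inl (.inl ())) (dualPair T).symm c
  refine (key ((((Fam.Iso.append (.refl S) (.map ChuOb.dual (Fam.Iso.nilLeft (.single T)).symm)).erase
    rfl).append (.refl _)).trans (Chu.cutIso ChuOb.dual S .nil Γ Δ T T))).of_eq fun g => ?_
  exact cut_perm_left (X := S ⊎ (Fam.single T).map ChuOb.dual)
    (Y := (.single T ⊎ Γ) ⊎ Δ.map ChuOb.dual)
    (Fam.Iso.append (.refl S) (.map ChuOb.dual (Fam.Iso.nilLeft (.single T)).symm)) t g (.inr ())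
    (.inl (.inl ())) rfl (dualPair T).symm (dualPair T).symm _

/-- Universality at the only input is the property of a cotensor product. -/
theorem Universal.isCotensor {S : Fam (ChuOb E bot)} {T : ChuOb E bot}
    {t : (chu E bot).Hom (.single T) S}
    (ht : Universal (X := .single T ⊎ S.map ChuOb.dual) t (.inl ())) :
    (chu E bot).IsCotensor t := by
  intro Γ Δ
  have key := fun c => ht (Y := Γ ⊎ (Δ ⊎ .single T).map ChuOb.dual)
    (Z := (Γ ⊎ Fam.nil) ⊎ (Δ ⊎ S).map ChuOb.dual) (.inr (.inr ())) (dualPair T) c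
  refine (key ((Fam.Iso.comm _ _).trans ((Fam.Iso.append (.refl _)
    (((Fam.Iso.append (Fam.Iso.nilRight (.single T)).symm
      (.map ChuOb.dual (.refl S)))).erase rfl)).trans
      (Chu.cutIso ChuOb.dual Γ Δ .nil S T T)))).of_eq fun g => ?_
  exact (cut_perm_right (X := Γ ⊎ (Δ ⊎ .single T).map ChuOb.dual)
    (Y := .single T ⊎ S.map ChuOb.dual)
    (Fam.Iso.append (Fam.Iso.nilRight (.single T)).symm (.map ChuOb.dual (.refl S)))
    g t (.inr (.inr ())) (.inl ()) rfl (dualPair T).symm (dualPair T).symm _).trans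
    (cut_comm _ _ _ _ _ _)

/-- Evaluation of `A` against its dual. -/
noncomputable def counit (A : ChuOb E bot) : (chu E bot).Hom (.single A.dual ⊎ .single A) .nil :=
  perm (X' := (.single A.dual ⊎ .single A) ⊎ Fam.nil.map ChuOb.dual)
    ((Fam.Iso.comm _ _).trans
      ⟨(Equiv.sumEmpty _ Empty).symm, by rintro (_ | _) <;> rfl⟩) (one A)

/-- Composition with the evaluation of `A` against its dual is a mere relabelling. -/
theorem isDual_counit (A : ChuOb E bot) : (chu E bot).IsDual (counit A) := by
  intro Γ Δ
  refine (perm_bijective (E := E) (bot := bot) (X := Γ ⊎ (Δ ⊎ .single A.dual).map ChuOb.dual)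
    (Y := (Γ ⊎ .single A) ⊎ (Δ ⊎ .nil).map ChuOb.dual)
    ⟨⟨fun
        | .inl i => .inl (.inl i)
        | .inr (.inl i) => .inr (.inl i)
        | .inr (.inr _) => .inl (.inr ()),
      fun
        | .inl (.inl i) => .inl i
        | .inl (.inr _) => .inr (.inr ())
        | .inr (.inl i) => .inr (.inl i), by rintro (i | i | i) <;> rfl,
        by rintro ((i | i) | i | ⟨⟨⟩⟩) <;> rfl⟩,
      by rintro (i | i | i); exacts [rfl, rfl, A.dual_dual.symm]⟩).of_eq
    fun g => ?_
  change ChuHom E bot (Γ ⊎ (Δ ⊎ .single A.dual).map ChuOb.dual) at g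
  change cut g (perm _ (one A)) _ _ _ _ = _
  refine (cut_perm_right (X := Γ ⊎ (Δ ⊎ .single A.dual).map ChuOb.dual) _ g (one A) (.inr (.inr ())) (.inr ()) rfl
    (dualPair A.dual).symm _ _).trans ?_
  apply cut_one'
  · rintro ⟨i | i | i, hi⟩
    · rfl
    · rfl
    · exact absurd rfl hi
  · rintro ⟨i | i, hi⟩
    · rfl
    · exact absurd rfl hi

/-- The pairing of `A` exhibits its negative component as an internal hom into the dualizing
object. -/
def NegRep (A : ChuOb E bot) : Prop :=
  Multicat.HomUniversal A.pair (.refl (.single A.pos ⊎ .single A.neg))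

/-- A morphism between objects whose negative components are internal homs is determined by its
component into the dualizing object, which is arbitrary. -/
theorem under_bijective {X : Fam (ChuOb E bot)} (h : ∀ k, NegRep (X.obj k)) :
    Function.Bijective (under : ChuHom E bot X → _) := by
  have hk := fun k => (h k).bijective (.refl _) (.insert (X.map ChuOb.pos) k rfl) rfl
  constructor
  · intro f g hfg
    refine ChuHom.ext hfg (funext fun k => (hk k).1 ?_)
    exact (f.compat_sub k).trans (hfg.trans (g.compat_sub k).symm)
  · intro b
    choose c hc using fun k => (hk k).2 b
    exact ⟨⟨b, c, fun k => (E.comp_eq_sub _ _ _).trans (hc k)⟩, rfl⟩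

/-- When all objects involved are determined by internal homs into the dualizing object, the universal
property of a positive component follows from that of the tensor product. -/
theorem coneUniversal_of_negRep {X : Fam (ChuOb E bot)} {t : ChuHom E bot X} {k : X.I}
    (ht : Multicat.TensorUniversal (t.comp k)) (hX : ∀ x : (X.erase k).I, NegRep (X.obj x.1))
    (hk : NegRep (X.obj k).dual) : t.ConeUniversal k := by
  have key : ∀ Y : Fam E.Ob, Function.Bijective fun f : E.Hom Y (X.obj k).pos =>
      E.sub f t.under (.insert (X.map ChuOb.pos) k rfl) (.refl (Y ⊎ _)) := by
    intro Y
    have h1 := hk.bijective (Y := Y) (.refl _) (.refl _) rfl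
    have h2 := ht.bijective (W := bot) (Y := Y) (.refl _) (.comm _ _)
    convert h2.comp h1 using 2 with f
    dsimp only [Function.comp]
    rw [← t.compat_sub k, E.sub_perm]
    apply E.sub_comm (w := (Fam.Iso.nilLeft _).append (.refl _))
    · rfl
    · rfl
    · rintro ⟨⟩ -; rfl
    · rintro ⟨⟩ -; rfl
    · intro i j hij
      cases hij
      rfl
    · intro i j hij
      obtain rfl : i = j := Subtype.ext hij
      rfl
    · rintro ⟨⟩
  have hc : ∀ (x : (X.erase k).I) (Y : Fam E.Ob), Function.Bijective
      fun c : E.Hom (Y ⊎ ((X.erase x.1).map ChuOb.pos).erase ⟨k, x.2.symm⟩) (X.obj x.1).neg =>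
        E.sub c (X.obj x.1).pair (.refl _) (.cone Y (X.map ChuOb.pos) k x) :=
    fun x Y => (hX x).bijective _ _ rfl
  constructor
  · rintro A rfl Y h h' hu -
    exact (key Y).1 hu
  · rintro A rfl Y b c h
    obtain ⟨f, hf⟩ := (key Y).2 b
    refine ⟨f, hf, fun x => (hc x Y).1 ?_⟩
    refine Eq.trans ?_ (hf.trans (h x).symm)
    rw [← t.compat_sub x.1]
    symm
    apply E.sub_assoc
    · rfl
    · intro i; rfl
    · intro i j hij
      exact congrArg Sum.inr (Subtype.ext hij)
    · intro i j hij
      exact congrArg Sum.inr (Subtype.ext hij)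

end ChuHom

/-! ### Tensor products and star-autonomy of the Chu construction -/

namespace Fam.Iso

/-- Put back an entry that has been erased, in the presence of further entries. -/
noncomputable abbrev insertLeft {C : Type u} (X M : Fam C) (s : X.I) :
    (X.erase s ⊎ M) ⊎ .single (X.obj s) ≅ₗ X ⊎ M :=
  (Fam.Iso.rightComm _ _ _).trans ((insert X s rfl).append (.refl M))

/-- Put back an entry that has been erased, in the presence of earlier entries. -/
noncomputable abbrev insertRight {C : Type u} (Y X : Fam C) (s : X.I) :
    (Y ⊎ X.erase s) ⊎ .single (X.obj s) ≅ₗ Y ⊎ X :=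
  (Fam.Iso.assoc _ _ _).trans (Fam.Iso.append (.refl Y) (insert X s rfl))

/-- Erasing an entry that has just been added changes nothing. -/
noncomputable abbrev eraseRight {C : Type u} (X : Fam C) (A : C) :
    X ≅ₗ (X ⊎ .single A).erase (.inr ()) :=
  ofFun (fun i => ⟨.inl i, by simp⟩)
    ⟨fun i j h => Sum.inl_injective (congrArg Subtype.val h), by
      rintro ⟨i | i, h⟩
      · exact ⟨i, rfl⟩
      · exact absurd rfl h⟩
    (fun _ => rfl)

/-- Adding an entry commutes with erasing another one. -/
noncomputable abbrev eraseLeft {C : Type u} (X : Fam C) (A : C) (s : X.I) :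
    X.erase s ⊎ .single A ≅ₗ (X ⊎ .single A).erase (.inl s) :=
  ofFun (Sum.elim (fun i => ⟨.inl i.1, fun h => i.2 (Sum.inl_injective h)⟩) fun _ => ⟨.inr (), by simp⟩)
    ⟨by
      rintro (⟨i, hi⟩ | i) (⟨j, hj⟩ | j) h
      · obtain rfl := Sum.inl_injective (congrArg Subtype.val h)
        rfl
      · cases congrArg Subtype.val h
      · cases congrArg Subtype.val h
      · rfl, by
      rintro ⟨i | i, h⟩
      · exact ⟨.inl ⟨i, fun e => h (congrArg Sum.inl e)⟩, rfl⟩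
      · exact ⟨.inr (), rfl⟩⟩
    (by rintro (i | i) <;> rfl)

/-- Erasing an added entry after another entry. -/
noncomputable abbrev eraseBoth {C : Type u} (X : Fam C) (A : C) (s : X.I) :
    X.erase s ≅ₗ ((X ⊎ .single A).erase (.inl s)).erase ⟨.inr (), by simp⟩ :=
  ofFun (fun i => ⟨⟨.inl i.1, fun h => i.2 (Sum.inl_injective h)⟩,
      fun h => by cases congrArg Subtype.val h⟩)
    ⟨fun i j h => Subtype.ext (Sum.inl_injective (congrArg (fun z => z.1.1) h)), by
      rintro ⟨⟨i | i, h⟩, h'⟩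
      · exact ⟨⟨i, fun e => h (congrArg Sum.inl e)⟩, rfl⟩
      · exact absurd rfl h'⟩
    (fun _ => rfl)

end Fam.Iso

namespace ChuHom
variable {E : Multicat.{u, v}} {bot : E.Ob}

/-- `N` is universal among the objects with the structure that the negative component of a tensor
product of the list `S` has. -/
structure IsCone (S : Fam (ChuOb E bot)) {N : E.Ob}
    (b : E.Hom (S.map ChuOb.pos ⊎ .single N) bot)
    (n : ∀ s, E.Hom ((S.map ChuOb.pos).erase s ⊎ .single N) (S.obj s).neg) : Prop where
  comm (s : S.I) : E.sub (n s) (S.obj s).pair (.refl _)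
    (.insertLeft (S.map ChuOb.pos) (.single N) s) = b
  hom_ext {Y : Fam E.Ob} {h h' : E.Hom Y N}
    (hb : E.sub h b (.refl _) (.refl _) = E.sub h' b (.refl _) (.refl _))
    (hn : ∀ s, E.sub h (n s) (.refl _) (.refl _) = E.sub h' (n s) (.refl _) (.refl _)) : h = h'
  lift {Y : Fam E.Ob} (b' : E.Hom (Y ⊎ S.map ChuOb.pos) bot)
    (n' : ∀ s, E.Hom (Y ⊎ (S.map ChuOb.pos).erase s) (S.obj s).neg)
    (h : ∀ s, E.sub (n' s) (S.obj s).pair (.refl _) (.insertRight Y (S.map ChuOb.pos) s) = b') :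
    ∃ f : E.Hom Y N, E.sub f b (.refl _) (.refl _) = b' ∧
      ∀ s, E.sub f (n s) (.refl _) (.refl _) = n' s

/-- The universal cone is a wide pullback, over the internal hom from the positive components into
`bot`, of the internal homs into the negative components. -/
theorem exists_isCone (hE : E.HasHoms) (hp : E.HasWidePullbacks) (S : Fam (ChuOb E bot)) :
    ∃ (N : E.Ob) (b : E.Hom (S.map ChuOb.pos ⊎ .single N) bot)
      (n : ∀ s, E.Hom ((S.map ChuOb.pos).erase s ⊎ .single N) (S.obj s).neg), IsCone S b n := by
  obtain ⟨L, e₀, h₀⟩ := hE.exists_hom (S.map ChuOb.pos) bot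
  choose H e he using fun s => hE.exists_hom ((S.map ChuOb.pos).erase s) (S.obj s).neg
  choose f hf using fun s => (h₀.bijective (Y := .single (H s)) (.refl _) (.comm _ _) rfl).2
    (E.sub (e s) (S.obj s).pair (.refl _) (.insertLeft (S.map ChuOb.pos) (.single (H s)) s))
  obtain ⟨N, p₀, p, hN⟩ := hp f
  have key : ∀ (s : S.I) {Y : Fam E.Ob} (a : E.Hom Y (H s)) {a₀ : E.Hom Y L},
      Multicat.post a (f s) = a₀ → ∀ {Θ : Fam E.Ob} (c : Y ⊎ S.map ChuOb.pos ≅ₗ Θ),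
      E.sub (E.sub a (e s) (.refl _) (.refl _)) (S.obj s).pair (.refl _)
        ((Fam.Iso.insertRight Y (S.map ChuOb.pos) s).trans c) = E.sub a₀ e₀ (.refl _) c := by
    rintro s Y a a₀ rfl Θ c
    refine Eq.trans (b := E.sub a (E.sub (e s) (S.obj s).pair (.refl _)
      (.insertLeft (S.map ChuOb.pos) (.single (H s)) s)) (.refl _) c) ?_ ?_
    · symm
      apply E.sub_assoc
      · rfl
      · intro i; rfl
      · rintro i j h
        obtain rfl := Sum.inl_injective h
        rfl
      · rintro i j h
        obtain rfl := Sum.inl_injective h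
        rfl
    · rw [← hf]
      apply E.sub_assoc
      · rfl
      · intro i; rfl
      · rintro ⟨⟩
      · rintro i j h; cases h; rfl
  refine ⟨N, E.sub p₀ e₀ (.refl _) (.comm _ _), fun s => E.sub (p s) (e s) (.refl _) (.comm _ _),
    ⟨fun s => ?_, fun {Y h h'} hb hn => ?_, fun {Y} b' n' hn => ?_⟩⟩
  · rw [← key s (p s) (hN.comm s), ← E.perm_sub_refl (p s), E.sub_perm_left]
    apply E.sub_congr
    · rfl
    · rintro (i | i) <;> rfl
    · rintro i j -; rfl
  · have e1 : ∀ (h : E.Hom Y N), E.sub h (E.sub p₀ e₀ (.refl _) (.comm _ _)) (.refl _) (.refl _) =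
        E.sub (Multicat.post h p₀) e₀ (.refl _) (.refl _) := by
      intro h
      apply E.sub_assoc
      · rfl
      · intro i; rfl
      · rintro ⟨⟩
      · rintro i j h; cases h; rfl
    have e2 : ∀ (h : E.Hom Y N) s, E.sub h (E.sub (p s) (e s) (.refl _) (.comm _ _)) (.refl _) (.refl _) =
        E.sub (Multicat.post h (p s)) (e s) (.refl _) (.refl _) := by
      intro h s
      apply E.sub_assoc
      · rfl
      · intro i; rfl
      · rintro ⟨⟩
      · rintro i j h; cases h; rfl
    refine hN.hom_ext ((h₀ Y).1 ?_) fun s => (he s Y).1 ?_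
    · exact (e1 h).symm.trans (hb.trans (e1 h'))
    · exact (e2 h s).symm.trans ((hn s).trans (e2 h' s))
  · obtain ⟨a₀, ha₀⟩ := (h₀ Y).2 b'
    choose a ha using fun s => (he s Y).2 (n' s)
    obtain ⟨c, hc₀, hc⟩ := hN.lift a₀ a fun s => (h₀ Y).1 (by
      refine (key s (a s) rfl (.refl _)).symm.trans (Eq.trans ?_ ha₀.symm)
      refine Eq.trans ?_ (hn s)
      exact congrArg (fun z => E.sub z _ _ _) (ha s))
    refine ⟨c, ?_, fun s => ?_⟩
    · refine Eq.trans ?_ ha₀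
      rw [← hc₀]
      apply E.sub_assoc
      · rfl
      · intro i; rfl
      · rintro ⟨⟩
      · rintro i j h; cases h; rfl
    · refine Eq.trans ?_ (ha s)
      rw [← hc]
      apply E.sub_assoc
      · rfl
      · intro i; rfl
      · rintro ⟨⟩
      · rintro i j h; cases h; rfl

/-- A tensor product of the positive components and a universal cone on the negative components make
a tensor product. -/
theorem IsCone.exists_universal {S : Fam (ChuOb E bot)} {N T₀ : E.Ob}
    {b : E.Hom (S.map ChuOb.pos ⊎ .single N) bot}
    {n : ∀ s, E.Hom ((S.map ChuOb.pos).erase s ⊎ .single N) (S.obj s).neg} (hb : IsCone S b n)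
    {t₀ : E.Hom (S.map ChuOb.pos) T₀} (ht : Multicat.TensorUniversal t₀) :
    ∃ (T : ChuOb E bot) (t : ChuHom E bot (S ⊎ (Fam.single T).map ChuOb.dual)),
      t.Universal (.inr ()) := by
  obtain ⟨q, hq⟩ := (ht.bijective (W := bot) (Y := .single N)
    (.comm (.single N) (.single T₀)) (.refl _)).2 b
  let T : ChuOb E bot := ⟨T₀, N, q⟩
  let X := S ⊎ (Fam.single T).map ChuOb.dual
  let v₀ : S.map ChuOb.pos ≅ₗ (X.erase (.inr ())).map ChuOb.pos :=
    (Fam.Iso.eraseRight S T.dual).map _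
  let v : ∀ s, (S.map ChuOb.pos).erase s ⊎ .single N ≅ₗ (X.erase (.inl s)).map ChuOb.pos := fun s =>
    (Fam.Iso.mapAppend ChuOb.pos (S.erase s) (.single T.dual)).trans
      ((Fam.Iso.eraseLeft S T.dual s).map _)
  let w : ∀ s : S.I, (S.map ChuOb.pos).erase s ≅ₗ
      ((X.erase (.inl s)).map ChuOb.pos).erase ⟨.inr (), by simp⟩ := fun s =>
    (Fam.Iso.eraseBoth S T.dual s).map ChuOb.pos
  let t : ChuHom E bot X :=
    { under := E.perm (.mapAppend ChuOb.pos S (.single T.dual)) rfl b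
      comp := fun
        | .inl s => E.perm (v s) rfl (n s)
        | .inr _ => E.perm v₀ rfl t₀
      compat := by
        rintro (s | s)
        · refine (E.comp_eq_sub _ _ _).trans ?_
          rw [← hb.comm s]
          refine (E.sub_perm_left (v s) rfl (n s) _ _ _).trans ?_
          apply E.sub_eq_perm
          · rfl
          · rintro (i | i) <;> rfl
          · rintro i j -; rfl
        · refine (E.comp_eq_sub _ _ _).trans ?_
          rw [← hq]
          refine E.sub_perm_perm (h := rfl) (h' := rfl) ?_ ?_ ?_
          · rfl
          · intro i; rfl
          · rintro i j -; rfl }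
  have tu : ∀ {Y : Fam E.Ob} (h : E.Hom Y N), E.sub h t.under
      (.insert (X.map ChuOb.pos) (.inr ()) rfl) (.refl _) =
      E.perm (Fam.Iso.append (.refl Y) v₀) rfl (E.sub h b (.refl _) (.refl _)) := by
    intro Y h
    refine (E.sub_perm _ _ _ _ _).trans ?_
    apply E.sub_eq_perm
    · rfl
    · intro i; rfl
    · rintro ⟨_ | _, hi⟩ j h
      · cases h; rfl
      · exact absurd rfl hi
  have tc : ∀ {Y : Fam E.Ob} (s : S.I) (h : E.Hom Y N), E.sub h (t.comp (.inl s))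
      (.insert ((X.erase (.inl s)).map ChuOb.pos) ⟨.inr (), by simp⟩ rfl) (.refl _) =
      E.perm (Fam.Iso.append (.refl Y) (w s)) rfl
        (E.sub h (n s) (.refl _) (.refl _)) := by
    intro Y s h
    refine (E.sub_perm _ _ _ _ _).trans ?_
    apply E.sub_eq_perm
    · exact (v s).symm_apply_eq rfl
    · intro i; rfl
    · rintro ⟨⟨_ | _, hi⟩, hi'⟩ j h
      · have h' := congrArg (v s).equiv h
        cases (Equiv.apply_symm_apply _ _).symm.trans h'
        rfl
      · exact absurd rfl hi'
  refine ⟨T, t, universal_of ?_ ?_⟩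
  · intro Y W
    have := ht.bijective (W := W) (Y := Y) (.refl _) (v₀.append (.refl Y))
    refine this.of_eq fun g => ?_
    refine (E.perm_refl _).symm.trans ((E.comp_eq_sub _ _ _).trans ?_)
    exact E.sub_perm_left v₀ rfl t₀ _ _ _
  · constructor
    · rintro A rfl Y h h' hu hc
      refine hb.hom_ext ((E.perm_bijective _ rfl).1 ((tu h).symm.trans (hu.trans (tu h'))))
        fun s => (E.perm_bijective _ rfl).1
          ((tc s h).symm.trans ((hc ⟨.inl s, by simp⟩).trans (tc s h')))
    · rintro A rfl Y b' n' h
      obtain ⟨b'', rfl⟩ := (E.perm_bijective (Fam.Iso.append (.refl Y) v₀) rfl).2 b'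
      choose m hm using fun s => (E.perm_bijective (Fam.Iso.append (.refl Y) (w s)) rfl).2 (n' ⟨.inl s, by simp⟩)
      obtain ⟨f, hf, hf'⟩ := hb.lift b'' m fun s => by
        apply (E.perm_bijective (Fam.Iso.append (.refl Y) v₀) rfl).1
        rw [← h ⟨.inl s, by simp⟩, ← hm]
        refine Eq.trans ?_ (E.sub_perm_left _ rfl _ _ _ _).symm
        symm
        apply E.sub_eq_perm
        · rfl
        · rintro (i | i) <;> rfl
        · rintro i j -; rfl
      refine ⟨f, (tu f).trans (congrArg _ hf), ?_⟩
      rintro ⟨s | s, hs⟩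
      · exact (tc s f).trans ((congrArg _ (hf' s)).trans (hm s))
      · exact absurd rfl hs

theorem exists_isTensor (hE : E.HasHoms) (hp : E.HasWidePullbacks) (ht : E.HasWeakTensors)
    (S : Fam (ChuOb E bot)) : ∃ (T : ChuOb E bot) (t : (chu E bot).Hom S (.single T)),
      Universal (X := S ⊎ (Fam.single T).map ChuOb.dual) t (.inr ()) := by
  obtain ⟨N, b, n, hb⟩ := exists_isCone hE hp S
  obtain ⟨T, t, h⟩ := ht (S.map ChuOb.pos)
  exact hb.exists_universal (h.tensorUniversal hE)

/-- The dual of a tensor product of duals is a cotensor product. -/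
theorem exists_isCotensor (hE : E.HasHoms) (hp : E.HasWidePullbacks) (ht : E.HasWeakTensors)
    (S : Fam (ChuOb E bot)) : ∃ (T : ChuOb E bot) (t : (chu E bot).Hom (.single T) S),
      (chu E bot).IsCotensor t := by
  obtain ⟨T, t, h⟩ := exists_isTensor hE hp ht (S.map ChuOb.dual)
  have h' := h.perm (.comm (S.map ChuOb.dual) (.single T.dual)) (k' := .inl ()) rfl
  exact ⟨T.dual, _, Universal.isCotensor (T := T.dual) h'⟩

/-- A closed multicategory with weak tensor products and pullbacks has a star-autonomous Chu
construction. -/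
theorem chu_isStarAutonomous (hE : E.HasHoms) (hp : E.HasWidePullbacks) (ht : E.HasWeakTensors) :
    (chu E bot).IsStarAutonomous where
  tensor _ _ := (exists_isTensor hE hp ht _).imp fun _ ⟨t, h⟩ => ⟨t, h.isTensor⟩
  unit := (exists_isTensor hE hp ht _).imp fun _ ⟨t, h⟩ => ⟨t, h.isTensor⟩
  cotensor _ _ := exists_isCotensor hE hp ht _
  counit := exists_isCotensor hE hp ht _
  dual A := ⟨A.dual, counit A, isDual_counit A⟩

end ChuHom

/-! ### Maps of modules -/

namespace Fam.Iso

/-- A concatenation of one list. -/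
abbrev sigmaOne {C : Type u} (hK : Finite Unit) (s : Unit → Fam C) : Fam.sigma hK s ≅ₗ s () :=
  ⟨⟨fun p => p.2, fun i => ⟨(), i⟩, fun _ => rfl, fun _ => rfl⟩, fun _ => rfl⟩

/-- A concatenation of lists, the last of which is split off. -/
abbrev sigmaSnoc {C : Type u} {K : Type} (hK : Finite K) (hK' : Finite (K ⊕ Unit))
    (s : K ⊕ Unit → Fam C) : Fam.sigma hK (fun k => s (.inl k)) ⊎ s (.inr ()) ≅ₗ Fam.sigma hK' s :=
  ⟨⟨Sum.elim (fun p => ⟨.inl p.1, p.2⟩) fun i => ⟨.inr (), i⟩,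
    fun p => match p with
      | ⟨.inl k, i⟩ => .inl ⟨k, i⟩
      | ⟨.inr _, i⟩ => .inr i,
    by rintro (i | i) <;> rfl, by rintro ⟨k | k, i⟩ <;> rfl⟩,
    by rintro (i | i) <;> rfl⟩

end Fam.Iso

/-- Maps of modules. -/
structure ModuleMap {P : Polycat.{u, v}} (U : PModule.{u, v, w₁} P) (V : PModule.{u, v, w₂} P) where
  app {Γ Δ : Fam P.Ob} : U.obj Γ Δ → V.obj Γ Δ
  map_perm {Γ Γ' Δ Δ' : Fam P.Ob} (σ : Γ ≅ₗ Γ') (τ : Δ ≅ₗ Δ') (x : U.obj Γ Δ) :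
    app (U.perm σ τ x) = V.perm σ τ (app x)
  map_lact {Γ Δ Φ Ψ : Fam P.Ob} {A : P.Ob} (f : P.Hom Γ (Δ ⊎ .single A))
    (x : U.obj (.single A ⊎ Φ) Ψ) : app (U.lact.comp f x) = V.lact.comp f (app x)
  map_ract {Γ Δ Φ Ψ : Fam P.Ob} {A : P.Ob} (x : U.obj Γ (Δ ⊎ .single A))
    (f : P.Hom (.single A ⊎ Φ) Ψ) : app (U.ract.comp x f) = V.ract.comp (app x) f

namespace ModuleMap
variable {P : Polycat.{u, v}} {U : PModule.{u, v, w₁} P} {V : PModule.{u, v, w₂} P}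
  (m : ModuleMap U V)

theorem map_lact_at {Γ Γ' Δ Δ' D G Φ Ψ : Fam P.Ob} {A : P.Ob} (f : P.Hom Γ D) (x : U.obj G Ψ)
    (a : Δ ⊎ .single A ≅ₗ D) (a' : .single A ⊎ Φ ≅ₗ G) (b : Γ ⊎ Φ ≅ₗ Γ') (c : Δ ⊎ Ψ ≅ₗ Δ') :
    m.app (U.lact.compAt f x a a' b c) = V.lact.compAt f (m.app x) a a' b c := by
  rw [Act.compAt, m.map_perm, m.map_lact, m.map_perm]; rfl

theorem map_ract_at {Γ Γ' Δ Δ' D G Φ Ψ : Fam P.Ob} {A : P.Ob} (x : U.obj Γ D) (f : P.Hom G Ψ)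
    (a : Δ ⊎ .single A ≅ₗ D) (a' : .single A ⊎ Φ ≅ₗ G) (b : Γ ⊎ Φ ≅ₗ Γ') (c : Δ ⊎ Ψ ≅ₗ Δ') :
    m.app (U.ract.compAt x f a a' b c) = V.ract.compAt (m.app x) f a a' b c := by
  rw [Act.compAt, m.map_perm, m.map_ract, m.map_perm]; rfl

end ModuleMap

namespace JModule
variable {P : Polycat.{u, v}} {J : P.Distinguished}

namespace MultiHom

/-- Unary multimorphisms, as functions of one element. -/
def app {U V : JModule P J} (φ : MultiHom (.single U) V) {Γ Δ : Fam P.Ob}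
    (x : U.toPModule.obj Γ Δ) : V.toPModule.obj Γ Δ :=
  V.toPModule.perm (Fam.Iso.sigmaOne _ fun _ => Γ) (Fam.Iso.sigmaOne _ fun _ => Δ)
    (φ.toFun fun _ => ⟨Γ, Δ, x⟩)

/-- Unary multimorphisms are maps of modules. -/
def toMap {U V : JModule P J} (φ : MultiHom (.single U) V) :
    ModuleMap U.toPModule V.toPModule where
  app := φ.app
  map_perm σ τ x := by
    refine Eq.trans ?_ (V.toPModule.perm_perm _ _ _ _ _).symm
    symm
    refine φ.perm_eq (x := fun _ => ⟨_, _, x⟩) (y := fun _ => ⟨_, _, U.toPModule.perm σ τ x⟩)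
      (fun _ => ⟨σ, τ, rfl⟩) ?_ ?_
    · intro k i; rfl
    · intro k i; rfl
  map_lact {Γ Δ Φ Ψ A} f x := by
    refine Eq.trans ?_ ((V.toPModule.lact.at_eq (b := .refl _) (c := .refl _)).trans
      (V.toPModule.perm_refl _))
    symm
    refine φ.lact_eq (x := fun _ => ⟨_, _, x⟩) (y := fun _ => ⟨_, _, U.toPModule.lact.comp f x⟩) () (fun i => absurd rfl i.2)
      ⟨Φ, .refl _, .refl _, .refl _, ?_⟩ ?_ ?_ ?_ ?_ ?_ ?_ ?_
    · exact U.toPModule.lact.at_eq.trans (U.toPModule.perm_refl _)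
    · rfl
    · intro i; rfl
    · rintro i j h; cases h; rfl
    · rintro i ⟨l, hl⟩; exact absurd rfl hl
    · intro i; rfl
    · intro i; rfl
    · rintro ⟨l, hl⟩; exact absurd rfl hl
  map_ract {Γ Δ Φ Ψ A} x f := by
    refine Eq.trans ?_ ((V.toPModule.ract.at_eq (b := .refl _) (c := .refl _)).trans
      (V.toPModule.perm_refl _))
    symm
    refine φ.ract_eq (x := fun _ => ⟨_, _, x⟩) (y := fun _ => ⟨_, _, U.toPModule.ract.comp x f⟩) () (fun i => absurd rfl i.2)
      ⟨Δ, .refl _, .refl _, .refl _, ?_⟩ ?_ ?_ ?_ ?_ ?_ ?_ ?_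
    · exact U.toPModule.ract.at_eq.trans (U.toPModule.perm_refl _)
    · rfl
    · intro i; rfl
    · rintro i j h; cases h; rfl
    · rintro i ⟨l, hl⟩; exact absurd rfl hl
    · intro i; rfl
    · intro i; rfl
    · rintro ⟨l, hl⟩; exact absurd rfl hl

/-- Composition with a map of modules. -/
def map {Γ : Fam (JModule P J)} {U V : JModule P J} (φ : MultiHom Γ U)
    (m : ModuleMap U.toPModule V.toPModule) : MultiHom Γ V where
  toFun x := m.app (φ.toFun x)
  map_perm x y e := by rw [← m.map_perm, φ.map_perm]
  map_lact x y k e Φ Ψ A f s := by rw [← m.map_lact_at, φ.map_lact x y k e f s]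
  map_ract x y k e Φ Ψ A f s := by rw [← m.map_ract_at, φ.map_ract x y k e f s]

theorem post_toFun {Γ : Fam (JModule P J)} {U V : JModule P J} (φ : MultiHom Γ U)
    (ψ : MultiHom (.single U) V) (x : ∀ k, Elt (Γ.obj k)) :
    (Multicat.post (E := jmod P J) φ ψ).toFun x = ψ.app (φ.toFun x) := by
  refine (V.toPModule.perm_perm _ _ _ _ _).trans ((V.toPModule.perm_perm _ _ _ _ _).trans ?_)
  apply V.toPModule.perm_congr
  · rintro ⟨⟨⟩, i⟩; rfl
  · rintro ⟨⟨⟩, i⟩; rfl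

/-- A map of modules as a unary multimorphism. -/
noncomputable def ofMap {U V : JModule P J} (m : ModuleMap U.toPModule V.toPModule) :
    MultiHom (.single U) V := (MultiHom.id U).map m

theorem ofMap_app {U V : JModule P J} (m : ModuleMap U.toPModule V.toPModule) {Γ Δ : Fam P.Ob}
    (x : U.toPModule.obj Γ Δ) : (ofMap m).app x = m.app x := by
  refine (m.map_perm _ _ _).symm.trans (congrArg m.app ?_)
  refine (U.toPModule.perm_perm _ _ _ _ _).trans (U.toPModule.perm_id' ?_ ?_)
  · intro i; rfl
  · intro i; rfl

theorem post_ofMap {Γ : Fam (JModule P J)} {U V : JModule P J} (φ : MultiHom Γ U)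
    (m : ModuleMap U.toPModule V.toPModule) :
    Multicat.post (E := jmod P J) φ (ofMap m) = φ.map m :=
  MultiHom.ext (funext fun x => (post_toFun φ (ofMap m) x).trans (ofMap_app m _))

end MultiHom
end JModule

/-! ### Pullbacks of modules -/

namespace PModule
variable {P : Polycat.{u, v}} {ι : Type} {D : PModule.{u, v, max 1 u v} P}
  {B : ι → PModule.{u, v, max 1 u v} P}

/-- Wide pullbacks of modules are computed pointwise. -/
def widePullback (f : ∀ i, ModuleMap (B i) D) : PModule.{u, v, max 1 u v} P where
  obj Γ Δ := {x : D.obj Γ Δ × (∀ i, (B i).obj Γ Δ) // ∀ i, (f i).app (x.2 i) = x.1}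
  perm σ τ x := ⟨⟨D.perm σ τ x.1.1, fun i => (B i).perm σ τ (x.1.2 i)⟩, fun i => by
    rw [(f i).map_perm, x.2]⟩
  perm_refl x := Subtype.ext (Prod.ext (D.perm_refl _) (funext fun i => (B i).perm_refl _))
  perm_perm σ σ' τ τ' x := Subtype.ext (Prod.ext (D.perm_perm _ _ _ _ _)
    (funext fun i => (B i).perm_perm _ _ _ _ _))
  lact := ⟨fun g x => ⟨⟨D.lact.comp g x.1.1, fun i => (B i).lact.comp g (x.1.2 i)⟩, fun i => by
      rw [(f i).map_lact, x.2]⟩,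
    fun σ τ ρ κ g x => Subtype.ext (Prod.ext (D.lact.comp_perm σ τ ρ κ g x.1.1)
      (funext fun i => (B i).lact.comp_perm σ τ ρ κ g (x.1.2 i)))⟩
  ract := ⟨fun x g => ⟨⟨D.ract.comp x.1.1 g, fun i => (B i).ract.comp (x.1.2 i) g⟩, fun i => by
      rw [(f i).map_ract, x.2]⟩,
    fun σ τ ρ κ x g => Subtype.ext (Prod.ext (D.ract.comp_perm σ τ ρ κ x.1.1 g)
      (funext fun i => (B i).ract.comp_perm σ τ ρ κ (x.1.2 i) g))⟩
  id_lact x := Subtype.ext (Prod.ext (D.id_lact _) (funext fun i => (B i).id_lact _))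
  ract_id x := Subtype.ext (Prod.ext (D.ract_id _) (funext fun i => (B i).ract_id _))
  assoc_left x g h := Subtype.ext (Prod.ext (D.assoc_left _ _ _) (funext fun i => (B i).assoc_left _ _ _))
  assoc_mid g x h := Subtype.ext (Prod.ext (D.assoc_mid _ _ _) (funext fun i => (B i).assoc_mid _ _ _))
  assoc_right g h x := Subtype.ext (Prod.ext (D.assoc_right _ _ _) (funext fun i => (B i).assoc_right _ _ _))
  out_left x g h := Subtype.ext (Prod.ext (D.out_left _ _ _) (funext fun i => (B i).out_left _ _ _))
  out_mid g x h := Subtype.ext (Prod.ext (D.out_mid _ _ _) (funext fun i => (B i).out_mid _ _ _))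
  in_left x g h := Subtype.ext (Prod.ext (D.in_left _ _ _) (funext fun i => (B i).in_left _ _ _))
  in_right g h x := Subtype.ext (Prod.ext (D.in_right _ _ _) (funext fun i => (B i).in_right _ _ _))

theorem widePullback_bijective {α : Type u} {β : Type v} {α' : ι → Type u'} {β' : ι → Type v'}
    {p : α → β} {p' : ∀ i, α' i → β' i} {f : ∀ i, α' i → α} {g : ∀ i, β' i → β}
    (hp : Function.Bijective p) (hp' : ∀ i, Function.Bijective (p' i))
    (h : ∀ i x, g i (p' i x) = p (f i x))
    (q : {x : α × (∀ i, α' i) // ∀ i, f i (x.2 i) = x.1} →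
      {x : β × (∀ i, β' i) // ∀ i, g i (x.2 i) = x.1})
    (hq : ∀ x, (q x).1 = (p x.1.1, fun i => p' i (x.1.2 i))) : Function.Bijective q := by
  constructor
  · intro x y hxy
    have := (hq x).symm.trans ((congrArg Subtype.val hxy).trans (hq y))
    exact Subtype.ext (Prod.ext (hp.1 (congrArg Prod.fst this))
      (funext fun i => (hp' i).1 (congrFun (congrArg Prod.snd this) i)))
  · rintro ⟨⟨y, z⟩, hy⟩
    obtain ⟨x, rfl⟩ := hp.2 y
    choose w hw using fun i => (hp' i).2 (z i)
    obtain rfl : (fun i => p' i (w i)) = z := funext hw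
    exact ⟨⟨⟨x, w⟩, fun i => hp.1 ((h i _).symm.trans (hy i))⟩, Subtype.ext (hq _)⟩

theorem widePullback_respectsTensor (f : ∀ i, ModuleMap (B i) D) {S : Fam P.Ob} {T : P.Ob}
    {t : P.Hom S (.single T)} (hD : D.RespectsTensor t) (hB : ∀ i, (B i).RespectsTensor t) :
    (widePullback f).RespectsTensor t := fun Γ Δ =>
  widePullback_bijective (hD Γ Δ) (fun i => hB i Γ Δ) (fun i x => (f i).map_lact _ x) _ fun _ => rfl

theorem widePullback_respectsCotensor (f : ∀ i, ModuleMap (B i) D) {S : Fam P.Ob} {T : P.Ob}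
    {t : P.Hom (.single T) S} (hD : D.RespectsCotensor t) (hB : ∀ i, (B i).RespectsCotensor t) :
    (widePullback f).RespectsCotensor t := fun Γ Δ =>
  widePullback_bijective (hD Γ Δ) (fun i => hB i Γ Δ) (fun i x => (f i).map_ract x _) _ fun _ => rfl

end PModule

namespace JModule
variable {P : Polycat.{u, v}} {J : P.Distinguished}

theorem hasWidePullbacks : (jmod P J).HasWidePullbacks := by
  intro ι D B f
  change JModule P J at D
  change ι → JModule P J at B
  let g := fun i => (f i : MultiHom (.single (B i)) D).toMap
  let Q : JModule P J := ⟨PModule.widePullback g,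
    ⟨fun h => PModule.widePullback_respectsTensor g (D.respects.tensor h) fun i => (B i).respects.tensor h,
     fun h => PModule.widePullback_respectsTensor g (D.respects.unit h) fun i => (B i).respects.unit h,
     fun h => PModule.widePullback_respectsCotensor g (D.respects.cotensor h) fun i => (B i).respects.cotensor h,
     fun h => PModule.widePullback_respectsCotensor g (D.respects.counit h) fun i => (B i).respects.counit h⟩⟩
  let m₀ : ModuleMap Q.toPModule D.toPModule :=
    ⟨fun x => x.1.1, fun _ _ _ => rfl, fun _ _ => rfl, fun _ _ => rfl⟩
  let m : ∀ i, ModuleMap Q.toPModule (B i).toPModule := fun i =>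
    ⟨fun x => x.1.2 i, fun _ _ _ => rfl, fun _ _ => rfl, fun _ _ => rfl⟩
  refine ⟨Q, MultiHom.ofMap m₀, fun i => MultiHom.ofMap (m i), ⟨fun i => ?_, ?_, ?_⟩⟩
  · apply MultiHom.ext
    funext x
    refine (MultiHom.post_toFun _ _ x).trans ?_
    exact ((MultiHom.id Q).toFun x).2 i
  · intro Y a₀ a h
    have h' : ∀ i x, (g i).app ((a i).toFun x) = a₀.toFun x := fun i x =>
      (MultiHom.post_toFun (a i) (f i) x).symm.trans (congrFun (congrArg MultiHom.toFun (h i)) x)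
    refine ⟨{ toFun x := ⟨⟨a₀.toFun x, fun i => (a i).toFun x⟩, fun i => h' i x⟩
              map_perm x y e := Subtype.ext (Prod.ext (a₀.map_perm x y e)
                (funext fun i => (a i).map_perm x y e))
              map_lact x y k e Φ Ψ A f s := Subtype.ext (Prod.ext (a₀.map_lact x y k e f s)
                (funext fun i => (a i).map_lact x y k e f s))
              map_ract x y k e Φ Ψ A f s := Subtype.ext (Prod.ext (a₀.map_ract x y k e f s)
                (funext fun i => (a i).map_ract x y k e f s)) }, ?_, fun i => ?_⟩
    · exact MultiHom.post_ofMap _ m₀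
    · exact MultiHom.post_ofMap _ (m i)
  · intro Y c d h₀ h
    apply MultiHom.ext
    funext x
    refine Subtype.ext (Prod.ext ?_ (funext fun i => ?_))
    · have := (MultiHom.post_ofMap c m₀).symm.trans (h₀.trans (MultiHom.post_ofMap d m₀))
      exact congrFun (congrArg MultiHom.toFun this) x
    · have := (MultiHom.post_ofMap c (m i)).symm.trans ((h i).trans (MultiHom.post_ofMap d (m i)))
      exact congrFun (congrArg MultiHom.toFun this) x

end JModule

/-! ### Internal homs of modules -/

namespace PModule
variable {P : Polycat.{u, v}} (W : PModule.{u, v, w₂} P)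

section
variable {K L Γ Γ' Δ Δ' Φ Ψ : Fam P.Ob} {A : P.Ob}

/-- Relabelling of the last entries. -/
abbrev permR (σ : Γ ≅ₗ Γ') (τ : Δ ≅ₗ Δ') (x : W.obj (K ⊎ Γ) (L ⊎ Δ)) : W.obj (K ⊎ Γ') (L ⊎ Δ') :=
  W.perm (Fam.Iso.append (.refl K) σ) (Fam.Iso.append (.refl L) τ) x

/-- The left action on the last entries. -/
abbrev lactR (f : P.Hom Γ (Δ ⊎ .single A)) (x : W.obj (K ⊎ (.single A ⊎ Φ)) (L ⊎ Ψ)) :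
    W.obj (K ⊎ (Γ ⊎ Φ)) (L ⊎ (Δ ⊎ Ψ)) :=
  W.lact.compAt f x (.refl _) (.leftComm _ _ _) (.leftComm _ _ _) (.leftComm _ _ _)

/-- The right action on the last entries. -/
abbrev ractR (x : W.obj (K ⊎ Γ) (L ⊎ (Δ ⊎ .single A))) (f : P.Hom (.single A ⊎ Φ) Ψ) :
    W.obj (K ⊎ (Γ ⊎ Φ)) (L ⊎ (Δ ⊎ Ψ)) :=
  W.ract.compAt x f (.assoc _ _ _) (.refl _) (.assoc _ _ _) (.assoc _ _ _)

variable {K' L' Θ Ξ : Fam P.Ob} {B : P.Ob}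

theorem shift_perm_permR (σ : Γ ≅ₗ Γ') (τ : Δ ≅ₗ Δ') (α : K ≅ₗ K') (β : L ≅ₗ L')
    (x : W.obj (K ⊎ Γ) (L ⊎ Δ)) :
    (W.shift Γ' Δ').perm α β (W.permR σ τ x) = W.permR σ τ ((W.shift Γ Δ).perm α β x) := by
  refine (W.perm_perm _ _ _ _ _).trans (Eq.trans ?_ (W.perm_perm _ _ _ _ _).symm)
  apply W.perm_congr
  · rintro (i | i) <;> rfl
  · rintro (i | i) <;> rfl

theorem shift_perm_lactR (f : P.Hom Γ (Δ ⊎ .single A)) (α : K ≅ₗ K') (β : L ≅ₗ L')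
    (x : W.obj (K ⊎ (.single A ⊎ Φ)) (L ⊎ Ψ)) :
    (W.shift (Γ ⊎ Φ) (Δ ⊎ Ψ)).perm α β (W.lactR f x) =
      W.lactR f ((W.shift (.single A ⊎ Φ) Ψ).perm α β x) := by
  refine (W.lact.perm_at _ _).trans ?_
  symm
  apply W.lact.at_permR
  · rfl
  · rfl
  · rintro i; rfl
  · rintro (i | i) (j | j) h <;> cases h <;> rfl
  · rintro i j h; cases h; rfl
  · rintro (i | i) <;> rfl

theorem shift_perm_ractR (x : W.obj (K ⊎ Γ) (L ⊎ (Δ ⊎ .single A))) (f : P.Hom (.single A ⊎ Φ) Ψ)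
    (α : K ≅ₗ K') (β : L ≅ₗ L') :
    (W.shift (Γ ⊎ Φ) (Δ ⊎ Ψ)).perm α β (W.ractR x f) =
      W.ractR ((W.shift Γ (Δ ⊎ .single A)).perm α β x) f := by
  refine (W.ract.perm_at _ _).trans ?_
  symm
  apply W.ract.at_permL
  · rfl
  · rfl
  · rintro (i | i) <;> rfl
  · rintro i j h; cases h; rfl
  · rintro (i | i) (j | j) h <;> cases h <;> rfl
  · rintro i; rfl

theorem shift_lact_permR (g : P.Hom Θ (Ξ ⊎ .single B)) (σ : Γ ≅ₗ Γ') (τ : Δ ≅ₗ Δ')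
    (x : W.obj ((.single B ⊎ K) ⊎ Γ) (L ⊎ Δ)) :
    (W.shift Γ' Δ').lact.comp g (W.permR σ τ x) = W.permR σ τ ((W.shift Γ Δ).lact.comp g x) := by
  refine Eq.trans ?_ (W.lact.perm_at _ _).symm
  apply W.lact.at_permR
  · rfl
  · rfl
  · rintro i; rfl
  · rintro (i | i) (j | j) h <;> cases h <;> rfl
  · rintro i j h; cases h; rfl
  · rintro (i | i) <;> rfl

theorem shift_ract_permR (g : P.Hom (.single B ⊎ Θ) Ξ) (σ : Γ ≅ₗ Γ') (τ : Δ ≅ₗ Δ')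
    (x : W.obj (K ⊎ Γ) ((L ⊎ .single B) ⊎ Δ)) :
    (W.shift Γ' Δ').ract.comp (W.permR σ τ x) g = W.permR σ τ ((W.shift Γ Δ).ract.comp x g) := by
  refine Eq.trans ?_ (W.ract.perm_at _ _).symm
  apply W.ract.at_permL
  · rfl
  · rfl
  · rintro (i | i) <;> rfl
  · rintro i j h; cases h; rfl
  · rintro (i | i) (j | j) h <;> cases h <;> rfl
  · rintro i; rfl

theorem shift_lact_lactR (g : P.Hom Θ (Ξ ⊎ .single B)) (f : P.Hom Γ (Δ ⊎ .single A))
    (x : W.obj ((.single B ⊎ K) ⊎ (.single A ⊎ Φ)) (L ⊎ Ψ)) :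
    (W.shift (Γ ⊎ Φ) (Δ ⊎ Ψ)).lact.comp g (W.lactR f x) =
      W.lactR f ((W.shift (.single A ⊎ Φ) Ψ).lact.comp g x) := by
  apply InLaw.compAt (@W.in_right) ((Fam.Iso.append (.refl (.single A))
    (Fam.Iso.assoc (.single B) K Φ).symm).trans (.leftComm _ _ _))
  · rfl
  · rfl
  · rintro ((i | i) | i) h <;> cases h; rfl
  · rintro (i | i | i) h <;> cases h; rfl
  · rfl
  · rfl
  · rintro (i | i) <;> rfl
  · rintro i j h; cases h; rfl
  · rintro i j h; cases h; rfl
  · rintro (x | x) ((i | i) | i) (j | j | j) (i' | i' | i') ((j' | j') | j') h h' k k' <;>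
      cases h <;> cases h' <;> cases k <;> cases k' <;> rfl
  · rintro i (j | j | j) h <;> cases h; rfl
  · rintro i ((j | j) | j) h <;> cases h; rfl

theorem shift_lact_ractR (g : P.Hom Θ (Ξ ⊎ .single B))
    (x : W.obj ((.single B ⊎ K) ⊎ Γ) (L ⊎ (Δ ⊎ .single A))) (f : P.Hom (.single A ⊎ Φ) Ψ) :
    (W.shift (Γ ⊎ Φ) (Δ ⊎ Ψ)).lact.comp g (W.ractR x f) =
      W.ractR ((W.shift Γ (Δ ⊎ .single A)).lact.comp g x) f := by
  apply AssocLaw.compAt (@W.assoc_mid)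
  · rfl
  · rfl
  · rfl
  · rfl
  · rintro i; rfl
  · rintro (i | i) (j | j | j) h <;> cases h <;> rfl
  · rintro i i' (j | j | j) h h' <;> cases h <;> cases h'; rfl
  · rintro i i' ((j | j) | j) h h' <;> cases h <;> cases h'; rfl
  · rintro (i | i) ((j | j) | j) h <;> cases h <;> rfl
  · rintro i; rfl

theorem shift_ract_lactR (f : P.Hom Γ (Δ ⊎ .single A))
    (x : W.obj (K ⊎ (.single A ⊎ Φ)) ((L ⊎ .single B) ⊎ Ψ)) (g : P.Hom (.single B ⊎ Θ) Ξ) :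
    (W.shift (Γ ⊎ Φ) (Δ ⊎ Ψ)).ract.comp (W.lactR f x) g =
      W.lactR f ((W.shift (.single A ⊎ Φ) Ψ).ract.comp x g) := by
  symm
  apply AssocLaw.compAt (@W.assoc_mid)
  · rfl
  · rfl
  · rfl
  · rfl
  · rintro i; rfl
  · rintro (i | i) ((j | j) | j) h <;> cases h <;> rfl
  · rintro i i' ((j | j) | j) h h' <;> cases h <;> cases h'; rfl
  · rintro i i' (j | j | j) h h' <;> cases h <;> cases h'; rfl
  · rintro (i | i) (j | j | j) h <;> cases h <;> rfl
  · rintro i; rfl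

theorem shift_ract_ractR (x : W.obj (K ⊎ Γ) ((L ⊎ .single B) ⊎ (Δ ⊎ .single A)))
    (f : P.Hom (.single A ⊎ Φ) Ψ) (g : P.Hom (.single B ⊎ Θ) Ξ) :
    (W.shift (Γ ⊎ Φ) (Δ ⊎ Ψ)).ract.comp (W.ractR x f) g =
      W.ractR ((W.shift Γ (Δ ⊎ .single A)).ract.comp x g) f := by
  apply OutLaw.compAt (@W.out_left)
    (((Fam.Iso.rightComm L Δ (.single B)).append (.refl (.single A))).trans (.assoc _ _ _))
  · rfl
  · rfl
  · rintro ((i | i) | i) h <;> cases h; rfl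
  · rintro (i | i | i) h <;> cases h; rfl
  · rfl
  · rfl
  · rintro (i | i) <;> rfl
  · rintro i j h; cases h; rfl
  · rintro i j h; cases h; rfl
  · rintro (x | x) ((i | i) | i) (j | j | j) (i' | i' | i') ((j' | j') | j') h h' k k' <;>
      cases h <;> cases h' <;> cases k <;> cases k' <;> rfl
  · rintro i (j | j | j) h <;> cases h; rfl
  · rintro i ((j | j) | j) h <;> cases h; rfl

end

variable {W}

/-- Elements of the internal hom from `U` to `W`: natural families of functions. -/
@[ext]
structure HomEl (U : PModule.{u, v, w₁} P) (W : PModule.{u, v, w₂} P) (K L : Fam P.Ob) where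
  app (Γ Δ : Fam P.Ob) : U.obj Γ Δ → W.obj (K ⊎ Γ) (L ⊎ Δ)
  map_perm {Γ Γ' Δ Δ' : Fam P.Ob} (σ : Γ ≅ₗ Γ') (τ : Δ ≅ₗ Δ') (x : U.obj Γ Δ) :
    app Γ' Δ' (U.perm σ τ x) = W.permR σ τ (app Γ Δ x)
  map_lact {Γ Δ Φ Ψ : Fam P.Ob} {A : P.Ob} (f : P.Hom Γ (Δ ⊎ .single A))
    (x : U.obj (.single A ⊎ Φ) Ψ) : app _ _ (U.lact.comp f x) = W.lactR f (app _ _ x)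
  map_ract {Γ Δ Φ Ψ : Fam P.Ob} {A : P.Ob} (x : U.obj Γ (Δ ⊎ .single A))
    (f : P.Hom (.single A ⊎ Φ) Ψ) : app _ _ (U.ract.comp x f) = W.ractR (app _ _ x) f

variable (U : PModule.{u, v, w₁} P) (W)

/-- The internal hom from `U` to `W`, whose structure is that of shifts of `W`. -/
def hom : PModule.{u, v, max 1 u w₁ w₂} P where
  obj := HomEl U W
  perm α β F :=
    { app Γ Δ x := (W.shift Γ Δ).perm α β (F.app Γ Δ x)
      map_perm σ τ x := by rw [F.map_perm, shift_perm_permR]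
      map_lact f x := by rw [F.map_lact, shift_perm_lactR]
      map_ract x f := by rw [F.map_ract, shift_perm_ractR] }
  perm_refl F := HomEl.ext (funext fun Γ => funext fun Δ => funext fun x => (W.shift Γ Δ).perm_refl _)
  perm_perm σ σ' τ τ' F := HomEl.ext (funext fun Γ => funext fun Δ => funext fun x =>
    (W.shift Γ Δ).perm_perm _ _ _ _ _)
  lact := ⟨fun g F =>
    { app Γ Δ x := (W.shift Γ Δ).lact.comp g (F.app Γ Δ x)
      map_perm σ τ x := by rw [F.map_perm, shift_lact_permR]
      map_lact f x := by rw [F.map_lact, shift_lact_lactR]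
      map_ract x f := by rw [F.map_ract, shift_lact_ractR] },
    fun σ τ ρ κ g F => HomEl.ext (funext fun Γ => funext fun Δ => funext fun x =>
      (W.shift Γ Δ).lact.comp_perm σ τ ρ κ g (F.app Γ Δ x))⟩
  ract := ⟨fun F g =>
    { app Γ Δ x := (W.shift Γ Δ).ract.comp (F.app Γ Δ x) g
      map_perm σ τ x := by rw [F.map_perm, shift_ract_permR]
      map_lact f x := by rw [F.map_lact, shift_ract_lactR]
      map_ract x f := by rw [F.map_ract, shift_ract_ractR] },
    fun σ τ ρ κ F g => HomEl.ext (funext fun Γ => funext fun Δ => funext fun x =>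
      (W.shift Γ Δ).ract.comp_perm σ τ ρ κ (F.app Γ Δ x) g)⟩
  id_lact F := HomEl.ext (funext fun Γ => funext fun Δ => funext fun x => (W.shift Γ Δ).id_lact _)
  ract_id F := HomEl.ext (funext fun Γ => funext fun Δ => funext fun x => (W.shift Γ Δ).ract_id _)
  assoc_left F g h := HomEl.ext (funext fun Γ => funext fun Δ => funext fun x =>
    (W.shift Γ Δ).assoc_left _ _ _)
  assoc_mid g F h := HomEl.ext (funext fun Γ => funext fun Δ => funext fun x =>
    (W.shift Γ Δ).assoc_mid _ _ _)
  assoc_right g h F := HomEl.ext (funext fun Γ => funext fun Δ => funext fun x =>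
    (W.shift Γ Δ).assoc_right _ _ _)
  out_left F g h := HomEl.ext (funext fun Γ => funext fun Δ => funext fun x =>
    (W.shift Γ Δ).out_left _ _ _)
  out_mid g F h := HomEl.ext (funext fun Γ => funext fun Δ => funext fun x =>
    (W.shift Γ Δ).out_mid _ _ _)
  in_left F g h := HomEl.ext (funext fun Γ => funext fun Δ => funext fun x =>
    (W.shift Γ Δ).in_left _ _ _)
  in_right g h F := HomEl.ext (funext fun Γ => funext fun Δ => funext fun x =>
    (W.shift Γ Δ).in_right _ _ _)

variable {W}

theorem hom_respectsTensor {S : Fam P.Ob} {T : P.Ob} {t : P.Hom S (.single T)}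
    (h : W.RespectsTensor t) : (W.hom U).RespectsTensor t := by
  intro K L
  have hb := fun Γ Δ => shift_respectsTensor (U := W) Γ Δ h K L
  constructor
  · intro F G hFG
    exact HomEl.ext (funext fun Γ => funext fun Δ => funext fun x =>
      (hb Γ Δ).1 (congrFun (congrFun (congrFun (congrArg HomEl.app hFG) Γ) Δ) x))
  · intro G
    choose F hF using fun Γ Δ x => (hb Γ Δ).2 (G.app Γ Δ x)
    dsimp only at hF
    refine ⟨⟨F, fun σ τ x => (hb _ _).1 ?_, fun f x => (hb _ _).1 ?_, fun x f => (hb _ _).1 ?_⟩,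
      HomEl.ext (funext fun Γ => funext fun Δ => funext fun x => hF Γ Δ x)⟩
    · exact (hF _ _ _).trans ((G.map_perm σ τ x).trans ((congrArg (W.permR σ τ) (hF _ _ x).symm).trans
        (W.shift_lact_permR _ _ _ _).symm))
    · exact (hF _ _ _).trans ((G.map_lact f x).trans ((congrArg (W.lactR f) (hF _ _ x).symm).trans
        (W.shift_lact_lactR _ _ _).symm))
    · exact (hF _ _ _).trans ((G.map_ract x f).trans ((congrArg (fun z => W.ractR z f) (hF _ _ x).symm).trans
        (W.shift_lact_ractR _ _ _).symm))

theorem hom_respectsCotensor {S : Fam P.Ob} {T : P.Ob} {t : P.Hom (.single T) S}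
    (h : W.RespectsCotensor t) : (W.hom U).RespectsCotensor t := by
  intro K L
  have hb := fun Γ Δ => shift_respectsCotensor (U := W) Γ Δ h K L
  constructor
  · intro F G hFG
    exact HomEl.ext (funext fun Γ => funext fun Δ => funext fun x =>
      (hb Γ Δ).1 (congrFun (congrFun (congrFun (congrArg HomEl.app hFG) Γ) Δ) x))
  · intro G
    choose F hF using fun Γ Δ x => (hb Γ Δ).2 (G.app Γ Δ x)
    dsimp only at hF
    refine ⟨⟨F, fun σ τ x => (hb _ _).1 ?_, fun f x => (hb _ _).1 ?_, fun x f => (hb _ _).1 ?_⟩,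
      HomEl.ext (funext fun Γ => funext fun Δ => funext fun x => hF Γ Δ x)⟩
    · exact (hF _ _ _).trans ((G.map_perm σ τ x).trans ((congrArg (W.permR σ τ) (hF _ _ x).symm).trans
        (W.shift_ract_permR _ _ _ _).symm))
    · exact (hF _ _ _).trans ((G.map_lact f x).trans ((congrArg (W.lactR f) (hF _ _ x).symm).trans
        (W.shift_ract_lactR _ _ _).symm))
    · exact (hF _ _ _).trans ((G.map_ract x f).trans ((congrArg (fun z => W.ractR z f) (hF _ _ x).symm).trans
        (W.shift_ract_ractR _ _ _).symm))

end PModule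

namespace PModule.HomEl
variable {P : Polycat.{u, v}} {U : PModule.{u, v, w₁} P} {W : PModule.{u, v, w₂} P} {K L : Fam P.Ob}
  (F : HomEl U W K L)

theorem map_lact_at {Γ Γ' Δ Δ' G Φ Ψ : Fam P.Ob} {A : P.Ob} (f : P.Hom Γ (Δ ⊎ .single A))
    (x : U.obj G Ψ) (a : .single A ⊎ Φ ≅ₗ G) (b : Γ ⊎ Φ ≅ₗ Γ') (c : Δ ⊎ Ψ ≅ₗ Δ') :
    F.app _ _ (U.lact.compAt f x (.refl _) a b c) = W.lact.compAt f (F.app _ _ x) (.refl _)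
      ((Fam.Iso.leftComm _ _ _).trans (Fam.Iso.append (.refl K) a))
      ((Fam.Iso.leftComm _ _ _).trans (Fam.Iso.append (.refl K) b))
      ((Fam.Iso.leftComm _ _ _).trans (Fam.Iso.append (.refl L) c)) := by
  have e : P.perm (.refl _) (.refl (Δ ⊎ .single A)) f = f := P.perm_refl f
  refine (congrArg (fun z => F.app _ _ (U.perm b c (U.lact.comp z _))) e).trans ?_
  refine (F.map_perm b c _).trans ?_
  refine (congrArg _ (F.map_lact f _)).trans ?_
  refine (W.lact.perm_at _ _).trans ?_
  refine (congrArg (fun z => W.lact.compAt f z _ _ _ _) (F.map_perm a.symm (.refl _) x)).trans ?_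
  apply W.lact.at_permR
  · rfl
  · exact congrArg Sum.inr (a.equiv.symm_apply_apply _).symm
  · intro i; rfl
  · rintro (i | i) (j | j) h
    · cases h; rfl
    · cases h
    · cases h
    · have h' := (Sum.inr_injective h).trans (a.equiv.symm_apply_apply (.inr j))
      cases h'; rfl
  · rintro i j h; cases h; rfl
  · rintro (i | i) <;> rfl

theorem map_ract_at {Γ Γ' Δ Δ' D Φ Ψ : Fam P.Ob} {A : P.Ob} (x : U.obj Γ D)
    (f : P.Hom (.single A ⊎ Φ) Ψ) (a : Δ ⊎ .single A ≅ₗ D) (b : Γ ⊎ Φ ≅ₗ Γ') (c : Δ ⊎ Ψ ≅ₗ Δ') :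
    F.app _ _ (U.ract.compAt x f a (.refl _) b c) = W.ract.compAt (F.app _ _ x) f
      ((Fam.Iso.assoc _ _ _).trans (Fam.Iso.append (.refl L) a)) (.refl _)
      ((Fam.Iso.assoc _ _ _).trans (Fam.Iso.append (.refl K) b))
      ((Fam.Iso.assoc _ _ _).trans (Fam.Iso.append (.refl L) c)) := by
  have e : P.perm (.refl (.single A ⊎ Φ)) (.refl _) f = f := P.perm_refl f
  refine (congrArg (fun z => F.app _ _ (U.perm b c (U.ract.comp _ z))) e).trans ?_
  refine (F.map_perm b c _).trans ?_
  refine (congrArg _ (F.map_ract _ f)).trans ?_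
  refine (W.ract.perm_at _ _).trans ?_
  refine (congrArg (fun z => W.ract.compAt z f _ _ _ _) (F.map_perm (.refl _) a.symm x)).trans ?_
  apply W.ract.at_permL
  · exact congrArg Sum.inr (a.equiv.symm_apply_apply _).symm
  · rfl
  · rintro (i | i) <;> rfl
  · rintro i j h; cases h; rfl
  · rintro (i | i) (j | j) h
    · cases h; rfl
    · cases h
    · cases h
    · have h' := (Sum.inr_injective h).trans (a.equiv.symm_apply_apply (.inl j))
      cases h'; rfl
  · intro i; rfl

end PModule.HomEl

namespace JModule
variable {P : Polycat.{u, v}} {J : P.Distinguished}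

/-- The internal hom from `U` to `W`. -/
def hom (U W : JModule P J) : JModule P J :=
  ⟨W.toPModule.hom U.toPModule,
    ⟨fun h => PModule.hom_respectsTensor _ (W.respects.tensor h),
     fun h => PModule.hom_respectsTensor _ (W.respects.unit h),
     fun h => PModule.hom_respectsCotensor _ (W.respects.cotensor h),
     fun h => PModule.hom_respectsCotensor _ (W.respects.counit h)⟩⟩

namespace MultiHom
variable {U W : JModule P J}

/-- The function underlying an element of the internal hom. -/
abbrev homApp {K L : Fam P.Ob} (F : (hom U W).toPModule.obj K L) {Γ Δ : Fam P.Ob}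
    (x : U.toPModule.obj Γ Δ) : W.toPModule.obj (K ⊎ Γ) (L ⊎ Δ) := PModule.HomEl.app F Γ Δ x

/-- Evaluation. -/
noncomputable def ev (U W : JModule P J) : MultiHom (.single U ⊎ .single (hom U W)) W where
  toFun x := W.toPModule.perm ((Fam.Iso.comm _ _).trans (.sigmaPair _ fun k => (x k).inp))
    ((Fam.Iso.comm _ _).trans (.sigmaPair _ fun k => (x k).out)) (homApp (x (.inr ())).el (x (.inl ())).el)
  map_perm x y e := by
    have h1 := (e (.inl ())).el_eq
    have h2 := (e (.inr ())).el_eq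
    rw [← h1, ← h2]
    refine (W.toPModule.perm_perm _ _ _ _ _).trans (Eq.symm ?_)
    refine (congrArg _ (PModule.HomEl.map_perm _ _ _ _)).trans ?_
    refine (W.toPModule.perm_perm _ _ _ _ _).trans ?_
    refine (W.toPModule.perm_perm _ _ _ _ _).trans ?_
    apply W.toPModule.perm_congr
    · rintro (i | i) <;> rfl
    · rintro (i | i) <;> rfl
  map_lact x y k e Φ Ψ A f s := by
    rcases k with k | k
    · have h1 := s.el_eq
      have h2 := (e ⟨.inr (), by simp⟩).el_eq
      rw [← h1, ← h2]
      refine Eq.trans (b := W.toPModule.lact.compAt f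
        (homApp (x (.inr ())).el (x (.inl ())).el) (.refl _)
        ((Fam.Iso.leftComm _ _ _).trans (Fam.Iso.append (.refl _) s.src))
        (((Fam.Iso.leftComm _ _ _).trans (Fam.Iso.append (e ⟨.inr (), by simp⟩).inp s.inp)).trans
          ((Fam.Iso.comm _ _).trans (.sigmaPair _ fun k => (y k).inp)))
        (((Fam.Iso.leftComm _ _ _).trans (Fam.Iso.append (e ⟨.inr (), by simp⟩).out s.out)).trans
          ((Fam.Iso.comm _ _).trans (.sigmaPair _ fun k => (y k).out)))) ?_
        (Eq.symm ((congrArg _ (PModule.HomEl.map_lact_at _ f _ _ _ _)).trans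
          ((W.toPModule.lact.perm_at _ _).trans ?_)))
      · apply W.toPModule.lact.at_permR
        · rfl
        · rfl
        · intro i; rfl
        · rintro (i | ⟨⟨_ | _, hl⟩, i⟩) (j | j) h
          · cases h
          · obtain rfl := Sum.inr_injective (s.src.equiv.injective (eq_of_heq (Sigma.mk.inj h).2))
            rfl
          · exact absurd rfl hl
          · exact absurd rfl hl
          · cases h; rfl
          · cases h
        · rintro i j h; cases h; rfl
        · rintro (i | i)
          · exact Fam.Iso.insertAt_ne (s := fun i => (x i).out) (t := fun i => (y i).out)
              (a := s.out) (e := fun i => (e i).out) _ (.inl ()) (.inr ()) (by simp) i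
          · exact Fam.Iso.insertAt_eq (s := fun i => (x i).out) (t := fun i => (y i).out)
              (a := s.out) (e := fun i => (e i).out) _ _ i
      · apply W.toPModule.lact.at_permR
        · rfl
        · rfl
        · intro i; rfl
        · rintro (i | i) (j | j) h
          · have h' : i = (e ⟨.inr (), by simp⟩).inp.equiv j := Sum.inl_injective h
            subst h'
            rfl
          · cases h
          · cases h
          · obtain rfl := Sum.inr_injective (s.src.equiv.injective (Sum.inr_injective h))
            rfl
        · rintro i j h; cases h; rfl
        · rintro (i | i) <;> rfl
    · have h1 := (e ⟨.inl (), by simp⟩).el_eq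
      have h2 := s.el_eq
      rw [← h1, ← h2]
      refine Eq.symm ((congrArg _ (PModule.HomEl.map_perm _ _ _ _)).trans ?_)
      refine (congrArg (fun z => W.toPModule.perm _ _ (W.toPModule.permR _ _ z))
        (PModule.shift_lact_at W.toPModule)).trans ?_
      refine (congrArg _ (W.toPModule.lact.perm_at _ _)).trans ((W.toPModule.lact.perm_at _ _).trans ?_)
      symm
      apply W.toPModule.lact.at_permR
      · rfl
      · rfl
      · intro i; rfl
      · rintro (i | ⟨⟨_ | _, hl⟩, i⟩) (j | j) h
        · obtain rfl := Sum.inr_injective (s.src.equiv.injective (eq_of_heq (Sigma.mk.inj h).2))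
          rfl
        · cases h
        · cases h
        · cases h; rfl
        · exact absurd rfl hl
        · exact absurd rfl hl
      · rintro i j h; cases h; rfl
      · rintro (i | i)
        · exact Fam.Iso.insertAt_eq (s := fun i => (x i).out) (t := fun i => (y i).out)
            (a := s.out) (e := fun i => (e i).out) _ _ i
        · exact Fam.Iso.insertAt_ne (s := fun i => (x i).out) (t := fun i => (y i).out)
            (a := s.out) (e := fun i => (e i).out) _ (.inr ()) (.inl ()) (by simp) i
  map_ract x y k e Φ Ψ A f s := by
    rcases k with k | k
    · have h1 := s.el_eq
      have h2 := (e ⟨.inr (), by simp⟩).el_eq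
      rw [← h1, ← h2]
      refine Eq.trans (b := W.toPModule.ract.compAt
        (homApp (x (.inr ())).el (x (.inl ())).el) f
        ((Fam.Iso.assoc _ _ _).trans (Fam.Iso.append (.refl _) s.src)) (.refl _)
        (((Fam.Iso.assoc _ _ _).trans (Fam.Iso.append (e ⟨.inr (), by simp⟩).inp s.inp)).trans
          ((Fam.Iso.comm _ _).trans (.sigmaPair _ fun k => (y k).inp)))
        (((Fam.Iso.assoc _ _ _).trans (Fam.Iso.append (e ⟨.inr (), by simp⟩).out s.out)).trans
          ((Fam.Iso.comm _ _).trans (.sigmaPair _ fun k => (y k).out)))) ?_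
        (Eq.symm ((congrArg _ (PModule.HomEl.map_ract_at _ _ f _ _ _)).trans
          ((W.toPModule.ract.perm_at _ _).trans ?_)))
      · apply W.toPModule.ract.at_permL
        · rfl
        · rfl
        · rintro (i | i)
          · exact Fam.Iso.insertAtR_ne (s := fun i => (x i).inp) (t := fun i => (y i).inp)
              (a := s.inp) (e := fun i => (e i).inp) _ (.inl ()) (.inr ()) (by simp) i
          · exact Fam.Iso.insertAtR_eq (s := fun i => (x i).inp) (t := fun i => (y i).inp)
              (a := s.inp) (e := fun i => (e i).inp) _ _ i
        · rintro i j h; cases h; rfl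
        · rintro (i | ⟨⟨_ | _, hl⟩, i⟩) (j | j) h
          · cases h
          · obtain rfl := Sum.inl_injective (s.src.equiv.injective (eq_of_heq (Sigma.mk.inj h).2))
            rfl
          · exact absurd rfl hl
          · exact absurd rfl hl
          · cases h; rfl
          · cases h
        · intro i; rfl
      · apply W.toPModule.ract.at_permL
        · rfl
        · rfl
        · rintro (i | i) <;> rfl
        · rintro i j h; cases h; rfl
        · rintro (i | i) (j | j) h
          · have h' : i = (e ⟨.inr (), by simp⟩).out.equiv j := Sum.inl_injective h
            subst h'
            rfl
          · cases h
          · cases h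
          · obtain rfl := Sum.inl_injective (s.src.equiv.injective (Sum.inr_injective h))
            rfl
        · intro i; rfl
    · have h1 := (e ⟨.inl (), by simp⟩).el_eq
      have h2 := s.el_eq
      rw [← h1, ← h2]
      refine Eq.symm ((congrArg _ (PModule.HomEl.map_perm _ _ _ _)).trans ?_)
      refine (congrArg (fun z => W.toPModule.perm _ _ (W.toPModule.permR _ _ z))
        (PModule.shift_ract_at W.toPModule)).trans ?_
      refine (congrArg _ (W.toPModule.ract.perm_at _ _)).trans ((W.toPModule.ract.perm_at _ _).trans ?_)
      symm
      apply W.toPModule.ract.at_permL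
      · rfl
      · rfl
      · rintro (i | i)
        · exact Fam.Iso.insertAtR_eq (s := fun i => (x i).inp) (t := fun i => (y i).inp)
            (a := s.inp) (e := fun i => (e i).inp) _ _ i
        · exact Fam.Iso.insertAtR_ne (s := fun i => (x i).inp) (t := fun i => (y i).inp)
            (a := s.inp) (e := fun i => (e i).inp) _ (.inr ()) (.inl ()) (by simp) i
      · rintro i j h; cases h; rfl
      · rintro (i | ⟨⟨_ | _, hl⟩, i⟩) (j | j) h
        · obtain rfl := Sum.inl_injective (s.src.equiv.injective (eq_of_heq (Sigma.mk.inj h).2))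
          rfl
        · cases h
        · cases h
        · cases h; rfl
        · exact absurd rfl hl
        · exact absurd rfl hl
      · intro i; rfl

end MultiHom
end JModule

/-! ### Currying -/

namespace JModule
variable {P : Polycat.{u, v}} {J : P.Distinguished}

/-- The module with elements those of `W` with additional inputs `K` and outputs `L`. -/
abbrev shift (W : JModule P J) (K L : Fam P.Ob) : JModule P J :=
  ⟨W.toPModule.shift K L, PModule.shift_respectsJ K L W.respects⟩

/-- Adding one element to a list of elements. -/
abbrev Elt.snoc {Y : Fam (JModule P J)} {U : JModule P J} (y : ∀ k, Elt (Y.obj k)) (u : Elt U) :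
    ∀ k, Elt ((Y ⊎ .single U).obj k)
  | .inl k => y k
  | .inr _ => u

theorem Elt.snoc_eta {Y : Fam (JModule P J)} {U : JModule P J}
    (x : ∀ k, Elt ((Y ⊎ .single U).obj k)) :
    Elt.snoc (fun k => x (.inl k)) (x (.inr ())) = x := by
  funext k; rcases k with k | k <;> rfl

namespace MultiHom
variable {Y : Fam (JModule P J)} {U W : JModule P J}

/-- Fixing the last argument of a multimorphism. -/
def fix (φ : MultiHom (Y ⊎ .single U) W) (u : Elt U) : MultiHom Y (W.shift u.inp u.out) where
  toFun y := W.toPModule.perm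
    (Fam.Iso.sigmaSnoc _ _ fun k => (Elt.snoc y u k).inp).symm
    (Fam.Iso.sigmaSnoc _ _ fun k => (Elt.snoc y u k).out).symm (φ.toFun (Elt.snoc y u))
  map_perm x y e := by
    refine (W.toPModule.perm_perm _ _ _ _ _).trans ?_
    refine φ.perm_eq (x := Elt.snoc x u) (y := Elt.snoc y u)
      (fun | .inl k => e k | .inr _ => .refl u) ?_ ?_
    · rintro (k | k) i <;> rfl
    · rintro (k | k) i <;> rfl
  map_lact x y k e Φ Ψ A f s := by
    refine (PModule.shift_lact_at W.toPModule).trans ?_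
    refine φ.lact_eq (x := Elt.snoc x u) (y := Elt.snoc y u) (.inl k)
      (fun | ⟨.inl l, h⟩ => e ⟨l, fun h' => h (congrArg Sum.inl h')⟩ | ⟨.inr _, _⟩ => .refl u)
      s ?_ ?_ ?_ ?_ ?_ ?_ ?_
    · rfl
    · intro i; rfl
    · rintro ((i | ⟨⟨l, hl⟩, i⟩) | i) j h
      · obtain rfl := Sum.inr_injective (s.src.equiv.injective
          (eq_of_heq (Sigma.mk.inj (Sum.inl_injective h)).2))
        rfl
      · exact absurd (congrArg Sigma.fst (Sum.inl_injective h)) hl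
      · cases h
    · rintro ((i | ⟨⟨l, hl⟩, i⟩) | i) ⟨l' | l', hl'⟩ j h
      · exact absurd (congrArg Sum.inl (congrArg Sigma.fst (Sum.inl_injective h)).symm) hl'
      · cases h
      · cases h; rfl
      · cases h
      · cases h
      · cases h; rfl
    · intro i; rfl
    · intro i
      exact congrArg Sum.inl (Fam.Iso.insertAt_eq (s := fun i => (x i).out) (t := fun i => (y i).out)
          (a := s.out) (e := fun i => (e i).out) _ _ i)
    · rintro ⟨l | l, hl⟩ i
      · exact congrArg Sum.inl (Fam.Iso.insertAt_ne (s := fun i => (x i).out)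
          (t := fun i => (y i).out) (a := s.out) (e := fun i => (e i).out) _ k l
          (fun h' => hl (congrArg Sum.inl h')) i)
      · rfl
  map_ract x y k e Φ Ψ A f s := by
    refine (PModule.shift_ract_at W.toPModule).trans ?_
    refine φ.ract_eq (x := Elt.snoc x u) (y := Elt.snoc y u) (.inl k)
      (fun | ⟨.inl l, h⟩ => e ⟨l, fun h' => h (congrArg Sum.inl h')⟩ | ⟨.inr _, _⟩ => .refl u)
      s ?_ ?_ ?_ ?_ ?_ ?_ ?_
    · rfl
    · intro i; rfl
    · rintro ((i | ⟨⟨l, hl⟩, i⟩) | i) j h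
      · obtain rfl := Sum.inl_injective (s.src.equiv.injective
          (eq_of_heq (Sigma.mk.inj (Sum.inl_injective h)).2))
        rfl
      · exact absurd (congrArg Sigma.fst (Sum.inl_injective h)) hl
      · cases h
    · rintro ((i | ⟨⟨l, hl⟩, i⟩) | i) ⟨l' | l', hl'⟩ j h
      · exact absurd (congrArg Sum.inl (congrArg Sigma.fst (Sum.inl_injective h)).symm) hl'
      · cases h
      · cases h; rfl
      · cases h
      · cases h
      · cases h; rfl
    · intro i; rfl
    · intro i
      exact congrArg Sum.inl (Fam.Iso.insertAtR_eq (s := fun i => (x i).inp)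
        (t := fun i => (y i).inp) (a := s.inp) (e := fun i => (e i).inp) _ _ i)
    · rintro ⟨l | l, hl⟩ i
      · exact congrArg Sum.inl (Fam.Iso.insertAtR_ne (s := fun i => (x i).inp)
          (t := fun i => (y i).inp) (a := s.inp) (e := fun i => (e i).inp) _ k l
          (fun h' => hl (congrArg Sum.inl h')) i)
      · rfl

theorem fix_perm (φ : MultiHom (Y ⊎ .single U) W) (y : ∀ k, Elt (Y.obj k)) {u u' : Elt U}
    (e : EltIso u u') : (φ.fix u').toFun y = W.toPModule.permR e.inp e.out ((φ.fix u).toFun y) := by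
  symm
  refine (W.toPModule.perm_perm _ _ _ _ _).trans ?_
  refine φ.perm_eq (x := Elt.snoc y u) (y := Elt.snoc y u')
    (fun | .inl k => .refl (y k) | .inr _ => e) ?_ ?_
  · rintro (k | k) i <;> rfl
  · rintro (k | k) i <;> rfl

theorem fix_lact (φ : MultiHom (Y ⊎ .single U) W) (y : ∀ k, Elt (Y.obj k)) {u u' : Elt U}
    {Φ Ψ : Fam P.Ob} {A : P.Ob} {f : P.Hom Φ (Ψ ⊎ .single A)} (s : LStep f u u') :
    (φ.fix u').toFun y = W.toPModule.lact.compAt f ((φ.fix u).toFun y) (.refl _)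
      ((Fam.Iso.leftComm _ _ _).trans (Fam.Iso.append (.refl _) s.src))
      ((Fam.Iso.leftComm _ _ _).trans (Fam.Iso.append (.refl _) s.inp))
      ((Fam.Iso.leftComm _ _ _).trans (Fam.Iso.append (.refl _) s.out)) := by
  symm
  refine φ.lact_eq (x := Elt.snoc y u) (y := Elt.snoc y u') (.inr ())
    (fun | ⟨.inl l, h⟩ => .refl (y l) | ⟨.inr _, h⟩ => absurd rfl h) s ?_ ?_ ?_ ?_ ?_ ?_ ?_
  · rfl
  · intro i; rfl
  · rintro (i | i) j h
    · cases h
    · obtain rfl := Sum.inr_injective (s.src.equiv.injective (Sum.inr_injective h))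
      rfl
  · rintro (i | i) ⟨l | l, hl⟩ j h
    · cases h; rfl
    · exact absurd rfl hl
    · cases h
    · exact absurd rfl hl
  · intro i; rfl
  · intro i; rfl
  · rintro ⟨l | l, hl⟩ i
    · rfl
    · exact absurd rfl hl

theorem fix_ract (φ : MultiHom (Y ⊎ .single U) W) (y : ∀ k, Elt (Y.obj k)) {u u' : Elt U}
    {Φ Ψ : Fam P.Ob} {A : P.Ob} {g : P.Hom (.single A ⊎ Φ) Ψ} (s : RStep g u u') :
    (φ.fix u').toFun y = W.toPModule.ract.compAt ((φ.fix u).toFun y) g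
      ((Fam.Iso.assoc _ _ _).trans (Fam.Iso.append (.refl _) s.src)) (.refl _)
      ((Fam.Iso.assoc _ _ _).trans (Fam.Iso.append (.refl _) s.inp))
      ((Fam.Iso.assoc _ _ _).trans (Fam.Iso.append (.refl _) s.out)) := by
  symm
  refine φ.ract_eq (x := Elt.snoc y u) (y := Elt.snoc y u') (.inr ())
    (fun | ⟨.inl l, h⟩ => .refl (y l) | ⟨.inr _, h⟩ => absurd rfl h) s ?_ ?_ ?_ ?_ ?_ ?_ ?_
  · rfl
  · intro i; rfl
  · rintro (i | i) j h
    · cases h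
    · obtain rfl := Sum.inl_injective (s.src.equiv.injective (Sum.inr_injective h))
      rfl
  · rintro (i | i) ⟨l | l, hl⟩ j h
    · cases h; rfl
    · exact absurd rfl hl
    · cases h
    · exact absurd rfl hl
  · intro i; rfl
  · intro i; rfl
  · rintro ⟨l | l, hl⟩ i
    · rfl
    · exact absurd rfl hl

/-- Currying the last argument. -/
def curry (φ : MultiHom (Y ⊎ .single U) W) : MultiHom Y (hom U W) where
  toFun y :=
    { app Γ Δ x := (φ.fix ⟨Γ, Δ, x⟩).toFun y
      map_perm σ τ x := φ.fix_perm y (u := ⟨_, _, x⟩) (u' := ⟨_, _, U.toPModule.perm σ τ x⟩)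
        ⟨σ, τ, rfl⟩
      map_lact f x := by
        refine (φ.fix_lact y (u := ⟨_, _, x⟩) (u' := ⟨_, _, U.toPModule.lact.comp f x⟩)
          ⟨_, .refl _, .refl _, .refl _,
            U.toPModule.lact.at_eq.trans (U.toPModule.perm_refl _)⟩).trans ?_
        apply W.toPModule.lact.at_congr
        · rfl
        · rfl
        · intro i; rfl
        · rintro (i | i) (j | j) h <;> cases h <;> rfl
        · rintro i j h; cases h; rfl
        · rintro (i | i) <;> rfl
      map_ract x f := by
        refine (φ.fix_ract y (u := ⟨_, _, x⟩) (u' := ⟨_, _, U.toPModule.ract.comp x f⟩)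
          ⟨_, .refl _, .refl _, .refl _,
            U.toPModule.ract.at_eq.trans (U.toPModule.perm_refl _)⟩).trans ?_
        apply W.toPModule.ract.at_congr
        · rfl
        · rfl
        · rintro (i | i) <;> rfl
        · rintro i j h; cases h; rfl
        · rintro (i | i) (j | j) h <;> cases h <;> rfl
        · intro i; rfl }
  map_perm x y e := PModule.HomEl.ext (funext fun Γ => funext fun Δ => funext fun z =>
    (φ.fix ⟨Γ, Δ, z⟩).map_perm x y e)
  map_lact x y k e Φ Ψ A f s := PModule.HomEl.ext (funext fun Γ => funext fun Δ => funext fun z =>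
    (φ.fix ⟨Γ, Δ, z⟩).map_lact x y k e f s)
  map_ract x y k e Φ Ψ A f s := PModule.HomEl.ext (funext fun Γ => funext fun Δ => funext fun z =>
    (φ.fix ⟨Γ, Δ, z⟩).map_ract x y k e f s)

/-- Uncurrying applies the value of `h` to the last argument. -/
theorem comp_ev_toFun (h : MultiHom Y (hom U W)) (x : ∀ k, Elt ((Y ⊎ .single U).obj k)) :
    (Multicat.sub (jmod P J) h (ev U W) (.refl _) (.refl _)).toFun x =
      W.toPModule.perm (Fam.Iso.sigmaSnoc _ _ fun k => (x k).inp)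
        (Fam.Iso.sigmaSnoc _ _ fun k => (x k).out)
        (homApp (h.toFun fun k => x (.inl k)) (x (.inr ())).el) := by
  refine (W.toPModule.perm_perm _ _ _ _ _).trans ((W.toPModule.perm_perm _ _ _ _ _).trans
    ((W.toPModule.perm_perm _ _ _ _ _).trans ?_))
  apply W.toPModule.perm_congr
  · rintro (⟨k, i⟩ | i) <;> rfl
  · rintro (⟨k, i⟩ | i) <;> rfl

theorem sub_curry (φ : MultiHom (Y ⊎ .single U) W) :
    Multicat.sub (jmod P J) (curry φ) (ev U W) (.refl _) (.refl _) = φ := by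
  refine MultiHom.ext (funext fun x => (comp_ev_toFun _ x).trans ?_)
  obtain ⟨y, u, rfl⟩ : ∃ y u, x = Elt.snoc y u := ⟨_, _, (Elt.snoc_eta x).symm⟩
  refine (W.toPModule.perm_perm _ _ _ _ _).trans (W.toPModule.perm_id' ?_ ?_)
  · rintro ⟨k | k, i⟩ <;> rfl
  · rintro ⟨k | k, i⟩ <;> rfl

theorem ev_homUniversal (U W : JModule P J) :
    Multicat.HomUniversal (E := jmod P J) (ev U W) (.refl _) := by
  intro Y
  constructor
  · intro h h' e
    refine MultiHom.ext (funext fun y => PModule.HomEl.ext (funext fun Γ => funext fun Δ =>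
      funext fun z => ?_))
    have := congrFun (congrArg MultiHom.toFun e) (Elt.snoc y (⟨Γ, Δ, z⟩ : Elt U))
    exact (W.toPModule.perm_bijective _ _).1
      ((comp_ev_toFun h _).symm.trans (this.trans (comp_ev_toFun h' _)))
  · exact fun φ => ⟨curry φ, sub_curry φ⟩

theorem curry_bijective : Function.Bijective (curry : MultiHom (Y ⊎ .single U) W → _) :=
  have h : Function.LeftInverse (fun h : MultiHom Y (hom U W) =>
      Multicat.sub (jmod P J) h (ev U W) (.refl _) (.refl _)) curry := sub_curry
  ⟨h.injective, fun _ => ⟨_, (ev_homUniversal U W Y).1 (h _)⟩⟩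

end MultiHom

theorem hasHoms : (jmod P J).HasHoms := fun U W => ⟨_, MultiHom.ev U W, MultiHom.ev_homUniversal U W⟩

end JModule

/-! ### Tensor products of modules -/

namespace JModule
variable {P : Polycat.{u, v}} {J : P.Distinguished}

namespace MultiHom

theorem app_injective {U V : JModule P J} {φ ψ : MultiHom (.single U) V}
    (h : ∀ {Γ Δ : Fam P.Ob} (x : U.toPModule.obj Γ Δ), φ.app x = ψ.app x) : φ = ψ :=
  MultiHom.ext (funext fun x => (V.toPModule.perm_bijective _ _).1 (h (x ()).el))

end MultiHom

/-- Formal expressions for the elements of a tensor product of modules: generators, relabellings,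
actions, and division by the tensor and cotensor products that act invertibly on every module under
consideration. -/
inductive Term (Z : Fam (JModule P J)) : Fam P.Ob → Fam P.Ob → Type (max 1 u v)
  | gen (x : ∀ k, Elt (Z.obj k)) :
      Term Z (.sigma Z.fin fun k => (x k).inp) (.sigma Z.fin fun k => (x k).out)
  | perm {Γ Γ' Δ Δ' : Fam P.Ob} (σ : Γ ≅ₗ Γ') (τ : Δ ≅ₗ Δ') (a : Term Z Γ Δ) : Term Z Γ' Δ'
  | lact {Γ Δ Φ Ψ : Fam P.Ob} {A : P.Ob} (f : P.Hom Γ (Δ ⊎ .single A))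
      (a : Term Z (.single A ⊎ Φ) Ψ) : Term Z (Γ ⊎ Φ) (Δ ⊎ Ψ)
  | ract {Γ Δ Φ Ψ : Fam P.Ob} {A : P.Ob} (a : Term Z Γ (Δ ⊎ .single A))
      (f : P.Hom (.single A ⊎ Φ) Ψ) : Term Z (Γ ⊎ Φ) (Δ ⊎ Ψ)
  | divTensor {S : Fam P.Ob} {T : P.Ob} (t : P.Hom S (.single T))
      (ht : ∀ W : JModule P J, W.toPModule.RespectsTensor t) {Γ Δ : Fam P.Ob}
      (a : Term Z (S ⊎ Γ) (.nil ⊎ Δ)) : Term Z (.single T ⊎ Γ) Δ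
  | divCotensor {S : Fam P.Ob} {T : P.Ob} (t : P.Hom (.single T) S)
      (ht : ∀ W : JModule P J, W.toPModule.RespectsCotensor t) {Γ Δ : Fam P.Ob}
      (a : Term Z (Γ ⊎ .nil) (Δ ⊎ S)) : Term Z Γ (Δ ⊎ .single T)

namespace Term
variable {Z : Fam (JModule P J)} {W : JModule P J}

/-- The value of a formal expression under a multimorphism. -/
noncomputable def eval (φ : MultiHom Z W) : {Γ Δ : Fam P.Ob} → Term Z Γ Δ → W.toPModule.obj Γ Δ
  | _, _, gen x => φ.toFun x
  | _, _, perm σ τ a => W.toPModule.perm σ τ (eval φ a)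
  | _, _, lact f a => W.toPModule.lact.comp f (eval φ a)
  | _, _, ract a f => W.toPModule.ract.comp (eval φ a) f
  | _, _, divTensor _ ht a => Function.surjInv (ht W _ _).2 (eval φ a)
  | _, _, divCotensor _ ht a => Function.surjInv (ht W _ _).2 (eval φ a)

/-- Expressions are identified if they have the same value under every multimorphism. -/
instance setoid (Z : Fam (JModule P J)) (Γ Δ : Fam P.Ob) : Setoid (Term Z Γ Δ) where
  r a b := ∀ (W : JModule P J) (φ : MultiHom Z W), eval φ a = eval φ b
  iseqv := ⟨fun _ _ _ => rfl, fun h W φ => (h W φ).symm, fun h h' W φ => (h W φ).trans (h' W φ)⟩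

variable (Z)

/-- The module of expressions modulo equality of values. It satisfies the laws of a module because all
modules do. -/
def quotient : PModule.{u, v, max 1 u v} P where
  obj Γ Δ := Quotient (setoid Z Γ Δ)
  perm σ τ := Quotient.map (perm σ τ) fun _ _ h W φ => congrArg (W.toPModule.perm σ τ) (h W φ)
  perm_refl := Quotient.ind fun _ => Quotient.sound fun W _ => W.toPModule.perm_refl _
  perm_perm σ σ' τ τ' := Quotient.ind fun _ => Quotient.sound fun W _ =>
    W.toPModule.perm_perm σ σ' τ τ' _
  lact := ⟨fun f => Quotient.map (sa := setoid Z _ _) (sb := setoid Z _ _) (lact f)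
      fun _ _ h W φ => congrArg (W.toPModule.lact.comp f) (h W φ),
    fun σ τ ρ κ f => Quotient.ind fun _ => Quotient.sound fun W _ =>
      W.toPModule.lact.comp_perm σ τ ρ κ f _⟩
  ract := ⟨fun x f => Quotient.map (sa := setoid Z _ _) (sb := setoid Z _ _) (fun a => ract a f)
      (fun _ _ h W φ => congrArg (fun z => W.toPModule.ract.comp z f) (h W φ)) x,
    fun σ τ ρ κ x f => Quotient.inductionOn x fun _ => Quotient.sound fun W _ =>
      W.toPModule.ract.comp_perm σ τ ρ κ _ f⟩
  id_lact := Quotient.ind fun _ => Quotient.sound fun W _ => W.toPModule.id_lact _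
  ract_id := Quotient.ind fun _ => Quotient.sound fun W _ => W.toPModule.ract_id _
  assoc_left x g h := Quotient.inductionOn x fun _ => Quotient.sound fun W _ =>
    W.toPModule.assoc_left _ g h
  assoc_mid f x h := Quotient.inductionOn x fun _ => Quotient.sound fun W _ =>
    W.toPModule.assoc_mid f _ h
  assoc_right f g x := Quotient.inductionOn x fun _ => Quotient.sound fun W _ =>
    W.toPModule.assoc_right f g _
  out_left x g h := Quotient.inductionOn x fun _ => Quotient.sound fun W _ =>
    W.toPModule.out_left _ g h
  out_mid f x h := Quotient.inductionOn x fun _ => Quotient.sound fun W _ =>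
    W.toPModule.out_mid f _ h
  in_left x g h := Quotient.inductionOn x fun _ => Quotient.sound fun W _ =>
    W.toPModule.in_left _ g h
  in_right f g x := Quotient.inductionOn x fun _ => Quotient.sound fun W _ =>
    W.toPModule.in_right f g _

theorem quotient_respectsTensor {S : Fam P.Ob} {T : P.Ob} (t : P.Hom S (.single T))
    (ht : ∀ W : JModule P J, W.toPModule.RespectsTensor t) : (quotient Z).RespectsTensor t := by
  intro Γ Δ
  refine Function.bijective_iff_has_inverse.mpr
    ⟨Quotient.map (divTensor t ht) fun _ _ h W φ =>
      congrArg (Function.surjInv (ht W _ _).2) (h W φ), ?_, ?_⟩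
  · exact Quotient.ind fun _ => Quotient.sound fun W _ =>
      (ht W _ _).1 (Function.surjInv_eq (ht W _ _).2 _)
  · exact Quotient.ind fun _ => Quotient.sound fun W _ => Function.surjInv_eq (ht W _ _).2 _

theorem quotient_respectsCotensor {S : Fam P.Ob} {T : P.Ob} (t : P.Hom (.single T) S)
    (ht : ∀ W : JModule P J, W.toPModule.RespectsCotensor t) : (quotient Z).RespectsCotensor t := by
  intro Γ Δ
  refine Function.bijective_iff_has_inverse.mpr
    ⟨Quotient.map (divCotensor t ht) fun _ _ h W φ =>
      congrArg (Function.surjInv (ht W _ _).2) (h W φ), ?_, ?_⟩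
  · exact Quotient.ind fun _ => Quotient.sound fun W _ =>
      (ht W _ _).1 (Function.surjInv_eq (ht W _ _).2 _)
  · exact Quotient.ind fun _ => Quotient.sound fun W _ => Function.surjInv_eq (ht W _ _).2 _

/-- The tensor product of a list of modules. -/
def tensor : JModule P J :=
  ⟨quotient Z,
    ⟨fun h => quotient_respectsTensor Z _ fun W => W.respects.tensor h,
     fun h => quotient_respectsTensor Z _ fun W => W.respects.unit h,
     fun h => quotient_respectsCotensor Z _ fun W => W.respects.cotensor h,
     fun h => quotient_respectsCotensor Z _ fun W => W.respects.counit h⟩⟩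

/-- The universal multimorphism into the tensor product. -/
def mk : MultiHom Z (tensor Z) where
  toFun x := Quotient.mk _ (gen x)
  map_perm x y e := Quotient.sound fun _ φ => φ.map_perm x y e
  map_lact x y k e _ _ _ f s := Quotient.sound fun _ φ => φ.map_lact x y k e f s
  map_ract x y k e _ _ _ g s := Quotient.sound fun _ φ => φ.map_ract x y k e g s

variable {Z}

/-- The map of modules out of the tensor product given by a multimorphism. -/
noncomputable def evalMap (φ : MultiHom Z W) : ModuleMap (tensor Z).toPModule W.toPModule where
  app := Quotient.lift (eval φ) fun _ _ h => h W φ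
  map_perm _ _ := Quotient.ind fun _ => rfl
  map_lact _ := Quotient.ind fun _ => rfl
  map_ract x _ := Quotient.inductionOn x fun _ => rfl

/-- Uniqueness holds because a map of modules commutes with all the operations of which expressions
are made, division included. -/
theorem mk_weakTensor (Z : Fam (JModule P J)) : Multicat.WeakTensor (E := jmod P J) (mk Z) := by
  intro W
  constructor
  · intro g g' h
    change JModule P J at W
    change MultiHom (.single (tensor Z)) W at g
    change MultiHom (.single (tensor Z)) W at g'
    apply MultiHom.app_injective
    intro Γ Δ
    refine Quotient.ind fun a => ?_
    induction a with
    | gen x =>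
      exact (MultiHom.post_toFun (mk Z) g x).symm.trans
        ((congrFun (congrArg MultiHom.toFun h) x).trans (MultiHom.post_toFun (mk Z) g' x))
    | perm σ τ a ih =>
      exact (g.toMap.map_perm σ τ _).trans ((congrArg _ ih).trans (g'.toMap.map_perm σ τ _).symm)
    | lact f a ih =>
      exact (g.toMap.map_lact f _).trans ((congrArg _ ih).trans (g'.toMap.map_lact f _).symm)
    | ract a f ih =>
      exact (g.toMap.map_ract _ f).trans ((congrArg (fun z => W.toPModule.ract.comp z f) ih).trans
        (g'.toMap.map_ract _ f).symm)
    | @divTensor S T t ht Γ Δ a ih =>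
      apply (ht W _ _).1
      have h' : (tensor Z).toPModule.lact.comp (P.perm (.refl _) (Fam.Iso.nilLeft _).symm t)
          (Quotient.mk _ (divTensor t ht a)) = Quotient.mk _ a :=
        Quotient.sound fun W φ => Function.surjInv_eq (ht W _ _).2 _
      exact (g.toMap.map_lact _ _).symm.trans ((congrArg g.app h').trans
        (ih.trans ((congrArg g'.app h').symm.trans (g'.toMap.map_lact _ _))))
    | @divCotensor S T t ht Γ Δ a ih =>
      apply (ht W _ _).1
      have h' : (tensor Z).toPModule.ract.comp (Quotient.mk _ (divCotensor t ht a))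
          (P.perm (Fam.Iso.nilRight _).symm (.refl _) t) = Quotient.mk _ a :=
        Quotient.sound fun W φ => Function.surjInv_eq (ht W _ _).2 _
      exact (g.toMap.map_ract _ _).symm.trans ((congrArg g.app h').trans
        (ih.trans ((congrArg g'.app h').symm.trans (g'.toMap.map_ract _ _))))
  · intro φ
    exact ⟨MultiHom.ofMap (evalMap φ), MultiHom.post_ofMap (mk Z) (evalMap φ)⟩

end Term

theorem hasWeakTensors : (jmod P J).HasWeakTensors := fun Z => ⟨_, Term.mk Z, Term.mk_weakTensor Z⟩

end JModule

/-! ### Representable modules -/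

/-- Evaluation at one element, as a map out of an internal hom. -/
def PModule.HomEl.evalAt {P : Polycat.{u, v}} {U : PModule.{u, v, w₁} P} {W : PModule.{u, v, w₂} P}
    {G D : Fam P.Ob} (x : U.obj G D) : ModuleMap (W.hom U) (W.shift G D) :=
  ⟨fun F => HomEl.app F _ _ x, fun _ _ _ => rfl, fun _ _ => rfl, fun _ _ => rfl⟩

namespace PModule
variable {P : Polycat.{u, v}} (W : PModule.{u, v, w} P)

/-- The identity acts trivially from the left. -/
theorem lact_id_at {S D₁ N G D Φ Γ' Δ' : Fam P.Ob} {A : P.Ob} {σ : .single A ≅ₗ S}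
    {τ : .single A ≅ₗ D₁} {x : W.obj G D} {a : N ⊎ .single A ≅ₗ D₁} {a' : .single A ⊎ Φ ≅ₗ G}
    {b : S ⊎ Φ ≅ₗ Γ'} {c : N ⊎ D ≅ₗ Δ'} {ρ : G ≅ₗ Γ'} {κ : D ≅ₗ Δ'}
    (h1 : b.equiv (.inl (σ.equiv ())) = ρ.equiv (a'.equiv (.inl ())))
    (h2 : ∀ i, b.equiv (.inr i) = ρ.equiv (a'.equiv (.inr i)))
    (h3 : ∀ i, c.equiv (.inr i) = κ.equiv i) :
    W.lact.compAt (P.perm σ τ (P.id A)) x a a' b c = W.perm ρ κ x := by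
  obtain ⟨x, rfl⟩ := W.perm_surj a' (.refl _) x
  refine Eq.trans (b := W.lact.compAt (P.perm (.refl _) (Fam.Iso.nilLeft _).symm (P.id A)) x
    (.refl _) (.refl _) (a'.trans ρ) ((Fam.Iso.nilLeft _).trans κ)) ?_ ?_
  · refine (W.lact.at_perm_left).trans (Eq.trans ?_ (W.lact.at_perm_left).symm)
    apply W.lact.at_permR
    · rfl
    · rfl
    · rintro ⟨⟩; exact h1
    · intro i j h
      obtain rfl := Sum.inr_injective (a'.equiv.injective h)
      exact h2 i
    · rintro i ⟨⟩
    · intro i; exact h3 i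
  · rw [W.lact.at_eq, W.id_lact, W.perm_perm, W.perm_perm]
    apply W.perm_congr
    · intro i; rfl
    · intro i; rfl

/-- The identity acts trivially from the right. -/
theorem ract_id_at {S D₁ N G D Φ Γ' Δ' : Fam P.Ob} {A : P.Ob} {σ : .single A ≅ₗ S}
    {τ : .single A ≅ₗ D₁} {x : W.obj G D} {a : Φ ⊎ .single A ≅ₗ D} {a' : .single A ⊎ N ≅ₗ S}
    {b : G ⊎ N ≅ₗ Γ'} {c : Φ ⊎ D₁ ≅ₗ Δ'} {ρ : G ≅ₗ Γ'} {κ : D ≅ₗ Δ'}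
    (h1 : c.equiv (.inr (τ.equiv ())) = κ.equiv (a.equiv (.inr ())))
    (h2 : ∀ i, c.equiv (.inl i) = κ.equiv (a.equiv (.inl i)))
    (h3 : ∀ i, b.equiv (.inl i) = ρ.equiv i) :
    W.ract.compAt x (P.perm σ τ (P.id A)) a a' b c = W.perm ρ κ x := by
  obtain ⟨x, rfl⟩ := W.perm_surj (.refl _) a x
  refine Eq.trans (b := W.ract.compAt x (P.perm (Fam.Iso.nilRight _).symm (.refl _) (P.id A))
    (.refl _) (.refl _) ((Fam.Iso.nilRight _).trans ρ) (a.trans κ)) ?_ ?_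
  · refine (W.ract.at_perm_right).trans (Eq.trans ?_ (W.ract.at_perm_right).symm)
    apply W.ract.at_permL
    · rfl
    · rfl
    · intro i; exact h3 i
    · rintro i ⟨⟩
    · intro i j h
      obtain rfl := Sum.inl_injective (a.equiv.injective h)
      exact h2 i
    · rintro ⟨⟩; exact h1
  · rw [W.ract.at_eq, W.ract_id, W.perm_perm, W.perm_perm]
    apply W.perm_congr
    · intro i; rfl
    · intro i; rfl

variable {W} {K L : Fam P.Ob} {A : P.Ob}

/-- The map out of the contravariant representable module given by an element. -/
def HomEl.ofYo (w : W.obj (K ⊎ .single A) (L ⊎ .nil)) : HomEl (yo A) W K L where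
  app Γ Δ x := W.lact.compAt x.down w (.refl _) (.comm _ _)
    ((Fam.Iso.comm _ _).trans (.append (.refl _) (.nilRight _)))
    ((Fam.Iso.leftComm _ _ _).trans (.append (.refl _) (.nilRight _)))
  map_perm σ τ x := by
    refine Eq.trans ?_ (W.lact.perm_at _ _).symm
    apply W.lact.at_permL
    · rfl
    · rfl
    · rintro (i | ⟨⟨⟩⟩); rfl
    · rintro i j h; cases h; rfl
    · rintro i j h; cases h; rfl
    · rintro (i | ⟨⟨⟩⟩); rfl
  map_lact f x := by
    symm
    apply AssocLaw.compAt (@W.assoc_right)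
    · rfl
    · rfl
    · rfl
    · rfl
    · rintro i; rfl
    · rintro (i | ⟨⟨⟩⟩) (j | j) h <;> cases h; rfl
    · rintro i i' (j | j) h h' <;> cases h <;> cases h'; rfl
    · rintro i i' (j | j) h h' <;> cases h <;> cases h'; rfl
    · rintro i (j | j) h <;> cases h; rfl
    · rintro (i | ⟨⟨⟩⟩); rfl
  map_ract x f := by
    apply OutLaw.compAt (@W.out_mid) (.rightComm _ _ _)
    · rfl
    · rfl
    · rintro (i | i) h <;> cases h; rfl
    · rintro (i | i) h <;> cases h; rfl
    · rfl
    · rfl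
    · rintro (i | ⟨⟨⟩⟩); rfl
    · rintro i j h; cases h; rfl
    · rintro i j h; cases h; rfl
    · rintro x (i | i) (j | j) (i' | i') (j' | j') h h' k k' <;>
        cases h <;> cases h' <;> cases k <;> cases k'; rfl
    · rintro i (j | j) h <;> cases h; rfl
    · rintro (i | ⟨⟨⟩⟩) (j | j) h <;> cases h; rfl

/-- The map out of the covariant representable module given by an element. -/
def HomEl.ofNoy (w : W.obj (K ⊎ .nil) (L ⊎ .single A)) : HomEl (noy A) W K L where
  app Γ Δ x := W.ract.compAt w x.down (.refl _) (.comm _ _)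
    ((Fam.Iso.rightComm _ _ _).trans (.nilRight _))
    (.append (.refl _) (.nilRight _))
  map_perm σ τ x := by
    refine Eq.trans ?_ (W.ract.perm_at _ _).symm
    apply W.ract.at_permR
    · rfl
    · rfl
    · rintro (i | ⟨⟨⟩⟩); rfl
    · rintro i j h; cases h; rfl
    · rintro i j h; cases h; rfl
    · rintro (i | ⟨⟨⟩⟩); rfl
  map_ract x f := by
    apply AssocLaw.compAt (@W.assoc_left)
    · rfl
    · rfl
    · rfl
    · rfl
    · rintro (i | ⟨⟨⟩⟩); rfl
    · rintro i (j | j) h <;> cases h; rfl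
    · rintro i i' (j | j) h h' <;> cases h <;> cases h'; rfl
    · rintro i i' (j | j) h h' <;> cases h <;> cases h'; rfl
    · rintro (i | ⟨⟨⟩⟩) (j | j) h <;> cases h; rfl
    · rintro i; rfl
  map_lact f x := by
    symm
    apply InLaw.compAt (@W.in_left) (.comm _ _)
    · rfl
    · rfl
    · rintro (i | i) h <;> cases h; rfl
    · rintro (i | i) h <;> cases h; rfl
    · rfl
    · rfl
    · rintro (i | ⟨⟨⟩⟩); rfl
    · rintro i j h; cases h; rfl
    · rintro i j h; cases h; rfl
    · rintro x (i | i) (j | j) (i' | i') (j' | j') h h' k k' <;>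
        cases h <;> cases h' <;> cases k <;> cases k'; rfl
    · rintro (i | ⟨⟨⟩⟩) (j | j) h <;> cases h; rfl
    · rintro i (j | j) h <;> cases h; rfl

end PModule

namespace JModule
variable {P : Polycat.{u, v}} {J : P.Distinguished}

namespace MultiHom

/-- Composition with a bijective map of modules is bijective. -/
theorem map_bijective {Y : Fam (JModule P J)} {U V : JModule P J}
    {m : ModuleMap U.toPModule V.toPModule}
    (hm : ∀ Γ Δ : Fam P.Ob, Function.Bijective (m.app : U.toPModule.obj Γ Δ → _)) :
    Function.Bijective fun φ : MultiHom Y U => φ.map m := by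
  constructor
  · intro φ ψ h
    exact MultiHom.ext (funext fun x => (hm _ _).1 (congrFun (congrArg MultiHom.toFun h) x))
  · intro ψ
    have hi : ∀ {Γ Δ : Fam P.Ob} (z : V.toPModule.obj Γ Δ),
        m.app (Function.surjInv (hm Γ Δ).2 z) = z := fun z => Function.surjInv_eq (hm _ _).2 z
    refine ⟨⟨fun x => Function.surjInv (hm _ _).2 (ψ.toFun x), fun x y e => ?_,
      fun x y k e _ _ _ f s => ?_, fun x y k e _ _ _ f s => ?_⟩, MultiHom.ext (funext fun x => hi _)⟩
    · apply (hm _ _).1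
      rw [m.map_perm, hi, hi]
      exact ψ.map_perm x y e
    · apply (hm _ _).1
      rw [m.map_lact_at, hi, hi]
      exact ψ.map_lact x y k e f s
    · apply (hm _ _).1
      rw [m.map_ract_at, hi, hi]
      exact ψ.map_ract x y k e f s

end MultiHom

/-- The element `x` represents `U`: elements of an internal hom out of `U` are determined by their
value at `x`, which is arbitrary. -/
def Represents {U : JModule P J} (x : Elt U) : Prop :=
  ∀ (W : JModule P J) (K L : Fam P.Ob),
    Function.Bijective fun F : PModule.HomEl U.toPModule W.toPModule K L => F.app _ _ x.el

theorem Represents.fix_bijective {Y : Fam (JModule P J)} {U W : JModule P J} {u : Elt U}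
    (hu : Represents u) :
    Function.Bijective fun φ : MultiHom (Y ⊎ .single U) W => φ.fix u :=
  (MultiHom.map_bijective (U := hom U W) (V := W.shift u.inp u.out)
    (m := PModule.HomEl.evalAt u.el) (hu W)).comp MultiHom.curry_bijective

theorem Represents.cast {U V : JModule P J} {u : Elt U} (hu : Represents u) (h : U = V) :
    Represents (u.cast h) := by
  subst h; exact hu

/-- Multimorphisms out of `Z` are determined by their value at `x`, which is arbitrary. -/
def Generic {Z : Fam (JModule P J)} (x : ∀ k, Elt (Z.obj k)) : Prop :=
  ∀ W : JModule P J, Function.Bijective fun φ : MultiHom Z W => φ.toFun x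

/-- Arguments are fixed at representing elements one at a time. -/
theorem generic_of_represents {Z : Fam (JModule P J)} {x : ∀ k, Elt (Z.obj k)}
    (hx : ∀ k, Represents (x k)) : Generic x := by
  induction Z using Fam.induction with
  | @iso Z Z' σ ih =>
    intro W
    have h := ih (x := MultiHom.resp σ x) (fun k => (hx _).cast _) W
    refine (Function.Bijective.of_comp_iff _ ((jmod P J).perm_bijective σ (rfl : W = W))).mp ?_
    exact (W.toPModule.perm_bijective _ _).comp h
  | nil =>
    intro W
    constructor
    · intro φ ψ h
      refine MultiHom.ext (funext fun y => ?_)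
      obtain rfl : x = y := funext fun k => k.elim
      exact h
    · intro w
      refine ⟨⟨fun y => (funext fun k => k.elim : x = y) ▸ w, fun y z e => ?_,
        fun y z k => k.elim, fun y z k => k.elim⟩, rfl⟩
      obtain rfl : x = y := funext fun k => k.elim
      obtain rfl : x = z := funext fun k => k.elim
      refine W.toPModule.perm_id' ?_ ?_
      · rintro ⟨⟨⟩, i⟩
      · rintro ⟨⟨⟩, i⟩
  | snoc Z U ih =>
    intro W
    have h := (ih (x := fun k => x (.inl k)) (fun k => hx _) (W.shift _ _)).comp
      (hx (.inr ())).fix_bijective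
    obtain ⟨y, u, rfl⟩ : ∃ y u, x = Elt.snoc y u := ⟨_, _, (Elt.snoc_eta x).symm⟩
    exact (Function.Bijective.of_comp_iff' (W.toPModule.perm_bijective _ _) _).mp h

/-- Every element of a contravariant representable module is obtained from the identity by acting with a
morphism of `P`. -/
def yoStep {A : P.Ob} (x : Elt (yo J A)) :
    LStep (A := A) (P.perm (Fam.Iso.nilRight _) (.refl _) x.el.down) (yoOne J A) x where
  rest := .nil
  src := .nilRight (.single A)
  inp := .nilRight _
  out := .nilRight _
  el_eq := by
    refine (PModule.shift_lact_at (PModule.self P)).trans ?_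
    refine ((PModule.self P).ract_id_at
      (x := ⟨P.perm (Fam.Iso.nilRight _) (.refl _) x.el.down⟩)
      (ρ := (Fam.Iso.nilRight _).symm) (κ := .refl _) ?_ ?_ ?_).trans ?_
    · rfl
    · intro i; rfl
    · intro i; rfl
    · refine ((PModule.self P).perm_perm _ _ _ _ _).trans ((PModule.self P).perm_id' ?_ ?_)
      · rintro (i | ⟨⟨⟩⟩); rfl
      · intro i; rfl

/-- Every element of a covariant representable module is obtained from the identity by acting with a
morphism of `P`. -/
def noyStep {A : P.Ob} (x : Elt (noy J A)) :
    RStep (A := A) (P.perm (.comm _ _) (Fam.Iso.nilRight _) x.el.down) (noyOne J A) x where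
  rest := .nil
  src := .nilLeft (.single A)
  inp := .nilLeft _
  out := .nilLeft _
  el_eq := by
    refine (PModule.shift_ract_at (PModule.self P)).trans ?_
    refine ((PModule.self P).lact_id_at
      (x := ⟨P.perm (.comm _ _) (Fam.Iso.nilRight _) x.el.down⟩)
      (ρ := (Fam.Iso.comm _ _)) (κ := (Fam.Iso.nilRight _).symm) ?_ ?_ ?_).trans ?_
    · rfl
    · intro i; rfl
    · intro i; rfl
    · refine ((PModule.self P).perm_perm _ _ _ _ _).trans ((PModule.self P).perm_id' ?_ ?_)
      · rintro (i | i) <;> rfl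
      · rintro (i | ⟨⟨⟩⟩); rfl

variable (J)

/-- The Yoneda lemma for contravariant representable modules. -/
theorem represents_yoOne (A : P.Ob) : Represents (yoOne J A) := by
  intro W K L
  constructor
  · intro F G h
    refine PModule.HomEl.ext (funext fun Γ => funext fun Δ => funext fun x => ?_)
    have hx := (yoStep (⟨Γ, Δ, x⟩ : Elt (yo J A))).el_eq
    exact (congrArg (F.app Γ Δ) hx.symm).trans ((F.map_lact_at _ _ _ _ _).trans
      ((congrArg (fun z => W.toPModule.lact.compAt _ z _ _ _ _) h).trans
        ((G.map_lact_at _ _ _ _ _).symm.trans (congrArg (G.app Γ Δ) hx))))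
  · intro w
    refine ⟨PModule.HomEl.ofYo w, (W.toPModule.lact_id_at (ρ := .refl _) (κ := .refl _)
      ?_ ?_ ?_).trans (W.toPModule.perm_refl _)⟩
    · rfl
    · intro i; rfl
    · rintro (i | ⟨⟨⟩⟩); rfl

/-- The Yoneda lemma for covariant representable modules. -/
theorem represents_noyOne (A : P.Ob) : Represents (noyOne J A) := by
  intro W K L
  constructor
  · intro F G h
    refine PModule.HomEl.ext (funext fun Γ => funext fun Δ => funext fun x => ?_)
    have hx := (noyStep (⟨Γ, Δ, x⟩ : Elt (noy J A))).el_eq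
    exact (congrArg (F.app Γ Δ) hx.symm).trans ((F.map_ract_at _ _ _ _ _).trans
      ((congrArg (fun z => W.toPModule.ract.compAt z _ _ _ _ _) h).trans
        ((G.map_ract_at _ _ _ _ _).symm.trans (congrArg (G.app Γ Δ) hx))))
  · intro w
    refine ⟨PModule.HomEl.ofNoy w, (W.toPModule.ract_id_at (ρ := .refl _) (κ := .refl _)
      ?_ ?_ ?_).trans (W.toPModule.perm_refl _)⟩
    · rfl
    · intro i; rfl
    · rintro (i | ⟨⟨⟩⟩); rfl

theorem ones_generic (Γ Δ : Fam P.Ob) : Generic (Z := ((Γ.map (yonedaOb P J) ⊎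
    (Δ.map (yonedaOb P J)).map ChuOb.dual).map ChuOb.pos : Fam (JModule P J))) (ones J Γ Δ) := by
  apply generic_of_represents
  rintro (i | i)
  · exact represents_yoOne J _
  · exact represents_noyOne J _

end JModule

/-! ### Representable modules in the envelope -/

/-- A concatenation of two lists, in the opposite order. -/
abbrev Fam.Iso.pairSigma {C : Type u} (hK : Finite (Unit ⊕ Unit)) (s : Unit ⊕ Unit → Fam C) :
    Fam.sigma hK s ≅ₗ s (.inr ()) ⊎ s (.inl ()) :=
  ⟨⟨fun | ⟨.inl _, i⟩ => .inr i | ⟨.inr _, i⟩ => .inl i,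
    Sum.elim (fun i => ⟨.inr (), i⟩) fun i => ⟨.inl (), i⟩,
    by rintro ⟨k | k, i⟩ <;> rfl, by rintro (i | i) <;> rfl⟩,
    by rintro ⟨k | k, i⟩ <;> rfl⟩

namespace JModule
variable {P : Polycat.{u, v}} {J : P.Distinguished}

/-- A list of two elements. -/
abbrev Elt.pair {U V : JModule P J} (u : Elt U) (v : Elt V) :
    ∀ k, Elt ((Fam.single U ⊎ Fam.single V).obj k)
  | .inl _ => u
  | .inr _ => v

namespace MultiHom
variable {Y : Fam (JModule P J)} {U V W : JModule P J}

theorem fix_sub (h : MultiHom Y V) (p : MultiHom (.single U ⊎ .single V) W) (u : Elt U)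
    (y : ∀ k, Elt (Y.obj k)) :
    (fix (Multicat.sub (jmod P J) h p (.refl _) (.refl _)) u).toFun y =
      W.toPModule.perm (.pairSigma _ _) (.pairSigma _ _)
        (p.toFun (Elt.pair u ⟨_, _, h.toFun y⟩)) := by
  refine (W.toPModule.perm_perm _ _ _ _ _).trans ((W.toPModule.perm_perm _ _ _ _ _).trans
    ((W.toPModule.perm_perm _ _ _ _ _).trans ?_))
  refine p.perm_eq (x := resp (Fam.Iso.refl _).symm (h.mid (resp (.refl _) (Elt.snoc y u))))
    (y := Elt.pair u ⟨_, _, h.toFun y⟩)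
    (fun | .inl _ => EltIso.refl u | .inr _ => ⟨.refl _, .refl _, V.toPModule.perm_refl _⟩) ?_ ?_
  · rintro (k | k) i <;> rfl
  · rintro (k | k) i <;> rfl

end MultiHom

theorem cut_yoOne {A : P.Ob} (z : Elt (noy J A)) :
    P.perm (.pairSigma _ _) (.pairSigma _ _) (cutEl (Elt.pair (yoOne J A) z)) = z.el.down := by
  refine (P.act.perm_at _ _).trans ?_
  refine (congrArg ULift.down ((PModule.self P).lact_id_at (x := ⟨z.el.down⟩)
    (ρ := .refl _) (κ := .refl _) ?_ ?_ ?_)).trans (P.perm_refl _)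
  · rfl
  · intro i; rfl
  · rintro (i | ⟨⟨⟩⟩); rfl

theorem cut_noyOne {A : P.Ob} (z : Elt (yo J A)) :
    P.perm ((Fam.Iso.pairSigma _ _).trans (.comm _ _)) ((Fam.Iso.pairSigma _ _).trans (.comm _ _))
      (cutEl (Elt.pair z (noyOne J A))) = z.el.down := by
  refine (P.act.perm_at _ _).trans ?_
  refine (congrArg ULift.down ((PModule.self P).ract_id_at (x := ⟨z.el.down⟩)
    (ρ := .refl _) (κ := .refl _) ?_ ?_ ?_)).trans (P.perm_refl _)
  · rfl
  · intro i; rfl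
  · rintro (i | ⟨⟨⟩⟩); rfl

/-- Composing with the pairing and evaluating it at the identity does nothing. -/
theorem fix_sub_cut {A : P.Ob} {Y : Fam (JModule P J)} (h : MultiHom Y (noy J A))
    (y : ∀ k, Elt (Y.obj k)) :
    (MultiHom.fix (Multicat.sub (jmod P J) h (cut J A) (.refl _) (.refl _)) (yoOne J A)).toFun y =
      h.toFun y :=
  (MultiHom.fix_sub h (cut J A) (yoOne J A) y).trans
    (congrArg ULift.up (cut_yoOne ⟨_, _, h.toFun y⟩))

variable (J)

/-- A multimorphism into the covariant representable module is determined by its pairing with the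
contravariant one, because the latter is represented by the identity. -/
theorem negRep_yonedaOb (A : P.Ob) : ChuHom.NegRep (yonedaOb P J A) := by
  intro Y
  refine (Function.Bijective.of_comp_iff' (represents_yoOne J A).fix_bijective _).mp ?_
  suffices h : (fun φ => φ.fix (yoOne J A)) ∘ (fun h : MultiHom Y (noy J A) =>
      Multicat.sub (jmod P J) h (cut J A) (.refl _) (.refl _)) = (id : MultiHom Y (noy J A) → _) by
    exact h ▸ Function.bijective_id
  exact funext fun h => MultiHom.ext (funext fun y => fix_sub_cut h y)

variable {J} in
theorem fix_sub_dual {A : P.Ob} {Y : Fam (JModule P J)} (h : MultiHom Y (yo J A))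
    (y : ∀ k, Elt (Y.obj k)) :
    (MultiHom.fix (Multicat.sub (jmod P J) h ((jmod P J).perm (.comm _ _) rfl (cut J A))
      (.refl _) (.refl _)) (noyOne J A)).toFun y = h.toFun y := by
  refine (MultiHom.fix_sub h _ (noyOne J A) y).trans
    (Eq.trans ?_ (congrArg ULift.up (cut_noyOne ⟨_, _, h.toFun y⟩)))
  refine ((self J).toPModule.perm_perm _ _ _ _ _).trans ?_
  refine (cut J A).perm_eq
    (x := MultiHom.resp (.comm _ _) (Elt.pair (noyOne J A) ⟨_, _, h.toFun y⟩))
    (y := Elt.pair ⟨_, _, h.toFun y⟩ (noyOne J A))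
    (fun | .inl _ => ⟨.refl _, .refl _, (yo J A).toPModule.perm_refl _⟩
         | .inr _ => EltIso.refl (noyOne J A)) ?_ ?_
  · rintro (k | k) i <;> rfl
  · rintro (k | k) i <;> rfl

theorem negRep_dual_yonedaOb (A : P.Ob) : ChuHom.NegRep (yonedaOb P J A).dual := by
  intro Y
  refine (Function.Bijective.of_comp_iff' (represents_noyOne J A).fix_bijective _).mp ?_
  suffices h : (fun φ => φ.fix (noyOne J A)) ∘ (fun h : MultiHom Y (yo J A) =>
      Multicat.sub (jmod P J) h ((jmod P J).perm (.comm _ _) rfl (cut J A)) (.refl _) (.refl _)) =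
        (id : MultiHom Y (yo J A) → _) by
    exact h ▸ Function.bijective_id
  exact funext fun h => MultiHom.ext (funext fun y => fix_sub_dual h y)

/-- A morphism of the envelope between images of objects of `P` is determined by its component into the
hom-sets of `P`, which is arbitrary. -/
theorem under_bijective (Γ Δ : Fam P.Ob) : Function.Bijective
    (ChuHom.under : (env P J).Hom (Γ.map (yonedaOb P J)) (Δ.map (yonedaOb P J)) → _) := by
  apply ChuHom.under_bijective
  rintro (i | i)
  · exact negRep_yonedaOb J _
  · exact negRep_dual_yonedaOb J _

/-- A morphism between images of objects of `P` amounts to a multimorphism from representable modules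
to the hom-sets of `P`, and this amounts, by the Yoneda lemma, to its value at the identities. -/
theorem atOnes_bijective (Γ Δ : Fam P.Ob) : Function.Bijective
    (atOnes J : (env P J).Hom (Γ.map (yonedaOb P J)) (Δ.map (yonedaOb P J)) → P.Hom Γ Δ) :=
  (P.bi.perm_bijective _ _).comp (Equiv.ulift.bijective.comp
    ((ones_generic J Γ Δ (self J)).comp (under_bijective J Γ Δ)))

variable {J}

theorem toFun_ones {Γ Δ : Fam P.Ob}
    (g : (env P J).Hom (Γ.map (yonedaOb P J)) (Δ.map (yonedaOb P J))) :
    MultiHom.toFun (ChuHom.under (E := jmod P J) (bot := self J) g) (ones J Γ Δ) =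
      ⟨P.perm (onesInp J Γ Δ) (onesOut J Γ Δ) (atOnes J g)⟩ := by
  refine congrArg ULift.up (Eq.symm ((P.perm_perm _ _ _ _ _).trans (P.bi.perm_id' ?_ ?_)))
  · exact fun i => Equiv.apply_symm_apply (onesInp J Γ Δ).equiv i
  · exact fun i => Equiv.apply_symm_apply (onesOut J Γ Δ).equiv i

theorem atOnes_eq {Γ Δ : Fam P.Ob}
    {g : (env P J).Hom (Γ.map (yonedaOb P J)) (Δ.map (yonedaOb P J))} {f : P.Hom Γ Δ}
    (h : MultiHom.toFun (ChuHom.under (E := jmod P J) (bot := self J) g) (ones J Γ Δ) =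
      ⟨P.perm (onesInp J Γ Δ) (onesOut J Γ Δ) f⟩) : atOnes J g = f :=
  (P.bi.perm_bijective (onesInp J Γ Δ) (onesOut J Γ Δ)).1
    (congrArg ULift.down ((toFun_ones g).symm.trans h))

/-- The value at a relabelling of the identities. -/
theorem toFun_of_ones {Γ Δ : Fam P.Ob}
    (g : (env P J).Hom (Γ.map (yonedaOb P J)) (Δ.map (yonedaOb P J)))
    {y : ∀ k, Elt (((Γ.map (yonedaOb P J) ⊎ (Δ.map (yonedaOb P J)).map ChuOb.dual).map
      ChuOb.pos : Fam (JModule P J)).obj k)} (e : ∀ k, EltIso (ones J Γ Δ k) (y k)) :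
    MultiHom.toFun (ChuHom.under (E := jmod P J) (bot := self J) g) y =
      ⟨P.perm ((onesInp J Γ Δ).trans (.sigma _ fun k => (e k).inp))
        ((onesOut J Γ Δ).trans (.sigma _ fun k => (e k).out)) (atOnes J g)⟩ :=
  ((ChuHom.under (E := jmod P J) (bot := self J) g).map_perm (ones J _ _) y e).symm.trans
    ((congrArg ((self J).toPModule.perm _ _) (toFun_ones g)).trans
      (congrArg ULift.up (P.perm_perm _ _ _ _ _)))

theorem atOnes_perm {Γ Γ' Δ Δ' : Fam P.Ob} (σ : Γ ≅ₗ Γ') (τ : Δ ≅ₗ Δ')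
    (g : (env P J).Hom (Γ.map (yonedaOb P J)) (Δ.map (yonedaOb P J))) :
    atOnes J ((env P J).perm (σ.map (yonedaOb P J)) (τ.map (yonedaOb P J)) g) =
      P.perm σ τ (atOnes J g) := by
  obtain ⟨I, hI, o⟩ := Γ
  obtain ⟨I', hI', o'⟩ := Γ'
  obtain ⟨K, hK, p⟩ := Δ
  obtain ⟨K', hK', p'⟩ := Δ'
  obtain ⟨σ, hσ⟩ := σ
  obtain ⟨τ, hτ⟩ := τ
  change I ≃ I' at σ
  change K ≃ K' at τ
  obtain rfl : (fun k => o' (σ k)) = o := funext hσ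
  obtain rfl : (fun k => p' (τ k)) = p := funext hτ
  apply atOnes_eq
  have e : ∀ k : I ⊕ K, EltIso (ones J ⟨I, hI, fun k => o' (σ k)⟩ ⟨K, hK, fun k => p' (τ k)⟩ k)
      (MultiHom.resp (P := P) (J := J) (Fam.Iso.map ChuOb.pos (Fam.Iso.append
        (Fam.Iso.map (yonedaOb P J) (Fam.Iso.mk (Γ := ⟨I, hI, fun k => o' (σ k)⟩)
          (Δ := ⟨I', hI', o'⟩) σ hσ))
        (Fam.Iso.map ChuOb.dual (Fam.Iso.map (yonedaOb P J)
          (Fam.Iso.mk (Γ := ⟨K, hK, fun k => p' (τ k)⟩) (Δ := ⟨K', hK', p'⟩) τ hτ)))))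
        (ones J ⟨I', hI', o'⟩ ⟨K', hK', p'⟩) k) := by
    rintro (k | k)
    · exact .refl (yoOne J (o' (σ k)))
    · exact .refl (noyOne J (p' (τ k)))
  refine (congrArg ((self J).toPModule.perm _ _) (toFun_of_ones g e)).trans ?_
  refine congrArg ULift.up ((P.perm_perm _ _ _ _ _).trans
    (Eq.trans (P.bi.perm_congr ?_ ?_) (P.perm_perm _ _ _ _ _).symm))
  · intro k; rfl
  · intro k; rfl

end JModule

/-! ### The functor into the envelope -/

namespace JModule
variable {P : Polycat.{u, v}} {J : P.Distinguished}

theorem cutEl_yoOne {A : P.Ob} (z : Elt (noy J A)) :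
    cutEl (Elt.pair (yoOne J A) z) =
      P.perm (Fam.Iso.pairSigma _ _).symm (Fam.Iso.pairSigma _ _).symm z.el.down := by
  rw [← cut_yoOne z, P.perm_perm]
  refine (P.bi.perm_id' ?_ ?_).symm
  · rintro ⟨k | k, i⟩ <;> rfl
  · rintro ⟨k | k, i⟩ <;> rfl

theorem atOnes_id (A : P.Ob) : atOnes J ((env P J).id (yonedaOb P J A)) = P.id A := by
  apply atOnes_eq (Γ := .single A) (Δ := .single A)
  have e : ∀ k : Unit ⊕ Unit, EltIso (Elt.pair (yoOne J A) (noyOne J A) k)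
      (MultiHom.resp (P := P) (J := J) (Fam.Iso.mapAppend ChuOb.pos (.single (yonedaOb P J A))
        (.single (yonedaOb P J A).dual)) (ones J (.single A) (.single A)) k) := by
    rintro (k | k)
    · exact .refl (yoOne J A)
    · exact .refl (noyOne J A)
  refine (congrArg ((self J).toPModule.perm _ _) (((cut J A).map_perm _ _ e).symm.trans
    (congrArg ((self J).toPModule.perm _ _) (congrArg ULift.up (cutEl_yoOne (noyOne J A)))))).trans ?_
  refine congrArg ULift.up ((congrArg _ (P.perm_perm _ _ _ _ _)).trans ((P.perm_perm _ _ _ _ _).trans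
    ((P.perm_perm _ _ _ _ _).trans (P.bi.perm_congr ?_ ?_))))
  · intro k; rfl
  · intro k; rfl

end JModule

/-- Splitting a concatenation indexed by a sum. -/
abbrev Fam.Iso.sigmaSum {C : Type u} {K L : Type} (hK : Finite K) (hL : Finite L)
    (hM : Finite (K ⊕ L)) (s : K ⊕ L → Fam C) :
    Fam.sigma hL (fun l => s (.inr l)) ⊎ Fam.sigma hK (fun k => s (.inl k)) ≅ₗ Fam.sigma hM s :=
  ⟨⟨Sum.elim (fun p => ⟨.inr p.1, p.2⟩) fun p => ⟨.inl p.1, p.2⟩,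
    fun | ⟨.inl k, i⟩ => .inr ⟨k, i⟩ | ⟨.inr l, i⟩ => .inl ⟨l, i⟩,
    by rintro (i | i) <;> rfl, by rintro ⟨k | l, i⟩ <;> rfl⟩, by rintro (i | i) <;> rfl⟩

/-- A list of outputs without its last entry, which has been erased. -/
abbrev Fam.Iso.eraseOut {C : Type u} {D : Type v} (G : C → D) (X : Fam D) (Δ : Fam C) (A : C) :
    (X ⊎ (Δ ⊎ .single A).map G).erase (.inr (.inr ())) ≅ₗ X ⊎ Δ.map G :=
  ⟨⟨fun | ⟨.inl i, _⟩ => .inl i | ⟨.inr (.inl i), _⟩ => .inr i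
        | ⟨.inr (.inr _), h⟩ => absurd rfl h,
    Sum.elim (fun i => ⟨.inl i, by simp⟩) fun i => ⟨.inr (.inl i), by simp⟩,
    by rintro ⟨i | i | i, h⟩; exacts [rfl, rfl, absurd rfl h], by rintro (i | i) <;> rfl⟩,
    by rintro ⟨i | i | i, h⟩; exacts [rfl, rfl, absurd rfl h]⟩

/-- A list of inputs without its first entry, which has been erased. -/
abbrev Fam.Iso.eraseIn {C : Type u} {D : Type v} (F : C → D) (A : C) (Φ : Fam C) (Y : Fam D) :
    ((.single A ⊎ Φ).map F ⊎ Y).erase (.inl (.inl ())) ≅ₗ Φ.map F ⊎ Y :=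
  ⟨⟨fun | ⟨.inl (.inl _), h⟩ => absurd rfl h
        | ⟨.inl (.inr i), _⟩ => .inl i
        | ⟨.inr i, _⟩ => .inr i,
    Sum.elim (fun i => ⟨.inl (.inr i), by simp⟩) fun i => ⟨.inr i, by simp⟩,
    by rintro ⟨(i | i) | i, h⟩; exacts [absurd rfl h, rfl, rfl], by rintro (i | i) <;> rfl⟩,
    by rintro ⟨(i | i) | i, h⟩; exacts [absurd rfl h, rfl, rfl]⟩

/-- Moving the last output to the end. -/
abbrev Fam.Iso.splitOut {C : Type u} {D : Type v} (G : C → D) (X : Fam D) (Δ : Fam C) (A : C) :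
    X ⊎ (Δ ⊎ .single A).map G ≅ₗ X ⊎ Δ.map G ⊎ .single (G A) :=
  ⟨(Equiv.sumAssoc _ _ _).symm, by rintro (i | i | i) <;> rfl⟩

/-- Moving the first input to the end. -/
abbrev Fam.Iso.splitIn {C : Type u} {D : Type v} (F : C → D) (A : C) (Φ : Fam C) (Y : Fam D) :
    (.single A ⊎ Φ).map F ⊎ Y ≅ₗ Φ.map F ⊎ Y ⊎ .single (F A) :=
  ⟨⟨Sum.elim (Sum.elim .inr fun i => .inl (.inl i)) fun i => .inl (.inr i),
    Sum.elim (Sum.elim (fun i => .inl (.inr i)) .inr) fun i => .inl (.inl i),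
    by rintro ((i | i) | i) <;> rfl, by rintro ((i | i) | i) <;> rfl⟩,
    by rintro ((i | i) | i) <;> rfl⟩

/-- The middle-four interchange of lists. -/
abbrev Fam.Iso.shuffle {C : Type u} {D : Type v} (F G : C → D) (Γ Φ Δ Ψ : Fam C) :
    (Γ ⊎ Φ).map F ⊎ (Δ ⊎ Ψ).map G ≅ₗ Γ.map F ⊎ Δ.map G ⊎ (Φ.map F ⊎ Ψ.map G) :=
  ⟨Equiv.sumSumSumComm _ _ _ _, by rintro ((i | i) | (i | i)) <;> rfl⟩

theorem ChuHom.under_cut {E : Multicat.{u, v}} {bot : E.Ob} {X Y Z : Fam (ChuOb E bot)}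
    (f : ChuHom E bot X) (g : ChuHom E bot Y) (k : X.I) (l : Y.I)
    (h : DualPair (X.obj k) (Y.obj l)) (c : X.erase k ⊎ Y.erase l ≅ₗ Z) :
    (cut f g k l h c).under = E.perm (c.map ChuOb.pos) rfl (E.sub (f.comp k) g.under
      (.insert (Y.map ChuOb.pos) l h.neg_eq.symm) (.mapAppend ChuOb.pos (X.erase k) (Y.erase l))) := rfl

namespace JModule
variable {P : Polycat.{u, v}} {J : P.Distinguished}

/-- The value of a composite multimorphism is that of the second factor at the value of the first. -/
theorem MultiHom.sub_toFun {X Y : Fam (JModule P J)} {V W : JModule P J} (h : MultiHom X V)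
    (p : MultiHom (Y ⊎ .single V) W) (z : ∀ k, Elt ((X ⊎ Y).obj k)) :
    MultiHom.toFun (Multicat.sub (jmod P J) h p (.refl _) (.refl _)) z =
      W.toPModule.perm (.sigmaSum X.fin Y.fin (X ⊎ Y).fin fun k => (z k).inp)
        (.sigmaSum X.fin Y.fin (X ⊎ Y).fin fun k => (z k).out)
        ((p.fix ⟨_, _, h.toFun fun k => z (.inl k)⟩).toFun fun k => z (.inr k)) := by
  refine (W.toPModule.perm_perm _ _ _ _ _).trans ((W.toPModule.perm_perm _ _ _ _ _).trans
    (Eq.trans ?_ (W.toPModule.perm_perm _ _ _ _ _).symm))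
  refine p.perm_eq (x := resp (Fam.Iso.refl _).symm (h.mid (resp (.refl _) z)))
    (y := Elt.snoc (fun k => z (.inr k)) ⟨_, _, h.toFun fun k => z (.inl k)⟩)
    (fun | .inl k => EltIso.refl (z (.inr k)) | .inr _ => ⟨.refl _, .refl _, V.toPModule.perm_refl _⟩) ?_ ?_
  · rintro (k | k) i <;> rfl
  · rintro (k | k) i <;> rfl

section
variable {Γ Δ Φ Ψ : Fam P.Ob} {A : P.Ob}

/-- The component of a morphism of the envelope at its last output. -/
noncomputable def outComp
    (f : (env P J).Hom (Γ.map (yonedaOb P J)) ((Δ ⊎ .single A).map (yonedaOb P J))) :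
    MultiHom ((Γ.map (yonedaOb P J) ⊎ (Δ.map (yonedaOb P J)).map ChuOb.dual).map ChuOb.pos :
      Fam (JModule P J)) (yo J A) :=
  (jmod P J).perm ((Fam.Iso.eraseOut (fun A => (yonedaOb P J A).dual) (Γ.map (yonedaOb P J)) Δ A).map
    ChuOb.pos) rfl (ChuHom.comp (E := jmod P J) (bot := self J) f (.inr (.inr ())))

theorem sub_outComp
    (f : (env P J).Hom (Γ.map (yonedaOb P J)) ((Δ ⊎ .single A).map (yonedaOb P J))) :
    Multicat.sub (jmod P J) (outComp f) ((jmod P J).perm (.comm _ _) rfl (cut J A)) (.refl _) (.refl _) =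
      (jmod P J).perm (((Fam.Iso.splitOut (fun A => (yonedaOb P J A).dual)
        (Γ.map (yonedaOb P J)) Δ A).map ChuOb.pos).trans (Fam.Iso.mapAppend ChuOb.pos _ _).symm) rfl
        (ChuHom.under (E := jmod P J) (bot := self J) f) := by
  refine Eq.trans ?_ (congrArg _ (ChuHom.compat_sub (E := jmod P J) (bot := self J) f (.inr (.inr ()))))
  refine (Multicat.sub_perm_left _ _ rfl _ _ _ _).trans ?_
  apply Multicat.sub_eq_perm
  · rfl
  · rintro ⟨i | i | i, h⟩
    · rfl
    · rfl
    · exact absurd rfl h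
  · rintro ⟨⟩ ⟨⟩ -
    rfl

theorem outComp_ones
    (f : (env P J).Hom (Γ.map (yonedaOb P J)) ((Δ ⊎ .single A).map (yonedaOb P J))) :
    (outComp f).toFun (ones J Γ Δ) =
      ⟨P.perm ((onesInp J Γ Δ).trans (Fam.Iso.nilRight _).symm)
        ((onesOut J Γ Δ).append (.refl _)) (atOnes J f)⟩ := by
  refine (fix_sub_dual (outComp f) (ones J Γ Δ)).symm.trans ?_
  refine (congrArg (fun φ : MultiHom (((Γ.map (yonedaOb P J) ⊎
    (Δ.map (yonedaOb P J)).map ChuOb.dual).map ChuOb.pos : Fam (JModule P J)) ⊎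
      .single (noy J A)) (self J) => (φ.fix (noyOne J A)).toFun (ones J Γ Δ)) (sub_outComp f)).trans ?_
  have e : ∀ k : Γ.I ⊕ (Δ.I ⊕ Unit), EltIso (ones J Γ (Δ ⊎ .single A) k)
      (MultiHom.resp (P := P) (J := J) (((Fam.Iso.splitOut (fun A => (yonedaOb P J A).dual)
        (Γ.map (yonedaOb P J)) Δ A).map ChuOb.pos).trans (Fam.Iso.mapAppend ChuOb.pos _ _).symm)
        (Elt.snoc (ones J Γ Δ) (noyOne J A)) k) := by
    rintro (k | k | k)
    · exact .refl (yoOne J _)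
    · exact .refl (noyOne J _)
    · exact .refl (noyOne J _)
  refine (congrArg ((self J).toPModule.perm _ _) (congrArg ((self J).toPModule.perm _ _)
    (toFun_of_ones f e))).trans ?_
  refine congrArg ULift.up ((congrArg _ (P.perm_perm _ _ _ _ _)).trans ((P.perm_perm _ _ _ _ _).trans
    (P.bi.perm_congr ?_ ?_)))
  · intro k; rfl
  · rintro (k | k) <;> rfl

/-- The component of a morphism of the envelope into the hom-sets, with its first input moved to
the end. -/
noncomputable def inUnder
    (g : (env P J).Hom ((.single A ⊎ Φ).map (yonedaOb P J)) (Ψ.map (yonedaOb P J))) :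
    MultiHom (((Φ.map (yonedaOb P J) ⊎ (Ψ.map (yonedaOb P J)).map ChuOb.dual).map ChuOb.pos :
      Fam (JModule P J)) ⊎ .single (yo J A)) (self J) :=
  (jmod P J).perm (((Fam.Iso.splitIn (yonedaOb P J) A Φ
    ((Ψ.map (yonedaOb P J)).map ChuOb.dual)).map ChuOb.pos).trans
      (Fam.Iso.mapAppend ChuOb.pos _ _).symm) rfl (ChuHom.under (E := jmod P J) (bot := self J) g)

theorem inUnder_ones
    (g : (env P J).Hom ((.single A ⊎ Φ).map (yonedaOb P J)) (Ψ.map (yonedaOb P J))) :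
    ((inUnder g).fix (yoOne J A)).toFun (ones J Φ Ψ) =
      ⟨P.perm ((Fam.Iso.comm _ _).trans ((onesInp J Φ Ψ).append (.refl _)))
        ((onesOut J Φ Ψ).trans (Fam.Iso.nilRight _).symm) (atOnes J g)⟩ := by
  have e : ∀ k : (Unit ⊕ Φ.I) ⊕ Ψ.I, EltIso (ones J (.single A ⊎ Φ) Ψ k)
      (MultiHom.resp (P := P) (J := J) (((Fam.Iso.splitIn (yonedaOb P J) A Φ
        ((Ψ.map (yonedaOb P J)).map ChuOb.dual)).map ChuOb.pos).trans
          (Fam.Iso.mapAppend ChuOb.pos _ _).symm) (Elt.snoc (ones J Φ Ψ) (yoOne J A)) k) := by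
    rintro ((k | k) | k)
    · exact .refl (yoOne J _)
    · exact .refl (yoOne J _)
    · exact .refl (noyOne J _)
  refine (congrArg ((self J).toPModule.perm _ _) (congrArg ((self J).toPModule.perm _ _)
    (toFun_of_ones g e))).trans ?_
  refine congrArg ULift.up ((congrArg _ (P.perm_perm _ _ _ _ _)).trans ((P.perm_perm _ _ _ _ _).trans
    (P.bi.perm_congr ?_ ?_)))
  · rintro (k | k) <;> rfl
  · intro k; rfl

/-- The component of a morphism of the envelope at its first input. -/
noncomputable def inComp
    (g : (env P J).Hom ((.single A ⊎ Φ).map (yonedaOb P J)) (Ψ.map (yonedaOb P J))) :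
    MultiHom ((Φ.map (yonedaOb P J) ⊎ (Ψ.map (yonedaOb P J)).map ChuOb.dual).map ChuOb.pos :
      Fam (JModule P J)) (noy J A) :=
  (jmod P J).perm ((Fam.Iso.eraseIn (yonedaOb P J) A Φ ((Ψ.map (yonedaOb P J)).map ChuOb.dual)).map
    ChuOb.pos) rfl (ChuHom.comp (E := jmod P J) (bot := self J) g (.inl (.inl ())))

theorem sub_inComp
    (g : (env P J).Hom ((.single A ⊎ Φ).map (yonedaOb P J)) (Ψ.map (yonedaOb P J))) :
    Multicat.sub (jmod P J) (inComp g) (cut J A) (.refl _) (.refl _) = inUnder g := by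
  refine Eq.trans ?_ (congrArg ((jmod P J).perm
    (((Fam.Iso.splitIn (yonedaOb P J) A Φ ((Ψ.map (yonedaOb P J)).map ChuOb.dual)).map
      ChuOb.pos).trans (Fam.Iso.mapAppend ChuOb.pos _ _).symm) rfl)
        (ChuHom.compat_sub (E := jmod P J) (bot := self J) g (.inl (.inl ()))))
  refine (Multicat.sub_perm_left _ _ rfl _ _ _ _).trans ?_
  apply Multicat.sub_eq_perm
  · rfl
  · rintro ⟨(i | i) | i, h⟩
    · exact absurd rfl h
    · rfl
    · rfl
  · rintro ⟨⟩ ⟨⟩ -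
    rfl

theorem inComp_ones
    (g : (env P J).Hom ((.single A ⊎ Φ).map (yonedaOb P J)) (Ψ.map (yonedaOb P J))) :
    (inComp g).toFun (ones J Φ Ψ) =
      ⟨P.perm ((Fam.Iso.comm _ _).trans ((onesInp J Φ Ψ).append (.refl _)))
        ((onesOut J Φ Ψ).trans (Fam.Iso.nilRight _).symm) (atOnes J g)⟩ :=
  (fix_sub_cut (inComp g) (ones J Φ Ψ)).symm.trans ((congrArg
    (fun φ : MultiHom (((Φ.map (yonedaOb P J) ⊎ (Ψ.map (yonedaOb P J)).map ChuOb.dual).map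
      ChuOb.pos : Fam (JModule P J)) ⊎ .single (yo J A)) (self J) =>
      (φ.fix (yoOne J A)).toFun (ones J Φ Ψ)) (sub_inComp g)).trans (inUnder_ones g))

variable
  (f : (env P J).Hom (Γ.map (yonedaOb P J)) ((Δ ⊎ .single A).map (yonedaOb P J)))
  (g : (env P J).Hom ((.single A ⊎ Φ).map (yonedaOb P J)) (Ψ.map (yonedaOb P J)))

/-- The composition of `P` is the action of an element of a representable module, so the value of a
composite at the identities is the composite of the values. -/
theorem inUnder_outComp_ones :
    ((inUnder g).fix ⟨_, _, (outComp f).toFun (ones J Γ Δ)⟩).toFun (ones J Φ Ψ) =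
      ⟨P.perm (((onesInp J Γ Δ).append (onesInp J Φ Ψ)).trans (.comm _ _))
        (((onesOut J Γ Δ).append (onesOut J Φ Ψ)).trans (.comm _ _))
        (P.comp (atOnes J f) (atOnes J g))⟩ := by
  refine ((inUnder g).fix_lact (ones J Φ Ψ) (yoStep ⟨_, _, (outComp f).toFun (ones J Γ Δ)⟩)).trans ?_
  have h : P.perm (Fam.Iso.nilRight _) (.refl _) ((outComp f).toFun (ones J Γ Δ)).down =
      P.perm (onesInp J Γ Δ) ((onesOut J Γ Δ).append (.refl _)) (atOnes J f) := by
    rw [outComp_ones]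
    refine (P.perm_perm _ _ _ _ _).trans (P.bi.perm_congr ?_ ?_)
    · intro i; rfl
    · intro i; rfl
  refine (congrArg₂ (fun p q => (self J).toPModule.lact.compAt p q _ _ _ _) h
    (inUnder_ones g)).trans ?_
  refine congrArg ULift.up (Eq.trans ?_ Polycat.perm_comp.symm)
  apply P.act.at_perm
  · rfl
  · rfl
  · intro i; rfl
  · rintro (i | ⟨⟨⟩⟩) j h; cases h; rfl
  · intro i j h; cases h; rfl
  · intro i; rfl

/-- Putting together the elements at which two morphisms are evaluated. -/
abbrev Elt.append {X Y : Fam (JModule P J)} (x : ∀ k, Elt (X.obj k)) (y : ∀ k, Elt (Y.obj k)) :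
    ∀ k, Elt ((X ⊎ Y).obj k)
  | .inl k => x k
  | .inr k => y k

/-- The component into the hom-sets of a composite in the envelope. -/
theorem cut_under
    {c : (Γ.map (yonedaOb P J) ⊎ ((Δ ⊎ .single A).map (yonedaOb P J)).map ChuOb.dual).erase
        (.inr (.inr ())) ⊎ ((Fam.single A ⊎ Φ).map (yonedaOb P J) ⊎
        (Ψ.map (yonedaOb P J)).map ChuOb.dual).erase (.inl (.inl ())) ≅ₗ
      (Γ ⊎ Φ).map (yonedaOb P J) ⊎ ((Δ ⊎ Ψ).map (yonedaOb P J)).map ChuOb.dual}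
    (h1 : ∀ i h, c.equiv (.inl ⟨.inl i, h⟩) = .inl (.inl i))
    (h2 : ∀ i h, c.equiv (.inl ⟨.inr (.inl i), h⟩) = .inr (.inl i))
    (h3 : ∀ i h, c.equiv (.inr ⟨.inl (.inr i), h⟩) = .inl (.inr i))
    (h4 : ∀ i h, c.equiv (.inr ⟨.inr i, h⟩) = .inr (.inr i)) :
    (jmod P J).perm (((Fam.Iso.shuffle (yonedaOb P J) (fun A => (yonedaOb P J A).dual) Γ Φ Δ Ψ).map
        ChuOb.pos).trans (Fam.Iso.mapAppend ChuOb.pos _ _).symm) rfl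
      (ChuHom.under (ChuHom.cut (E := jmod P J) (bot := self J) f g (.inr (.inr ()))
        (.inl (.inl ())) (ChuHom.dualPair (yonedaOb P J A)).symm c)) =
      Multicat.sub (jmod P J) (outComp f) (inUnder g) (.refl _) (.refl _) := by
  refine (congrArg ((jmod P J).perm _ rfl) (ChuHom.under_cut (E := jmod P J) (bot := self J) f g
    (.inr (.inr ())) (.inl (.inl ())) (ChuHom.dualPair (yonedaOb P J A)).symm c)).trans ?_
  refine ((jmod P J).perm_perm _ _ _ _ _).trans (Eq.symm ?_)
  apply Multicat.sub_perm_perm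
  · rfl
  · rintro ⟨i | i | i, h⟩
    · exact congrArg (Fam.Iso.shuffle (yonedaOb P J) (fun A => (yonedaOb P J A).dual) Γ Φ Δ Ψ).equiv
        (h1 i h)
    · exact congrArg (Fam.Iso.shuffle (yonedaOb P J) (fun A => (yonedaOb P J A).dual) Γ Φ Δ Ψ).equiv
        (h2 i h)
    · exact absurd rfl h
  · rintro ⟨(i | i) | i, h⟩ j hj
    · exact absurd rfl h
    · cases hj
      exact congrArg (Fam.Iso.shuffle (yonedaOb P J) (fun A => (yonedaOb P J A).dual) Γ Φ Δ Ψ).equiv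
        (h3 i h)
    · cases hj
      exact congrArg (Fam.Iso.shuffle (yonedaOb P J) (fun A => (yonedaOb P J A).dual) Γ Φ Δ Ψ).equiv
        (h4 i h)

/-- Evaluation at the identities takes composites in the envelope to composites. -/
theorem atOnes_cut
    {c : (Γ.map (yonedaOb P J) ⊎ ((Δ ⊎ .single A).map (yonedaOb P J)).map ChuOb.dual).erase
        (.inr (.inr ())) ⊎ ((Fam.single A ⊎ Φ).map (yonedaOb P J) ⊎
        (Ψ.map (yonedaOb P J)).map ChuOb.dual).erase (.inl (.inl ())) ≅ₗ
      (Γ ⊎ Φ).map (yonedaOb P J) ⊎ ((Δ ⊎ Ψ).map (yonedaOb P J)).map ChuOb.dual}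
    (h1 : ∀ i h, c.equiv (.inl ⟨.inl i, h⟩) = .inl (.inl i))
    (h2 : ∀ i h, c.equiv (.inl ⟨.inr (.inl i), h⟩) = .inr (.inl i))
    (h3 : ∀ i h, c.equiv (.inr ⟨.inl (.inr i), h⟩) = .inl (.inr i))
    (h4 : ∀ i h, c.equiv (.inr ⟨.inr i, h⟩) = .inr (.inr i)) :
    atOnes J (ChuHom.cut (E := jmod P J) (bot := self J) f g (.inr (.inr ()))
        (.inl (.inl ())) (ChuHom.dualPair (yonedaOb P J A)).symm c) =
      P.comp (atOnes J f) (atOnes J g) := by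
  have e : ∀ k : (Γ.I ⊕ Φ.I) ⊕ (Δ.I ⊕ Ψ.I), EltIso (ones J (Γ ⊎ Φ) (Δ ⊎ Ψ) k)
      (MultiHom.resp (P := P) (J := J) (((Fam.Iso.shuffle (yonedaOb P J)
        (fun A => (yonedaOb P J A).dual) Γ Φ Δ Ψ).map ChuOb.pos).trans
          (Fam.Iso.mapAppend ChuOb.pos _ _).symm) (Elt.append (ones J Γ Δ) (ones J Φ Ψ)) k) := by
    rintro ((k | k) | (k | k))
    · exact .refl (yoOne J _)
    · exact .refl (yoOne J _)
    · exact .refl (noyOne J _)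
    · exact .refl (noyOne J _)
  generalize hq : ChuHom.cut (E := jmod P J) (bot := self J) f g (.inr (.inr ()))
    (.inl (.inl ())) (ChuHom.dualPair (yonedaOb P J A)).symm c = q
  have h := cut_under f g h1 h2 h3 h4
  rw [hq] at h
  have h' := (congrArg ((self J).toPModule.perm _ _)
    (toFun_of_ones (Γ := Γ ⊎ Φ) (Δ := Δ ⊎ Ψ) q e)).symm.trans
    ((congrArg (fun φ => MultiHom.toFun φ (Elt.append (ones J Γ Δ) (ones J Φ Ψ))) h).trans
    ((MultiHom.sub_toFun _ _ _).trans (congrArg ((self J).toPModule.perm _ _)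
      (inUnder_outComp_ones f g))))
  have h'' := congrArg ULift.down h'
  refine (P.bi.perm_bijective _ _).1 (((P.perm_perm _ _ _ _ _).symm.trans h'').trans
    ((P.perm_perm _ _ _ _ _).trans (P.bi.perm_congr ?_ ?_)))
  · rintro (k | k) <;> rfl
  · rintro (k | k) <;> rfl

end

end JModule

namespace JModule
variable {P : Polycat.{u, v}} (J : P.Distinguished)

theorem atOnes_comp {J : P.Distinguished} {Γ Δ Φ Ψ : Fam P.Ob} {A : P.Ob}
    (f : (env P J).Hom (Γ.map (yonedaOb P J)) ((Δ ⊎ .single A).map (yonedaOb P J)))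
    (g : (env P J).Hom ((.single A ⊎ Φ).map (yonedaOb P J)) (Ψ.map (yonedaOb P J))) :
    atOnes J ((env P J).perm (.mapAppend (yonedaOb P J) Γ Φ) (.mapAppend (yonedaOb P J) Δ Ψ)
      ((env P J).comp (A := yonedaOb P J A)
        ((env P J).perm (.refl _) (Fam.Iso.mapAppend (yonedaOb P J) Δ (.single A)).symm f)
        ((env P J).perm (Fam.Iso.mapAppend (yonedaOb P J) (.single A) Φ).symm (.refl _) g))) =
      P.comp (atOnes J f) (atOnes J g) := by
  refine (congrArg (fun q => atOnes J (Γ := Γ ⊎ Φ) (Δ := Δ ⊎ Ψ) q)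
    ((congrArg (ChuHom.perm _) (ChuHom.cut_perm (E := jmod P J) (bot := self J) _ _ f g
      (.inr (.inr ())) (.inl (.inl ())) rfl rfl (ChuHom.dualPair (yonedaOb P J A)).symm
      (ChuHom.dualPair (yonedaOb P J A)).symm _)).trans (ChuHom.perm_cut _ _ _ _ _ _ _))).trans ?_
  apply atOnes_cut
  · intro i h; rfl
  · intro i h; rfl
  · intro i h; rfl
  · intro i h; rfl

/-- The morphism of the envelope that evaluates to a given morphism at the identities. -/
noncomputable def yonedaMap {Γ Δ : Fam P.Ob} :
    P.Hom Γ Δ ≃ (env P J).Hom (Γ.map (yonedaOb P J)) (Δ.map (yonedaOb P J)) :=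
  (Equiv.ofBijective _ (atOnes_bijective J Γ Δ)).symm

theorem atOnes_yonedaMap {Γ Δ : Fam P.Ob} (f : P.Hom Γ Δ) : atOnes J (yonedaMap J f) = f :=
  (Equiv.ofBijective _ (atOnes_bijective J Γ Δ)).apply_symm_apply f

theorem yonedaMap_eq {Γ Δ : Fam P.Ob} {f : P.Hom Γ Δ}
    {g : (env P J).Hom (Γ.map (yonedaOb P J)) (Δ.map (yonedaOb P J))} (h : atOnes J g = f) :
    yonedaMap J f = g :=
  (atOnes_bijective J Γ Δ).1 ((atOnes_yonedaMap J f).trans h.symm)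

/-- The embedding of a polycategory into its envelope. -/
noncomputable def yoneda : PolyFunctor P (env P J) (yonedaOb P J) where
  map f := yonedaMap J f
  map_perm σ τ f := yonedaMap_eq J ((atOnes_perm σ τ _).trans
    (congrArg _ (atOnes_yonedaMap J f)))
  map_id A := yonedaMap_eq J (Γ := .single A) (Δ := .single A) (atOnes_id A)
  map_comp f g := yonedaMap_eq J ((atOnes_comp _ _).trans
    (congrArg₂ P.comp (atOnes_yonedaMap J f) (atOnes_yonedaMap J g)))

theorem yoneda_fullyFaithful : (yoneda J).FullyFaithful := fun _ _ => (yonedaMap J).bijective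

end JModule

/-! ### Preservation of the distinguished tensor and cotensor products -/

namespace Multicat
variable {E : Multicat.{u, v}}

theorem TensorUniversal.of_perm {Γ Γ' : Fam E.Ob} {T : E.Ob} (σ : Γ ≅ₗ Γ') {t : E.Hom Γ T}
    (ht : TensorUniversal (E.perm σ rfl t)) : TensorUniversal t := by
  intro Y W
  refine (Function.Bijective.of_comp_iff' (E.perm_bijective (σ.append (.refl Y)) rfl) _).mp ?_
  exact (ht Y W).of_eq fun g => (E.comp_perm_left σ t g).symm

end Multicat

namespace JModule
variable {P : Polycat.{u, v}} {J : P.Distinguished}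

theorem Represents.app_bijective {U : JModule P J} {u : Elt U} (hu : Represents u)
    (W : JModule P J) : Function.Bijective fun φ : MultiHom (.single U) W => φ.app u.el :=
  (W.toPModule.perm_bijective _ _).comp
    (generic_of_represents (Z := .single U) (x := fun _ => u) (fun _ => hu) W)

/-- A multimorphism into a contravariant representable module is a weak tensor product if acting with
its value at generic elements is bijective: by the Yoneda lemma, multimorphisms out of both sides are
elements of `W`, and composition becomes that action. -/
theorem weakTensor_of_lact {Z : Fam (JModule P J)} {T : P.Ob} {h : MultiHom Z (yo J T)}
    {x : ∀ k, Elt (Z.obj k)} (hx : Generic x)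
    (hr : ∀ W : JModule P J, Function.Bijective fun w : W.toPModule.obj (.single T) .nil =>
      W.toPModule.lact.compAt (P.perm (Fam.Iso.nilRight _) (.refl _) (h.toFun x).down) w (.refl _)
        (.nilRight (.single T)) (.nilRight _) (.nilRight _)) :
    Multicat.WeakTensor (E := jmod P J) h := by
  intro W
  refine (Function.Bijective.of_comp_iff' (hx W) _).mp
    (((hr W).comp ((represents_yoOne J T).app_bijective W)).of_eq fun g => ?_)
  refine (MultiHom.post_toFun h g x).trans ?_
  have hs := (yoStep (⟨_, _, h.toFun x⟩ : Elt (yo J T))).el_eq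
  exact (congrArg g.app hs.symm).trans (g.toMap.map_lact_at _ _ _ _ _ _)

/-- A multimorphism into a covariant representable module is a weak tensor product if acting with
its value at generic elements is bijective. -/
theorem weakTensor_of_ract {Z : Fam (JModule P J)} {T : P.Ob} {h : MultiHom Z (noy J T)}
    {x : ∀ k, Elt (Z.obj k)} (hx : Generic x)
    (hr : ∀ W : JModule P J, Function.Bijective fun w : W.toPModule.obj .nil (.single T) =>
      W.toPModule.ract.compAt w (P.perm (.comm _ _) (Fam.Iso.nilRight _) (h.toFun x).down)
        (.nilLeft (.single T)) (.refl _) (.nilLeft _) (.nilLeft _)) :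
    Multicat.WeakTensor (E := jmod P J) h := by
  intro W
  refine (Function.Bijective.of_comp_iff' (hx W) _).mp
    (((hr W).comp ((represents_noyOne J T).app_bijective W)).of_eq fun g => ?_)
  refine (MultiHom.post_toFun h g x).trans ?_
  have hs := (noyStep (⟨_, _, h.toFun x⟩ : Elt (noy J T))).el_eq
  exact (congrArg g.app hs.symm).trans (g.toMap.map_ract_at _ _ _ _ _ _)

variable (J)

/-- If `t` acts invertibly on all modules, it induces a universal multimorphism into the contravariant
representable module of its output. -/
theorem weakTensor_outComp {S : Fam P.Ob} {T : P.Ob} {t : P.Hom S (.single T)}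
    (ht : ∀ W : JModule P J, W.toPModule.RespectsTensor t) :
    Multicat.WeakTensor (E := jmod P J)
      (outComp (yonedaMap J (P.perm (.refl S) (Fam.Iso.nilLeft (.single T)).symm t))) := by
  refine weakTensor_of_lact (ones_generic J S .nil) fun W => ?_
  refine ((W.toPModule.perm_bijective ((Fam.Iso.nilRight _).trans (onesInp J S .nil))
    ((Fam.Iso.nilRight _).trans (onesOut J S .nil))).comp ((ht W .nil .nil).comp
      (W.toPModule.perm_bijective (Fam.Iso.nilRight _).symm (.refl _)))).of_eq fun w => ?_
  rw [outComp_ones, atOnes_yonedaMap]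
  refine Eq.trans (congrArg (fun p => W.toPModule.lact.compAt p w _ _ _ _)
    ((P.perm_perm _ _ _ _ _).trans (P.perm_perm _ _ _ _ _))) ?_
  refine Eq.trans (b := W.toPModule.lact.compAt t w (.nilLeft _) (.nilRight _)
    ((Fam.Iso.nilRight _).trans (onesInp J S .nil))
    ((Fam.Iso.nilRight _).trans (onesOut J S .nil))) ?_ rfl
  apply W.toPModule.lact.at_permL
  · rfl
  · rfl
  · intro i; rfl
  · rintro ⟨⟩
  · rintro _ ⟨⟩
  · rintro ⟨⟩

/-- If `t` acts invertibly on all modules, it induces a universal multimorphism into the covariant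
representable module of its input. -/
theorem weakTensor_inComp {S : Fam P.Ob} {T : P.Ob} {t : P.Hom (.single T) S}
    (ht : ∀ W : JModule P J, W.toPModule.RespectsCotensor t) :
    Multicat.WeakTensor (E := jmod P J)
      (inComp (yonedaMap J (P.perm (Fam.Iso.nilRight (.single T)).symm (.refl S) t))) := by
  refine weakTensor_of_ract (ones_generic J .nil S) fun W => ?_
  refine ((W.toPModule.perm_bijective ((Fam.Iso.nilLeft _).trans (onesInp J .nil S))
    ((Fam.Iso.nilLeft _).trans (onesOut J .nil S))).comp ((ht W .nil .nil).comp
      (W.toPModule.perm_bijective (.refl _) (Fam.Iso.nilLeft _).symm))).of_eq fun w => ?_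
  rw [inComp_ones, atOnes_yonedaMap]
  refine Eq.trans (congrArg (fun p => W.toPModule.ract.compAt w p _ _ _ _)
    ((P.perm_perm _ _ _ _ _).trans (P.perm_perm _ _ _ _ _))) ?_
  refine Eq.trans (b := W.toPModule.ract.compAt w t (.nilLeft _) (.nilRight _)
    ((Fam.Iso.nilLeft _).trans (onesInp J .nil S))
    ((Fam.Iso.nilLeft _).trans (onesOut J .nil S))) ?_ rfl
  apply W.toPModule.ract.at_permR
  · rfl
  · rfl
  · rintro ⟨⟩
  · rintro _ ⟨⟩
  · rintro ⟨⟩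
  · intro i; rfl

theorem negRep_dual_dual_yonedaOb (A : P.Ob) : ChuHom.NegRep (yonedaOb P J A).dual.dual :=
  (ChuOb.dual_dual (yonedaOb P J A)).symm ▸ negRep_yonedaOb J A

/-- A morphism of `P` that all modules treat as a tensor product is a tensor product in the
envelope. -/
theorem isTensor_yonedaMap {S : Fam P.Ob} {T : P.Ob} {t : P.Hom S (.single T)}
    (ht : ∀ W : JModule P J, W.toPModule.RespectsTensor t) :
    (env P J).IsTensor (T := yonedaOb P J T) (yonedaMap J t) := by
  have hu := Multicat.TensorUniversal.of_perm (E := jmod P J) _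
    ((weakTensor_outComp J ht).tensorUniversal hasHoms)
  have hc := ChuHom.universal_of hu (ChuHom.coneUniversal_of_negRep hu
    (by
      rintro ⟨i | i, h⟩
      · exact negRep_yonedaOb J _
      · exact negRep_dual_yonedaOb J _)
    (negRep_dual_dual_yonedaOb J T))
  have he : yonedaMap J t = (env P J).perm (.refl (S.map (yonedaOb P J)))
      ((Fam.Iso.nilLeft (.single T)).map (yonedaOb P J))
      (yonedaMap J (P.perm (.refl S) (Fam.Iso.nilLeft (.single T)).symm t)) :=
    Eq.trans (congrArg (yonedaMap J) (Eq.symm ((P.perm_perm _ _ _ _ _).trans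
      (P.bi.perm_id' (fun _ => rfl) (fun _ => rfl)))))
      ((yoneda J).map_perm (.refl S) (Fam.Iso.nilLeft (.single T)) _)
  rw [he]
  exact ChuHom.Universal.isTensor (S := S.map (yonedaOb P J)) (T := yonedaOb P J T)
    (hc.perm (Fam.Iso.append (.refl (S.map (yonedaOb P J)))
      (((Fam.Iso.nilLeft (.single T)).map (yonedaOb P J)).map ChuOb.dual)) (k' := .inr ()) rfl)

/-- A morphism of `P` that all modules treat as a cotensor product is a cotensor product in the
envelope. -/
theorem isCotensor_yonedaMap {S : Fam P.Ob} {T : P.Ob} {t : P.Hom (.single T) S}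
    (ht : ∀ W : JModule P J, W.toPModule.RespectsCotensor t) :
    (env P J).IsCotensor (T := yonedaOb P J T) (yonedaMap J t) := by
  have hu := Multicat.TensorUniversal.of_perm (E := jmod P J) _
    ((weakTensor_inComp J ht).tensorUniversal hasHoms)
  have hc := ChuHom.universal_of hu (ChuHom.coneUniversal_of_negRep hu
    (by
      rintro ⟨(i | i) | i, h⟩
      · exact negRep_yonedaOb J _
      · exact negRep_yonedaOb J _
      · exact negRep_dual_yonedaOb J _)
    (negRep_dual_yonedaOb J T))
  have he : yonedaMap J t = (env P J).perm ((Fam.Iso.nilRight (.single T)).map (yonedaOb P J))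
      (.refl (S.map (yonedaOb P J)))
      (yonedaMap J (P.perm (Fam.Iso.nilRight (.single T)).symm (.refl S) t)) :=
    Eq.trans (congrArg (yonedaMap J) (Eq.symm ((P.perm_perm _ _ _ _ _).trans
      (P.bi.perm_id' (fun _ => rfl) (fun _ => rfl)))))
      ((yoneda J).map_perm (Fam.Iso.nilRight (.single T)) (.refl S) _)
  rw [he]
  exact ChuHom.Universal.isCotensor (S := S.map (yonedaOb P J)) (T := yonedaOb P J T)
    (hc.perm (Fam.Iso.append ((Fam.Iso.nilRight (.single T)).map (yonedaOb P J))
      (.refl ((S.map (yonedaOb P J)).map ChuOb.dual))) (k' := .inl ()) rfl)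

theorem yoneda_preserves : (yoneda J).Preserves J :=
  ⟨fun h => isTensor_yonedaMap J fun W => W.respects.tensor h,
    fun h => isTensor_yonedaMap J fun W => W.respects.unit h,
    fun h => isCotensor_yonedaMap J fun W => W.respects.cotensor h,
    fun h => isCotensor_yonedaMap J fun W => W.respects.counit h⟩

end JModule

theorem mainTheorem7 (P : Polycat.{u, v}) (J : P.Distinguished) :
    (env P J).IsStarAutonomous ∧
    (∀ A : ChuOb (jmod P J) (JModule.self J),
      ∃ e : (env P J).Hom (.single A.dual ⊎ .single A) .nil, (env P J).IsDual e) ∧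
    ∃ F : PolyFunctor P (env P J) (yonedaOb P J),
      F.FullyFaithful ∧
      (∀ {Γ Δ : Fam P.Ob} (f : P.Hom Γ Δ), JModule.atOnes J (F.map f) = f) ∧
      F.Preserves J :=
  ⟨ChuHom.chu_isStarAutonomous JModule.hasHoms JModule.hasWidePullbacks JModule.hasWeakTensors,
    fun A => ⟨ChuHom.counit A, ChuHom.isDual_counit A⟩,
    JModule.yoneda J, JModule.yoneda_fullyFaithful J, JModule.atOnes_yonedaMap J,
    JModule.yoneda_preserves J⟩
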